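/- **Setting.** $\mathbb C((z))$ is the field of formal Laurent series, $'=d/dz$, $D=d/dz$, $\lambda\in\mathbb C$. *Pseudodifferential symbols.* $\Psi DS_\lambda$ is the affine space of symbols $L=D^\lambda+\sum_{m<0}u_mD^{\lambda+m}$, $u_m\in\mathbb C((z))$, multiplied by $D^\alpha\circ f=\sum_{l\ge0}\binom{\alpha}{l}f^{(l)}D^{\alpha-l}$. Its cotangent vectors are $X=D^{-\lambda}\circ Q$ with $Q$ a differential operator, acting on tangent vectors $\delta L=\sum_{m<0}\delta u_mD^{\lambda+m}$ by $F_X(\delta L)=\mathrm{Tr}(\delta L\circ X)$, where $\mathrm{Tr}\sum p_iD^i=\mathrm{Res}_{z=0}\,p_{-1}$. The quadratic Gelfand–Dickey structure is $\{F_X,F_Y\}_{GD}(L)=F_Y\big((LX)_+L-L(XL)_+\big)$. Put $\big(\sum u_mD^{\lambda+m}\big)^*=\sum(-1)^mD^{\lambda+m}\circ u_m$; $\Psi DS_\lambda^{SA}=\{L\in\Psi DS_\lambda: L^*=L\}$ carries the Gelfand–Dickey structure given by the same formula on those $X,Y$ for which $F_X,F_Y$ are $*$-invariant. $DO_n^{SA}\subset\Psi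 DS_n^{SA}$ denotes the self-adjoint differential operators of order $n$. *Matrices of complex size.* $\mathfrak{gl}_\lambda=U(\mathfrak{sl}_2)/(ef+fe+\tfrac12h^2-\tfrac12(\lambda-1)(\lambda+1))$, realized by infinite matrices through its action $fv_i=v_{i+1}$, $hv_i=(\lambda-1-2i)v_i$, $ev_i=i(\lambda-i)v_{i-1}$ on the Verma module with basis $v_0,v_1,\dots$. Let $\sigma$ be the anti-involution of $\mathfrak{gl}_\lambda$ induced by $x\mapsto-x$ on $\mathfrak{sl}_2$, and $\mathfrak{po}_\lambda$ its $(-1)$-eigenspace. The loop algebra $\mathfrak{po}_\lambda(z)$ consists of the matrices over $\mathbb C((z))$ with finitely many non-zero diagonals below the main one (and possibly infinitely many above it), each diagonal being the corresponding diagonal of an element of $\mathfrak{po}_\lambda\otimes\mathbb C((z))$. For such matrices and their products $\sum_{i<N}a_{ii}$ is a polynomial $P(N)$, and $\mathrm{Tr}A=P(\lambda)$. The affine algebra is $\mathfrak{po}_\lambda(z)\oplus\mathbb C$ with $[(X,a),(Y,b)]=([X,Y],\mathrm{Res}\,\mathrm{Tr}\,X'Y\,dz)$; a pair $(A,k)$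 is the functional $(X,a)\mapsto\mathrm{Res}\,\mathrm{Tr}(AX)z^{-1}dz+ka$, and the Kirillov–Kostant structure at $(A,k)$ on functions with differentials $X,Y$ is $\langle(A,k),[(X,0),(Y,0)]\rangle$. Let $\mathfrak n$ be the subalgebra of strictly upper triangular elements of $\mathfrak{po}_\lambda(z)$; $\exp\mathfrak n$ acts on the hyperplane of level $k$ by the coadjoint action $A\mapsto XAX^{-1}-kzX'X^{-1}$, with momentum map $p$ the restriction of functionals to $\mathfrak n$. The Hamiltonian reduction at level $k$ is $p^{-1}(f)/\exp\mathfrak n$ with the reduced Poisson structure (bracket of arbitrary continuations of invariant functions). The same definitions, with the usual trace of $n\times n$ matrices and principal nilpotent $f:v_i\mapsto v_{i+1}$ ($v_n=0$), give the Drinfeld–Sokolov reduction for the Lie algebra of matrices skew with respect to the form $(v_i,v_{n-1-i})=(-1)^i$, i.e. $\mathfrak{sp}_n$ for $n$ even and $\mathfrak{so}_n$ for $n$ odd. **Theorem.** Let $k\ne0$. 1. For every $\lambda\in\mathbb C\setminus\mathbb Z$ there is an isomorphism of Poisson manifolds from the Hamiltonian reduction at level $k$ of the Kirillov–Kostant structure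 for $\mathfrak{po}_\lambda$ onto $\Psi DS_\lambda^{SA}$ with the quadratic Gelfand–Dickey structure multiplied by $-k^{-1}$ (so exactly the Gelfand–Dickey structure for $k=-1$). That is, there is a map $\Phi_\lambda:p^{-1}(f)\to\Psi DS_\lambda^{SA}$, surjective, whose fibres are the $\exp\mathfrak n$-orbits, under which functionals $F_X$ pull back to functions with differentials in $\mathfrak{po}_\lambda(z)$ and the reduced structure corresponds to $-k^{-1}\{\ ,\ \}_{GD}$. Every orbit contains exactly one element $f+\sum_{i\ge0}b_i(z)e^{2i+1}$, all of these lie in $p^{-1}(f)$, and in the coordinates $(b_i)$, $(u_m)$ the map $\Phi_\lambda$ and its inverse are given by differential polynomials over $\mathbb C((z))$. 2. This interpolates the Drinfeld–Sokolov reductions for $\mathfrak{sp}_{2n}$ and $\mathfrak{so}_{2n+1}$. The coefficients of the differential polynomials giving $\Phi_\lambda$ can be chosen polynomial in $\lambda$, in such a way that for each integer $n\ge1$ their values at $\lambda=n$ give in the same manner (with only those $b_i$ for which $e^{2i+1}\neq0$) an isomorphism from the Drinfeld–Sokolov reduction at level $k$ for $\mathfrak{sp}_n$ ($n$ even), $\mathfrak{so}_n$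 ($n$ odd) onto $DO_n^{SA}$ with $-k^{-1}\{\ ,\ \}_{GD}$. Moreover, for $\lambda=n$, taking the upper left $n\times n$ block maps $\mathfrak{po}_n(z)$ onto the loop algebra of $\mathfrak{sp}_n$, resp. $\mathfrak{so}_n$; it takes $e,f$ to $e,f$, is multiplicative on products of two elements of $\mathfrak{po}_n(z)$, and takes $\mathrm{Tr}$ of such products to the usual trace. 3. The Gelfand–Dickey structures of all $\Psi DS_\lambda^{SA}$, $\lambda\in\mathbb C$, are the polynomial continuation in $\lambda$ of those in 1: for every $\lambda\in\mathbb C$ the coefficients $u_{-2},u_{-4},\dots$ are free coordinates on $\Psi DS_\lambda^{SA}$, the functionals $u\mapsto\mathrm{Res}\,a\,u_{-2i}$ ($a\in\mathbb C((z))$, $i\geq 1$) have differentials in its cotangent space, and their Gelfand–Dickey brackets at a point with given $u_{-2},u_{-4},\dots$ are polynomial in $\lambda$. -/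

import Mathlib

open scoped Polynomial

noncomputable section

namespace ComplexSize

/-! ### The field of formal Laurent series in `z` -/

/-- The field `ℂ((z))`. -/
def K : Type := LaurentSeries ℂ

instance : Field K := inferInstanceAs (Field (LaurentSeries ℂ))

/-- Complex numbers as constant Laurent series. -/
instance : Algebra ℂ K := (HahnSeries.C : ℂ →+* LaurentSeries ℂ).toAlgebra

/-- The coordinate `z`. -/
def zz : K := (HahnSeries.single 1 1 : LaurentSeries ℂ)

/-- The derivation `d/dz` of `ℂ((z))`. -/
def dz : K →+ K := (LaurentSeries.derivative ℂ : LaurentSeries ℂ →ₗ[ℂ] LaurentSeries ℂ).toAddMonoidHom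

/-- The residue at `z = 0` of `a dz`. -/
def res (a : K) : ℂ := HahnSeries.coeff (Γ := ℤ) (R := ℂ) a (-1)

attribute [local instance] LieRing.ofAssociativeRing

/-! ### The algebra `gl_λ` and its subspace `po_λ` -/

/-- The Lie algebra `sl₂`. -/
abbrev sl2 : Type := LieAlgebra.SpecialLinear.sl (Fin 2) ℂ

def sl2E : sl2 := ⟨!![0, 1; 0, 0], by
  change Matrix.traceLinearMap (Fin 2) ℂ ℂ _ = 0
  simp [Matrix.trace_fin_two]⟩

def sl2F : sl2 := ⟨!![0, 0; 1, 0], by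
  change Matrix.traceLinearMap (Fin 2) ℂ ℂ _ = 0
  simp [Matrix.trace_fin_two]⟩

def sl2H : sl2 := ⟨!![1, 0; 0, -1], by
  change Matrix.traceLinearMap (Fin 2) ℂ ℂ _ = 0
  simp [Matrix.trace_fin_two]⟩

/-- The universal enveloping algebra of `sl₂`. -/
abbrev U : Type := UniversalEnvelopingAlgebra ℂ sl2

/-- The canonical map `sl₂ → U(sl₂)`. -/
def toU : sl2 →ₗ⁅ℂ⁆ U := UniversalEnvelopingAlgebra.ι ℂ

/-- The Casimir element `C = ef + fe + h²/2`. -/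
def casimir : U :=
  toU sl2E * toU sl2F + toU sl2F * toU sl2E + (1 / 2 : ℂ) • (toU sl2H * toU sl2H)

/-- The relation `C = (λ - 1)(λ + 1)/2`. -/
inductive CasimirRel (lam : ℂ) : U → U → Prop
  | rel : CasimirRel lam casimir (algebraMap ℂ U ((lam - 1) * (lam + 1) / 2))

/-- `gl_λ = U(sl₂) / (C - (λ - 1)(λ + 1)/2)`. -/
abbrev Gl (lam : ℂ) : Type := RingQuot (CasimirRel lam)

/-- The quotient map `U(sl₂) → gl_λ`. -/
def toGl (lam : ℂ) : U →ₐ[ℂ] Gl lam := RingQuot.mkAlgHom ℂ (CasimirRel lam)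

/-- `x ↦ -x`, as a Lie algebra map from `sl₂` to the opposite of `U(sl₂)`. -/
def negOp : sl2 →ₗ⁅ℂ⁆ Uᵐᵒᵖ where
  toFun x := MulOpposite.op (-toU x)
  map_add' x y := by simp [add_comm]
  map_smul' c x := by simp
  map_lie' := by
    intro x y
    rw [LieHom.map_lie, Ring.lie_def, Ring.lie_def, ← MulOpposite.op_mul, ← MulOpposite.op_mul,
      ← MulOpposite.op_sub]
    congr 1
    noncomm_ring

/-- The anti-involution of `U(sl₂)` extending `x ↦ -x` on `sl₂`. -/
def sigmaU : U →ₐ[ℂ] Uᵐᵒᵖ := UniversalEnvelopingAlgebra.lift ℂ negOp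

theorem sigmaU_toU (x : sl2) : sigmaU (toU x) = MulOpposite.op (-toU x) :=
  UniversalEnvelopingAlgebra.lift_ι_apply ℂ negOp x

theorem sigmaU_casimir : sigmaU casimir = MulOpposite.op casimir := by
  simp only [casimir, map_add, map_mul, map_smul, sigmaU_toU, ← MulOpposite.op_mul,
    ← MulOpposite.op_smul, ← MulOpposite.op_add, neg_mul_neg]
  rw [add_comm (toU sl2F * toU sl2E)]

/-- The anti-involution `σ` of `gl_λ` induced by `x ↦ -x` on `sl₂`. -/
def sigma (lam : ℂ) : Gl lam →ₐ[ℂ] (Gl lam)ᵐᵒᵖ :=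
  RingQuot.liftAlgHom ℂ ⟨(AlgHom.op (toGl lam)).comp sigmaU, by
    rintro _ _ ⟨⟩
    rw [AlgHom.comp_apply, sigmaU_casimir, AlgHom.commutes]
    simp only [AlgHom.op_apply_apply, MulOpposite.unop_op]
    rw [show toGl lam casimir = _ from RingQuot.mkAlgHom_rel ℂ CasimirRel.rel, AlgHom.commutes]
    rfl⟩

theorem sigma_sl2 (lam : ℂ) (x : sl2) :
    sigma lam (toGl lam (toU x)) = MulOpposite.op (-toGl lam (toU x)) := by
  refine (RingQuot.liftAlgHom_mkAlgHom_apply ℂ _ _ _).trans ?_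
  rw [AlgHom.comp_apply, sigmaU_toU]
  simp

/-- `po_λ`: the eigenspace of `σ` in `gl_λ` for the eigenvalue `-1`. -/
def po (lam : ℂ) : Set (Gl lam) := {a | sigma lam a = MulOpposite.op (-a)}

/-! ### Matrices over `ℂ((z))` -/

section Matrices

variable {ι : Type}

/-- Linear endomorphisms of the free `ℂ((z))`-module with basis `(v_i)_{i ∈ ι}`, i.e.
column-finite matrices. -/
abbrev Mat (ι : Type) : Type := Module.End K (ι →₀ K)

/-- The basis vector `v_i`. -/
def bas (i : ι) : ι →₀ K := Finsupp.single i 1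

/-- The `(i, j)` entry. -/
def entry (A : Mat ι) (i j : ι) : K := A (bas j) i

/-- The endomorphism with given columns. -/
def ofCols (c : ι → ι →₀ K) : Mat ι := Finsupp.linearCombination K c

/-- Entrywise `d/dz`. -/
def matDeriv (A : Mat ι) : Mat ι :=
  ofCols fun j => (A (bas j)).mapRange dz (map_zero dz)

end Matrices

/-! ### The Verma module `M(λ - 1)` with coefficients in `ℂ((z))` -/

def vF : Mat ℕ := ofCols fun i => bas (i + 1)

def vH (lam : ℂ) : Mat ℕ := ofCols fun i => algebraMap ℂ K (lam - 1 - 2 * i) • bas i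

def vE (lam : ℂ) : Mat ℕ := ofCols fun i => algebraMap ℂ K (i * (lam - i)) • bas (i - 1)

theorem vF_bas (i : ℕ) : vF (bas i) = bas (i + 1) := by simp [vF, ofCols, bas]

theorem vH_bas (lam : ℂ) (i : ℕ) :
    vH lam (bas i) = algebraMap ℂ K (lam - 1 - 2 * i) • bas i := by
  simp [vH, ofCols, bas]

theorem vE_bas (lam : ℂ) (i : ℕ) :
    vE lam (bas i) = algebraMap ℂ K (i * (lam - i)) • bas (i - 1) := by
  simp [vE, ofCols, bas]

theorem mat_ext {A B : Mat ℕ} (h : ∀ i, A (bas i) = B (bas i)) : A = B := by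
  apply Finsupp.lhom_ext'
  intro i
  apply LinearMap.ext_ring
  exact h i

theorem v_ef (lam : ℂ) : vE lam * vF - vF * vE lam = vH lam := by
  apply mat_ext
  intro i
  rcases i with _ | i
  · simp only [LinearMap.sub_apply, Module.End.mul_apply, vF_bas, vE_bas, vH_bas, map_smul]
    simp
  · simp only [LinearMap.sub_apply, Module.End.mul_apply, vF_bas, vE_bas, vH_bas, map_smul,
      Nat.add_sub_cancel, ← sub_smul, ← map_sub]
    congr 2
    push_cast
    ring

theorem v_he (lam : ℂ) : vH lam * vE lam - vE lam * vH lam = (2 : ℂ) • vE lam := by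
  apply mat_ext
  intro i
  rcases i with _ | i
  · simp only [LinearMap.sub_apply, LinearMap.smul_apply, Module.End.mul_apply, vE_bas, vH_bas,
      map_smul]
    simp
  · simp only [LinearMap.sub_apply, LinearMap.smul_apply, Module.End.mul_apply, vE_bas, vH_bas,
      map_smul, Nat.add_sub_cancel, smul_smul, ← sub_smul, ← map_mul, ← map_sub,
      ← algebraMap_smul K (2 : ℂ)]
    congr 2
    push_cast
    ring

theorem v_hf (lam : ℂ) : vH lam * vF - vF * vH lam = -((2 : ℂ) • vF) := by
  apply mat_ext
  intro i
  simp only [LinearMap.sub_apply, LinearMap.smul_apply, LinearMap.neg_apply, Module.End.mul_apply,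
    vF_bas, vH_bas, map_smul, ← sub_smul, ← map_sub, ← neg_smul, ← algebraMap_smul K (-2 : ℂ)]
  congr 2
  push_cast
  ring

theorem v_casimir (lam : ℂ) :
    vE lam * vF + vF * vE lam + (1 / 2 : ℂ) • (vH lam * vH lam) =
      algebraMap ℂ (Mat ℕ) ((lam - 1) * (lam + 1) / 2) := by
  apply mat_ext
  intro i
  rw [Algebra.algebraMap_eq_smul_one]
  rcases i with _ | i
  · simp only [LinearMap.add_apply, LinearMap.smul_apply, Module.End.mul_apply, vF_bas, vE_bas,
      vH_bas, map_smul, Module.End.one_apply, smul_smul, ← algebraMap_smul K (1 / 2 : ℂ),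
      ← algebraMap_smul K ((lam - 1) * (lam + 1) / 2), ← map_mul]
    simp only [Nat.cast_zero, zero_mul, map_zero, zero_smul, add_zero, Nat.zero_add,
      Nat.sub_self, ← add_smul, ← map_add]
    congr 2
    push_cast
    ring
  · simp only [LinearMap.add_apply, LinearMap.smul_apply, Module.End.mul_apply, vF_bas, vE_bas,
      vH_bas, map_smul, Module.End.one_apply, smul_smul, ← algebraMap_smul K (1 / 2 : ℂ),
      ← algebraMap_smul K ((lam - 1) * (lam + 1) / 2), ← map_mul, Nat.add_sub_cancel,
      ← add_smul, ← map_add]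
    congr 2
    push_cast
    ring

/-- The representation of `sl₂` by `f v_i = v_{i+1}`, `h v_i = (λ - 1 - 2i) v_i`,
`e v_i = i (λ - i) v_{i-1}`. -/
def vermaLie (lam : ℂ) : sl2 →ₗ⁅ℂ⁆ Mat ℕ where
  toFun x := x.1 0 1 • vE lam + x.1 1 0 • vF + x.1 0 0 • vH lam
  map_add' x y := by
    simp only [AddMemClass.coe_add, Matrix.add_apply, add_smul]
    abel
  map_smul' c x := by
    simp [smul_add, smul_smul]
  map_lie' := by
    rintro ⟨x, hx⟩ ⟨y, hy⟩
    have hx' : x 1 1 = -x 0 0 := by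
      have : Matrix.traceLinearMap (Fin 2) ℂ ℂ x = 0 := hx
      simp only [Matrix.traceLinearMap_apply, Matrix.trace_fin_two] at this
      linear_combination this
    have hy' : y 1 1 = -y 0 0 := by
      have : Matrix.traceLinearMap (Fin 2) ℂ ℂ y = 0 := hy
      simp only [Matrix.traceLinearMap_apply, Matrix.trace_fin_two] at this
      linear_combination this
    have ef := v_ef lam
    have he := v_he lam
    have hf := v_hf lam
    have e1 : vE lam * vF = vF * vE lam + vH lam := by rw [← ef]; abel
    have e2 : vH lam * vE lam = vE lam * vH lam + (2 : ℂ) • vE lam := by rw [← he]; abel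
    have e3 : vH lam * vF = vF * vH lam - (2 : ℂ) • vF := by
      rw [sub_eq_add_neg (vF * vH lam) ((2 : ℂ) • vF), ← hf]; abel
    simp only [LieAlgebra.SpecialLinear.sl_bracket, Ring.lie_def, Matrix.sub_apply,
      Matrix.mul_apply, Fin.sum_univ_two, hx', hy']
    simp only [mul_add, add_mul, smul_mul_assoc, mul_smul_comm, e1, e2, e3, smul_add,
      smul_smul]
    module

/-- The action of `gl_λ` on the Verma module, identifying `gl_λ` with an algebra of infinite
matrices. -/
def verma (lam : ℂ) : Gl lam →ₐ[ℂ] Mat ℕ :=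
  RingQuot.liftAlgHom ℂ ⟨UniversalEnvelopingAlgebra.lift ℂ (vermaLie lam), by
    have h : ∀ x : sl2, UniversalEnvelopingAlgebra.lift ℂ (vermaLie lam) (toU x) =
        vermaLie lam x := UniversalEnvelopingAlgebra.lift_ι_apply ℂ (vermaLie lam)
    have hE : vermaLie lam sl2E = vE lam := by simp [vermaLie, sl2E]
    have hF : vermaLie lam sl2F = vF := by simp [vermaLie, sl2F]
    have hH : vermaLie lam sl2H = vH lam := by simp [vermaLie, sl2H]
    rintro _ _ ⟨⟩
    rw [AlgHom.commutes, ← v_casimir]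
    simp only [casimir, map_add, map_mul, map_smul, h, hE, hF, hH]⟩

/-- The completed loop algebra of `po_λ`: matrices over `ℂ((z))` with finitely many non-zero
diagonals below the main one (and possibly infinitely many above it), each diagonal of which is
the corresponding diagonal of an element of `po_λ ⊗ ℂ((z))`. -/
def loopPo (lam : ℂ) : Set (Mat ℕ) :=
  {A | (∃ N : ℕ, ∀ i j, j + N < i → entry A i j = 0) ∧
    ∀ d : ℤ, ∃ B ∈ Submodule.span K (verma lam '' po lam),
      ∀ i j : ℕ, (j : ℤ) - i = d → entry A i j = entry B i j}

open Classical in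
/-- The trace on matrices of complex size: if the sum of the first `N` diagonal entries is a
polynomial `P(N)`, then `Tr A = P(λ)`. -/
def traceC (lam : ℂ) (A : Mat ℕ) : K :=
  if h : ∃ P : K[X], ∀ᶠ N : ℕ in Filter.atTop,
      P.eval (N : K) = ∑ i ∈ Finset.range N, entry A i i
  then h.choose.eval (algebraMap ℂ K lam) else 0

/-! ### Matrices of finite size -/

/-- The principal nilpotent matrix `f v_i = v_{i+1}`. -/
def finF (n : ℕ) : Mat (Fin n) :=
  ofCols fun j => if h : (j : ℕ) + 1 < n then bas ⟨j + 1, h⟩ else 0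

/-- `e v_i = i (n - i) v_{i-1}`. -/
def finE (n : ℕ) : Mat (Fin n) :=
  ofCols fun j => algebraMap ℂ K (j * ((n : ℂ) - j)) • bas ⟨(j : ℕ) - 1, by omega⟩

/-- The bilinear form `(v_i, v_{n-1-i}) = (-1)^i`, which is non-degenerate, alternating for `n`
even and symmetric for `n` odd. -/
def clForm (n : ℕ) (v w : Fin n →₀ K) : K := ∑ i : Fin n, (-1) ^ (i : ℕ) * v i * w i.rev

/-- The loop algebra of the Lie algebra of matrices that are skew with respect to this form:
`sp_n` for `n` even and `so_n` for `n` odd. -/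
def loopCl (n : ℕ) : Set (Mat (Fin n)) :=
  {A | ∀ v w, clForm n (A v) w = -clForm n v (A w)}

/-- The usual trace. -/
def traceN (n : ℕ) (A : Mat (Fin n)) : K := ∑ i, entry A i i

/-- The upper left `n × n` block of an infinite matrix. -/
def block (n : ℕ) (A : Mat ℕ) : Mat (Fin n) :=
  ofCols fun j => Finsupp.equivFunOnFinite.symm fun i => entry A i j

/-! ### Affinization, Kirillov–Kostant structure and Drinfeld–Sokolov reduction

Here `𝔤` is a loop algebra of matrices indexed by `ι` and `tr` a `ℂ((z))`-valued trace on it. -/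

section Reduction

variable {ι : Type}

/-- The inner product `Res Tr(A B) z⁻¹ dz`. -/
def form (tr : Mat ι → K) (A B : Mat ι) : ℂ := res (tr (A * B) * zz⁻¹)

/-- The cocycle `Res Tr(A' B) dz`. -/
def cocycle (tr : Mat ι → K) (A B : Mat ι) : ℂ := res (tr (matDeriv A * B))

/-- The bracket of the affine algebra `𝔤 ⊕ ℂ c`. -/
def affBracket (tr : Mat ι → K) (X Y : Mat ι × ℂ) : Mat ι × ℂ :=
  (X.1 * Y.1 - Y.1 * X.1, cocycle tr X.1 Y.1)

/-- The pair `(A, k)` as a linear functional on the affine algebra. -/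
def affPair (tr : Mat ι → K) (l X : Mat ι × ℂ) : ℂ := form tr l.1 X.1 + l.2 * X.2

/-- The Kirillov–Kostant structure `⟨[X, Y], (A, k)⟩` at the point `(A, k)` of the hyperplane
of level `k`, on functions with differentials `X`, `Y`. -/
def kirillovKostant (tr : Mat ι → K) (k : ℂ) (A X Y : Mat ι) : ℂ :=
  affPair tr (A, k) (affBracket tr (X, 0) (Y, 0))

variable [LinearOrder ι]

/-- The nilpotent subalgebra of strictly upper triangular elements. -/
def nilp (𝔤 : Set (Mat ι)) : Set (Mat ι) := {Y ∈ 𝔤 | ∀ i j, j ≤ i → entry Y i j = 0}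

/-- The preimage `p⁻¹(f)` of the momentum map, i.e. of the restriction of functionals to the
nilpotent subalgebra. -/
def fiber (𝔤 : Set (Mat ι)) (tr : Mat ι → K) (f : Mat ι) : Set (Mat ι) :=
  {A ∈ 𝔤 | ∀ Y ∈ nilp 𝔤, form tr A Y = form tr f Y}

/-- The tangent space to `p⁻¹(f)`. -/
def fiberTangent (𝔤 : Set (Mat ι)) (tr : Mat ι → K) : Set (Mat ι) :=
  {B ∈ 𝔤 | ∀ Y ∈ nilp 𝔤, form tr B Y = 0}

/-- `X = exp Y`, for a locally nilpotent `Y`. -/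
def IsExp (Y X : Mat ι) : Prop :=
  ∀ v, X v = ∑ᶠ m : ℕ, algebraMap ℂ K ((m.factorial : ℂ)⁻¹) • (Y ^ m) v

/-- `(B, k)` is obtained from `(A, k)` by the coadjoint action of the nilpotent group `exp 𝔫`:
`B = X A X⁻¹ - k z X' X⁻¹` with `X = exp Y`, `Y ∈ 𝔫`. -/
def Gauge (𝔤 : Set (Mat ι)) (k : ℂ) (A B : Mat ι) : Prop :=
  ∃ Y ∈ nilp 𝔤, ∃ X, IsExp Y X ∧ B * X = X * A - (algebraMap ℂ K k * zz) • matDeriv X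

/-- `A = f + ∑ b_i(z) e^{2i+1}`. -/
def IsSlice (e f : Mat ι) (b : ℕ → K) (A : Mat ι) : Prop :=
  (∀ i, e ^ (2 * i + 1) = 0 → b i = 0) ∧
    ∀ v, A v = f v + ∑ᶠ i : ℕ, b i • (e ^ (2 * i + 1)) v

end Reduction

/-! ### Pseudodifferential symbols -/

/-- A sequence `u` is used as the symbol `∑_{m ∈ ℤ} u_m(z) D^{μ + m}` of complex order; only
sequences vanishing for large `m` occur, and the number `μ` is kept track of separately. -/
abbrev Symb : Type := ℤ → K

/-- Composition of `∑ a_i D^{μ + i}` with `∑ b_j D^{ν + j}`, by the rule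
`D^α ∘ f = ∑_l (α choose l) f^{(l)} D^{α - l}`; the result is `∑_m (comp μ a b)_m D^{μ + ν + m}`. -/
def comp (mu : ℂ) (a b : Symb) : Symb := fun m =>
  ∑ᶠ p : ℤ × ℤ, if m ≤ p.1 + p.2 then
    algebraMap ℂ K (Ring.choose (mu + p.1) (p.1 + p.2 - m).toNat) *
      (a p.1 * dz^[(p.1 + p.2 - m).toNat] (b p.2)) else 0

/-- The symbol with the single coefficient `a` in place `m`. -/
def mono (m : ℤ) (a : K) : Symb := Pi.single m a

/-- The differential part of a symbol of integral order (`μ = 0`). -/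
def plus (P : Symb) : Symb := fun m => if 0 ≤ m then P m else 0

/-- The trace of a symbol of integral order: the residue of the coefficient of `D⁻¹`. -/
def symTr (P : Symb) : ℂ := res (P (-1))

/-- `ΨDS_λ`: symbols `D^λ + ∑_{m < 0} u_m D^{λ + m}`; this set does not depend on `λ` when written
in coefficients. -/
def PsiDS : Set Symb := {L | L 0 = 1 ∧ ∀ m, 0 < m → L m = 0}

/-- Tangent vectors `∑_{m < 0} δu_m D^{λ + m}`. -/
def PsiTangent : Set Symb := {δ | ∀ m, 0 ≤ m → δ m = 0}

/-- Cotangent vectors `D^{-λ} ∘ Q`, where `Q` is a differential operator. -/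
def PsiCotangent (lam : ℂ) : Set Symb :=
  {X | ∃ Q : Symb, (∀ m, m < 0 → Q m = 0) ∧ (∃ N : ℤ, ∀ m, N < m → Q m = 0) ∧
    X = comp (-lam) (mono 0 1) Q}

/-- The linear functional `F_X(δ) = Tr(δ ∘ X)`. -/
def FF (lam : ℂ) (X δ : Symb) : ℂ := symTr (comp lam δ X)

/-- The Hamiltonian map `V_X(L) = (L X)_+ L - L (X L)_+`. -/
def hamV (lam : ℂ) (X L : Symb) : Symb :=
  comp 0 (plus (comp lam L X)) L - comp lam L (plus (comp (-lam) X L))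

/-- The quadratic Gelfand–Dickey structure `{F_X, F_Y}(L) = F_Y(V_X(L))`. -/
def gelfandDickey (lam : ℂ) (L X Y : Symb) : ℂ := FF lam Y (hamV lam X L)

/-- The involution `(∑ u_m D^{λ + m})^* = ∑ (-1)^m D^{λ + m} ∘ u_m`. -/
def star (lam : ℂ) (u : Symb) : Symb := fun m =>
  ∑ᶠ j : ℤ, algebraMap ℂ K ((-1) ^ j) * comp lam (mono j 1) (mono 0 (u j)) m

/-- `ΨDS_λ^{SA}`: self-adjoint symbols. -/
def PsiSA (lam : ℂ) : Set Symb := {L ∈ PsiDS | star lam L = L}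

/-- The tangent space to `ΨDS_λ^{SA}`. -/
def PsiSATangent (lam : ℂ) : Set Symb := {δ ∈ PsiTangent | star lam δ = δ}

/-- The cotangent space to `ΨDS_λ^{SA}`: the cotangent vectors `X` to `ΨDS_λ` whose functional
`F_X` is invariant under the involution. -/
def PsiSACotangent (lam : ℂ) : Set Symb :=
  {X ∈ PsiCotangent lam | ∀ δ ∈ PsiTangent, FF lam X (star lam δ) = FF lam X δ}

/-- `DO_n`: differential operators `D^n + ∑_{-n ≤ m < 0} u_m D^{n + m}`. -/
def DO (n : ℕ) : Set Symb := {L ∈ PsiDS | ∀ m : ℤ, m < -n → L m = 0}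

/-! ### Isomorphism of the reduced space with a space of self-adjoint symbols -/

/-- The value at `b` of a differential polynomial in `(b_i)` over `ℂ((z))`; the variable `(i, l)`
stands for `b_i^{(l)}`. -/
def evalDiff (P : MvPolynomial (ℕ × ℕ) K) (b : ℕ → K) : K :=
  MvPolynomial.eval (fun p => dz^[p.2] (b p.1)) P

/-- Specialization at `λ` of a differential polynomial with coefficients in `ℂ((z))[λ]`. -/
def specialize (lam : ℂ) (P : MvPolynomial (ℕ × ℕ) K[X]) : MvPolynomial (ℕ × ℕ) K :=
  MvPolynomial.map (Polynomial.evalRingHom (algebraMap ℂ K lam)) P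

section Iso

variable {ι : Type} [LinearOrder ι]

/-- `x ∈ 𝔤` represents the differential at `A ∈ p⁻¹(f)` of the pull-back of the functional `F_X`
under `Φ : p⁻¹(f) → ΨDS_λ^{SA}`. -/
def Represents (𝔤 : Set (Mat ι)) (tr : Mat ι → K) (lam : ℂ) (Φ : Mat ι → Symb)
    (A : Mat ι) (X : Symb) (x : Mat ι) : Prop :=
  x ∈ 𝔤 ∧ ∀ B ∈ fiberTangent 𝔤 tr,
    HasDerivAt (fun t : ℂ => FF lam X (Φ (A + algebraMap ℂ K t • B) - Φ A)) (form tr x B) 0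

/-- `Φ` induces an isomorphism of Poisson manifolds from the Hamiltonian reduction
`p⁻¹(f) / exp 𝔫` of the Kirillov–Kostant structure of level `k` onto the space `S` of self-adjoint
symbols of order `λ` with the structure `-k⁻¹ { , }_GD`, given in coordinates by the differential
polynomials `Q`. -/
structure IsReductionIso (𝔤 : Set (Mat ι)) (tr : Mat ι → K) (e f : Mat ι) (k lam : ℂ)
    (S : Set Symb) (Q : ℕ → MvPolynomial (ℕ × ℕ) K) (Φ : Mat ι → Symb) : Prop where
  mapsTo : ∀ A ∈ fiber 𝔤 tr f, Φ A ∈ S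
  surj : ∀ L ∈ S, ∃ A ∈ fiber 𝔤 tr f, Φ A = L
  /-- The fibres of `Φ` are the orbits. -/
  orbit : ∀ A ∈ fiber 𝔤 tr f, ∀ B ∈ fiber 𝔤 tr f, Φ A = Φ B ↔ Gauge 𝔤 k A B
  /-- The elements `f + ∑ b_i e^{2i+1}` form a global slice, so that the `b_i` are coordinates
  on the quotient. -/
  slice_exists : ∀ b : ℕ → K, (∀ i, e ^ (2 * i + 1) = 0 → b i = 0) →
    ∃ A ∈ fiber 𝔤 tr f, IsSlice e f b A
  slice_unique : ∀ A ∈ fiber 𝔤 tr f, ∃! b : ℕ → K,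
    ∃ B ∈ fiber 𝔤 tr f, IsSlice e f b B ∧ Gauge 𝔤 k A B
  /-- In these coordinates `Φ` and its inverse are given by differential polynomials. -/
  regular : ∀ b A, IsSlice e f b A →
    ∀ m : ℕ, Φ A (-(m + 1 : ℤ)) = evalDiff (Q m) b
  regular_inv : ∃ R : ℕ → MvPolynomial (ℕ × ℕ) K, ∀ b A, IsSlice e f b A →
    ∀ i : ℕ, b i = evalDiff (R i) (fun m => Φ A (-(m + 1 : ℤ)))
  /-- Every covector on `S` pulls back to a covector represented by an element of `𝔤`. -/
  differential : ∀ A ∈ fiber 𝔤 tr f, ∀ X ∈ PsiSACotangent lam,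
    ∃ x, Represents 𝔤 tr lam Φ A X x
  /-- `Φ` carries the reduced structure, computed through arbitrary continuations of the pulled
  back functions, to the Gelfand–Dickey structure. -/
  poisson : ∀ A ∈ fiber 𝔤 tr f, ∀ X ∈ PsiSACotangent lam, ∀ Y ∈ PsiSACotangent lam, ∀ x y,
    Represents 𝔤 tr lam Φ A X x → Represents 𝔤 tr lam Φ A Y y →
      kirillovKostant tr k A x y = -k⁻¹ * gelfandDickey lam (Φ A) X Y

end Iso

/-- `X` represents on `ΨDS_λ^{SA}` the functional `u ↦ Res a u_{-2(i+1)}`. -/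
def IsCoordCovector (lam : ℂ) (i : ℕ) (a : K) (X : Symb) : Prop :=
  X ∈ PsiSACotangent lam ∧
    ∀ δ ∈ PsiSATangent lam, FF lam X δ = res (a * δ (-(2 * (i + 1) : ℤ)))

end ComplexSize

end

open scoped Polynomial

noncomputable section

namespace ComplexSize

attribute [local instance] LieRing.ofAssociativeRing

/-! ### Laurent series -/

/-! Read the basis vector v_s as the symbol D^s, with s any complex number. Left composition with D
sends g D^s to g' D^s + g D^{s+1}, so it is the connection ∇₀ = d/dz + F. For an upper triangular a
there is exactly one unitriangular operator L_a with ∇₀ L_a = L_a ∇_a and L_a v_0 = v_0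
(`gdef_solOp`, `eq_of_gdef_eq`). For natural s its columns come from the usual elimination that
turns a first-order system into a scalar equation, and L_a v_n is the Drinfeld–Sokolov operator of
order n. The entries of L_a are obtained by indefinite summation, so they are polynomials in s, and
the same column makes sense at s = λ. The Poisson map sends a to the symbol L_a v_λ.

All sizes are treated at once by operators v_s ↦ Σ p_d(s) v_{s-d} with polynomial coefficients.
Elements of gl_λ are those whose coefficients p_d are divisible by W_d, the coefficient of e^d; then
the spans of v_0, v_1, … and of v_λ, v_{λ+1}, … are preserved. Both po_λ(z) and the loop algebras of
sp_n, so_n are sets of matrices of σ-skew operators of this kind (`loopPo_eq`, `loopCl_eq`), and the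
trace is summation of p_0 "from 0 to λ - 1" (`csum`). Conjugation by powers of kz turns the level k
action into the plain gauge action, at the cost of the Cartan term h/2z (`rep_gdef`).

Orbits. If x intertwines ∇_a and ∇_b and fixes v_0 and v_λ, uniqueness gives L_b x = L_a, so the
symbols agree. Conversely, if they agree, x = L_b⁻¹ L_a intertwines the connections and fixes v_0
and v_λ, hence preserves both spans; uniqueness again gives σ(x) x = 1, so log x is skew
(`exists_gauge`, `sig_mul_eq_one`, `exists_log`). Self-adjointness: L_{-σ(a)} v_λ is the adjoint of
L_a v_λ (`vl_Lop_neg_sig`).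

Poisson structure. Right multiplication by P = X∘L commutes with ∇₀, so its conjugate by L_a, with a
minus sign, commutes with ∇_a. The part x of it on and below the diagonal represents the covector X:
because the trace of ∇_a y - y ∇_a is a total derivative plus a boundary term at λ, pairing x with a
variation gives Res of the D⁻¹-coefficient of δL∘X. The commutator [∇_a, x] moves the symbol by
L(XL)_+ - (LX)_+L (`exists_representing`, with `factor` identifying differential parts). Taking
σ-skew parts gives the self-adjoint case, and invariance of the pairing makes the answer independent
of the continuations (`poisson_Phi`).

Slice. On f + Σ b_i e^{2i+1} the coefficient u_{-2i-2} is a nonzero multiple of b_i plus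
differential polynomials in b_0, …, b_{i-1}; the multiple is a trace of W_{2i+1}, computed by the
recursion `csum_wPoly_succ`. Since a self-adjoint symbol is determined by its even coefficients, the
slice parametrizes all symbols, and every construction used is polynomial in λ (`UPoly`). -/

theorem coeff_mul_Icc {R : Type*} [Semiring R] (x y : HahnSeries ℤ R) (N M : ℤ)
    (hx : ∀ i < -N, x.coeff i = 0) (hy : ∀ i < -M, y.coeff i = 0) (d : ℤ) :
    (x * y).coeff d = ∑ e ∈ Finset.Icc (-M) (d + N), x.coeff (d - e) * y.coeff e := by
  rw [HahnSeries.coeff_mul]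
  refine Finset.sum_of_injOn Prod.snd ?_ ?_ ?_ ?_
  · intro a ha b hb hab
    simp only [Finset.mem_coe, Finset.mem_antidiagonal] at ha hb
    ext
    · have := ha.2.2; have := hb.2.2; omega
    · exact hab
  · intro a ha
    simp only [Finset.mem_coe, Finset.mem_antidiagonal, HahnSeries.mem_support] at ha
    have h1 : ¬ a.1 < -N := fun h => ha.1 (hx _ h)
    have h2 : ¬ a.2 < -M := fun h => ha.2.1 (hy _ h)
    have := ha.2.2
    simp only [Finset.coe_Icc, Set.mem_Icc]
    omega
  · intro e _ h
    by_contra hne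
    refine h ⟨(d - e, e), ?_, rfl⟩
    simp only [Finset.mem_coe, Finset.mem_antidiagonal, HahnSeries.mem_support]
    exact ⟨left_ne_zero_of_mul hne, right_ne_zero_of_mul hne, by ring⟩
  · intro a ha
    simp only [Finset.mem_antidiagonal] at ha
    rw [← ha.2.2, add_sub_cancel_right]

theorem exists_coeff_bound {R : Type*} [Zero R] (x : HahnSeries ℤ R) :
    ∃ N : ℕ, ∀ i < -(N : ℤ), x.coeff i = 0 := by
  refine ⟨(-x.order).toNat, fun i hi => HahnSeries.coeff_eq_zero_of_lt_order ?_⟩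
  omega

theorem dz_coeff (a : K) (n : ℤ) :
    HahnSeries.coeff (Γ := ℤ) (R := ℂ) (dz a) n
      = (n + 1) * HahnSeries.coeff (Γ := ℤ) (R := ℂ) a (n + 1) := by
  have h := LaurentSeries.hasseDeriv_coeff (R := ℂ) (V := ℂ) 1 a n
  rw [Nat.cast_one, Ring.choose_one_right, zsmul_eq_mul, Int.cast_add, Int.cast_one] at h
  exact h

theorem K_ext {a b : K} (h : ∀ n : ℤ, HahnSeries.coeff (Γ := ℤ) (R := ℂ) a n
    = HahnSeries.coeff (Γ := ℤ) (R := ℂ) b n) : a = b :=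
  HahnSeries.ext (funext h)

theorem dz_mul (a b : K) : dz (a * b) = dz a * b + a * dz b := by
  obtain ⟨N, hN⟩ := exists_coeff_bound (a : LaurentSeries ℂ)
  obtain ⟨M, hM⟩ := exists_coeff_bound (b : LaurentSeries ℂ)
  have hN' : ∀ i < -((N : ℤ) + 1), HahnSeries.coeff (Γ := ℤ) (R := ℂ) (dz a) i = 0 := fun i hi => by
    rw [dz_coeff, hN _ (by omega), mul_zero]
  have hM' : ∀ i < -((M : ℤ) + 1), HahnSeries.coeff (Γ := ℤ) (R := ℂ) (dz b) i = 0 := fun i hi => by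
    rw [dz_coeff, hM _ (by omega), mul_zero]
  apply K_ext
  intro n
  rw [dz_coeff]
  refine Eq.trans ?_ (HahnSeries.coeff_add (Γ := ℤ) (R := ℂ) (x := dz a * b) (y := a * dz b)
    (a := n)).symm
  refine (congrArg _ (coeff_mul_Icc (R := ℂ) a b N M hN hM (n + 1))).trans ?_
  refine Eq.trans ?_ (congrArg₂ _ (coeff_mul_Icc (R := ℂ) (dz a) b (N + 1) M hN' hM n).symm
    (coeff_mul_Icc (R := ℂ) a (dz b) N (M + 1) hN hM' n).symm)
  have h3 : ∑ e ∈ Finset.Icc (-((M : ℤ) + 1)) (n + N),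
        HahnSeries.coeff (Γ := ℤ) (R := ℂ) a (n - e) * HahnSeries.coeff (Γ := ℤ) (R := ℂ) (dz b) e
      = ∑ e ∈ Finset.Icc (-(M : ℤ)) (n + 1 + N), HahnSeries.coeff (Γ := ℤ) (R := ℂ) a (n + 1 - e)
        * (e * HahnSeries.coeff (Γ := ℤ) (R := ℂ) b e) := by
    refine Finset.sum_nbij' (· + 1) (· - 1) ?_ ?_ ?_ ?_ ?_
    · intro e he; simp only [Finset.mem_Icc] at *; omega
    · intro e he; simp only [Finset.mem_Icc] at *; omega
    · intro e _; ring
    · intro e _; ring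
    · intro e _
      rw [dz_coeff]
      push_cast
      rw [show n + 1 - (e + 1) = n - e by ring]
  rw [h3, Finset.mul_sum, show n + ((N : ℤ) + 1) = n + 1 + N by ring, ← Finset.sum_add_distrib]
  refine Finset.sum_congr rfl fun e _ => ?_
  rw [dz_coeff, show n - e + 1 = n + 1 - e by ring]
  push_cast
  ring

theorem coeff_algebraMap_mul (c : ℂ) (a : K) (n : ℤ) :
    HahnSeries.coeff (Γ := ℤ) (R := ℂ) (algebraMap ℂ K c * a) n
      = c * HahnSeries.coeff (Γ := ℤ) (R := ℂ) a n :=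
  HahnSeries.coeff_single_zero_mul (Γ := ℤ) (R := ℂ) (r := c) (x := a) (a := n)

theorem dz_const_mul (c : ℂ) (a : K) : dz (algebraMap ℂ K c * a) = algebraMap ℂ K c * dz a := by
  apply K_ext
  intro n
  rw [dz_coeff, coeff_algebraMap_mul, coeff_algebraMap_mul, dz_coeff]
  ring

theorem dz_const (c : ℂ) : dz (algebraMap ℂ K c) = 0 := by
  have h := dz_mul 1 1
  simp only [mul_one, one_mul] at h
  have h1 : dz 1 = 0 := by
    have := congrArg (fun t => t - dz 1) h
    simpa using this.symm
  have := dz_const_mul c 1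
  rwa [mul_one, h1, mul_zero] at this

theorem dz_one : dz 1 = 0 := by simpa using dz_const 1

/-- The derivation as a `ℂ`-linear map. -/
def dzL : K →ₗ[ℂ] K where
  toFun := dz
  map_add' := map_add dz
  map_smul' c a := by
    rw [Algebra.smul_def, dz_const_mul, RingHom.id_apply, Algebra.smul_def]

/-- The residue as a `ℂ`-linear map. -/
def resL : K →ₗ[ℂ] ℂ where
  toFun := res
  map_add' a b := HahnSeries.coeff_add (Γ := ℤ) (R := ℂ) (x := a) (y := b) (a := -1)
  map_smul' c a := by
    rw [Algebra.smul_def]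
    exact coeff_algebraMap_mul c a (-1)

theorem res_add (a b : K) : res (a + b) = res a + res b := map_add resL a b
theorem res_neg (a : K) : res (-a) = -res a := map_neg resL a
theorem res_sub (a b : K) : res (a - b) = res a - res b := map_sub resL a b
theorem res_zero : res 0 = 0 := map_zero resL
theorem res_const_mul (c : ℂ) (a : K) : res (algebraMap ℂ K c * a) = c * res a :=
  coeff_algebraMap_mul c a (-1)

theorem res_sum {β : Type*} (s : Finset β) (f : β → K) : res (∑ i ∈ s, f i) = ∑ i ∈ s, res (f i) :=
  map_sum resL f s

theorem res_dz (a : K) : res (dz a) = 0 := by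
  unfold res
  rw [dz_coeff]
  norm_num

theorem dz_zz : dz zz = 1 := by
  apply K_ext
  intro n
  rw [dz_coeff]
  change ((n : ℂ) + 1) * (HahnSeries.single (1 : ℤ) (1 : ℂ)).coeff (n + 1)
    = (HahnSeries.single (0 : ℤ) (1 : ℂ)).coeff n
  by_cases h : n = 0
  · subst h; simp
  · rw [HahnSeries.coeff_single_of_ne (by omega), HahnSeries.coeff_single_of_ne h, mul_zero]

theorem zz_ne_zero : zz ≠ 0 :=
  HahnSeries.single_ne_zero (Γ := ℤ) (R := ℂ) one_ne_zero

theorem eq_zero_of_res_mul {a : K} (h : ∀ b : K, res (a * b) = 0) : a = 0 := by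
  apply K_ext
  intro n
  have := h ((HahnSeries.single (-1 - n) 1 : LaurentSeries ℂ))
  have h2 := HahnSeries.coeff_mul_single_add (Γ := ℤ) (R := ℂ) (r := 1) (x := a) (a := n)
    (b := -1 - n)
  rw [show n + (-1 - n) = -1 by ring, mul_one] at h2
  exact h2.symm.trans this

instance : CharZero K := charZero_of_injective_algebraMap (algebraMap ℂ K).injective

theorem dz_inv {a : K} (ha : a ≠ 0) : dz a⁻¹ = -(dz a * (a⁻¹ * a⁻¹)) := by
  have h := dz_mul a a⁻¹
  rw [mul_inv_cancel₀ ha, dz_one] at h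
  have h2 : a * dz a⁻¹ = -(dz a * a⁻¹) := by linear_combination -h
  calc dz a⁻¹ = a⁻¹ * (a * dz a⁻¹) := by rw [← mul_assoc, inv_mul_cancel₀ ha, one_mul]
    _ = _ := by rw [h2]; ring

/-- The gauge factors (kz)^d are homogeneous, so differentiating them only multiplies by d/z. This
is the source of the Cartan term `hOp`. -/
theorem dz_zpow {k : ℂ} (hk : k ≠ 0) (d : ℤ) :
    dz ((algebraMap ℂ K k * zz) ^ d) = d * zz⁻¹ * (algebraMap ℂ K k * zz) ^ d := by
  have hk' : algebraMap ℂ K k ≠ 0 := by simpa using hk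
  have hz := zz_ne_zero
  set κ := algebraMap ℂ K k * zz with hκ
  have hκ0 : κ ≠ 0 := mul_ne_zero hk' hz
  have h1 : dz κ = zz⁻¹ * κ := by
    rw [hκ, dz_const_mul, dz_zz]; field_simp
  have hn : ∀ n : ℕ, dz (κ ^ n) = n * zz⁻¹ * κ ^ n := by
    intro n
    induction n with
    | zero => simp [dz_one]
    | succ n ih =>
      rw [pow_succ, dz_mul, ih, h1]; push_cast; ring
  cases d with
  | ofNat n => simpa using hn n
  | negSucc n =>
    rw [zpow_negSucc, dz_inv (pow_ne_zero _ hκ0), hn]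
    have := pow_ne_zero (n + 1) hκ0
    rw [Int.cast_negSucc]
    field_simp

theorem dz_sum {β : Type*} (s : Finset β) (f : β → K) : dz (∑ i ∈ s, f i) = ∑ i ∈ s, dz (f i) :=
  map_sum dz f s

theorem iter_dz_add (n : ℕ) (a b : K) : dz^[n] (a + b) = dz^[n] a + dz^[n] b := by
  induction n generalizing a b with
  | zero => rfl
  | succ n ih => simp only [Function.iterate_succ, Function.comp, map_add, ih]

theorem iter_dz_zero (n : ℕ) : dz^[n] 0 = 0 := by
  induction n with
  | zero => rfl
  | succ n ih => simp only [Function.iterate_succ, Function.comp, map_zero, ih]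

theorem iter_dz_const_mul (n : ℕ) (c : ℂ) (a : K) :
    dz^[n] (algebraMap ℂ K c * a) = algebraMap ℂ K c * dz^[n] a := by
  induction n generalizing a with
  | zero => rfl
  | succ n ih => simp only [Function.iterate_succ, Function.comp, dz_const_mul, ih]

/-- `dz^[n]` as a linear map. -/
def dzP (n : ℕ) : K →ₗ[ℂ] K where
  toFun := dz^[n]
  map_add' := iter_dz_add n
  map_smul' c a := by
    rw [Algebra.smul_def, iter_dz_const_mul, RingHom.id_apply, Algebra.smul_def]

theorem dzP_apply (n : ℕ) (a : K) : dzP n a = dz^[n] a := rfl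

/-! ### Indefinite summation of polynomials -/

/-- The polynomial `S` with `S(X + 1) - S(X) = X ^ n` and `S(0) = 0`. -/
def powSum (n : ℕ) : ℚ[X] :=
  Polynomial.C ((n + 1 : ℚ)⁻¹) *
    (Polynomial.bernoulli (n + 1) - Polynomial.C ((Polynomial.bernoulli (n + 1)).eval 0))

/-- This is the difference equation of the Bernoulli polynomials. -/
theorem taylor_powSum (n : ℕ) : Polynomial.taylor 1 (powSum n) - powSum n = Polynomial.X ^ n := by
  have h := Polynomial.bernoulli_comp_one_add_X (n + 1)
  have h1 : (n + 1 : ℚ) ≠ 0 := by positivity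
  have h2 : Polynomial.taylor 1 (Polynomial.bernoulli (n + 1))
      = Polynomial.bernoulli (n + 1) + (n + 1 : ℚ) • Polynomial.X ^ n := by
    rw [Polynomial.taylor_apply, Polynomial.C_1, add_comm Polynomial.X, h]
    congr 1
    rw [Nat.add_sub_cancel, ← Nat.cast_smul_eq_nsmul ℚ]
    push_cast
    rfl
  rw [powSum, Polynomial.taylor_mul, Polynomial.taylor_C, map_sub, Polynomial.taylor_C, h2,
    ← mul_sub, Polynomial.smul_eq_C_mul, sub_sub_sub_cancel_right, add_sub_cancel_left, ← mul_assoc, ← Polynomial.C_mul,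
    inv_mul_cancel₀ h1, Polynomial.C_1, one_mul]

section Summation

variable {R : Type*} [CommRing R] [Algebra ℚ R]

/-- Indefinite summation: `antidiff p (X + 1) - antidiff p X = p` and `antidiff p 0 = 0`. -/
def antidiff : R[X] →ₗ[R] R[X] :=
  Polynomial.lsum fun n => LinearMap.toSpanSingleton R R[X] ((powSum n).map (algebraMap ℚ R))

theorem antidiff_monomial (n : ℕ) (c : R) :
    antidiff (Polynomial.monomial n c) = Polynomial.C c * (powSum n).map (algebraMap ℚ R) := by
  simp [antidiff, Polynomial.sum_monomial_index, Polynomial.smul_eq_C_mul]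

theorem taylor_antidiff (p : R[X]) : Polynomial.taylor 1 (antidiff p) - antidiff p = p := by
  induction p using Polynomial.induction_on' with
  | add p q hp hq =>
    rw [map_add, map_add, add_sub_add_comm, hp, hq]
  | monomial n c =>
    have h := congrArg (Polynomial.map (algebraMap ℚ R)) (taylor_powSum n)
    rw [Polynomial.map_sub, Polynomial.map_taylor, map_one, Polynomial.map_pow,
      Polynomial.map_X] at h
    rw [antidiff_monomial, Polynomial.taylor_mul, Polynomial.taylor_C, ← mul_sub, h,
      Polynomial.C_mul_X_pow_eq_monomial]

theorem antidiff_eval_zero (p : R[X]) : (antidiff p).eval 0 = 0 := by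
  induction p using Polynomial.induction_on' with
  | add p q hp hq => rw [map_add, Polynomial.eval_add, hp, hq, add_zero]
  | monomial n c =>
    rw [antidiff_monomial, Polynomial.eval_mul, Polynomial.eval_zero_map]
    simp [powSum]

/-- Summation has rational structure constants, so it commutes with every change of coefficients.
This is what lets it be carried out over universal differential polynomials. -/
theorem map_antidiff {R' : Type*} [CommRing R'] [Algebra ℚ R'] (φ : R →+* R') (p : R[X]) :
    (antidiff p).map φ = antidiff (p.map φ) := by
  induction p using Polynomial.induction_on' with
  | add p q hp hq => rw [map_add, Polynomial.map_add, hp, hq, Polynomial.map_add, map_add]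
  | monomial n c =>
    rw [antidiff_monomial, Polynomial.map_mul, Polynomial.map_C, Polynomial.map_map,
      Polynomial.map_monomial, antidiff_monomial]
    congr 2
    exact Subsingleton.elim _ _

end Summation

/-! ### Values, translations and sums of polynomials in the row index -/

/-- Evaluation at a complex number of a polynomial over `ℂ((z))`. -/
def ev (s : ℂ) : K[X] →+* K := Polynomial.evalRingHom (algebraMap ℂ K s)

theorem ev_apply (s : ℂ) (p : K[X]) : ev s p = p.eval (algebraMap ℂ K s) := rfl

theorem ev_C (s : ℂ) (a : K) : ev s (Polynomial.C a) = a := Polynomial.eval_C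
theorem ev_X (s : ℂ) : ev s Polynomial.X = algebraMap ℂ K s := Polynomial.eval_X

theorem ev_natCast (n : ℕ) (p : K[X]) : ev (n : ℂ) p = p.eval (n : K) := by
  rw [ev_apply, map_natCast]

/-- A nonzero polynomial has finitely many roots; identities in the row index therefore need
checking only at large integers. -/
theorem ev_ext_nat {p q : K[X]} (N : ℕ) (h : ∀ n : ℕ, N ≤ n → ev n p = ev n q) : p = q := by
  refine Polynomial.eq_of_infinite_eval_eq p q ?_
  refine Set.Infinite.mono (s := Set.range fun n : ℕ => ((n + N : ℕ) : K)) ?_ ?_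
  · rintro _ ⟨n, rfl⟩
    have := h (n + N) (by omega)
    rw [ev_natCast, ev_natCast] at this
    exact this
  · refine Set.infinite_range_of_injective fun a b hab => ?_
    have : a + N = b + N := by exact_mod_cast hab
    omega

theorem ev_ext {p q : K[X]} (h : ∀ s : ℂ, ev s p = ev s q) : p = q :=
  ev_ext_nat 0 fun n _ => h n

/-- Translation of the argument by an integer. -/
def tr (d : ℤ) : K[X] →ₐ[K] K[X] := Polynomial.taylorAlgHom (d : K)

theorem tr_apply (d : ℤ) (p : K[X]) : tr d p = Polynomial.taylor (d : K) p := rfl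

theorem ev_tr (s : ℂ) (d : ℤ) (p : K[X]) : ev s (tr d p) = ev (s + d) p := by
  rw [tr_apply, ev_apply, Polynomial.taylor_eval, ev_apply, map_add, map_intCast]

theorem tr_zero (p : K[X]) : tr 0 p = p := by
  rw [tr_apply, Int.cast_zero, Polynomial.taylor_zero]

theorem tr_tr (d e : ℤ) (p : K[X]) : tr d (tr e p) = tr (d + e) p := by
  simp only [tr_apply, Polynomial.taylor_taylor, Int.cast_add]

theorem ev_antidiff_succ (s : ℂ) (p : K[X]) :
    ev (s + 1) (antidiff p) = ev s (antidiff p) + ev s p := by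
  have h := congrArg (ev s) (taylor_antidiff p)
  rw [map_sub, ev_apply s (Polynomial.taylor _ _), Polynomial.taylor_eval] at h
  rw [ev_apply, map_add, map_one, ← h]
  ring

theorem ev_antidiff_zero (p : K[X]) : ev 0 (antidiff p) = 0 := by
  rw [ev_apply, map_zero, antidiff_eval_zero]

theorem ev_antidiff_nat (n : ℕ) (p : K[X]) :
    ev n (antidiff p) = ∑ i ∈ Finset.range n, ev i p := by
  induction n with
  | zero => rw [Nat.cast_zero, ev_antidiff_zero, Finset.sum_range_zero]
  | succ n ih => rw [Nat.cast_succ, ev_antidiff_succ, ih, Finset.sum_range_succ]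

/-- The difference of the two polynomials is periodic, hence constant. This is the uniqueness half
of indefinite summation. -/
theorem eq_of_ev_succ {p q : K[X]} (s₀ : ℂ) (h : ∀ s, ev (s + 1) p - ev s p = ev (s + 1) q - ev s q)
    (h₀ : ev s₀ p = ev s₀ q) : p = q := by
  have key : ∀ n : ℕ, ev (s₀ + n) p = ev (s₀ + n) q := by
    intro n
    induction n with
    | zero => simpa using h₀
    | succ n ih =>
      have := h (s₀ + n)
      rw [ih] at this
      rw [Nat.cast_succ, ← add_assoc]
      exact sub_left_injective this
  refine Polynomial.eq_of_infinite_eval_eq p q ?_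
  refine Set.Infinite.mono (s := Set.range fun n : ℕ => algebraMap ℂ K (s₀ + n)) ?_ ?_
  · rintro _ ⟨n, rfl⟩
    exact key n
  · refine Set.infinite_range_of_injective fun a b hab => ?_
    have : s₀ + a = s₀ + b := (algebraMap ℂ K).injective hab
    exact_mod_cast add_left_cancel this

/-- The sum of the values of `p` "from `0` to `λ - 1`". -/
def csum (lam : ℂ) (p : K[X]) : K := ev lam (antidiff p)

theorem csum_add (lam : ℂ) (p q : K[X]) : csum lam (p + q) = csum lam p + csum lam q := by
  rw [csum, map_add, map_add]; rfl

theorem csum_sub (lam : ℂ) (p q : K[X]) : csum lam (p - q) = csum lam p - csum lam q := by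
  rw [csum, map_sub, map_sub]; rfl

theorem csum_zero (lam : ℂ) : csum lam 0 = 0 := by rw [csum, map_zero, map_zero]

theorem csum_sum (lam : ℂ) {β : Type*} (t : Finset β) (f : β → K[X]) :
    csum lam (∑ i ∈ t, f i) = ∑ i ∈ t, csum lam (f i) := by
  simp only [csum, map_sum]

theorem csum_C_mul (lam : ℂ) (a : K) (p : K[X]) :
    csum lam (Polynomial.C a * p) = a * csum lam p := by
  rw [csum, ← Polynomial.smul_eq_C_mul, map_smul, Polynomial.smul_eq_C_mul, map_mul, ev_C]; rfl

theorem csum_nat (n : ℕ) (p : K[X]) : csum n p = ∑ i ∈ Finset.range n, ev i p :=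
  ev_antidiff_nat n p

/-- A telescoping sum with a complex number of terms. -/
theorem csum_eq_of_diff {lam : ℂ} {p q : K[X]} (h : ∀ s, ev s p = ev (s + 1) q - ev s q) :
    csum lam p = ev lam q - ev 0 q := by
  have : antidiff p = q - Polynomial.C (ev 0 q) := by
    refine eq_of_ev_succ 0 (fun s => ?_) ?_
    · rw [ev_antidiff_succ, map_sub, map_sub, ev_C, ev_C, h]
      ring
    · rw [ev_antidiff_zero, map_sub, ev_C, sub_self]
  rw [csum, this, map_sub, ev_C]

/-- Translation invariance of `csum` on polynomials vanishing at the ends. -/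
theorem csum_tr {lam : ℂ} {p : K[X]} (d : ℕ) (h0 : ∀ i : ℕ, i < d → ev i p = 0)
    (h1 : ∀ i : ℕ, i < d → ev (lam + i) p = 0) : csum lam (tr d p) = csum lam p := by
  have hs : antidiff (tr d p) = tr d (antidiff p) - Polynomial.C (ev d (antidiff p)) := by
    refine eq_of_ev_succ 0 (fun s => ?_) ?_
    · rw [ev_antidiff_succ, map_sub, map_sub, ev_C, ev_C, ev_tr, ev_tr, ev_tr,
        show s + 1 + ((d : ℤ) : ℂ) = s + (d : ℤ) + 1 by ring, ev_antidiff_succ]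
      ring
    · rw [ev_antidiff_zero, map_sub, ev_C, ev_tr, zero_add, Int.cast_natCast, sub_self]
  have key : ∀ n : ℕ, n ≤ d → ev (lam + n) (antidiff p) = ev lam (antidiff p) := by
    intro n hn
    induction n with
    | zero => rw [Nat.cast_zero, add_zero]
    | succ n ih =>
      rw [Nat.cast_succ, ← add_assoc, ev_antidiff_succ, h1 n (by omega), add_zero, ih (by omega)]
  have h2 : ev d (antidiff p) = 0 := by
    rw [ev_antidiff_nat]
    exact Finset.sum_eq_zero fun i hi => h0 i (Finset.mem_range.1 hi)
  rw [csum, hs, h2, map_sub, ev_tr, Polynomial.C_0, map_zero, sub_zero, Int.cast_natCast, key d le_rfl]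
  rfl

/-- The reflection `p(X) ↦ p(c - X)`. -/
def refl (c : ℂ) : K[X] →ₐ[K] K[X] :=
  Polynomial.aeval (Polynomial.C (algebraMap ℂ K c) - Polynomial.X)

theorem ev_refl (s c : ℂ) (p : K[X]) : ev s (refl c p) = ev (c - s) p := by
  rw [refl, ev_apply, ← Polynomial.comp_eq_aeval, Polynomial.eval_comp, ev_apply]
  simp

/-- Summation from 0 to λ - 1 may be done in the reverse order; this gives invariance of the trace
under the anti-involution. -/
theorem csum_refl (lam : ℂ) (p : K[X]) : csum lam (refl (lam - 1) p) = csum lam p := by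
  have hs : antidiff (refl (lam - 1) p)
      = Polynomial.C (ev lam (antidiff p)) - refl lam (antidiff p) := by
    refine eq_of_ev_succ 0 (fun s => ?_) ?_
    · rw [ev_antidiff_succ, map_sub, map_sub, ev_C, ev_C, ev_refl, ev_refl, ev_refl,
        show lam - s = lam - 1 - s + 1 by ring, ev_antidiff_succ,
        show lam - (s + 1) = lam - 1 - s by ring]
      ring
    · rw [ev_antidiff_zero, map_sub, ev_C, ev_refl, sub_zero, sub_self]
  rw [csum, hs, map_sub, ev_C, ev_refl, sub_self, ev_antidiff_zero, sub_zero]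
  rfl

/-! ### Coefficientwise differentiation of polynomials -/

/-- Coefficientwise `d/dz`. -/
def pd : K[X] →ₗ[ℂ] K[X] :=
  Polynomial.lsum fun n => ((Polynomial.monomial n).restrictScalars ℂ).comp dzL

theorem pd_monomial (n : ℕ) (c : K) : pd (Polynomial.monomial n c) = Polynomial.monomial n (dz c) := by
  rw [pd, Polynomial.lsum_apply, Polynomial.sum_monomial_index]
  · rfl
  · exact map_zero _

theorem ev_pd (s : ℂ) (p : K[X]) : ev s (pd p) = dz (ev s p) := by
  induction p using Polynomial.induction_on' with
  | add p q hp hq => simp only [map_add, hp, hq]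
  | monomial m c =>
    rw [pd_monomial, ev_apply, ev_apply, Polynomial.eval_monomial, Polynomial.eval_monomial,
      ← map_pow, mul_comm, ← dz_const_mul, mul_comm]

theorem pd_mul (p q : K[X]) : pd (p * q) = pd p * q + p * pd q :=
  ev_ext fun s => by simp only [ev_pd, map_mul, map_add, dz_mul]

theorem pd_tr (d : ℤ) (p : K[X]) : pd (tr d p) = tr d (pd p) :=
  ev_ext fun s => by simp only [ev_pd, ev_tr]

theorem pd_C (a : K) : pd (Polynomial.C a) = Polynomial.C (dz a) :=
  ev_ext fun s => by simp only [ev_pd, ev_C]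

theorem antidiff_pd (p : K[X]) : antidiff (pd p) = pd (antidiff p) := by
  refine eq_of_ev_succ 0 (fun s => ?_) ?_
  · simp only [ev_pd, ev_antidiff_succ, map_add]
    ring
  · rw [ev_antidiff_zero, ev_pd, ev_antidiff_zero, map_zero]

theorem csum_pd (lam : ℂ) (p : K[X]) : csum lam (pd p) = dz (csum lam p) := by
  rw [csum, antidiff_pd, ev_pd]; rfl

/-! ### Formal difference operators

A series `∑_d x_d` stands for the operator `v_s ↦ ∑_d x_d(s) v_{s-d}`, the coefficients `x_d`
being polynomials in `s` over `ℂ((z))`. -/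

/-- Formal series with operator coefficients. -/
def Hs : Type := HahnSeries ℤ (Module.End ℂ K[X])

instance : Ring Hs := inferInstanceAs (Ring (HahnSeries ℤ (Module.End ℂ K[X])))

/-- The coefficients of a series. -/
def Hs.coeff (x : Hs) (d : ℤ) : Module.End ℂ K[X] := HahnSeries.coeff x d

theorem Hs.ext {x y : Hs} (h : ∀ d, x.coeff d = y.coeff d) : x = y := HahnSeries.ext (funext h)

theorem Hs.coeff_add (x y : Hs) (d : ℤ) : (x + y).coeff d = x.coeff d + y.coeff d :=
  HahnSeries.coeff_add (Γ := ℤ) (R := Module.End ℂ K[X])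

theorem Hs.coeff_neg (x : Hs) (d : ℤ) : (-x).coeff d = -x.coeff d :=
  HahnSeries.coeff_neg (Γ := ℤ) (R := Module.End ℂ K[X])

theorem Hs.coeff_sub (x y : Hs) (d : ℤ) : (x - y).coeff d = x.coeff d - y.coeff d :=
  HahnSeries.coeff_sub (Γ := ℤ) (R := Module.End ℂ K[X])

theorem Hs.coeff_zero (d : ℤ) : (0 : Hs).coeff d = 0 := rfl

theorem Hs.coeff_one (d : ℤ) : (1 : Hs).coeff d = if d = 0 then 1 else 0 := by
  refine (HahnSeries.coeff_one (Γ := ℤ) (R := Module.End ℂ K[X])).trans ?_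
  split_ifs <;> rfl

theorem Hs.coeff_mul_Icc (x y : Hs) (N M : ℤ) (hx : ∀ i < -N, x.coeff i = 0)
    (hy : ∀ i < -M, y.coeff i = 0) (d : ℤ) :
    (x * y).coeff d = ∑ e ∈ Finset.Icc (-M) (d + N), x.coeff (d - e) * y.coeff e :=
  ComplexSize.coeff_mul_Icc (R := Module.End ℂ K[X]) x y N M hx hy d

theorem Hs.exists_bound (x : Hs) : ∃ N : ℕ, ∀ i < -(N : ℤ), x.coeff i = 0 :=
  exists_coeff_bound (R := Module.End ℂ K[X]) x

/-- The series with a single coefficient. -/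
def Hs.single (d : ℤ) (u : Module.End ℂ K[X]) : Hs := HahnSeries.single d u

theorem Hs.coeff_single (d e : ℤ) (u : Module.End ℂ K[X]) :
    (Hs.single d u).coeff e = if e = d then u else 0 := by
  split_ifs with h
  · subst h; exact HahnSeries.coeff_single_same _ _
  · exact HahnSeries.coeff_single_of_ne h

theorem Hs.coeff_single_mul (d e : ℤ) (u : Module.End ℂ K[X]) (x : Hs) :
    (Hs.single d u * x).coeff e = u * x.coeff (e - d) :=
  HahnSeries.coeff_single_mul (R := Module.End ℂ K[X])

theorem Hs.coeff_mul_single (d e : ℤ) (u : Module.End ℂ K[X]) (x : Hs) :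
    (x * Hs.single d u).coeff e = x.coeff (e - d) * u :=
  HahnSeries.coeff_mul_single (R := Module.End ℂ K[X])

/-- The series with given coefficients. -/
def Hs.mk (N : ℤ) (u : ℤ → Module.End ℂ K[X]) (h : ∀ d < -N, u d = 0) : Hs :=
  HahnSeries.ofSuppBddBelow u ⟨-N, fun d hd => by
    by_contra hlt
    exact hd (h d (not_le.1 hlt))⟩

theorem Hs.coeff_mk (N : ℤ) (u : ℤ → Module.End ℂ K[X]) (h : ∀ d < -N, u d = 0) (d : ℤ) :
    (Hs.mk N u h).coeff d = u d :=
  congrFun HahnSeries.coeff_ofSuppBddBelow d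

/-- The operator `v_s ↦ p(s) v_{s-d}`. -/
def op (d : ℤ) (p : K[X]) : Module.End ℂ K[X] :=
  ((tr d).toLinearMap.restrictScalars ℂ) ∘ₗ LinearMap.mulLeft ℂ p

theorem op_apply (d : ℤ) (p q : K[X]) : op d p q = tr d (p * q) := rfl

/-- Applying the second factor first, v_s goes to q(s) v_{s-e} and then to p(s-e) q(s) v_{s-d-e}.
Since coefficients are genuine endomorphisms of `K[X]`, associativity comes for free, and d/dz lives
in the same ring. -/
theorem op_mul (d e : ℤ) (p q : K[X]) : op d p * op e q = op (d + e) (tr (-e) p * q) := by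
  apply LinearMap.ext
  intro r
  rw [Module.End.mul_apply, op_apply, op_apply, op_apply]
  simp only [map_mul, tr_tr, mul_assoc, add_neg_cancel_right]

theorem op_add (d : ℤ) (p q : K[X]) : op d (p + q) = op d p + op d q := by
  apply LinearMap.ext
  intro r
  rw [LinearMap.add_apply, op_apply, op_apply, op_apply, add_mul, map_add]

theorem op_zero (d : ℤ) : op d 0 = 0 := by
  apply LinearMap.ext
  intro r
  rw [op_apply, zero_mul, map_zero, LinearMap.zero_apply]

theorem op_neg (d : ℤ) (p : K[X]) : op d (-p) = -op d p := by
  apply LinearMap.ext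
  intro r
  rw [LinearMap.neg_apply, op_apply, op_apply, neg_mul, map_neg]

theorem op_one : op 0 1 = 1 := by
  apply LinearMap.ext
  intro r
  rw [op_apply, one_mul, tr_zero, Module.End.one_apply]

theorem op_sum (d : ℤ) {β : Type*} (s : Finset β) (f : β → K[X]) :
    op d (∑ i ∈ s, f i) = ∑ i ∈ s, op d (f i) :=
  map_sum (⟨⟨op d, op_zero d⟩, op_add d⟩ : K[X] →+ Module.End ℂ K[X]) f s

/-- The polynomial in place `d`. -/
def cf (x : Hs) (d : ℤ) : K[X] := tr (-d) (x.coeff d 1)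

theorem cf_of_coeff {x : Hs} {d : ℤ} {p : K[X]} (h : x.coeff d = op d p) : cf x d = p := by
  rw [cf, h, op_apply, tr_tr, neg_add_cancel, tr_zero, mul_one]

/-- The ring of formal difference operators. -/
def opRing : Subring Hs where
  carrier := {x | ∀ d, ∃ p, x.coeff d = op d p}
  zero_mem' d := ⟨0, by rw [op_zero]; rfl⟩
  one_mem' d := by
    by_cases h : d = 0
    · subst h
      exact ⟨1, by rw [op_one, Hs.coeff_one, if_pos rfl]⟩
    · exact ⟨0, by rw [op_zero, Hs.coeff_one, if_neg h]⟩
  add_mem' {x y} hx hy d := by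
    obtain ⟨p, hp⟩ := hx d
    obtain ⟨q, hq⟩ := hy d
    exact ⟨p + q, by rw [op_add, ← hp, ← hq, Hs.coeff_add]⟩
  neg_mem' {x} hx d := by
    obtain ⟨p, hp⟩ := hx d
    exact ⟨-p, by rw [op_neg, ← hp, Hs.coeff_neg]⟩
  mul_mem' {x y} hx hy d := by
    choose p hp using hx
    choose q hq using hy
    obtain ⟨N, hN⟩ := x.exists_bound
    obtain ⟨M, hM⟩ := y.exists_bound
    refine ⟨∑ e ∈ Finset.Icc (-(M : ℤ)) (d + N), tr (-e) (p (d - e)) * q e, ?_⟩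
    rw [Hs.coeff_mul_Icc x y N M hN hM, op_sum]
    refine Finset.sum_congr rfl fun e _ => ?_
    rw [hp, hq, op_mul, sub_add_cancel]

theorem coeff_eq_op {x : Hs} (hx : x ∈ opRing) (d : ℤ) : x.coeff d = op d (cf x d) := by
  obtain ⟨p, hp⟩ := hx d
  rw [cf_of_coeff hp, hp]

theorem opRing_ext {x y : Hs} (hx : x ∈ opRing) (hy : y ∈ opRing) (h : ∀ d, cf x d = cf y d) :
    x = y := by
  refine Hs.ext fun d => ?_
  rw [coeff_eq_op hx, coeff_eq_op hy, h]

theorem cf_add (x y : Hs) (d : ℤ) : cf (x + y) d = cf x d + cf y d := by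
  rw [cf, Hs.coeff_add, LinearMap.add_apply, map_add]; rfl

theorem cf_sub (x y : Hs) (d : ℤ) : cf (x - y) d = cf x d - cf y d := by
  rw [cf, Hs.coeff_sub, LinearMap.sub_apply, map_sub]; rfl

theorem cf_neg (x : Hs) (d : ℤ) : cf (-x) d = -cf x d := by
  rw [cf, Hs.coeff_neg, LinearMap.neg_apply, map_neg]; rfl

theorem cf_zero (d : ℤ) : cf 0 d = 0 := by
  rw [cf, Hs.coeff_zero, LinearMap.zero_apply, map_zero]

theorem cf_one (d : ℤ) : cf 1 d = if d = 0 then 1 else 0 := by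
  rw [cf, Hs.coeff_one]
  split_ifs with h
  · subst h; rw [Module.End.one_apply, neg_zero, tr_zero]
  · rw [LinearMap.zero_apply, map_zero]

/-! ### Triangularity, matrix entries and constructors of difference operators -/

/-- `x` has no terms in places below `-N`. -/
def LowBd (N : ℤ) (x : Hs) : Prop := ∀ d < -N, cf x d = 0

theorem LowBd.mono {N M : ℤ} {x : Hs} (h : LowBd N x) (hNM : N ≤ M) : LowBd M x :=
  fun d hd => h d (by omega)

theorem LowBd.add {N : ℤ} {x y : Hs} (hx : LowBd N x) (hy : LowBd N y) : LowBd N (x + y) :=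
  fun d hd => by rw [cf_add, hx d hd, hy d hd, add_zero]

theorem LowBd.sub {N : ℤ} {x y : Hs} (hx : LowBd N x) (hy : LowBd N y) : LowBd N (x - y) :=
  fun d hd => by rw [cf_sub, hx d hd, hy d hd, sub_zero]

theorem LowBd.neg {N : ℤ} {x : Hs} (hx : LowBd N x) : LowBd N (-x) :=
  fun d hd => by rw [cf_neg, hx d hd, neg_zero]

theorem lowBd_one : LowBd 0 1 := fun d hd => by rw [cf_one, if_neg (by omega)]

theorem exists_lowBd (x : Hs) : ∃ N : ℕ, LowBd N x := by
  obtain ⟨N, hN⟩ := x.exists_bound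
  exact ⟨N, fun d hd => by rw [cf, hN d hd, LinearMap.zero_apply, map_zero]⟩

theorem cf_mul {x y : Hs} (hx : x ∈ opRing) (hy : y ∈ opRing) {N M : ℤ} (hN : LowBd N x)
    (hM : LowBd M y) (d : ℤ) :
    cf (x * y) d = ∑ e ∈ Finset.Icc (-M) (d + N), tr (-e) (cf x (d - e)) * cf y e := by
  apply cf_of_coeff
  rw [Hs.coeff_mul_Icc x y N M (fun i hi => by rw [coeff_eq_op hx, hN i hi, op_zero])
    (fun i hi => by rw [coeff_eq_op hy, hM i hi, op_zero]), op_sum]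
  refine Finset.sum_congr rfl fun e _ => ?_
  rw [coeff_eq_op hx, coeff_eq_op hy, op_mul, sub_add_cancel]

/-- The value at `s` of the polynomial in place `d`. -/
def vl (x : Hs) (d : ℤ) (s : ℂ) : K := ev s (cf x d)

theorem vl_add (x y : Hs) (d : ℤ) (s : ℂ) : vl (x + y) d s = vl x d s + vl y d s := by
  rw [vl, cf_add, map_add]; rfl

theorem vl_sub (x y : Hs) (d : ℤ) (s : ℂ) : vl (x - y) d s = vl x d s - vl y d s := by
  rw [vl, cf_sub, map_sub]; rfl

theorem vl_neg (x : Hs) (d : ℤ) (s : ℂ) : vl (-x) d s = -vl x d s := by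
  rw [vl, cf_neg, map_neg]; rfl

theorem vl_zero (d : ℤ) (s : ℂ) : vl 0 d s = 0 := by rw [vl, cf_zero, map_zero]
theorem vl_one (d : ℤ) (s : ℂ) : vl 1 d s = if d = 0 then 1 else 0 := by
  rw [vl, cf_one]; split_ifs <;> simp

theorem LowBd.vl {N : ℤ} {x : Hs} (h : LowBd N x) {d : ℤ} (hd : d < -N) (s : ℂ) : vl x d s = 0 := by
  rw [ComplexSize.vl, h d hd, map_zero]

theorem vl_mul {x y : Hs} (hx : x ∈ opRing) (hy : y ∈ opRing) {N M : ℤ} (hN : LowBd N x)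
    (hM : LowBd M y) (d : ℤ) (s : ℂ) :
    vl (x * y) d s = ∑ e ∈ Finset.Icc (-M) (d + N), vl x (d - e) (s - e) * vl y e s := by
  rw [vl, cf_mul hx hy hN hM, map_sum]
  refine Finset.sum_congr rfl fun e _ => ?_
  rw [map_mul, ev_tr, Int.cast_neg, ← sub_eq_add_neg]
  rfl

theorem opRing_ext_vl {x y : Hs} (hx : x ∈ opRing) (hy : y ∈ opRing)
    (h : ∀ d s, vl x d s = vl y d s) : x = y :=
  opRing_ext hx hy fun d => ev_ext (h d)

theorem LowBd.mul {x y : Hs} (hx : x ∈ opRing) (hy : y ∈ opRing) {N M : ℤ} (hN : LowBd N x)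
    (hM : LowBd M y) : LowBd (N + M) (x * y) := fun d hd => by
  rw [cf_mul hx hy hN hM, Finset.Icc_eq_empty (by omega), Finset.sum_empty]

theorem LowBd.upper_mul {x y : Hs} (hx : x ∈ opRing) (hy : y ∈ opRing) (hN : LowBd 0 x)
    (hM : LowBd 0 y) : LowBd 0 (x * y) := LowBd.mul hx hy hN hM

/-- The pairs of natural numbers with sum `m`. -/
abbrev adiag (m : ℕ) : Finset (ℕ × ℕ) := Finset.HasAntidiagonal.antidiagonal m

/-- The product of upper triangular operators. -/
theorem vl_mul_nat {x y : Hs} (hx : x ∈ opRing) (hy : y ∈ opRing) (hN : LowBd 0 x)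
    (hM : LowBd 0 y) (m : ℕ) (s : ℂ) :
    vl (x * y) m s = ∑ p ∈ adiag m, vl x p.1 (s - p.2) * vl y p.2 s := by
  rw [vl_mul hx hy hN hM]
  symm
  refine Finset.sum_nbij' (fun p : ℕ × ℕ => (p.2 : ℤ)) (fun e : ℤ => ((m - e).toNat, e.toNat))
    ?_ ?_ ?_ ?_ ?_
  · intro p hp; simp only [Finset.mem_Icc, Finset.HasAntidiagonal.mem_antidiagonal] at *; omega
  · intro p hp; simp only [Finset.mem_Icc, Finset.HasAntidiagonal.mem_antidiagonal] at *; omega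
  · intro p hp
    simp only [Finset.HasAntidiagonal.mem_antidiagonal] at hp
    ext <;> simp only [] <;> omega
  · intro p hp; simp only [Finset.mem_Icc] at *; omega
  · intro p hp
    simp only [Finset.HasAntidiagonal.mem_antidiagonal] at hp
    rw [show (m : ℤ) - p.2 = p.1 by omega]
    push_cast
    rfl

/-- The operator with given coefficients in places `≥ -N`. -/
def mkOp (N : ℤ) (a : ℤ → K[X]) : Hs :=
  Hs.mk N (fun d => op d (if -N ≤ d then a d else 0)) fun d hd => by
    rw [if_neg (by omega), op_zero]

theorem coeff_mkOp (N : ℤ) (a : ℤ → K[X]) (d : ℤ) :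
    (mkOp N a).coeff d = op d (if -N ≤ d then a d else 0) :=
  Hs.coeff_mk _ _ _ d

theorem mkOp_mem (N : ℤ) (a : ℤ → K[X]) : mkOp N a ∈ opRing := fun d => ⟨_, coeff_mkOp N a d⟩

theorem cf_mkOp (N : ℤ) (a : ℤ → K[X]) (d : ℤ) : cf (mkOp N a) d = if -N ≤ d then a d else 0 :=
  cf_of_coeff (coeff_mkOp N a d)

theorem vl_mkOp (N : ℤ) (a : ℤ → K[X]) (d : ℤ) (s : ℂ) :
    vl (mkOp N a) d s = if -N ≤ d then ev s (a d) else 0 := by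
  rw [vl, cf_mkOp]; split_ifs <;> simp

theorem lowBd_mkOp (N : ℤ) (a : ℤ → K[X]) : LowBd N (mkOp N a) := fun d hd => by
  rw [cf_mkOp, if_neg (by omega)]

/-- The operator with the single coefficient `p` in place `d`. -/
def sgl (d : ℤ) (p : K[X]) : Hs := Hs.single d (op d p)

theorem coeff_sgl (d : ℤ) (p : K[X]) (e : ℤ) :
    (sgl d p).coeff e = op e (if e = d then p else 0) := by
  rw [sgl, Hs.coeff_single]
  split_ifs with h
  · rw [h]
  · rw [op_zero]

theorem sgl_mem (d : ℤ) (p : K[X]) : sgl d p ∈ opRing := fun e => ⟨_, coeff_sgl d p e⟩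

theorem cf_sgl (d : ℤ) (p : K[X]) (e : ℤ) : cf (sgl d p) e = if e = d then p else 0 :=
  cf_of_coeff (coeff_sgl d p e)

theorem vl_sgl (d : ℤ) (p : K[X]) (e : ℤ) (s : ℂ) :
    vl (sgl d p) e s = if e = d then ev s p else 0 := by
  rw [vl, cf_sgl]; split_ifs <;> simp

theorem cf_sgl_mul {x : Hs} (hx : x ∈ opRing) (d : ℤ) (p : K[X]) (e : ℤ) :
    cf (sgl d p * x) e = tr (-(e - d)) p * cf x (e - d) := by
  apply cf_of_coeff
  rw [sgl, Hs.coeff_single_mul, coeff_eq_op hx, op_mul, add_sub_cancel]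

theorem cf_mul_sgl {x : Hs} (hx : x ∈ opRing) (d : ℤ) (p : K[X]) (e : ℤ) :
    cf (x * sgl d p) e = tr (-d) (cf x (e - d)) * p := by
  apply cf_of_coeff
  rw [sgl, Hs.coeff_mul_single, coeff_eq_op hx, op_mul, sub_add_cancel]

theorem vl_sgl_mul {x : Hs} (hx : x ∈ opRing) (d : ℤ) (p : K[X]) (e : ℤ) (s : ℂ) :
    vl (sgl d p * x) e s = ev (s - (e - d)) p * vl x (e - d) s := by
  rw [vl, cf_sgl_mul hx, map_mul, ev_tr]
  push_cast
  rw [← sub_eq_add_neg]; rfl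

theorem vl_mul_sgl {x : Hs} (hx : x ∈ opRing) (d : ℤ) (p : K[X]) (e : ℤ) (s : ℂ) :
    vl (x * sgl d p) e s = vl x (e - d) (s - d) * ev s p := by
  rw [vl, cf_mul_sgl hx, map_mul, ev_tr]
  push_cast
  rw [← sub_eq_add_neg]; rfl

/-- Scalars. -/
def scl (a : K) : Hs := sgl 0 (Polynomial.C a)

theorem vl_scl_mul {x : Hs} (hx : x ∈ opRing) (a : K) (e : ℤ) (s : ℂ) :
    vl (scl a * x) e s = a * vl x e s := by
  rw [scl, vl_sgl_mul hx, ev_C, sub_zero]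

theorem cf_scl_mul {x : Hs} (hx : x ∈ opRing) (a : K) (e : ℤ) :
    cf (scl a * x) e = Polynomial.C a * cf x e :=
  ev_ext fun s => by rw [map_mul, ev_C]; exact vl_scl_mul hx a e s

theorem scl_mem (a : K) : scl a ∈ opRing := sgl_mem _ _

theorem scl_comm {x : Hs} (hx : x ∈ opRing) (a : K) : scl a * x = x * scl a :=
  opRing_ext_vl (mul_mem (scl_mem a) hx) (mul_mem hx (scl_mem a)) fun d s => by
    rw [vl_scl_mul hx, scl, vl_mul_sgl hx, ev_C, sub_zero, Int.cast_zero, sub_zero, mul_comm]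

/-! ### The derivation and the connections -/

/-- The operator `d/dz`. -/
def dl : Hs := Hs.single 0 pd

theorem pd_comm_op (d : ℤ) (p : K[X]) : (pd : Module.End ℂ K[X]) * op d p - op d p * pd = op d (pd p) := by
  apply LinearMap.ext
  intro r
  rw [LinearMap.sub_apply, Module.End.mul_apply, Module.End.mul_apply, op_apply, op_apply,
    op_apply, pd_tr, pd_mul, map_add, add_sub_cancel_right]

theorem coeff_dl_comm {x : Hs} (hx : x ∈ opRing) (d : ℤ) :
    (dl * x - x * dl).coeff d = op d (pd (cf x d)) := by
  rw [Hs.coeff_sub, dl, Hs.coeff_single_mul, Hs.coeff_mul_single, sub_zero, coeff_eq_op hx,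
    pd_comm_op]

theorem dl_comm_mem {x : Hs} (hx : x ∈ opRing) : dl * x - x * dl ∈ opRing :=
  fun d => ⟨_, coeff_dl_comm hx d⟩

theorem cf_dl_comm {x : Hs} (hx : x ∈ opRing) (d : ℤ) : cf (dl * x - x * dl) d = pd (cf x d) :=
  cf_of_coeff (coeff_dl_comm hx d)

theorem vl_dl_comm {x : Hs} (hx : x ∈ opRing) (d : ℤ) (s : ℂ) :
    vl (dl * x - x * dl) d s = dz (vl x d s) := by
  rw [vl, cf_dl_comm hx, ev_pd]; rfl

/-- The operator `v_s ↦ v_{s+1}`. -/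
def Fop : Hs := sgl (-1) 1

theorem Fop_mem : Fop ∈ opRing := sgl_mem _ _

theorem vl_Fop (d : ℤ) (s : ℂ) : vl Fop d s = if d = -1 then 1 else 0 := by
  rw [Fop, vl_sgl, map_one]

theorem lowBd_Fop : LowBd 1 Fop := fun d hd => by rw [Fop, cf_sgl, if_neg (by omega)]

theorem vl_Fop_mul {x : Hs} (hx : x ∈ opRing) (e : ℤ) (s : ℂ) :
    vl (Fop * x) e s = vl x (e + 1) s := by
  rw [Fop, vl_sgl_mul hx, map_one, one_mul, sub_neg_eq_add]

theorem vl_mul_Fop {x : Hs} (hx : x ∈ opRing) (e : ℤ) (s : ℂ) :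
    vl (x * Fop) e s = vl x (e + 1) (s + 1) := by
  rw [Fop, vl_mul_sgl hx, map_one, mul_one, sub_neg_eq_add]
  push_cast
  rw [sub_neg_eq_add]

/-- The connection `d/dz + f + a`. -/
def nabla (a : Hs) : Hs := dl + Fop + a

/-- The defect `∇_b x - x ∇_a`. -/
def gdef (b x a : Hs) : Hs := nabla b * x - x * nabla a

theorem comm_defect_eq {R : Type*} [Ring R] (d f b x a : R) :
    (d + f + b) * x - x * (d + f + a)
      = (d * x - x * d) + (f * x - x * f) + (b * x - x * a) := by
  noncomm_ring

theorem comm_defect_mul {R : Type*} [Ring R] (c y b x a : R) :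
    c * (y * x) - y * x * a = (c * y - y * b) * x + y * (b * x - x * a) := by
  noncomm_ring

theorem comm_defect_sub {R : Type*} [Ring R] (b x y a : R) :
    b * (x - y) - (x - y) * a = b * x - x * a - (b * y - y * a) := by
  noncomm_ring

theorem comm_defect_sig {R : Type*} [Ring R] (u f x a b : R) :
    u + (x * -f - -f * x) + (x * b - a * x) = u + (f * x - x * f) + (-a * x - x * -b) := by
  noncomm_ring

theorem gdef_eq (b x a : Hs) :
    gdef b x a = (dl * x - x * dl) + (Fop * x - x * Fop) + (b * x - x * a) :=
  comm_defect_eq _ _ _ _ _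

theorem gdef_mem {b x a : Hs} (hb : b ∈ opRing) (hx : x ∈ opRing) (ha : a ∈ opRing) :
    gdef b x a ∈ opRing := by
  rw [gdef_eq]
  exact add_mem (add_mem (dl_comm_mem hx) (sub_mem (mul_mem Fop_mem hx) (mul_mem hx Fop_mem)))
    (sub_mem (mul_mem hb hx) (mul_mem hx ha))

/-- The term F x - x F is a finite difference in s of the coefficient in the next place. An equation
for the defect is thus a recursion in the place, solved by summation in s. -/
theorem vl_gdef {x : Hs} (b a : Hs) (hx : x ∈ opRing) (d : ℤ) (s : ℂ) :
    vl (gdef b x a) d s = dz (vl x d s) + (vl x (d + 1) s - vl x (d + 1) (s + 1))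
      + (vl (b * x) d s - vl (x * a) d s) := by
  rw [gdef_eq, vl_add, vl_add, vl_dl_comm hx, vl_sub, vl_sub, vl_Fop_mul hx, vl_mul_Fop hx]

/-- A Leibniz rule: intertwiners of connections compose, and an intertwiner can be pulled out of a
defect. -/
theorem gdef_mul (c y b x a : Hs) : gdef c (y * x) a = gdef c y b * x + y * gdef b x a :=
  comm_defect_mul _ _ _ _ _

theorem gdef_sub_mid (b x y a : Hs) : gdef b (x - y) a = gdef b x a - gdef b y a :=
  comm_defect_sub _ _ _ _

/-! ### The anti-involution -/

/-- `σ(x)_d(s) = (-1)^d x_d(λ - 1 + d - s)`. -/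
def sig (lam : ℂ) (x : Hs) : Hs :=
  Hs.mk (Classical.choose x.exists_bound : ℕ)
    (fun d => op d ((-1) ^ d.natAbs * refl (lam - 1 + d) (cf x d))) fun d hd => by
      rw [cf, Classical.choose_spec x.exists_bound d hd, LinearMap.zero_apply, map_zero, map_zero,
        mul_zero, op_zero]

theorem coeff_sig (lam : ℂ) (x : Hs) (d : ℤ) :
    (sig lam x).coeff d = op d ((-1) ^ d.natAbs * refl (lam - 1 + d) (cf x d)) :=
  Hs.coeff_mk _ _ _ d

theorem sig_mem (lam : ℂ) (x : Hs) : sig lam x ∈ opRing := fun d => ⟨_, coeff_sig lam x d⟩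

theorem cf_sig (lam : ℂ) (x : Hs) (d : ℤ) :
    cf (sig lam x) d = (-1) ^ d.natAbs * refl (lam - 1 + d) (cf x d) :=
  cf_of_coeff (coeff_sig lam x d)

theorem vl_sig (lam : ℂ) (x : Hs) (d : ℤ) (s : ℂ) :
    vl (sig lam x) d s = (-1) ^ d.natAbs * vl x d (lam - 1 + d - s) := by
  rw [vl, cf_sig, map_mul, ev_refl, map_pow, map_neg, map_one]; rfl

theorem LowBd.sig {N : ℤ} {x : Hs} (h : LowBd N x) (lam : ℂ) : LowBd N (sig lam x) := fun d hd => by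
  rw [cf_sig, h d hd, map_zero, MulZeroClass.mul_zero]

theorem sig_add (lam : ℂ) (x y : Hs) : sig lam (x + y) = sig lam x + sig lam y :=
  opRing_ext_vl (sig_mem _ _) (add_mem (sig_mem _ _) (sig_mem _ _)) fun d s => by
    rw [vl_add, vl_sig, vl_sig, vl_sig, vl_add, mul_add]

theorem sig_neg (lam : ℂ) (x : Hs) : sig lam (-x) = -sig lam x :=
  opRing_ext_vl (sig_mem _ _) (neg_mem (sig_mem _ _)) fun d s => by
    rw [vl_neg, vl_sig, vl_sig, vl_neg, mul_neg]

theorem sig_sub (lam : ℂ) (x y : Hs) : sig lam (x - y) = sig lam x - sig lam y :=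
  opRing_ext_vl (sig_mem _ _) (sub_mem (sig_mem _ _) (sig_mem _ _)) fun d s => by
    rw [vl_sub, vl_sig, vl_sig, vl_sig, vl_sub, mul_sub]

theorem sig_one (lam : ℂ) : sig lam 1 = 1 :=
  opRing_ext_vl (sig_mem _ _) (one_mem _) fun d s => by
    rw [vl_sig, vl_one, vl_one]
    split_ifs with h
    · subst h; simp
    · rw [mul_zero]

theorem neg_one_pow_natAbs_add (d e : ℤ) :
    (-1 : K) ^ (d + e).natAbs = (-1) ^ d.natAbs * (-1) ^ e.natAbs := by
  rw [← pow_add]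
  apply neg_one_pow_congr
  simp only [Nat.even_add, Int.natAbs_even, Int.even_add]

theorem sig_sig {lam : ℂ} {x : Hs} (hx : x ∈ opRing) : sig lam (sig lam x) = x :=
  opRing_ext_vl (sig_mem _ _) hx fun d s => by
    rw [vl_sig, vl_sig, ← mul_assoc, ← pow_add, Even.neg_one_pow ⟨_, rfl⟩, one_mul,
      sub_sub_cancel]

theorem sig_mul {lam : ℂ} {x y : Hs} (hx : x ∈ opRing) (hy : y ∈ opRing) :
    sig lam (x * y) = sig lam y * sig lam x := by
  obtain ⟨N, hN⟩ := exists_lowBd x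
  obtain ⟨M, hM⟩ := exists_lowBd y
  refine opRing_ext_vl (sig_mem _ _) (mul_mem (sig_mem _ _) (sig_mem _ _)) fun d s => ?_
  rw [vl_sig, vl_mul hx hy hN hM, vl_mul (sig_mem _ _) (sig_mem _ _) (hM.sig lam) (hN.sig lam),
    Finset.mul_sum]
  refine Finset.sum_nbij' (fun e => d - e) (fun e => d - e) ?_ ?_ ?_ ?_ ?_
  · intro e he; simp only [Finset.mem_Icc] at *; omega
  · intro e he; simp only [Finset.mem_Icc] at *; omega
  · intro e _; ring
  · intro e _; ring
  · intro e _
    rw [vl_sig, vl_sig, sub_sub_cancel, show d = (d - e) + e by ring, neg_one_pow_natAbs_add]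
    rw [sub_add_cancel]
    push_cast
    rw [show lam - 1 + (d : ℂ) - s - e = lam - 1 + ((d : ℂ) - e) - s by ring,
      show lam - 1 + (e : ℂ) - (s - (d - e)) = lam - 1 + d - s by ring]
    ring

theorem sig_Fop (lam : ℂ) : sig lam Fop = -Fop :=
  opRing_ext_vl (sig_mem _ _) (neg_mem Fop_mem) fun d s => by
    rw [vl_sig, vl_neg, vl_Fop, vl_Fop]
    split_ifs with h
    · subst h; norm_num
    · rw [mul_zero, neg_zero]

theorem sig_dl_comm {lam : ℂ} {x : Hs} (hx : x ∈ opRing) :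
    sig lam (dl * x - x * dl) = dl * sig lam x - sig lam x * dl :=
  opRing_ext_vl (sig_mem _ _) (dl_comm_mem (sig_mem _ _)) fun d s => by
    rw [vl_sig, vl_dl_comm hx, vl_dl_comm (sig_mem _ _), vl_sig]
    rcases Nat.even_or_odd d.natAbs with h | h
    · rw [h.neg_one_pow, one_mul, one_mul]
    · rw [h.neg_one_pow, neg_one_mul, neg_one_mul, map_neg]

/-- The anti-involution commutes with d/dz and changes the sign of F, so it reverses the roles of
the two connections and replaces a, b by -σ(a), -σ(b). -/
theorem sig_gdef {lam : ℂ} {b x a : Hs} (hb : b ∈ opRing) (hx : x ∈ opRing) (ha : a ∈ opRing) :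
    sig lam (gdef b x a) = gdef (-sig lam a) (sig lam x) (-sig lam b) := by
  rw [gdef_eq, gdef_eq, sig_add, sig_add, sig_dl_comm hx, sig_sub, sig_sub, sig_mul Fop_mem hx,
    sig_mul hx Fop_mem, sig_mul hb hx, sig_mul hx ha, sig_Fop]
  exact comm_defect_sig _ _ _ _ _

/-! ### Coefficients of elements of `gl_λ` -/

/-- The factor `(X - t)(λ + t - X)`. -/
def wFactor (lam : ℂ) (t : ℤ) : K[X] :=
  (Polynomial.X - Polynomial.C (t : K)) * (Polynomial.C (algebraMap ℂ K lam + t) - Polynomial.X)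

theorem ev_wFactor (lam : ℂ) (t : ℤ) (s : ℂ) :
    ev s (wFactor lam t) = algebraMap ℂ K ((s - t) * (lam + t - s)) := by
  simp [wFactor, ev_C, ev_X]

theorem tr_wFactor (lam : ℂ) (t b : ℤ) : tr (-b) (wFactor lam t) = wFactor lam (t + b) :=
  ev_ext fun s => by
    rw [ev_tr, ev_wFactor, ev_wFactor]
    push_cast
    ring

/-- The matrix coefficient of `e^d`: `e^d v_s = W_d(s) v_{s-d}`. -/
def wPoly (lam : ℂ) (d : ℤ) : K[X] := ∏ t ∈ Finset.Ico 0 d, wFactor lam t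

theorem tr_wPoly (lam : ℂ) (d b : ℤ) :
    tr (-b) (wPoly lam d) = ∏ t ∈ Finset.Ico b (d + b), wFactor lam t := by
  rw [wPoly, map_prod]
  refine Finset.prod_nbij' (· + b) (· - b) ?_ ?_ ?_ ?_ ?_
  · intro e he; simp only [Finset.mem_Ico] at *; omega
  · intro e he; simp only [Finset.mem_Ico] at *; omega
  · intro e _; ring
  · intro e _; ring
  · intro e _; rw [tr_wFactor]

/-- Whatever the signs of a and b, the intervals [b, a + b) and [0, b) together cover [0, a + b).
This makes `glRing` closed under multiplication. -/
theorem wPoly_mul_dvd (lam : ℂ) (a b : ℤ) :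
    wPoly lam (a + b) ∣ tr (-b) (wPoly lam a) * wPoly lam b := by
  rw [tr_wPoly, wPoly, wPoly, ← Finset.prod_union_inter]
  refine Dvd.dvd.mul_right (Finset.prod_dvd_prod_of_subset _ _ _ ?_) _
  intro t ht
  simp only [Finset.mem_union, Finset.mem_Ico] at *
  omega

theorem wPoly_of_nonpos (lam : ℂ) {d : ℤ} (hd : d ≤ 0) : wPoly lam d = 1 := by
  rw [wPoly, Finset.Ico_eq_empty (by omega), Finset.prod_empty]

theorem wPoly_succ (lam : ℂ) (d : ℕ) : wPoly lam (d + 1) = wFactor lam d * wPoly lam d := by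
  have h : Finset.Ico (0 : ℤ) (d + 1) = insert (d : ℤ) (Finset.Ico 0 (d : ℤ)) := by
    ext t; simp only [Finset.mem_insert, Finset.mem_Ico]; omega
  rw [wPoly, h, Finset.prod_insert (by simp), wPoly]

theorem ev_wPoly_eq_zero {lam : ℂ} {d : ℤ} {i : ℕ} (h : (i : ℤ) < d) : ev i (wPoly lam d) = 0 := by
  rw [wPoly, map_prod]
  refine Finset.prod_eq_zero (i := (i : ℤ)) (by simp only [Finset.mem_Ico]; omega) ?_
  rw [ev_wFactor]
  simp

theorem ev_wPoly_eq_zero' {lam : ℂ} {d : ℤ} {i : ℕ} (h : (i : ℤ) < d) :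
    ev (lam + i) (wPoly lam d) = 0 := by
  rw [wPoly, map_prod]
  refine Finset.prod_eq_zero (i := (i : ℤ)) (by simp only [Finset.mem_Ico]; omega) ?_
  rw [ev_wFactor]
  simp

/-- The ring of operators whose coefficients are divisible by those of the powers of `e`. -/
def glRing (lam : ℂ) : Subring Hs where
  carrier := {x | x ∈ opRing ∧ ∀ d, wPoly lam d ∣ cf x d}
  zero_mem' := ⟨zero_mem _, fun d => by rw [cf_zero]; exact dvd_zero _⟩
  one_mem' := ⟨one_mem _, fun d => by
    rw [cf_one]
    split_ifs with h
    · rw [wPoly_of_nonpos _ h.le]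
    · exact dvd_zero _⟩
  add_mem' hx hy := ⟨add_mem hx.1 hy.1, fun d => by rw [cf_add]; exact dvd_add (hx.2 d) (hy.2 d)⟩
  neg_mem' hx := ⟨neg_mem hx.1, fun d => by rw [cf_neg]; exact (hx.2 d).neg_right⟩
  mul_mem' {x y} hx hy := ⟨mul_mem hx.1 hy.1, fun d => by
    obtain ⟨N, hN⟩ := exists_lowBd x
    obtain ⟨M, hM⟩ := exists_lowBd y
    rw [cf_mul hx.1 hy.1 hN hM]
    refine Finset.dvd_sum fun e _ => ?_
    have h := wPoly_mul_dvd lam (d - e) e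
    rw [sub_add_cancel] at h
    exact h.trans (mul_dvd_mul (map_dvd (tr (-e)) (hx.2 (d - e))) (hy.2 e))⟩

theorem sgl_mem_glRing {lam : ℂ} {d : ℤ} {p : K[X]} (h : wPoly lam d ∣ p) :
    sgl d p ∈ glRing lam :=
  ⟨sgl_mem d p, fun e => by
    rw [cf_sgl]
    split_ifs with he
    · rw [he]; exact h
    · exact dvd_zero _⟩

theorem Fop_mem_glRing (lam : ℂ) : Fop ∈ glRing lam :=
  sgl_mem_glRing (by rw [wPoly_of_nonpos lam (by omega)])

theorem scl_mem_glRing (lam : ℂ) (a : K) : scl a ∈ glRing lam :=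
  sgl_mem_glRing (by rw [wPoly_of_nonpos lam le_rfl]; exact one_dvd _)

theorem refl_wFactor (lam : ℂ) (c : ℤ) (t : ℤ) :
    refl (lam + c) (wFactor lam t) = wFactor lam (c - t) :=
  ev_ext fun s => by
    rw [ev_refl, ev_wFactor, ev_wFactor]
    push_cast
    ring

/-- The reflection permutes the factors by t ↦ d - 1 - t. -/
theorem refl_wPoly (lam : ℂ) (d : ℤ) : refl (lam - 1 + d) (wPoly lam d) = wPoly lam d := by
  rw [wPoly, map_prod]
  refine Finset.prod_nbij' (fun t => d - 1 - t) (fun t => d - 1 - t) ?_ ?_ ?_ ?_ ?_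
  · intro e he; simp only [Finset.mem_Ico] at *; omega
  · intro e he; simp only [Finset.mem_Ico] at *; omega
  · intro e _; ring
  · intro e _; ring
  · intro e _
    rw [← refl_wFactor]
    push_cast
    rw [show lam - 1 + (d : ℂ) = lam + (d - 1) by ring]

theorem sig_mem_glRing {lam : ℂ} {x : Hs} (hx : x ∈ glRing lam) : sig lam x ∈ glRing lam :=
  ⟨sig_mem lam x, fun d => by
    rw [cf_sig]
    refine Dvd.dvd.mul_left ?_ _
    have := map_dvd (refl (lam - 1 + d)) (hx.2 d)
    rwa [refl_wPoly] at this⟩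

theorem dl_comm_mem_glRing {lam : ℂ} {x : Hs} (hx : x ∈ glRing lam) :
    dl * x - x * dl ∈ glRing lam :=
  ⟨dl_comm_mem hx.1, fun d => by
    obtain ⟨p, hp⟩ := hx.2 d
    have h0 : pd (wPoly lam d) = 0 := ev_ext fun s => by
      rw [ev_pd, wPoly, map_prod]
      simp only [ev_wFactor]
      rw [← map_prod, dz_const, map_zero]
    rw [cf_dl_comm hx.1, hp, pd_mul, h0, zero_mul, zero_add]
    exact dvd_mul_right _ _⟩

theorem gdef_mem_glRing {lam : ℂ} {b x a : Hs} (hb : b ∈ glRing lam) (hx : x ∈ glRing lam)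
    (ha : a ∈ glRing lam) : gdef b x a ∈ glRing lam := by
  rw [gdef_eq]
  have hF := Fop_mem_glRing lam
  exact add_mem (add_mem (dl_comm_mem_glRing hx) (sub_mem (mul_mem hF hx) (mul_mem hx hF)))
    (sub_mem (mul_mem hb hx) (mul_mem hx ha))

theorem vl_eq_zero_of_glRing {lam : ℂ} {x : Hs} (hx : x ∈ glRing lam) {d : ℤ} {i : ℕ}
    (h : (i : ℤ) < d) : vl x d i = 0 := by
  obtain ⟨p, hp⟩ := hx.2 d
  rw [vl, hp, map_mul, ev_wPoly_eq_zero h, zero_mul]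

theorem vl_eq_zero_of_glRing' {lam : ℂ} {x : Hs} (hx : x ∈ glRing lam) {d : ℤ} {i : ℕ}
    (h : (i : ℤ) < d) : vl x d (lam + i) = 0 := by
  obtain ⟨p, hp⟩ := hx.2 d
  rw [vl, hp, map_mul, ev_wPoly_eq_zero' h, zero_mul]

/-! ### Vanishing at the ends -/

/-- The operator preserves the span of `v_{s₀}, v_{s₀+1}, …`. -/
def Stab (s₀ : ℂ) (x : Hs) : Prop := ∀ (i : ℕ) (d : ℤ), (i : ℤ) < d → vl x d (s₀ + i) = 0

theorem stab_zero_of_glRing {lam : ℂ} {x : Hs} (hx : x ∈ glRing lam) : Stab 0 x := fun i d h => by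
  rw [zero_add]; exact vl_eq_zero_of_glRing hx h

theorem stab_of_glRing {lam : ℂ} {x : Hs} (hx : x ∈ glRing lam) : Stab lam x := fun _ _ h =>
  vl_eq_zero_of_glRing' hx h

theorem stab_zero (s₀ : ℂ) : Stab s₀ 0 := fun _ _ _ => vl_zero _ _

theorem vl_mul_eq_zero {s₀ : ℂ} {x y : Hs} (hx : x ∈ opRing) (hy : y ∈ opRing)
    (hx0 : LowBd 0 x) (hy0 : LowBd 0 y) {i : ℕ}
    (h1 : ∀ j : ℕ, j ≤ i → ∀ d : ℤ, (j : ℤ) < d → vl x d (s₀ + j) = 0)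
    (h2 : ∀ d : ℤ, (i : ℤ) < d → vl y d (s₀ + i) = 0) {d : ℤ} (hd : (i : ℤ) < d) :
    vl (x * y) d (s₀ + i) = 0 := by
  rw [vl_mul hx hy hx0 hy0]
  refine Finset.sum_eq_zero fun e he => ?_
  simp only [Finset.mem_Icc] at he
  rcases lt_or_ge (i : ℤ) e with h | h
  · rw [h2 e h, mul_zero]
  · obtain ⟨n, rfl⟩ := Int.eq_ofNat_of_zero_le (show 0 ≤ e by omega)
    obtain ⟨j, rfl⟩ : ∃ j, i = j + n := ⟨i - n, by omega⟩
    have := h1 j (by omega) (d - n) (by omega)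
    rw [show s₀ + ((j + n : ℕ) : ℂ) - ((n : ℤ) : ℂ) = s₀ + j by push_cast; ring, this, zero_mul]

/-- A gauge transformation that fixes the vector `v_{s₀}` preserves the span of
`v_{s₀}, v_{s₀+1}, …` if the two connections do. -/
theorem stab_of_gdef {s₀ : ℂ} {b x a : Hs} (hb : b ∈ opRing) (hx : x ∈ opRing) (ha : a ∈ opRing)
    (hb0 : LowBd 0 b) (hx0 : LowBd 0 x) (ha0 : LowBd 0 a) (h : gdef b x a = 0) (hsb : Stab s₀ b)
    (hsa : Stab s₀ a) (h0 : ∀ d : ℤ, 0 < d → vl x d s₀ = 0) : Stab s₀ x := by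
  have key : ∀ i : ℕ, ∀ j ≤ i, ∀ d : ℤ, (j : ℤ) < d → vl x d (s₀ + j) = 0 := by
    intro i
    induction i with
    | zero =>
      intro j hj d hd
      obtain rfl : j = 0 := by omega
      rw [Nat.cast_zero, add_zero]
      exact h0 d hd
    | succ i ih =>
      intro j hj d hd
      rcases Nat.lt_or_ge i j with hij | hij
      · obtain rfl : j = i + 1 := by omega
        -- In place d - 1 at s₀ + i the equation expresses column i + 1 in place d through columns
        -- up to i, and every other term vanishes by induction.
        have e := vl_gdef b a hx (d - 1) (s₀ + i)
        rw [h, vl_zero, ih i le_rfl (d - 1) (by omega), map_zero, sub_add_cancel,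
          ih i le_rfl d (by omega), vl_mul_eq_zero hb hx hb0 hx0 (fun j _ => hsb j)
            (ih i le_rfl) (by omega : (i : ℤ) < d - 1),
          vl_mul_eq_zero hx ha hx0 ha0 ih (hsa i) (by omega : (i : ℤ) < d - 1)] at e
        rw [Nat.cast_succ, ← add_assoc]
        linear_combination e
      · exact ih j hij d hd
  exact fun i => key i i le_rfl

/-! ### Recursive construction of sequences -/

/-- The sequence `f` with `f m = G m f`, if `G m f` depends only on `f 0, …, f (m - 1)`. -/
def seqRec {α : Type*} [Zero α] (G : ℕ → (ℕ → α) → α) (m : ℕ) : α :=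
  G m fun i => if _h : i < m then seqRec G i else 0
termination_by m

theorem seqRec_eq {α : Type*} [Zero α] {G : ℕ → (ℕ → α) → α}
    (hG : ∀ m f g, (∀ i < m, f i = g i) → G m f = G m g) (m : ℕ) :
    seqRec G m = G m (seqRec G) := by
  rw [seqRec]
  exact hG m _ _ fun i hi => dif_pos hi

/-! ### The equation `∇₀ x - x ∇_a = r` -/

/-- One step of the solution of `∇₀ x - x ∇_a = r`. -/
def solStep (c : K[X]) (a r : Hs) : ℕ → (ℕ → K[X]) → K[X]
  | 0, _ => c
  | m + 1, f => antidiff (pd (f m) - (∑ p ∈ adiag m, tr (-p.2) (f p.1) * cf a p.2) - cf r m)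

theorem solStep_congr (c : K[X]) (a r : Hs) (m : ℕ) (f g : ℕ → K[X]) (h : ∀ i < m, f i = g i) :
    solStep c a r m f = solStep c a r m g := by
  cases m with
  | zero => rfl
  | succ m =>
    simp only [solStep]
    rw [h m (by omega), Finset.sum_congr rfl fun p hp => ?_]
    rw [h p.1]
    have := Finset.HasAntidiagonal.mem_antidiagonal.1 hp
    omega

/-- The coefficients of the solution of `∇₀ x - x ∇_a = r` with `x_0 = c`. -/
def solSeq (c : K[X]) (a r : Hs) : ℕ → K[X] := seqRec (solStep c a r)

theorem solSeq_zero (c : K[X]) (a r : Hs) : solSeq c a r 0 = c :=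
  seqRec_eq (solStep_congr c a r) 0

theorem solSeq_succ (c : K[X]) (a r : Hs) (m : ℕ) : solSeq c a r (m + 1) =
    antidiff (pd (solSeq c a r m)
      - (∑ p ∈ adiag m, tr (-p.2) (solSeq c a r p.1) * cf a p.2) - cf r m) :=
  seqRec_eq (solStep_congr c a r) (m + 1)

/-- The solution of `∇₀ x - x ∇_a = r` with `x_0 = c`. -/
def solOp (c : K[X]) (a r : Hs) : Hs := mkOp 0 fun d => solSeq c a r d.toNat

theorem solOp_mem (c : K[X]) (a r : Hs) : solOp c a r ∈ opRing := mkOp_mem _ _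
theorem lowBd_solOp (c : K[X]) (a r : Hs) : LowBd 0 (solOp c a r) := lowBd_mkOp _ _

theorem cf_solOp (c : K[X]) (a r : Hs) (m : ℕ) : cf (solOp c a r) m = solSeq c a r m := by
  rw [solOp, cf_mkOp, if_pos (by omega), Int.toNat_natCast]

/-- The normalization of `antidiff` at 0 is chosen for this: the solution maps v_0 to c(0) v_0. -/
theorem vl_solOp_zero (c : K[X]) (a r : Hs) {d : ℤ} (hd : 0 < d) : vl (solOp c a r) d 0 = 0 := by
  obtain ⟨n, rfl⟩ := Int.eq_ofNat_of_zero_le (show 0 ≤ d - 1 by omega) |>.imp fun n hn =>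
    show d = ((n + 1 : ℕ) : ℤ) by push_cast; omega
  rw [vl, cf_solOp, solSeq_succ, ev_antidiff_zero]

/-- In place m the equation prescribes the difference x_{m+1}(s+1) - x_{m+1}(s) through earlier
coefficients, and `solSeq` sums exactly this difference. -/
theorem gdef_solOp (c : K) {a r : Hs} (ha : a ∈ opRing) (ha0 : LowBd 0 a)
    (hr : r ∈ opRing) (hr0 : LowBd 0 r) : gdef 0 (solOp (Polynomial.C c) a r) a = r := by
  set x := solOp (Polynomial.C c) a r with hx
  have hxm : x ∈ opRing := solOp_mem _ _ _
  have hx0 : LowBd 0 x := lowBd_solOp _ _ _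
  refine opRing_ext_vl (gdef_mem (zero_mem _) hxm ha) hr fun d s => ?_
  rw [vl_gdef 0 a hxm, zero_mul, vl_zero, zero_sub]
  rcases lt_or_ge d 0 with hd | hd
  · rw [(LowBd.upper_mul hxm ha hx0 ha0).vl (by omega), hr0.vl (by omega), hx0.vl (by omega), map_zero,
      neg_zero, add_zero, zero_add]
    rcases lt_or_ge (d + 1) 0 with hd1 | hd1
    · rw [hx0.vl (by omega), hx0.vl (by omega), sub_zero]
    -- Place -1 requires x_0 to be independent of s, which is why the initial coefficient is a
    -- constant.
    · obtain rfl : d = -1 := by omega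
      have h0 : cf x ((0 : ℕ) : ℤ) = Polynomial.C c := by rw [hx, cf_solOp, solSeq_zero]
      have h0' : cf x (-1 + 1) = Polynomial.C c := h0
      rw [vl, vl, h0', ev_C, ev_C, sub_self]
  · obtain ⟨m, rfl⟩ := Int.eq_ofNat_of_zero_le hd
    have e1 : cf x ((m : ℤ) + 1) = _ := (cf_solOp (Polynomial.C c) a r (m + 1)).trans
      (solSeq_succ (Polynomial.C c) a r m)
    have e2 : vl x (m + 1) (s + 1) = vl x (m + 1) s
        + (dz (vl x m s) - vl (x * a) m s - vl r m s) := by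
      rw [vl, e1, ev_antidiff_succ, (ev s).map_sub, (ev s).map_sub, ev_pd,
        vl_mul_nat hxm ha hx0 ha0, map_sum, vl, e1]
      congr 3
      · rw [vl, hx, cf_solOp]
      · refine Finset.sum_congr rfl fun p _ => ?_
        rw [map_mul, ev_tr, vl, hx, cf_solOp]
        push_cast
        rw [← sub_eq_add_neg]
        rfl
    rw [e2]
    ring

/-- Going up from the lowest place: if everything below place d vanishes, the equation says that x_d
is periodic in s, so it is constant and equal to its value at 0. -/
theorem eq_zero_of_gdef_eq_zero {x a : Hs} (hx : x ∈ opRing) (ha : a ∈ opRing) (ha0 : LowBd 0 a)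
    (h : gdef 0 x a = 0) (h0 : ∀ d, vl x d 0 = 0) : x = 0 := by
  obtain ⟨N, hN⟩ := exists_lowBd x
  have key : ∀ n : ℕ, ∀ d : ℤ, d < n - N → cf x d = 0 := by
    intro n
    induction n with
    | zero => intro d hd; exact hN d (by omega)
    | succ n ih =>
      intro d hd
      rcases lt_or_ge d (n - N) with h1 | h1
      · exact ih d h1
      refine eq_of_ev_succ 0 (fun s => ?_) (by rw [map_zero]; exact h0 d)
      rw [map_zero, map_zero, sub_zero]
      have e := vl_gdef 0 a hx (d - 1) s
      rw [h, vl_zero, zero_mul, vl_zero, sub_add_cancel, vl, vl, vl, ih (d - 1) (by omega), map_zero,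
        map_zero, vl_mul hx ha hN ha0, Finset.sum_eq_zero fun e he => ?_] at e
      · linear_combination e
      · simp only [Finset.mem_Icc] at he
        rw [vl, ih (d - 1 - e) (by omega), map_zero, zero_mul]
  exact opRing_ext hx (zero_mem _) fun d => by
    rw [cf_zero]
    exact key (d + 1 + N).toNat d (by omega)

theorem eq_of_gdef_eq {x y a : Hs} (hx : x ∈ opRing) (hy : y ∈ opRing) (ha : a ∈ opRing)
    (ha0 : LowBd 0 a) (h : gdef 0 x a = gdef 0 y a) (h0 : ∀ d, vl x d 0 = vl y d 0) : x = y :=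
  sub_eq_zero.1 <| eq_zero_of_gdef_eq_zero (sub_mem hx hy) ha ha0
    (by rw [gdef_sub_mid, h, sub_self]) fun d => by rw [vl_sub, h0, sub_self]

/-- The operator `L = L_a` with `∇₀ L = L ∇_a` and `L v_0 = v_0`. -/
def Lop (a : Hs) : Hs := solOp (Polynomial.C 1) a 0

theorem Lop_mem (a : Hs) : Lop a ∈ opRing := solOp_mem _ _ _
theorem lowBd_Lop (a : Hs) : LowBd 0 (Lop a) := lowBd_solOp _ _ _
theorem cf_Lop_zero (a : Hs) : cf (Lop a) 0 = 1 :=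
  (cf_solOp (Polynomial.C 1) a 0 0).trans (solSeq_zero _ _ _)

theorem gdef_Lop {a : Hs} (ha : a ∈ opRing) (ha0 : LowBd 0 a) : gdef 0 (Lop a) a = 0 :=
  gdef_solOp 1 ha ha0 (zero_mem _) fun d _ => cf_zero d

theorem vl_Lop_at_zero (a : Hs) (d : ℤ) : vl (Lop a) d 0 = if d = 0 then 1 else 0 := by
  rcases lt_trichotomy d 0 with h | h | h
  · rw [(lowBd_Lop a).vl (by omega), if_neg h.ne]
  · subst h; rw [vl, cf_Lop_zero, map_one, if_pos rfl]
  · rw [Lop, vl_solOp_zero _ _ _ h, if_neg h.ne']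

/-! ### Unitriangular operators -/

/-- Unitriangular operators. -/
structure Unitri (x : Hs) : Prop where
  mem : x ∈ opRing
  low : LowBd 0 x
  cf_zero : cf x 0 = 1

theorem unitri_Lop (a : Hs) : Unitri (Lop a) := ⟨Lop_mem a, lowBd_Lop a, cf_Lop_zero a⟩

theorem Unitri.vl_zero {x : Hs} (hx : Unitri x) (s : ℂ) : vl x 0 s = 1 := by
  rw [vl, hx.cf_zero, map_one]

theorem Unitri.mul {x y : Hs} (hx : Unitri x) (hy : Unitri y) : Unitri (x * y) where
  mem := mul_mem hx.mem hy.mem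
  low := LowBd.upper_mul hx.mem hy.mem hx.low hy.low
  cf_zero := by
    rw [cf_mul hx.mem hy.mem hx.low hy.low]
    simp [hx.cf_zero, hy.cf_zero]

theorem Unitri.sig {x : Hs} (hx : Unitri x) (lam : ℂ) : Unitri (sig lam x) where
  mem := sig_mem _ _
  low := hx.low.sig lam
  cf_zero := by rw [cf_sig, hx.cf_zero]; simp

theorem Unitri.exists_right_inv {x : Hs} (hx : Unitri x) : ∃ y, Unitri y ∧ x * y = 1 := by
  let G : ℕ → (ℕ → K[X]) → K[X] := fun m f =>
    if m = 0 then 1 else -∑ i ∈ Finset.range m, tr (-i) (cf x (m - i)) * f i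
  have hG : ∀ m f g, (∀ i < m, f i = g i) → G m f = G m g := fun m f g h => by
    simp only [G]
    rw [Finset.sum_congr rfl fun i hi => by rw [h i (Finset.mem_range.1 hi)]]
  set y := mkOp 0 fun d => seqRec G d.toNat with hy
  have hcf : ∀ m : ℕ, cf y m = seqRec G m := fun m => by
    rw [hy, cf_mkOp, if_pos (by omega), Int.toNat_natCast]
  have hyu : Unitri y := ⟨mkOp_mem _ _, lowBd_mkOp _ _, by
    refine (hcf 0).trans ?_
    rw [seqRec_eq hG]; simp [G]⟩
  refine ⟨y, hyu, opRing_ext (mul_mem hx.mem hyu.mem) (one_mem _) fun d => ?_⟩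
  rcases lt_or_ge d 0 with hd | hd
  · rw [(LowBd.upper_mul hx.mem hyu.mem hx.low hyu.low) d (by omega), cf_one, if_neg (by omega)]
  obtain ⟨m, rfl⟩ := Int.eq_ofNat_of_zero_le hd
  rcases Nat.eq_zero_or_pos m with rfl | hm
  · rw [cf_one, if_pos Int.natCast_zero]; exact (hx.mul hyu).cf_zero
  have h1 : cf (x * y) m = ∑ i ∈ Finset.range (m + 1), tr (-i) (cf x (m - i)) * cf y i := by
    rw [cf_mul hx.mem hyu.mem hx.low hyu.low]
    refine Finset.sum_nbij' (fun e : ℤ => e.toNat) (fun e : ℕ => (e : ℤ)) ?_ ?_ ?_ ?_ ?_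
    · intro e he; simp only [Finset.mem_Icc, Finset.mem_range] at *; omega
    · intro e he; simp only [Finset.mem_Icc, Finset.mem_range] at *; omega
    · intro e he; simp only [Finset.mem_Icc] at *; omega
    · intro e he; simp
    · intro e he
      simp only [Finset.mem_Icc] at he
      rw [Int.toNat_of_nonneg (by omega)]
  rw [h1, Finset.sum_range_succ, sub_self, hx.cf_zero, map_one, one_mul, hcf m, seqRec_eq hG,
    cf_one, if_neg (by omega)]
  simp only [G, if_neg hm.ne']
  rw [Finset.sum_congr rfl fun i _ => by rw [hcf i], add_neg_cancel]

theorem Unitri.exists_inv {x : Hs} (hx : Unitri x) : ∃ y, Unitri y ∧ x * y = 1 ∧ y * x = 1 := by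
  obtain ⟨y, hy, hxy⟩ := hx.exists_right_inv
  obtain ⟨z, -, hyz⟩ := hy.exists_right_inv
  have : x = z := by
    calc x = x * (y * z) := by rw [hyz, mul_one]
      _ = z := by rw [← mul_assoc, hxy, one_mul]
  exact ⟨y, hy, hxy, by rw [this, hyz]⟩

theorem Unitri.cancel_left {x u v : Hs} (hx : Unitri x) (h : x * u = x * v) : u = v := by
  obtain ⟨y, -, -, hyx⟩ := hx.exists_inv
  calc u = y * (x * u) := by rw [← mul_assoc, hyx, one_mul]
    _ = v := by rw [h, ← mul_assoc, hyx, one_mul]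

/-- Comparison of the first column of a product with a unitriangular operator. -/
theorem Unitri.vl_eq_zero_of_mul {x y : Hs} (hx : Unitri x) (hy : y ∈ opRing) {s : ℂ} (m : ℤ)
    (h : ∀ d < m, vl (x * y) d s = 0) : ∀ d < m, vl y d s = 0 := by
  obtain ⟨N, hN⟩ := exists_lowBd y
  have key : ∀ n : ℕ, ∀ d : ℤ, d < n - N → d < m → vl y d s = 0 := by
    intro n
    induction n with
    | zero => intro d hd _; exact hN.vl (by omega) s
    | succ n ih =>
      intro d hd hm
      rcases lt_or_ge d (n - N) with h1 | h1
      · exact ih d h1 hm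
      have e := h d hm
      rw [vl_mul hx.mem hy hx.low hN, Finset.sum_eq_single d, sub_self, hx.vl_zero, one_mul] at e
      · exact e
      · intro b hb hne
        simp only [Finset.mem_Icc] at hb
        rw [ih b (by omega) (by omega), mul_zero]
      · intro hb
        simp only [Finset.mem_Icc] at hb
        rw [hN.vl (by omega), mul_zero]
  exact fun d hd => key (d + 1 + N).toNat d (by omega) hd

/-! ### Symbols as sequences

A sequence `f` stands for the symbol `∑_n f_n D^{α-n}`, the order `α` being kept track of
separately. -/

/-- The binomial coefficient as a polynomial. -/
def chPoly (l : ℕ) : K[X] :=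
  (Polynomial.C (l.factorial : ℂ)⁻¹ * descPochhammer ℂ l).map (algebraMap ℂ K)

theorem ev_chPoly (s : ℂ) (l : ℕ) : ev s (chPoly l) = algebraMap ℂ K (Ring.choose s l) := by
  rw [chPoly, ev_apply, Polynomial.eval_map_algebraMap, Polynomial.aeval_algebraMap_apply,
    Ring.choose_eq_smul]
  congr 1
  rw [Polynomial.coe_aeval_eq_eval, Polynomial.eval_mul, Polynomial.eval_C, smul_eq_mul,
    ← descPochhammer_map (algebraMap ℤ ℂ), Polynomial.eval_map_algebraMap,
    ← Polynomial.eval₂_smulOneHom_eq_smeval, Polynomial.aeval_def]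
  rw [Subsingleton.elim (algebraMap ℤ ℂ) RingHom.smulOneHom]

/-- The coefficients of `D^β ∘ g ∘ D^{-β}`. -/
def Th (b : ℂ) (g : ℕ → K) (n : ℕ) : K :=
  ∑ p ∈ adiag n, algebraMap ℂ K (Ring.choose b p.1) * dz^[p.1] (g p.2)

/-- The coefficients of `D^β ∘ g ∘ D^{-β}` as polynomials in `β`. -/
def ThPoly (g : ℕ → K) (n : ℕ) : K[X] :=
  ∑ p ∈ adiag n, chPoly p.1 * Polynomial.C (dz^[p.1] (g p.2))

theorem ev_ThPoly (b : ℂ) (g : ℕ → K) (n : ℕ) : ev b (ThPoly g n) = Th b g n := by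
  rw [ThPoly, map_sum, Th]
  exact Finset.sum_congr rfl fun p _ => by rw [map_mul, ev_chPoly, ev_C]

theorem Th_at_zero (b : ℂ) (g : ℕ → K) : Th b g 0 = g 0 := by
  simp [Th]

theorem Th_succ (b : ℂ) (g : ℕ → K) (n : ℕ) :
    Th (b + 1) g (n + 1) = Th b g (n + 1) + dz (Th b g n) := by
  rw [Th, Th, Finset.Nat.sum_antidiagonal_succ, Finset.Nat.sum_antidiagonal_succ, Th, dz_sum]
  simp only [Ring.choose_zero_right, Ring.choose_succ_succ, map_add, add_mul,
    Finset.sum_add_distrib, Function.iterate_succ_apply', dz_const_mul]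
  ring

theorem Th_zero (g : ℕ → K) : Th 0 g = g := by
  funext n
  rw [Th, Finset.sum_eq_single (0, n)]
  · simp
  · rintro ⟨l, p⟩ hp hne
    have := Finset.HasAntidiagonal.mem_antidiagonal.1 hp
    simp only at this
    obtain ⟨k, rfl⟩ : ∃ k, l = k + 1 := ⟨l - 1, by
      rcases Nat.eq_zero_or_pos l with rfl | h
      · exact absurd (by simp at this; rw [this]) hne
      · omega⟩
    rw [Ring.choose_zero_succ, map_zero, zero_mul]
  · intro h
    exact absurd (Finset.HasAntidiagonal.mem_antidiagonal.2 (by simp)) h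

/-- Composition with `D` on the left. -/
def Dl (f : ℕ → K) : ℕ → K
  | 0 => f 0
  | n + 1 => f (n + 1) + dz (f n)

theorem Th_add_one (b : ℂ) (g : ℕ → K) : Th (b + 1) g = Dl (Th b g) := by
  funext n
  cases n with
  | zero => rw [Th_at_zero, Dl, Th_at_zero]
  | succ n => rw [Th_succ, Dl]

/-- Composition of symbols; `α` is the order of the left factor. -/
def symMul (al : ℂ) (f g : ℕ → K) (n : ℕ) : K := ∑ p ∈ adiag n, f p.1 * Th (al - p.1) g p.2

theorem symMul_Dl (al : ℂ) (f g : ℕ → K) : symMul (al + 1) (Dl f) g = Dl (symMul al f g) := by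
  funext n
  cases n with
  | zero => simp [symMul, Dl, Th_at_zero]
  | succ n =>
    have h1 : ∀ p : ℕ × ℕ, f p.1 * Th (al + 1 - p.1) g p.2
        = f p.1 * Dl (Th (al - p.1) g) p.2 := fun p => by
      rw [← Th_add_one, sub_add_eq_add_sub]
    have h2 : symMul (al + 1) (Dl f) g (n + 1) = (∑ p ∈ adiag (n + 1), f p.1 * Th (al + 1 - p.1) g p.2)
        + ∑ p ∈ adiag n, dz (f p.1) * Th (al - p.1) g p.2 := by
      rw [symMul, Finset.Nat.sum_antidiagonal_succ, Finset.Nat.sum_antidiagonal_succ, add_assoc,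
        ← Finset.sum_add_distrib]
      congr 1
      refine Finset.sum_congr rfl fun p _ => ?_
      simp only [Dl]
      push_cast
      rw [add_sub_add_right_eq_sub]
      ring
    have h3 : Dl (symMul al f g) (n + 1) = symMul al f g (n + 1) + dz (symMul al f g n) := rfl
    rw [h2, Finset.sum_congr rfl fun p _ => h1 p, h3, symMul, symMul,
      Finset.Nat.sum_antidiagonal_succ', dz_sum, Finset.Nat.sum_antidiagonal_succ']
    simp only [Dl, dz_mul, mul_add, Finset.sum_add_distrib]
    ring

/-- For natural exponents conjugation is iterated left composition with D, which commutes with right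
composition by `symMul_Dl`, a form of the Leibniz rule. -/
theorem Th_symMul_nat (k : ℕ) (be : ℂ) (g h : ℕ → K) :
    Th k (symMul be g h) = symMul (k + be) (Th k g) h := by
  induction k with
  | zero => rw [Nat.cast_zero, Th_zero, Th_zero, zero_add]
  | succ k ih =>
    rw [Nat.cast_succ, Th_add_one, ih, Th_add_one, ← symMul_Dl]
    congr 1
    ring

/-- Both sides have coefficients polynomial in b, so the case of natural b suffices. -/
theorem Th_symMul (b be : ℂ) (g h : ℕ → K) : Th b (symMul be g h) = symMul (b + be) (Th b g) h := by
  funext n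
  have key : ThPoly (symMul be g h) n = ∑ p ∈ adiag n,
      ThPoly g p.1 * Polynomial.taylor (algebraMap ℂ K (be - p.1)) (ThPoly h p.2) := by
    refine ev_ext_nat 0 fun k _ => ?_
    rw [ev_ThPoly, Th_symMul_nat, map_sum, symMul]
    refine Finset.sum_congr rfl fun p _ => ?_
    rw [map_mul, ev_ThPoly, ev_apply _ (Polynomial.taylor _ _), Polynomial.taylor_eval, ← map_add,
      ← ev_apply, ev_ThPoly, add_sub_assoc]
  rw [← ev_ThPoly, key, map_sum, symMul]
  refine Finset.sum_congr rfl fun p _ => ?_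
  rw [map_mul, ev_ThPoly, ev_apply _ (Polynomial.taylor _ _), Polynomial.taylor_eval, ← map_add,
      ← ev_apply, ev_ThPoly, add_sub_assoc]

theorem sum_adiag_assoc (n : ℕ) (f : ℕ → ℕ → ℕ → K) :
    ∑ p ∈ adiag n, ∑ q ∈ adiag p.1, f q.1 q.2 p.2 = ∑ p ∈ adiag n, ∑ q ∈ adiag p.2, f p.1 q.1 q.2 := by
  rw [Finset.sum_sigma', Finset.sum_sigma']
  refine Finset.sum_nbij' (fun x => ⟨(x.2.1, x.2.2 + x.1.2), (x.2.2, x.1.2)⟩)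
    (fun x => ⟨(x.1.1 + x.2.1, x.2.2), (x.1.1, x.2.1)⟩) ?_ ?_ ?_ ?_ ?_
  · rintro ⟨⟨a, b⟩, ⟨c, d⟩⟩ hx
    obtain ⟨e1, e2⟩ := Finset.mem_sigma.1 hx
    have e1 := Finset.HasAntidiagonal.mem_antidiagonal.1 e1
    have e2 := Finset.HasAntidiagonal.mem_antidiagonal.1 e2
    refine Finset.mem_sigma.2 ⟨Finset.HasAntidiagonal.mem_antidiagonal.2 ?_,
      Finset.HasAntidiagonal.mem_antidiagonal.2 ?_⟩ <;> simp only at * <;> omega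
  · rintro ⟨⟨a, b⟩, ⟨c, d⟩⟩ hx
    obtain ⟨e1, e2⟩ := Finset.mem_sigma.1 hx
    have e1 := Finset.HasAntidiagonal.mem_antidiagonal.1 e1
    have e2 := Finset.HasAntidiagonal.mem_antidiagonal.1 e2
    refine Finset.mem_sigma.2 ⟨Finset.HasAntidiagonal.mem_antidiagonal.2 ?_,
      Finset.HasAntidiagonal.mem_antidiagonal.2 ?_⟩ <;> simp only at * <;> omega
  · rintro ⟨⟨a, b⟩, ⟨c, d⟩⟩ hx
    simp only [Finset.mem_sigma, Finset.HasAntidiagonal.mem_antidiagonal] at *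
    rw [hx.2]
  · rintro ⟨⟨a, b⟩, ⟨c, d⟩⟩ hx
    simp only [Finset.mem_sigma, Finset.HasAntidiagonal.mem_antidiagonal] at *
    rw [hx.2]
  · rintro ⟨⟨a, b⟩, ⟨c, d⟩⟩ hx
    rfl

/-- After expanding, associativity only uses that D^β∘(g∘h) = (D^β∘g)∘h, which is `Th_symMul`. -/
theorem symMul_assoc (al be : ℂ) (f g h : ℕ → K) :
    symMul (al + be) (symMul al f g) h = symMul al f (symMul be g h) := by
  funext n
  have h1 : ∀ p : ℕ × ℕ, f p.1 * Th (al - p.1) (symMul be g h) p.2 = ∑ q ∈ adiag p.2,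
      f p.1 * (Th (al - p.1) g q.1 * Th (al + be - (p.1 + q.1 : ℕ)) h q.2) := fun p => by
    rw [Th_symMul, symMul, Finset.mul_sum]
    refine Finset.sum_congr rfl fun q _ => ?_
    push_cast
    rw [show al - p.1 + be - q.1 = al + be - (p.1 + q.1) by ring]
  have h2 : ∀ p : ℕ × ℕ, symMul al f g p.1 * Th (al + be - p.1) h p.2 = ∑ q ∈ adiag p.1,
      f q.1 * (Th (al - q.1) g q.2 * Th (al + be - (q.1 + q.2 : ℕ)) h p.2) := fun p => by
    rw [symMul, Finset.sum_mul]
    refine Finset.sum_congr rfl fun q hq => ?_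
    rw [Finset.HasAntidiagonal.mem_antidiagonal.1 hq, mul_assoc]
  rw [symMul, symMul, Finset.sum_congr rfl fun p _ => h1 p, Finset.sum_congr rfl fun p _ => h2 p]
  exact sum_adiag_assoc n fun i j l => f i * (Th (al - i) g j * Th (al + be - (i + j : ℕ)) h l)

theorem symMul_add_left (al : ℂ) (f f' g : ℕ → K) :
    symMul al (fun n => f n + f' n) g = fun n => symMul al f g n + symMul al f' g n := by
  funext n
  simp only [symMul, add_mul, Finset.sum_add_distrib]

theorem symMul_const_left (al : ℂ) (c : K) (f g : ℕ → K) :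
    symMul al (fun n => c * f n) g = fun n => c * symMul al f g n := by
  funext n
  simp only [symMul, mul_assoc, Finset.mul_sum]

/-- Shift of a sequence by `k` places. -/
def shiftSeq (k : ℕ) (f : ℕ → K) (n : ℕ) : K := if k ≤ n then f (n - k) else 0

theorem shiftSeq_add (k : ℕ) (f : ℕ → K) (n : ℕ) : shiftSeq k f (n + k) = f n := by
  rw [shiftSeq, if_pos (by omega), Nat.add_sub_cancel]

theorem symMul_shiftSeq_left (al : ℂ) (k : ℕ) (f g : ℕ → K) :
    symMul al (shiftSeq k f) g = shiftSeq k (symMul (al - k) f g) := by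
  funext n
  rcases Nat.lt_or_ge n k with h | h
  · rw [shiftSeq, if_neg (by omega), symMul]
    refine Finset.sum_eq_zero fun p hp => ?_
    have := Finset.HasAntidiagonal.mem_antidiagonal.1 hp
    rw [shiftSeq, if_neg (by omega), zero_mul]
  · obtain ⟨m, rfl⟩ : ∃ m, n = m + k := ⟨n - k, by omega⟩
    rw [shiftSeq_add, symMul, symMul]
    symm
    refine Finset.sum_of_injOn (fun p => (p.1 + k, p.2)) ?_ ?_ ?_ ?_
    · rintro ⟨a, b⟩ _ ⟨c, d⟩ _ h
      simp only [Prod.mk.injEq] at h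
      ext <;> simp only [] <;> omega
    · rintro ⟨a, b⟩ h
      simp only [Finset.mem_coe, Finset.HasAntidiagonal.mem_antidiagonal] at *
      omega
    · rintro ⟨a, b⟩ h1 h2
      simp only [Finset.HasAntidiagonal.mem_antidiagonal] at h1
      rw [shiftSeq, if_neg, zero_mul]
      intro hk
      simp only at hk
      refine h2 ⟨(a - k, b), ?_, ?_⟩
      · simp only [Finset.mem_coe, Finset.HasAntidiagonal.mem_antidiagonal]; omega
      · ext <;> simp only [] <;> omega
    · rintro ⟨a, b⟩ _
      simp only [shiftSeq_add]
      push_cast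
      rw [sub_sub, add_comm (k : ℂ)]

/-- Triangularity of the composition with a monic symbol on the right. -/
theorem eq_zero_of_symMul_eq_zero {al : ℂ} {f g : ℕ → K} (hg : g 0 = 1) (n : ℕ)
    (h : ∀ i < n, symMul al f g i = 0) : ∀ i < n, f i = 0 := by
  intro i
  induction i using Nat.strong_induction_on with
  | _ i ih =>
    intro hi
    have e := h i hi
    rw [symMul, Finset.sum_eq_single (i, 0)] at e
    · simpa [Th_at_zero, hg] using e
    · rintro ⟨a, b⟩ hp hne
      have := Finset.HasAntidiagonal.mem_antidiagonal.1 hp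
      simp only at this
      rw [ih a _ (by omega), zero_mul]
      rcases Nat.eq_zero_or_pos b with rfl | hb
      · exact absurd (by simp at this; rw [this]) hne
      · omega
    · intro h
      exact absurd (Finset.HasAntidiagonal.mem_antidiagonal.2 (by simp)) h

theorem symMul_eq_of_vanish {al : ℂ} {f g : ℕ → K} (hg : g 0 = 1) (n : ℕ)
    (h : ∀ i < n, f i = 0) : symMul al f g n = f n := by
  rw [symMul, Finset.sum_eq_single (n, 0)]
  · simp [Th_at_zero, hg]
  · rintro ⟨a, b⟩ hp hne
    have := Finset.HasAntidiagonal.mem_antidiagonal.1 hp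
    simp only at this
    rw [h a, zero_mul]
    rcases Nat.eq_zero_or_pos b with rfl | hb
    · exact absurd (by simp at this; rw [this]) hne
    · omega
  · intro h
    exact absurd (Finset.HasAntidiagonal.mem_antidiagonal.2 (by simp)) h

/-! ### Gauge transformations and the first columns of `L_a` -/

theorem vl_mul_of_col {x y : Hs} (hx : x ∈ opRing) (hy : y ∈ opRing) {s : ℂ}
    (h : ∀ e, vl y e s = if e = 0 then 1 else 0) (d : ℤ) : vl (x * y) d s = vl x d s := by
  obtain ⟨N, hN⟩ := exists_lowBd x
  obtain ⟨M, hM⟩ := exists_lowBd y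
  rw [vl_mul hx hy hN hM, Finset.sum_eq_single 0]
  · rw [h, if_pos rfl, mul_one, sub_zero, Int.cast_zero, sub_zero]
  · intro e _ he
    rw [h, if_neg he, mul_zero]
  · intro h0
    simp only [Finset.mem_Icc, not_and_or] at h0
    rw [hN.vl (by omega), zero_mul]

/-- Both sides intertwine ∇₀ with ∇_a and fix v_0, so they agree by uniqueness. -/
theorem Lop_mul_eq {a b x : Hs} (ha : a ∈ opRing) (hb : b ∈ opRing) (ha0 : LowBd 0 a)
    (hb0 : LowBd 0 b) (hx : x ∈ opRing) (h : gdef b x a = 0)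
    (h0 : ∀ e, vl x e 0 = if e = 0 then 1 else 0) : Lop b * x = Lop a := by
  refine eq_of_gdef_eq (mul_mem (Lop_mem b) hx) (Lop_mem a) ha ha0 ?_ fun d => ?_
  · rw [gdef_mul 0 (Lop b) b x a, gdef_Lop hb hb0, h, zero_mul, mul_zero, add_zero,
      gdef_Lop ha ha0]
  · rw [vl_mul_of_col (Lop_mem b) hx h0, vl_Lop_at_zero, vl_Lop_at_zero]

theorem Unitri.vl_col {x : Hs} (hx : Unitri x) {s : ℂ} (h : ∀ d : ℤ, 0 < d → vl x d s = 0) (e : ℤ) :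
    vl x e s = if e = 0 then 1 else 0 := by
  rcases lt_trichotomy e 0 with he | rfl | he
  · rw [hx.low.vl (by omega), if_neg he.ne]
  · rw [hx.vl_zero, if_pos rfl]
  · rw [h e he, if_neg he.ne']

theorem Stab.col {x : Hs} {s : ℂ} (h : Stab s x) (d : ℤ) (hd : 0 < d) : vl x d s = 0 := by
  simpa using h 0 d (by simpa using hd)

/-- Here L_a = L_b x, and x fixes v_λ because it is unitriangular and preserves the span of v_λ,
v_{λ+1}, …: the symbol is gauge invariant. -/
theorem vl_Lop_eq_of_gauge {lam : ℂ} {a b x : Hs} (ha : a ∈ opRing) (hb : b ∈ opRing)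
    (ha0 : LowBd 0 a) (hb0 : LowBd 0 b) (hx : Unitri x) (h : gdef b x a = 0) (h0 : Stab 0 x)
    (h1 : Stab lam x) (d : ℤ) : vl (Lop a) d lam = vl (Lop b) d lam := by
  rw [← Lop_mul_eq ha hb ha0 hb0 hx.mem h (hx.vl_col h0.col),
    vl_mul_of_col (Lop_mem b) hx.mem (hx.vl_col h1.col)]

/-- The only candidate is x = L_b⁻¹ L_a. Equality of the columns at 0 and at λ says that x fixes v_0
and v_λ, and then `stab_of_gdef` propagates this to both spans. -/
theorem exists_gauge {lam : ℂ} {a b : Hs} (ha : a ∈ opRing) (hb : b ∈ opRing) (ha0 : LowBd 0 a)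
    (hb0 : LowBd 0 b) (sa : Stab 0 a) (sb : Stab 0 b) (sa' : Stab lam a) (sb' : Stab lam b)
    (h : ∀ d, vl (Lop a) d lam = vl (Lop b) d lam) :
    ∃ x, Unitri x ∧ gdef b x a = 0 ∧ Stab 0 x ∧ Stab lam x := by
  obtain ⟨y, hy, hby, -⟩ := (unitri_Lop b).exists_inv
  set x := y * Lop a with hxd
  have hx : Unitri x := hy.mul (unitri_Lop a)
  have hbx : Lop b * x = Lop a := by rw [hxd, ← mul_assoc, hby, one_mul]
  have hg : gdef b x a = 0 := by
    refine (unitri_Lop b).cancel_left ?_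
    have := gdef_mul 0 (Lop b) b x a
    rw [hbx, gdef_Lop ha ha0, gdef_Lop hb hb0, zero_mul, zero_add] at this
    rw [mul_zero, ← this]
  have col : ∀ s : ℂ, (∀ d, vl (Lop a) d s = vl (Lop b) d s) → ∀ d : ℤ, 0 < d → vl x d s = 0 := by
    intro s hs d hd
    have := (unitri_Lop b).vl_eq_zero_of_mul (sub_mem hx.mem (one_mem _)) (s := s) (d + 1)
      (fun e _ => by rw [mul_sub, mul_one, vl_sub, hbx, hs, sub_self]) d (by omega)
    rwa [vl_sub, vl_one, if_neg hd.ne', sub_zero] at this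
  refine ⟨x, hx, hg, ?_, ?_⟩
  · exact stab_of_gdef hb hx.mem ha hb0 hx.low ha0 hg sb sa
      (col 0 fun d => by rw [vl_Lop_at_zero, vl_Lop_at_zero])
  · exact stab_of_gdef hb hx.mem ha hb0 hx.low ha0 hg sb' sa' (col lam h)

/-- By skewness σ(x) intertwines in the opposite direction, so σ(x) x commutes with ∇_a. It fixes
v_0, because σ exchanges the behaviour at the two ends 0 and λ; uniqueness makes it the identity. -/
theorem sig_mul_eq_one {lam : ℂ} {a b x : Hs} (ha : a ∈ opRing) (hb : b ∈ opRing)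
    (ha0 : LowBd 0 a) (hx : Unitri x) (h : gdef b x a = 0) (h0 : Stab 0 x)
    (h1 : Stab lam x) (sa : sig lam a = -a) (sb : sig lam b = -b) : sig lam x * x = 1 := by
  have h2 : gdef a (sig lam x) b = 0 := by
    have := sig_gdef (lam := lam) hb hx.mem ha
    rw [h, sa, sb, neg_neg, neg_neg] at this
    rw [← this]
    simpa using sig_sub lam 0 0
  have h3 : gdef a (sig lam x * x) a = 0 := by
    rw [gdef_mul a (sig lam x) b x a, h, h2, zero_mul, mul_zero, add_zero]
  refine (unitri_Lop a).cancel_left ?_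
  rw [mul_one]
  refine Lop_mul_eq ha ha ha0 ha0 (mul_mem (sig_mem _ _) hx.mem) h3 fun e => ?_
  rw [vl_mul_of_col (sig_mem _ _) hx.mem (hx.vl_col h0.col)]
  refine (hx.sig lam).vl_col (fun d hd => ?_) e
  obtain ⟨n, rfl⟩ : ∃ n : ℕ, d = n + 1 := ⟨(d - 1).toNat, by omega⟩
  rw [vl_sig, show lam - 1 + ((n + 1 : ℤ) : ℂ) - 0 = lam + n by push_cast; ring,
    h1 n (n + 1) (by omega), mul_zero]

/-- `L_a` also preserves the span of `v_0, v_1, …`. -/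
theorem stab_Lop {a : Hs} (ha : a ∈ opRing) (ha0 : LowBd 0 a) (sa : Stab 0 a) : Stab 0 (Lop a) :=
  stab_of_gdef (zero_mem _) (Lop_mem a) ha (fun d _ => cf_zero d) (lowBd_Lop a) ha0
    (gdef_Lop ha ha0) (stab_zero 0) sa fun d hd => by rw [vl_Lop_at_zero, if_neg hd.ne']

/-! ### Adjoint symbols -/

/-- The adjoint of the symbol `∑ u_j D^{λ-j}`. -/
def starSeq (lam : ℂ) (u : ℕ → K) (m : ℕ) : K :=
  ∑ p ∈ adiag m, algebraMap ℂ K (Ring.choose (lam - p.2) p.1) * ((-1) ^ p.2 * dz^[p.1] (u p.2))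

/-- Commuting with ∇₀ means commuting with left composition by D, so v is right multiplication by a
symbol Σ D^{-p}∘c_p. In row p - 1 only c_p itself survives, as the binomial coefficients C(l - 1, l)
with l ≥ 1 vanish. -/
theorem vl_eq_of_gdef_zero {v : Hs} (hv : v ∈ opRing) (hv0 : LowBd 0 v) (h : gdef 0 v 0 = 0) (m : ℕ)
    (s : ℂ) : vl v m s = ∑ p ∈ adiag m, algebraMap ℂ K (Ring.choose (s - p.2) p.1)
      * dz^[p.1] (vl v p.2 (p.2 - 1)) := by
  have hstep : ∀ (m : ℕ) s, vl v (m + 1) (s + 1) = vl v (m + 1) s + dz (vl v m s) := by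
    intro m s
    have := vl_gdef 0 0 hv m s
    rw [h, vl_zero, zero_mul, mul_zero, vl_zero] at this
    linear_combination this
  have hzero : ∀ s, vl v (0 : ℕ) (s + 1) = vl v (0 : ℕ) s := by
    intro s
    have := vl_gdef 0 0 hv (-1) s
    rw [h, vl_zero, zero_mul, mul_zero, vl_zero, hv0.vl (by omega), map_zero] at this
    have h2 : vl v (-1 + 1) s - vl v (-1 + 1) (s + 1) = 0 := by linear_combination -this
    exact (sub_eq_zero.1 h2).symm
  let q : ℕ → K[X] := fun m => ∑ p ∈ adiag m, tr (-p.2) (chPoly p.1)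
      * Polynomial.C (dz^[p.1] (vl v p.2 (p.2 - 1)))
  have hq : ∀ m s, ev s (q m) = ∑ p ∈ adiag m, algebraMap ℂ K (Ring.choose (s - p.2) p.1)
      * dz^[p.1] (vl v p.2 (p.2 - 1)) := by
    intro m s
    rw [map_sum]
    refine Finset.sum_congr rfl fun p _ => ?_
    rw [map_mul, ev_tr, ev_chPoly, ev_C]
    push_cast
    rw [← sub_eq_add_neg]
  have key : ∀ m : ℕ, cf v m = q m := by
    intro m
    induction m with
    | zero =>
      refine eq_of_ev_succ (-1) (fun s => ?_) ?_
      · have := hzero s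
        rw [vl, vl] at this
        rw [this, hq, hq]
        simp
      · rw [hq]
        simp [vl]
    | succ m ih =>
      refine eq_of_ev_succ m (fun s => ?_) ?_
      · have e1 := hstep m s
        have e2 : vl v m s = ev s (q m) := by rw [vl, ih]
        have e3 : ev (s + 1) (cf v ((m + 1 : ℕ) : ℤ)) - ev s (cf v ((m + 1 : ℕ) : ℤ))
            = dz (ev s (q m)) := by
          rw [← e2, Nat.cast_succ]
          exact sub_eq_iff_eq_add'.2 e1
        rw [e3, hq, hq, hq, Finset.Nat.sum_antidiagonal_succ, Finset.Nat.sum_antidiagonal_succ,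
          dz_sum]
        simp only [Ring.choose_zero_right, add_sub_add_left_eq_sub, ← Finset.sum_sub_distrib]
        refine Finset.sum_congr rfl fun p _ => ?_
        rw [add_sub_right_comm, Ring.choose_succ_succ, dz_const_mul, Function.iterate_succ_apply',
          map_add]
        ring
      · rw [hq, Finset.sum_eq_single (0, m + 1)]
        · simp [vl]
        · rintro ⟨l, p⟩ hp hne
          have := Finset.HasAntidiagonal.mem_antidiagonal.1 hp
          simp only at this
          obtain ⟨k, rfl⟩ : ∃ k, l = k + 1 := ⟨l - 1, by
            rcases Nat.eq_zero_or_pos l with rfl | h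
            · exact absurd (by rw [← this, zero_add]) hne
            · omega⟩
          have e : (m : ℂ) - (p : ℕ) = (k : ℕ) := by
            rw [show m = k + p by omega]; push_cast; ring
          simp only
          rw [e, Ring.choose_natCast, Nat.choose_succ_self, Nat.cast_zero, map_zero, zero_mul]
        · intro h
          exact absurd (Finset.HasAntidiagonal.mem_antidiagonal.2 (by simp)) h
  rw [vl, key, hq]

/-- Put b = -σ(a). The product L_b σ(L_a) commutes with ∇₀, hence is given by `vl_eq_of_gdef_zero`.
Since L_a and L_b preserve the span of v_0, v_1, …, its column at λ is that of L_b, while its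
entries in row j - 1 and place j are (-1)^j times the coefficients of L_a v_λ. The resulting formula
is the definition of the adjoint. -/
theorem vl_Lop_neg_sig {lam : ℂ} {a : Hs} (ha : a ∈ opRing) (ha0 : LowBd 0 a) (sa : Stab 0 a)
    (sa' : Stab 0 (sig lam a)) (m : ℕ) :
    vl (Lop (-sig lam a)) m lam = starSeq lam (fun j => vl (Lop a) j lam) m := by
  set b := -sig lam a with hb
  have hbm : b ∈ opRing := neg_mem (sig_mem _ _)
  have hb0 : LowBd 0 b := (ha0.sig lam).neg
  have sb : Stab 0 b := fun i d h => by rw [hb, vl_neg, sa' i d h, neg_zero]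
  have hs := (unitri_Lop a).sig lam
  have u : Unitri (Lop b * sig lam (Lop a)) := (unitri_Lop b).mul hs
  have h1 : gdef b (sig lam (Lop a)) 0 = 0 := by
    have := sig_gdef (lam := lam) (zero_mem _) (Lop_mem a) ha
    have z : sig lam 0 = 0 := by simpa using sig_sub lam 0 0
    rw [gdef_Lop ha ha0, z, neg_zero] at this
    exact this.symm
  have h2 : gdef 0 (Lop b * sig lam (Lop a)) 0 = 0 := by
    rw [gdef_mul 0 (Lop b) b, h1, gdef_Lop hbm hb0, zero_mul, mul_zero, add_zero]
  have h3 : vl (Lop b * sig lam (Lop a)) m lam = vl (Lop b) m lam := by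
    refine vl_mul_of_col (Lop_mem b) hs.mem (hs.vl_col fun d hd => ?_) m
    obtain ⟨n, rfl⟩ : ∃ n : ℕ, d = n + 1 := ⟨(d - 1).toNat, by omega⟩
    rw [vl_sig, show lam - 1 + ((n + 1 : ℤ) : ℂ) - lam = 0 + n by push_cast; ring,
      stab_Lop ha ha0 sa n (n + 1) (by omega), mul_zero]
  have h4 : ∀ j : ℕ, vl (Lop b * sig lam (Lop a)) j (j - 1) = (-1) ^ j * vl (Lop a) j lam := by
    intro j
    rw [vl_mul_nat (Lop_mem b) hs.mem (lowBd_Lop b) hs.low, Finset.sum_eq_single (0, j)]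
    · rw [Nat.cast_zero, (unitri_Lop b).vl_zero, one_mul, vl_sig]
      push_cast
      rw [show lam - 1 + (j : ℂ) - (j - 1) = lam by ring, Int.natAbs_natCast]
    · rintro ⟨p, q⟩ hp hne
      have := Finset.HasAntidiagonal.mem_antidiagonal.1 hp
      simp only at this
      obtain ⟨n, rfl⟩ : ∃ n, p = n + 1 := ⟨p - 1, by
        rcases Nat.eq_zero_or_pos p with rfl | h
        · exact absurd (by rw [← this, zero_add]) hne
        · omega⟩
      have e : ((j : ℂ) - 1 - ((q : ℕ) : ℂ)) = 0 + n := by rw [← this]; push_cast; ring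
      simp only
      rw [e, stab_Lop hbm hb0 sb n _ (by push_cast; omega), zero_mul]
    · intro h
      exact absurd (Finset.HasAntidiagonal.mem_antidiagonal.2 (by simp)) h
  rw [← h3, vl_eq_of_gdef_zero u.mem u.low h2, starSeq]
  refine Finset.sum_congr rfl fun p _ => ?_
  rw [h4, show ((-1 : K) ^ p.2) = algebraMap ℂ K ((-1) ^ p.2) by simp, iter_dz_const_mul]

/-! ### Dependence of the first column at `n` on the upper left block -/

/-- The columns of L_a at 0, 1, …, n are built successively from the columns of a before n. Hence at
λ = n the symbol depends only on the n × n block. -/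
theorem vl_Lop_congr {a b : Hs} (ha : a ∈ opRing) (hb : b ∈ opRing) (ha0 : LowBd 0 a)
    (hb0 : LowBd 0 b) (sb : Stab 0 b) (n : ℕ)
    (h : ∀ j < n, ∀ d : ℤ, vl a d j = vl b d j) (d : ℤ) : vl (Lop a) d n = vl (Lop b) d n := by
  have step : ∀ (a : Hs), a ∈ opRing → LowBd 0 a → ∀ d s, vl (Lop a) d (s + 1) =
      vl (Lop a) d s + dz (vl (Lop a) (d - 1) s) - vl (Lop a * a) (d - 1) s := by
    intro a ha ha0 d s
    have := vl_gdef 0 a (Lop_mem a) (d - 1) s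
    rw [gdef_Lop ha ha0, vl_zero, zero_mul, vl_zero, sub_add_cancel] at this
    linear_combination this
  have key : ∀ i ≤ n, ∀ d : ℤ, vl (Lop a) d i = vl (Lop b) d i := by
    intro i
    induction i using Nat.strong_induction_on with
    | _ i ih =>
      intro hi d
      cases i with
      | zero => rw [Nat.cast_zero, vl_Lop_at_zero, vl_Lop_at_zero]
      | succ i =>
        rw [Nat.cast_succ, step a ha ha0, step b hb hb0, ih i (by omega) (by omega) d,
          ih i (by omega) (by omega) (d - 1)]
        suffices hs : vl (Lop a * a) (d - 1) i = vl (Lop b * b) (d - 1) i by rw [hs]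
        rw [vl_mul (Lop_mem a) ha (lowBd_Lop a) ha0, vl_mul (Lop_mem b) hb (lowBd_Lop b) hb0]
        refine Finset.sum_congr rfl fun e he => ?_
        simp only [Finset.mem_Icc] at he
        obtain ⟨m, rfl⟩ := Int.eq_ofNat_of_zero_le (show 0 ≤ e by omega)
        rw [h i (by omega)]
        rcases lt_or_ge i m with him | him
        · have := sb i m (by omega)
          rw [zero_add] at this
          rw [this, mul_zero, mul_zero]
        · have := ih (i - m) (by omega) (by omega) (d - 1 - m)
          rw [Nat.cast_sub him] at this
          rw [Int.cast_natCast, this]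
  exact key n le_rfl d

/-! ### The trace -/

/-- The contributions of places e and -e to the two products are translates of each other by e;
divisibility by W_e kills the boundary terms at 0 and at λ. -/
theorem csum_mul_comm {lam : ℂ} {x y : Hs} (hx : x ∈ opRing) (hy : y ∈ opRing)
    (h1 : ∀ e : ℕ, wPoly lam e ∣ cf y e ∨ cf x (-e) = 0)
    (h2 : ∀ e : ℕ, wPoly lam e ∣ cf x e ∨ cf y (-e) = 0) :
    csum lam (cf (x * y) 0) = csum lam (cf (y * x) 0) := by
  obtain ⟨N, hN⟩ := exists_lowBd x
  obtain ⟨M, hM⟩ := exists_lowBd y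
  rw [cf_mul hx hy hN hM, cf_mul hy hx hM hN, csum_sum, csum_sum]
  refine Finset.sum_nbij' (fun e => -e) (fun e => -e) ?_ ?_ (fun e _ => neg_neg e)
    (fun e _ => neg_neg e) fun e _ => ?_
  · intro e he; simp only [Finset.mem_Icc] at *; omega
  · intro e he; simp only [Finset.mem_Icc] at *; omega
  · have aux : ∀ {p : K[X]} (d : ℕ), wPoly lam d ∣ p → csum lam (tr d p) = csum lam p := by
      rintro p d ⟨q, rfl⟩
      refine csum_tr d (fun i hi => ?_) fun i hi => ?_
      · rw [map_mul, ev_wPoly_eq_zero (by omega), zero_mul]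
      · rw [map_mul, ev_wPoly_eq_zero' (by omega), zero_mul]
    rw [neg_neg, zero_sub, zero_sub, neg_neg]
    rcases le_total 0 e with he | he
    · obtain ⟨d, rfl⟩ := Int.eq_ofNat_of_zero_le he
      have : tr d (cf y d) * cf x (-d) = tr d (tr (-d) (cf x (-d)) * cf y d) := by
        rw [map_mul, tr_tr, add_neg_cancel, tr_zero, mul_comm]
      rw [this]
      rcases h1 d with h | h
      · exact (aux d (h.mul_left _)).symm
      · simp [h]
    · obtain ⟨d, hd⟩ := Int.eq_ofNat_of_zero_le (show 0 ≤ -e by omega)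
      obtain rfl : e = -d := by omega
      rw [neg_neg]
      have : tr d (cf x d) * cf y (-d) = tr d (tr (-d) (cf y (-d)) * cf x d) := by
        rw [map_mul, tr_tr, add_neg_cancel, tr_zero, mul_comm]
      rw [this]
      rcases h2 d with h | h
      · exact aux d (h.mul_left _)
      · simp [h]

/-- A Stokes formula: [a, y] has trace zero, d/dz contributes a total derivative, and the sum of [F,
y] telescopes to the boundary values of y_1. The boundary value at λ will produce the residue of a
symbol. -/
theorem csum_gdef {lam : ℂ} {a y : Hs} (ha : a ∈ glRing lam) (ha0 : LowBd 0 a) (hy : y ∈ opRing) :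
    csum lam (cf (gdef a y a) 0) = dz (csum lam (cf y 0)) - (vl y 1 lam - vl y 1 0) := by
  have e1 : csum lam (cf (Fop * y - y * Fop) 0) = -(vl y 1 lam - vl y 1 0) := by
    have : csum lam (cf (Fop * y - y * Fop) 0) = ev lam (-cf y 1) - ev 0 (-cf y 1) := by
      refine csum_eq_of_diff fun s => ?_
      have h : vl (Fop * y - y * Fop) 0 s = vl y (0 + 1) s - vl y (0 + 1) (s + 1) := by
        rw [vl_sub, vl_Fop_mul hy, vl_mul_Fop hy]
      rw [zero_add] at h
      rw [map_neg, map_neg]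
      refine h.trans ?_
      rw [vl, vl]
      ring
    rw [this, map_neg, map_neg, vl, vl]
    ring
  have e2 : csum lam (cf (a * y - y * a) 0) = 0 := by
    rw [cf_sub, csum_sub, csum_mul_comm ha.1 hy (fun e => ?_) fun e => Or.inl (ha.2 e), sub_self]
    rcases Nat.eq_zero_or_pos e with rfl | he
    · exact Or.inl (by rw [wPoly_of_nonpos lam (by simp)]; exact one_dvd _)
    · exact Or.inr (ha0 _ (by omega))
  rw [gdef_eq, cf_add, cf_add, csum_add, csum_add, cf_dl_comm hy, csum_pd, e1, e2]
  ring

/-! ### Operators commuting with `∇₀` -/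

/-- The operator commuting with `∇₀` whose column at `s` is `D^s ∘ P ∘ D^{-s}`, where
`P = ∑ P_n D^{N-n}`. -/
def hat (N : ℤ) (P : ℕ → K) : Hs := mkOp N fun d => ThPoly P (d + N).toNat

theorem hat_mem (N : ℤ) (P : ℕ → K) : hat N P ∈ opRing := mkOp_mem _ _
theorem lowBd_hat (N : ℤ) (P : ℕ → K) : LowBd N (hat N P) := lowBd_mkOp _ _

theorem vl_hat (N : ℤ) (P : ℕ → K) (m : ℕ) (s : ℂ) : vl (hat N P) (m - N) s = Th s P m := by
  rw [hat, vl_mkOp, if_pos (by omega), sub_add_cancel, Int.toNat_natCast, ev_ThPoly]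

theorem gdef_hat (N : ℤ) (P : ℕ → K) : gdef 0 (hat N P) 0 = 0 := by
  refine opRing_ext_vl (gdef_mem (zero_mem _) (hat_mem N P) (zero_mem _)) (zero_mem _) fun d s => ?_
  rw [vl_gdef 0 0 (hat_mem N P), zero_mul, mul_zero, vl_zero, sub_zero, add_zero]
  rcases lt_or_ge (d + 1) (-N) with h | h
  · rw [(lowBd_hat N P).vl h, (lowBd_hat N P).vl h, (lowBd_hat N P).vl (by omega), map_zero]
    simp
  obtain ⟨m, hm⟩ := Int.eq_ofNat_of_zero_le (show 0 ≤ d + 1 + N by omega)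
  obtain rfl : d = m - N - 1 := by omega
  rw [sub_add_cancel, vl_hat, vl_hat]
  cases m with
  | zero => rw [(lowBd_hat N P).vl (by push_cast; omega), Th_at_zero, Th_at_zero, map_zero]; simp
  | succ m =>
    rw [show ((m + 1 : ℕ) : ℤ) - N - 1 = m - N by push_cast; ring, vl_hat, Th_succ]
    ring

/-- Reading x v_s as a symbol, `hat N P` composes it on the right with P. -/
theorem vl_hat_mul (N : ℤ) (P : ℕ → K) {x : Hs} (hx : x ∈ opRing) (hx0 : LowBd 0 x) (m : ℕ) (s : ℂ) :
    vl (hat N P * x) (m - N) s = symMul s (fun e => vl x e s) P m := by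
  rw [vl_mul (hat_mem N P) hx (lowBd_hat N P) hx0, sub_add_cancel, symMul]
  refine Finset.sum_nbij' (fun e : ℤ => (e.toNat, m - e.toNat)) (fun p : ℕ × ℕ => (p.1 : ℤ))
    ?_ ?_ ?_ ?_ ?_
  · intro e he
    simp only [Finset.mem_Icc, Finset.HasAntidiagonal.mem_antidiagonal] at *
    omega
  · intro p hp
    simp only [Finset.mem_Icc, Finset.HasAntidiagonal.mem_antidiagonal] at *
    omega
  · intro e he
    simp only [Finset.mem_Icc] at *
    omega
  · rintro ⟨p, q⟩ hp
    have := Finset.HasAntidiagonal.mem_antidiagonal.1 hp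
    simp only [Prod.mk.injEq] at *
    omega
  · intro e he
    simp only [Finset.mem_Icc] at he
    obtain ⟨j, rfl⟩ := Int.eq_ofNat_of_zero_le (show 0 ≤ e by omega)
    rw [show (m : ℤ) - N - j = (m - j : ℕ) - N by omega, vl_hat, Int.toNat_natCast, mul_comm,
      Int.cast_natCast]

/-! ### Columns of `L_a` as left multiples of the first one -/

theorem symMul_one_left (g : ℕ → K) : symMul 0 (fun n => if n = 0 then 1 else 0) g = g := by
  funext n
  rw [symMul, Finset.sum_eq_single (0, n)]
  · simp [Th_zero]
  · rintro ⟨l, p⟩ hp hne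
    have := Finset.HasAntidiagonal.mem_antidiagonal.1 hp
    simp only at this
    rw [if_neg, zero_mul]
    rintro rfl
    exact hne (by rw [← this, zero_add])
  · intro h
    exact absurd (Finset.HasAntidiagonal.mem_antidiagonal.2 (by simp)) h

theorem symMul_sub_left (al : ℂ) (f f' g : ℕ → K) :
    symMul al (fun n => f n - f' n) g = fun n => symMul al f g n - symMul al f' g n := by
  funext n
  simp only [symMul, sub_mul, Finset.sum_sub_distrib]

theorem symMul_sum_left (al : ℂ) {β : Type*} (t : Finset β) (f : β → ℕ → K) (g : ℕ → K) (n : ℕ) :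
    symMul al (fun n => ∑ b ∈ t, f b n) g n = ∑ b ∈ t, symMul al (f b) g n := by
  simp only [symMul, Finset.sum_mul]
  exact Finset.sum_comm

/-- The product with an operator whose column at `s` vanishes above the place `i`. -/
theorem vl_mul_range {x y : Hs} (hx : x ∈ opRing) (hy : y ∈ opRing) (hy0 : LowBd 0 y) {i : ℕ} {s : ℂ}
    (h : ∀ q : ℤ, i < q → vl y q s = 0) (d : ℤ) :
    vl (x * y) d s = ∑ q ∈ Finset.range (i + 1), vl x (d - q) (s - q) * vl y q s := by
  obtain ⟨N, hN⟩ := exists_lowBd x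
  rw [vl_mul hx hy hN hy0]
  have e1 : ∑ q ∈ Finset.range (i + 1), vl x (d - q) (s - q) * vl y q s
      = ∑ q ∈ Finset.Icc (0 : ℤ) i, vl x (d - q) (s - q) * vl y q s := by
    refine Finset.sum_nbij' (fun q : ℕ => (q : ℤ)) (fun q => q.toNat) ?_ ?_ ?_ ?_ ?_
    · intro q hq; simp only [Finset.mem_Icc, Finset.mem_range] at *; omega
    · intro q hq; simp only [Finset.mem_Icc, Finset.mem_range] at *; omega
    · intro q _; simp
    · intro q hq; simp only [Finset.mem_Icc] at *; omega
    · intro q _; rw [Int.cast_natCast]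
  rw [e1, neg_zero]
  refine (Finset.sum_subset (s₂ := Finset.Icc 0 (max (d + N) i)) ?_ ?_).trans
    (Finset.sum_subset ?_ ?_).symm
  · exact Finset.Icc_subset_Icc_right (le_max_left _ _)
  · intro q hq hq'
    simp only [Finset.mem_Icc] at *
    rw [hN.vl (by omega), zero_mul]
  · exact Finset.Icc_subset_Icc_right (le_max_right _ _)
  · intro q hq hq'
    simp only [Finset.mem_Icc] at *
    rw [h q (by omega), mul_zero]

/-- The column at s₀ + i is a differential operator of order i composed with the column at s₀. It
follows from L_a v_{s+1} = D∘L_a v_s - Σ a_q(s) L_a v_{s-q}, where stability confines the sum to q ≤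
i when s = s₀ + i. -/
theorem exists_left_factor {a : Hs} (ha : a ∈ opRing) (ha0 : LowBd 0 a) {s₀ : ℂ} (sa : Stab s₀ a)
    (i : ℕ) : ∃ M : ℕ → K, (∀ n, i < n → M n = 0) ∧
      ∀ m : ℕ, vl (Lop a) m (s₀ + i) = symMul i M (fun e => vl (Lop a) e s₀) m := by
  set g : ℕ → K := fun e => vl (Lop a) e s₀ with hg
  have hrec : ∀ (m : ℕ) s, vl (Lop a) m (s + 1) = Dl (fun e => vl (Lop a) e s) m
      - shiftSeq 1 (fun m => vl (Lop a * a) m s) m := by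
    intro m s
    have := vl_gdef 0 a (Lop_mem a) (m - 1) s
    rw [gdef_Lop ha ha0, vl_zero, zero_mul, vl_zero, sub_add_cancel] at this
    cases m with
    | zero => 
      simp only [Dl, shiftSeq, Nat.cast_zero]
      rw [(unitri_Lop a).vl_zero, (unitri_Lop a).vl_zero]; simp
    | succ m =>
      rw [shiftSeq_add]
      simp only [Dl]
      rw [Nat.cast_succ, add_sub_cancel_right] at this
      rw [Nat.cast_succ]
      linear_combination this
  induction i using Nat.strong_induction_on with
  | _ i ih =>
    cases i with
    | zero =>
      refine ⟨fun n => if n = 0 then 1 else 0, fun n hn => if_neg hn.ne', fun m => ?_⟩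
      rw [Nat.cast_zero, symMul_one_left, add_zero]
    | succ i =>
      choose! M hM0 hM using ih
      -- The new factor is D∘M_i - Σ a_q M_{i-q}; the shift by q + 1 accounts for the order i - q of
      -- the factor inside one of order i + 1.
      refine ⟨fun n => Dl (M i) n - ∑ q ∈ Finset.range (i + 1),
        vl a q (s₀ + i) * shiftSeq (q + 1) (M (i - q)) n, fun n hn => ?_, fun m => ?_⟩
      · obtain ⟨n, rfl⟩ : ∃ n', n = n' + 1 := ⟨n - 1, by omega⟩
        simp only [Dl]
        rw [hM0 i (by omega) _ (by omega), hM0 i (by omega) _ (by omega), map_zero, zero_add,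
          zero_sub, neg_eq_zero]
        refine Finset.sum_eq_zero fun q hq => ?_
        have := Finset.mem_range.1 hq
        rw [shiftSeq, if_pos (by omega), hM0 _ (by omega) _ (by omega), mul_zero]
      · rw [symMul_sub_left]
        simp only
        rw [symMul_sum_left, Nat.cast_succ, symMul_Dl, ← add_assoc, hrec]
        have e1 : (fun e : ℕ => vl (Lop a) e (s₀ + i)) = symMul i (M i) g :=
          funext (hM i (by omega))
        rw [e1]
        refine congrArg (fun t => Dl (symMul i (M i) g) m - t) ?_
        have e2 : ∀ q ∈ Finset.range (i + 1),
            symMul (i + 1) (fun n => vl a q (s₀ + i) * shiftSeq (q + 1) (M (i - q)) n) g m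
            = shiftSeq (q + 1) (fun m => vl (Lop a) m (s₀ + i - q) * vl a q (s₀ + i)) m := by
          intro q hq
          have hq := Finset.mem_range.1 hq
          rw [symMul_const_left, symMul_shiftSeq_left, show (i : ℂ) + 1 - (q + 1 : ℕ) = (i - q : ℕ) by
            rw [Nat.cast_sub (by omega)]; push_cast; ring]
          simp only [shiftSeq]
          split_ifs
          · rw [← hM _ (by omega), mul_comm, Nat.cast_sub (show q ≤ i by omega), add_sub_assoc]
          · rw [mul_zero]
        rw [Finset.sum_congr rfl e2]
        cases m with
        | zero =>
          exact (if_neg (by omega)).trans (Finset.sum_eq_zero fun q _ => if_neg (by omega)).symm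
        | succ m =>
          rw [shiftSeq_add, vl_mul_range (Lop_mem a) ha ha0 (sa i)]
          have e3 : ∀ q ∈ Finset.range (i + 1),
            shiftSeq (q + 1) (fun m => vl (Lop a) m (s₀ + i - q) * vl a q (s₀ + i)) (m + 1)
            = vl (Lop a) (m - q) (s₀ + i - q) * vl a q (s₀ + i) := by
            intro q hq
            rw [shiftSeq]
            split_ifs with h
            · rw [Nat.cast_sub h]; push_cast; rw [add_sub_add_right_eq_sub]
            · rw [(lowBd_Lop a).vl (by omega), zero_mul]
          rw [Finset.sum_congr rfl e3]

/-! ### Factorization -/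

/-- The part of an operator in places `≤ 0`. -/
def lowPart (N : ℕ) (x : Hs) : Hs := mkOp N fun d => if d ≤ 0 then cf x d else 0

theorem lowPart_mem (N : ℕ) (x : Hs) : lowPart N x ∈ opRing := mkOp_mem _ _
theorem lowBd_lowPart (N : ℕ) (x : Hs) : LowBd N (lowPart N x) := lowBd_mkOp _ _

theorem cf_lowPart {N : ℕ} {x : Hs} (hN : LowBd N x) (d : ℤ) :
    cf (lowPart N x) d = if d ≤ 0 then cf x d else 0 := by
  rw [lowPart, cf_mkOp]
  split_ifs with h1 h2 h2
  · rfl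
  · rfl
  · rw [hN d (by omega)]
  · rfl

theorem vl_lowPart {N : ℕ} {x : Hs} (hN : LowBd N x) (d : ℤ) (s : ℂ) :
    vl (lowPart N x) d s = if d ≤ 0 then vl x d s else 0 := by
  rw [vl, cf_lowPart hN]
  split_ifs
  · rfl
  · rw [map_zero]

theorem lowPart_mem_glRing {N : ℕ} {x : Hs} (hN : LowBd N x) (lam : ℂ) :
    lowPart N x ∈ glRing lam := by
  refine ⟨lowPart_mem N x, fun d => ?_⟩
  rw [cf_lowPart hN]
  split_ifs with h
  · rw [wPoly_of_nonpos lam h]; exact one_dvd _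
  · exact dvd_zero _

/-- The differential part of `∑ Y_n D^{N-n}`. -/
def truncSeq (N : ℕ) (Y : ℕ → K) (n : ℕ) : K := if n ≤ N then Y n else 0

theorem symMul_truncSeq_left {al : ℂ} {N : ℕ} {f g : ℕ → K} {n : ℕ} (h : n ≤ N) :
    symMul al (truncSeq N f) g n = symMul al f g n := by
  refine Finset.sum_congr rfl fun p hp => ?_
  have := Finset.HasAntidiagonal.mem_antidiagonal.1 hp
  rw [truncSeq, if_pos (by omega)]

/-- If `Y ∘ L = ∑ x_e D^{-e}`-combinations of the columns of `L_a`, then the differential part of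
`Y` corresponds to the part `e ≤ 0`, and the next coefficient of `Y` is `x_1`. -/
theorem factor {a x : Hs} {s₀ : ℂ} (ha : a ∈ opRing) (ha0 : LowBd 0 a) (sa : Stab s₀ a)
    (hx : x ∈ opRing) {N : ℕ} (hN : LowBd N x) {Y : ℕ → K}
    (h : ∀ m : ℕ, symMul N Y (fun e => vl (Lop a) e s₀) m = vl (Lop a * x) (m - N) s₀) :
    (∀ m : ℕ, symMul N (truncSeq N Y) (fun e => vl (Lop a) e s₀) m
      = vl (Lop a * lowPart N x) (m - N) s₀) ∧ Y (N + 1) = vl x 1 s₀ := by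
  choose M hM0 hM using exists_left_factor ha ha0 sa
  set g : ℕ → K := fun e => vl (Lop a) e s₀ with hg
  have hg0 : g 0 = 1 := (unitri_Lop a).vl_zero s₀
  -- the sum of the left factors
  let Z : ℕ → K := fun n => ∑ j ∈ Finset.range (N + 1), vl x (-j) s₀ * shiftSeq (N - j) (M j) n
  have hZ0 : ∀ n, N < n → Z n = 0 := fun n hn => Finset.sum_eq_zero fun j hj => by
    have hj := Finset.mem_range.1 hj
    rw [shiftSeq, if_pos (by omega), hM0 j _ (by omega), mul_zero]
  have hZ : ∀ m : ℕ, symMul N Z g m = vl (Lop a * lowPart N x) (m - N) s₀ := by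
    intro m
    rw [symMul_sum_left, vl_mul (Lop_mem a) (lowPart_mem N x) (lowBd_Lop a) (lowBd_lowPart N x)]
    have e1 : ∑ e ∈ Finset.Icc (-(N : ℤ)) (m - N + 0), vl (Lop a) (m - N - e) (s₀ - e)
          * vl (lowPart N x) e s₀
        = ∑ e ∈ Finset.Icc (-(N : ℤ)) 0, vl (Lop a) (m - N - e) (s₀ - e) * vl x e s₀ := by
      have e2 : ∀ e ∈ Finset.Icc (-(N : ℤ)) 0, vl (Lop a) (m - N - e) (s₀ - e) * vl x e s₀
          = vl (Lop a) (m - N - e) (s₀ - e) * vl (lowPart N x) e s₀ := fun e he => by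
        simp only [Finset.mem_Icc] at he
        rw [vl_lowPart hN, if_pos he.2]
      rw [Finset.sum_congr rfl e2]
      refine (Finset.sum_subset (s₂ := Finset.Icc (-(N : ℤ)) (max (m - N + 0) 0)) ?_ ?_).trans
        (Finset.sum_subset ?_ ?_).symm
      · exact Finset.Icc_subset_Icc_right (le_max_left _ _)
      · intro q hq hq'
        simp only [Finset.mem_Icc] at *
        rw [(lowBd_Lop a).vl (by omega), zero_mul]
      · exact Finset.Icc_subset_Icc_right (le_max_right _ _)
      · intro q hq hq'
        simp only [Finset.mem_Icc] at *
        rw [vl_lowPart hN, if_neg (by omega), mul_zero]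
    rw [e1]
    refine Finset.sum_nbij' (fun j : ℕ => -(j : ℤ)) (fun e => (-e).toNat) ?_ ?_ ?_ ?_ ?_
    · intro q hq; simp only [Finset.mem_Icc, Finset.mem_range] at *; omega
    · intro q hq; simp only [Finset.mem_Icc, Finset.mem_range] at *; omega
    · intro q _; simp
    · intro q hq; simp only [Finset.mem_Icc] at *; omega
    · intro j hj
      have hj := Finset.mem_range.1 hj
      rw [symMul_const_left, symMul_shiftSeq_left, show (N : ℂ) - (N - j : ℕ) = j by
        rw [Nat.cast_sub (by omega)]; ring]
      simp only [shiftSeq]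
      rw [mul_comm]
      split_ifs with h
      · rw [← hM]
        push_cast [Nat.cast_sub h, Nat.cast_sub (show j ≤ N by omega)]
        rw [sub_neg_eq_add, sub_neg_eq_add, sub_add]
      · rw [(lowBd_Lop a).vl (by omega), zero_mul]
  have hdiff : ∀ m : ℕ, symMul N (fun n => Y n - Z n) g m
      = vl (Lop a * (x - lowPart N x)) (m - N) s₀ := fun m => by
    rw [symMul_sub_left, mul_sub, vl_sub, ← h, ← hZ]
  have hup : LowBd (-1) (x - lowPart N x) := fun d hd => by
    rw [cf_sub, cf_lowPart hN, if_pos (by omega), sub_self]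
  have hxm : x - lowPart N x ∈ opRing := sub_mem hx (lowPart_mem N x)
  -- The difference Y - Z composed with a monic symbol involves only strictly upper triangular terms
  -- of x, so it has negative order; as Z is differential, it is the differential part of Y.
  have hvan : ∀ n < N + 1, Y n - Z n = 0 := eq_zero_of_symMul_eq_zero hg0 (N + 1) fun i hi => by
    rw [hdiff, (LowBd.mul (Lop_mem a) hxm (lowBd_Lop a) hup).vl (by omega)]
  have htr : truncSeq N Y = Z := by
    funext n
    rw [truncSeq]
    split_ifs with h
    · exact sub_eq_zero.1 (hvan n (by omega))
    · exact (hZ0 n (by omega)).symm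
  refine ⟨fun m => by rw [htr, hZ], ?_⟩
  have e := hdiff (N + 1)
  rw [symMul_eq_of_vanish hg0 (N + 1) hvan, hZ0 _ (by omega), sub_zero] at e
  rw [e, vl_mul (Lop_mem a) hxm (lowBd_Lop a) hup]
  push_cast
  rw [show (N : ℤ) + 1 - N + 0 = 1 by ring, Finset.Icc_self, Finset.sum_singleton,
    show (N : ℤ) + 1 - N - 1 = 0 by ring, (unitri_Lop a).vl_zero, one_mul, vl_sub, vl_lowPart hN,
    if_neg (by omega), sub_zero]

/-! ### Variations of `L_a` -/

/-- The variation of `L_a` in the direction `b`. -/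
def Lvar (a b : Hs) : Hs := solOp (Polynomial.C 0) a (Lop a * b)

theorem Lvar_mem (a b : Hs) : Lvar a b ∈ opRing := solOp_mem _ _ _
theorem lowBd_Lvar (a b : Hs) : LowBd 0 (Lvar a b) := lowBd_solOp _ _ _

/-- This is the derivative at t = 0 of the equation ∇₀ L = L ∇_{a+tb}. -/
theorem gdef_Lvar {a b : Hs} (ha : a ∈ opRing) (ha0 : LowBd 0 a) (hb : b ∈ opRing)
    (hb0 : LowBd 0 b) : gdef 0 (Lvar a b) a = Lop a * b :=
  gdef_solOp 0 ha ha0 (mul_mem (Lop_mem a) hb) (LowBd.upper_mul (Lop_mem a) hb (lowBd_Lop a) hb0)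

theorem vl_Lvar_at_zero (a b : Hs) (d : ℤ) : vl (Lvar a b) d 0 = 0 := by
  rcases lt_trichotomy d 0 with h | h | h
  · rw [(lowBd_Lvar a b).vl (by omega)]
  · subst h
    have : cf (Lvar a b) ((0 : ℕ) : ℤ) = Polynomial.C 0 := by rw [Lvar, cf_solOp, solSeq_zero]
    rw [vl]
    refine (congrArg (ev 0) this).trans (by simp)
  · rw [Lvar, vl_solOp_zero _ _ _ h]

theorem Lvar_eq {a b y : Hs} (ha : a ∈ opRing) (ha0 : LowBd 0 a) (hb : b ∈ opRing)
    (hb0 : LowBd 0 b) (hy : y ∈ opRing) (h : gdef 0 y a = Lop a * b) (h0 : ∀ d, vl y d 0 = 0) :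
    Lvar a b = y :=
  eq_of_gdef_eq (Lvar_mem a b) hy ha ha0 ((gdef_Lvar ha ha0 hb hb0).trans h.symm)
    fun d => by rw [vl_Lvar_at_zero, h0]

theorem gdef_neg_mid (b x a : Hs) : gdef b (-x) a = -gdef b x a := by
  have := gdef_sub_mid b 0 x a
  have h0 : gdef b 0 a = 0 := by rw [gdef, mul_zero, zero_mul, sub_zero]
  rwa [h0, zero_sub, zero_sub] at this

theorem Th_delta (b : ℂ) : Th b (fun n => if n = 0 then 1 else 0) = fun n => if n = 0 then 1 else 0 := by
  funext n
  rw [Th, Finset.sum_eq_single (0, n)]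
  · simp
  · rintro ⟨l, p⟩ hp hne
    have := Finset.HasAntidiagonal.mem_antidiagonal.1 hp
    simp only at this
    obtain ⟨k, rfl⟩ : ∃ k, l = k + 1 := ⟨l - 1, by
      rcases Nat.eq_zero_or_pos l with rfl | h
      · exact absurd (by rw [← this, zero_add]) hne
      · omega⟩
    simp only [Function.iterate_succ_apply]
    split_ifs <;> simp [dz_one]
  · intro h
    exact absurd (Finset.HasAntidiagonal.mem_antidiagonal.2 (by simp)) h

theorem symMul_one_right (al : ℂ) (f : ℕ → K) :
    symMul al f (fun n => if n = 0 then 1 else 0) = f := by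
  funext n
  rw [symMul, Finset.sum_eq_single (n, 0)]
  · simp [Th_delta]
  · rintro ⟨i, j⟩ hp hne
    have := Finset.HasAntidiagonal.mem_antidiagonal.1 hp
    simp only at this
    rw [Th_delta]
    simp only
    rw [if_neg, mul_zero]
    rintro rfl
    exact hne (by rw [← this, add_zero])
  · intro h
    exact absurd (Finset.HasAntidiagonal.mem_antidiagonal.2 (by simp)) h

theorem symMul_neg_left (al : ℂ) (f g : ℕ → K) (n : ℕ) :
    symMul al (fun n => -f n) g n = -symMul al f g n := by
  simp only [symMul, neg_mul, Finset.sum_neg_distrib]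

theorem truncSeq_neg (N : ℕ) (f : ℕ → K) :
    truncSeq N (fun n => -f n) = fun n => -truncSeq N f n := by
  funext n
  simp only [truncSeq]
  split_ifs
  · rfl
  · rw [neg_zero]

/-- The first column of `L_a` at `lam`, as a symbol of order `lam`. -/
def colSeq (lam : ℂ) (x : Hs) (m : ℕ) : K := vl x m lam

/-- The covector `X = ∑ X_n D^{N-λ-n}` is represented at `a` by an operator `x` such that
`∇_a x - x ∇_a` is upper triangular, and this variation of `a` moves the symbol by `-V_X`. -/
theorem exists_representing {lam : ℂ} {a : Hs} (ha : a ∈ glRing lam) (ha0 : LowBd 0 a) (N : ℕ)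
    (X : ℕ → K) : ∃ x ∈ glRing lam, LowBd 0 (gdef a x a) ∧
      (∀ m : ℕ, colSeq lam (Lvar a (gdef a x a)) m =
        symMul lam (colSeq lam (Lop a))
            (truncSeq N (symMul (N - lam) X (colSeq lam (Lop a)))) (m + N)
          - symMul N (truncSeq N (symMul lam (colSeq lam (Lop a)) X)) (colSeq lam (Lop a)) (m + N)) ∧
      ∀ b ∈ opRing, LowBd 0 b →
        res (symMul lam (colSeq lam (Lvar a b)) X (N + 1)) = res (csum lam (cf (x * b) 0)) := by
  have ham := ha.1
  have sa := stab_of_glRing ha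
  have sa0 := stab_zero_of_glRing ha
  set L := Lop a with hL
  set q := colSeq lam L with hq
  set P := symMul (N - lam) X q with hP
  have hLm : L ∈ opRing := Lop_mem a
  obtain ⟨Li, hLi, hLLi, -⟩ := (unitri_Lop a).exists_inv
  -- The conjugate by L_a of right multiplication by P = X∘L commutes with ∇_a. The sign makes
  -- pairing with x equal to F_X.
  set x0 := -(Li * (hat N P * L)) with hx0
  have hPLm : hat N P * L ∈ opRing := mul_mem (hat_mem N P) hLm
  have hx0m : x0 ∈ opRing := neg_mem (mul_mem hLi.mem hPLm)
  have hN : LowBd N x0 := by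
    have := LowBd.mul hLi.mem hPLm hLi.low (LowBd.mul (hat_mem N P) hLm (lowBd_hat N P) (lowBd_Lop a))
    rw [add_zero, zero_add] at this
    exact this.neg
  have hLx0 : L * x0 = -(hat N P * L) := by rw [hx0, mul_neg, ← mul_assoc, hLLi, one_mul]
  have hgL : gdef 0 L a = 0 := gdef_Lop ham ha0
  have hgx0 : gdef a x0 a = 0 := by
    refine (unitri_Lop a).cancel_left ?_
    have h1 := gdef_mul 0 L a x0 a
    rw [hLx0, hgL, zero_mul, zero_add, gdef_neg_mid, gdef_mul 0 (hat N P) 0 L a, gdef_hat, hgL,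
      zero_mul, mul_zero, add_zero, neg_zero] at h1
    rw [mul_zero, ← h1]
  -- Cutting off the strictly upper part does not affect pairings with upper triangular variations,
  -- and makes [∇_a, x] = -[∇_a, x0 - x] upper triangular.
  set x := lowPart N x0 with hx
  have hxm : x ∈ opRing := lowPart_mem N x0
  have hup : LowBd (-1) (x0 - x) := fun d hd => by
    rw [cf_sub, cf_lowPart hN, if_pos (by omega), sub_self]
  have hdm : x0 - x ∈ opRing := sub_mem hx0m hxm
  have hB0 : LowBd 0 (gdef a x a) := by
    have e : gdef a x a = -gdef a (x0 - x) a := by rw [gdef_sub_mid, hgx0, zero_sub, neg_neg]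
    intro d hd
    refine ev_ext fun s => ?_
    rw [e, map_zero]
    change vl _ d s = 0
    rw [vl_neg, vl_gdef a a hdm, hup.vl (by omega), hup.vl (by omega), hup.vl (by omega),
      (LowBd.mul ham hdm ha0 hup).vl (by omega), (LowBd.mul hdm ham hup ha0).vl (by omega), map_zero]
    simp
  have hBm : gdef a x a ∈ opRing := gdef_mem ham hxm ham
  -- the columns of `L x` at `0` and at `lam`
  have hδ : (fun e : ℕ => vl L e 0) = fun e => if e = 0 then 1 else 0 :=
    funext fun e => by rw [hL, vl_Lop_at_zero]; simp
  have hcol0 : ∀ m : ℕ, vl (L * x) (m - N) 0 = -truncSeq N P m := by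
    have key := (factor (s₀ := 0) ham ha0 sa0 hx0m hN (Y := fun n => -P n) fun m => ?_).1
    · intro m
      rw [← key m, hδ, symMul_one_right, truncSeq_neg]
    · rw [← hL, hδ, symMul_one_right, hLx0, vl_neg, vl_hat_mul N P hLm (lowBd_Lop a), hδ,
        symMul_one_left]
  have hassoc : symMul N (symMul lam q X) q = symMul lam q P := by
    rw [hP, ← symMul_assoc, add_sub_cancel]
  have hcol : ∀ m : ℕ, vl (L * x) (m - N) lam
      = -symMul N (truncSeq N (symMul lam q X)) q m := by
    have key := (factor (s₀ := lam) ham ha0 sa hx0m hN (Y := fun n => -symMul lam q X n)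
      fun m => ?_).1
    · intro m
      rw [← key m, truncSeq_neg, symMul_neg_left]
      rfl
    · rw [symMul_neg_left, ← hL, hLx0, vl_neg, vl_hat_mul N P hLm (lowBd_Lop a)]
      exact congrArg (fun f => -f m) hassoc
  refine ⟨x, lowPart_mem_glRing hN lam, hB0, fun m => ?_, fun b hb hb0 => ?_⟩
  -- L x solves the variational equation, but its column at 0 is -P_+; adding right multiplication
  -- by P_+, which commutes with ∇₀, restores the normalization. At λ the two terms are -(LX)_+L and
  -- L(XL)_+.
  · have hv : Lvar a (gdef a x a) = L * x + hat N (truncSeq N P) * L := by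
      refine Lvar_eq ham ha0 hBm hB0
        (add_mem (mul_mem hLm hxm) (mul_mem (hat_mem _ _) hLm)) ?_ fun d => ?_
      · have h2 := gdef_mul 0 (hat N (truncSeq N P)) 0 L a
        rw [gdef_hat, hgL, zero_mul, mul_zero, add_zero] at h2
        have h1 := gdef_mul 0 L a x a
        rw [hgL, zero_mul, zero_add] at h1
        rw [← sub_neg_eq_add (L * x), gdef_sub_mid, gdef_neg_mid, h1, h2, neg_zero, sub_zero]
      · rw [vl_add]
        rcases lt_or_ge d (-N) with hd | hd
        · have l1 := LowBd.mul hLm hxm (lowBd_Lop a) (lowBd_lowPart N x0)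
          have l2 := LowBd.mul (hat_mem N (truncSeq N P)) hLm (lowBd_hat N _) (lowBd_Lop a)
          rw [l1.vl (by omega), l2.vl (by omega), add_zero]
        · obtain ⟨m, hm⟩ := Int.eq_ofNat_of_zero_le (show 0 ≤ d + N by omega)
          obtain rfl : d = m - N := by omega
          rw [hcol0, vl_hat_mul _ _ hLm (lowBd_Lop a), hδ, symMul_one_left, neg_add_cancel]
    rw [colSeq, hv, vl_add, show (m : ℤ) = (m + N : ℕ) - N by push_cast; ring, hcol,
      vl_hat_mul _ _ hLm (lowBd_Lop a)]
    exact neg_add_eq_sub _ _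
  · set l := Lvar a b with hl
    have hlm : l ∈ opRing := Lvar_mem a b
    have hl0 : LowBd 0 l := lowBd_Lvar a b
    -- L⁻¹l is the infinitesimal gauge transformation producing b, so [∇_a, y] = x0 b. Then L y =
    -- -(right multiplication by P applied to l), whose column at 0 vanishes and whose column at λ
    -- is -(δL∘X)∘L; `factor` reads off y_1(λ) as the D⁻¹-coefficient.
    set y := x0 * (Li * l) with hy
    have hηm : Li * l ∈ opRing := mul_mem hLi.mem hlm
    have hη0 : LowBd 0 (Li * l) := LowBd.upper_mul hLi.mem hlm hLi.low hl0
    have hym : y ∈ opRing := mul_mem hx0m hηm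
    have hyN : LowBd N y := by simpa using LowBd.mul hx0m hηm hN hη0
    have hLη : L * (Li * l) = l := by rw [← mul_assoc, hLLi, one_mul]
    have hgη : gdef a (Li * l) a = b := by
      refine (unitri_Lop a).cancel_left ?_
      have h1 := gdef_mul 0 L a (Li * l) a
      rw [hLη, hgL, zero_mul, zero_add, gdef_Lvar ham ha0 hb hb0] at h1
      exact h1.symm
    have hgy : gdef a y a = x0 * b := by
      rw [hy, gdef_mul a x0 a, hgx0, zero_mul, zero_add, hgη]
    have hLy : L * y = -(hat N P * l) := by
      rw [hy, ← mul_assoc, hLx0, neg_mul, mul_assoc, hLη]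
    have hLycol : ∀ (m : ℕ) s, vl (L * y) (m - N) s = -symMul s (fun e => vl l e s) P m :=
      fun m s => by rw [hLy, vl_neg, vl_hat_mul N P hlm hl0]
    have hy0 : vl y 1 0 = 0 := by
      refine (unitri_Lop a).vl_eq_zero_of_mul hym 2 (fun d _ => ?_) 1 (by omega)
      rcases lt_or_ge d (-N) with hd | hd
      · have := LowBd.mul hLm hym (lowBd_Lop a) hyN
        rw [this.vl (by omega)]
      · obtain ⟨m, hm⟩ := Int.eq_ofNat_of_zero_le (show 0 ≤ d + N by omega)
        obtain rfl : d = m - N := by omega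
        rw [hLycol, neg_eq_zero, symMul]
        exact Finset.sum_eq_zero fun p _ => by rw [vl_Lvar_at_zero, zero_mul]
    have hy1 : -symMul lam (colSeq lam l) X (N + 1) = vl y 1 lam := by
      refine (factor (s₀ := lam) ham ha0 sa hym hyN (Y := fun n => -symMul lam (colSeq lam l) X n)
        fun m => ?_).2
      rw [symMul_neg_left, ← hL, hLycol]
      refine congrArg Neg.neg ?_
      change symMul N (symMul lam (colSeq lam l) X) q m = symMul lam (colSeq lam l) P m
      rw [hP, ← symMul_assoc, add_sub_cancel]
    -- A strictly upper triangular operator times an upper triangular one has no diagonal.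
    have hx0b : cf (x0 * b) 0 = cf (x * b) 0 := by
      have : LowBd (-1 + 0) ((x0 - x) * b) := LowBd.mul hdm hb hup hb0
      have h2 := this 0 (by omega)
      rw [sub_mul, cf_sub] at h2
      exact sub_eq_zero.1 h2
    rw [← hx0b, ← hgy, csum_gdef ha ha0 hym, res_sub, res_dz, hy0, ← hy1, sub_zero, res_neg, zero_sub,
      neg_neg]

/-! ### Families depending polynomially on a parameter -/

/-- Families of polynomials depending polynomially on `t`. -/
def polyFam : AddSubgroup (ℂ → K[X]) :=
  AddSubgroup.closure {f | ∃ (j : ℕ) (c : K[X]), f = fun t => Polynomial.C (algebraMap ℂ K t ^ j) * c}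

theorem polyFam_zero : (fun _ : ℂ => (0 : K[X])) ∈ polyFam := zero_mem polyFam

theorem polyFam_add {f g : ℂ → K[X]} (hf : f ∈ polyFam) (hg : g ∈ polyFam) :
    (fun t => f t + g t) ∈ polyFam := add_mem hf hg

theorem polyFam_neg {f : ℂ → K[X]} (hf : f ∈ polyFam) : (fun t => -f t) ∈ polyFam := neg_mem hf

theorem polyFam_sub {f g : ℂ → K[X]} (hf : f ∈ polyFam) (hg : g ∈ polyFam) :
    (fun t => f t - g t) ∈ polyFam := sub_mem hf hg

theorem polyFam_map (T : K[X] →+ K[X])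
    (hT : ∀ (x : ℂ) (c : K[X]), T (Polynomial.C (algebraMap ℂ K x) * c)
      = Polynomial.C (algebraMap ℂ K x) * T c) {f : ℂ → K[X]} (hf : f ∈ polyFam) :
    (fun t => T (f t)) ∈ polyFam := by
  induction hf using AddSubgroup.closure_induction with
  | mem f hf =>
    obtain ⟨j, c, rfl⟩ := hf
    refine AddSubgroup.subset_closure ⟨j, T c, funext fun t => ?_⟩
    simp only
    rw [← map_pow, hT]
  | zero => simpa using polyFam_zero
  | add f g _ _ hf hg => simpa using polyFam_add hf hg
  | neg f _ hf => simpa using polyFam_neg hf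

theorem polyFam_const (c : K[X]) : (fun _ => c) ∈ polyFam :=
  AddSubgroup.subset_closure ⟨0, c, funext fun t => by simp⟩

theorem polyFam_mul_param {f : ℂ → K[X]} (hf : f ∈ polyFam) :
    (fun t => Polynomial.C (algebraMap ℂ K t) * f t) ∈ polyFam := by
  induction hf using AddSubgroup.closure_induction with
  | mem f hf =>
    obtain ⟨j, c, rfl⟩ := hf
    refine AddSubgroup.subset_closure ⟨j + 1, c, funext fun t => ?_⟩
    rw [← mul_assoc, ← map_mul, pow_succ']
  | zero => simpa using polyFam_zero
  | add f g _ _ hf hg => simpa [mul_add] using polyFam_add hf hg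
  | neg f _ hf => simpa using polyFam_neg hf

theorem polyFam_mul_const (p : K[X]) {f : ℂ → K[X]} (hf : f ∈ polyFam) :
    (fun t => f t * p) ∈ polyFam :=
  polyFam_map (AddMonoidHom.mulRight p) (fun x c => by simp [mul_assoc]) hf

theorem polyFam_sum {β : Type*} (s : Finset β) {f : β → ℂ → K[X]} (h : ∀ b ∈ s, f b ∈ polyFam) :
    (fun t => ∑ b ∈ s, f b t) ∈ polyFam := by
  have := sum_mem h
  rwa [show ∑ b ∈ s, f b = fun t => ∑ b ∈ s, f b t from funext fun t => Finset.sum_apply t s f] at this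

/-- Families of elements of `K` depending polynomially on `t`. -/
def PolyK (f : ℂ → K) : Prop := ∃ p : K[X], ∀ t, f t = ev t p

theorem polyK_of_polyFam (s : ℂ) {f : ℂ → K[X]} (hf : f ∈ polyFam) : PolyK fun t => ev s (f t) := by
  induction hf using AddSubgroup.closure_induction with
  | mem f hf =>
    obtain ⟨j, c, rfl⟩ := hf
    refine ⟨Polynomial.X ^ j * Polynomial.C (ev s c), fun t => ?_⟩
    simp only [map_mul, map_pow, ev_C, ev_X]
  | zero => exact ⟨0, fun t => by simp⟩
  | add f g _ _ hf hg =>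
    obtain ⟨p, hp⟩ := hf
    obtain ⟨q, hq⟩ := hg
    exact ⟨p + q, fun t => by simp only [Pi.add_apply, map_add, hp, hq]⟩
  | neg f _ hf =>
    obtain ⟨p, hp⟩ := hf
    exact ⟨-p, fun t => by simp only [Pi.neg_apply, map_neg, hp]⟩

theorem PolyK.sum {β : Type*} (s : Finset β) {f : β → ℂ → K} (h : ∀ b ∈ s, PolyK (f b)) :
    PolyK fun t => ∑ b ∈ s, f b t := by
  choose! p hp using h
  exact ⟨∑ b ∈ s, p b, fun t => by rw [map_sum]; exact Finset.sum_congr rfl fun b hb => hp b hb t⟩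

theorem PolyK.const_mul {f : ℂ → K} (h : PolyK f) (a : K) : PolyK fun t => a * f t := by
  obtain ⟨p, hp⟩ := h
  exact ⟨Polynomial.C a * p, fun t => by simp only [map_mul, ev_C, hp]⟩

theorem PolyK.sub {f g : ℂ → K} (hf : PolyK f) (hg : PolyK g) : PolyK fun t => f t - g t := by
  obtain ⟨p, hp⟩ := hf
  obtain ⟨q, hq⟩ := hg
  exact ⟨p - q, fun t => by simp only [map_sub, hp, hq]⟩

theorem PolyK.iter_dz {f : ℂ → K} (h : PolyK f) (n : ℕ) : PolyK fun t => dz^[n] (f t) := by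
  induction n with
  | zero => exact h
  | succ n ih =>
    obtain ⟨p, hp⟩ := ih
    refine ⟨pd p, fun t => ?_⟩
    simp only [Function.iterate_succ_apply'] at hp ⊢
    rw [hp, ev_pd]

/-- Comparison of the coefficients of t, legitimate because the remainder is polynomial in t; it
replaces differentiation of families with values in `K`. -/
theorem eq_zero_of_jet {x : K} {g : ℂ → K} (hg : PolyK g)
    (h : ∀ t : ℂ, algebraMap ℂ K t * x + algebraMap ℂ K t ^ 2 * g t = 0) : x = 0 := by
  obtain ⟨p, hp⟩ := hg
  have : Polynomial.X * Polynomial.C x + Polynomial.X ^ 2 * p = 0 := ev_ext fun t => by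
    simp only [map_add, map_mul, map_pow, ev_X, ev_C, map_zero, ← hp, h]
  have h1 := congrArg (fun q => q.coeff 1) this
  simpa [Polynomial.coeff_X_pow_mul'] using h1

theorem hasDerivAt_jet {β : Type*} (s : Finset β) (x : β → K) (g : β → ℂ → K) (w : β → K)
    (hg : ∀ b, PolyK (g b)) :
    HasDerivAt (fun t : ℂ => ∑ b ∈ s, res ((algebraMap ℂ K t * x b + algebraMap ℂ K t ^ 2 * g b t) * w b))
      (∑ b ∈ s, res (x b * w b)) 0 := by
  refine HasDerivAt.fun_sum fun b _ => ?_
  obtain ⟨p, hp⟩ := hg b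
  let r : ℂ[X] := ∑ i ∈ Finset.range (p.natDegree + 1),
    Polynomial.C (res (p.coeff i * w b)) * Polynomial.X ^ i
  have hr : ∀ t, res (g b t * w b) = r.eval t := fun t => by
    rw [hp, ev_apply, Polynomial.eval_eq_sum_range, Finset.sum_mul, res_sum, Polynomial.eval_finsetSum]
    refine Finset.sum_congr rfl fun i _ => ?_
    rw [← map_pow, mul_right_comm, mul_comm, res_const_mul, Polynomial.eval_mul, Polynomial.eval_C,
      Polynomial.eval_pow, Polynomial.eval_X, mul_comm]
  have hf : (fun t : ℂ => res ((algebraMap ℂ K t * x b + algebraMap ℂ K t ^ 2 * g b t) * w b))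
      = fun t => t * res (x b * w b) + t ^ 2 * r.eval t := funext fun t => by
    rw [← hr, add_mul, res_add, mul_assoc, res_const_mul, mul_assoc, ← map_pow, res_const_mul]
  rw [hf]
  have h1 : HasDerivAt (fun t : ℂ => t * res (x b * w b)) (1 * res (x b * w b)) 0 :=
    (hasDerivAt_id (0 : ℂ)).mul_const _
  have h2 := (hasDerivAt_pow 2 (0 : ℂ)).fun_mul (r.hasDerivAt 0)
  have h3 := h1.fun_add h2
  simpa using h3

/-! ### Jets of `L_a` -/

theorem cf_mul_nat {x y : Hs} (hx : x ∈ opRing) (hy : y ∈ opRing) (hx0 : LowBd 0 x)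
    (hy0 : LowBd 0 y) (m : ℕ) :
    cf (x * y) m = ∑ p ∈ adiag m, tr (-p.2) (cf x p.1) * cf y p.2 := ev_ext fun s => by
  refine (vl_mul_nat hx hy hx0 hy0 m s).trans ?_
  rw [map_sum]
  refine Finset.sum_congr rfl fun p _ => ?_
  rw [map_mul, ev_tr]
  push_cast
  rw [← sub_eq_add_neg]
  rfl

theorem cf_solOp_succ (c : K[X]) (a r : Hs) (m : ℕ) : cf (solOp c a r) (m + 1 : ℕ) =
    antidiff (pd (cf (solOp c a r) m)
      - (∑ p ∈ adiag m, tr (-p.2) (cf (solOp c a r) p.1) * cf a p.2) - cf r m) := by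
  simp only [cf_solOp, solSeq_succ]

theorem antidiff_C_mul (x : K) (p : K[X]) :
    antidiff (Polynomial.C x * p) = Polynomial.C x * antidiff p := by
  rw [← Polynomial.smul_eq_C_mul, map_smul, Polynomial.smul_eq_C_mul]

theorem pd_const_mul (t : ℂ) (p : K[X]) : pd (Polynomial.C (algebraMap ℂ K t) * p)
    = Polynomial.C (algebraMap ℂ K t) * pd p := by
  rw [pd_mul, pd_C, dz_const, map_zero, zero_mul, zero_add]

theorem tr_C_mul (d : ℤ) (x : K) (p : K[X]) :
    tr d (Polynomial.C x * p) = Polynomial.C x * tr d p := by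
  rw [map_mul]
  congr 1
  exact (tr d).commutes x

/-- `L_{a+tb}` to second order in `t`. -/
theorem cf_Lop_jet {a b : Hs} (hb : b ∈ opRing) (hb0 : LowBd 0 b) (m : ℕ) :
    ∃ g ∈ polyFam, ∀ t : ℂ, cf (Lop (a + scl (algebraMap ℂ K t) * b)) m
      = cf (Lop a) m + Polynomial.C (algebraMap ℂ K t) * cf (Lvar a b) m
        + Polynomial.C (algebraMap ℂ K t) ^ 2 * g t := by
  induction m using Nat.strong_induction_on with
  | _ m ih =>
    cases m with
    | zero =>
      refine ⟨_, polyFam_zero, fun t => ?_⟩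
      rw [Lop, Lop, Lvar, cf_solOp, cf_solOp, cf_solOp, solSeq_zero, solSeq_zero, solSeq_zero]
      simp
    | succ m =>
      choose! g hg hgt using ih
      refine ⟨fun t => antidiff (pd (g m t) - ∑ p ∈ adiag m, (tr (-p.2) (g p.1 t) * cf a p.2
        + tr (-p.2) (cf (Lvar a b) p.1) * cf b p.2
        + Polynomial.C (algebraMap ℂ K t) * (tr (-p.2) (g p.1 t) * cf b p.2))), ?_, fun t => ?_⟩
      · refine polyFam_map antidiff.toAddMonoidHom (fun x c => antidiff_C_mul _ _)
          (polyFam_sub (polyFam_map pd.toAddMonoidHom (fun x c => pd_const_mul x c) (hg m (by omega)))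
          (polyFam_sum _ fun p hp => ?_))
        have hp := Finset.HasAntidiagonal.mem_antidiagonal.1 hp
        have h1 : (fun t => tr (-p.2) (g p.1 t)) ∈ polyFam :=
          polyFam_map (tr (-p.2)).toRingHom.toAddMonoidHom (fun x c => tr_C_mul _ _ _)
            (hg p.1 (by omega))
        exact polyFam_add (polyFam_add (polyFam_mul_const _ h1) (polyFam_const _))
          (polyFam_mul_param (polyFam_mul_const _ h1))
      · have e1 := cf_solOp_succ (Polynomial.C 1) (a + scl (algebraMap ℂ K t) * b) 0 m
        have e2 := cf_solOp_succ (Polynomial.C 1) a 0 m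
        have e3 := cf_solOp_succ (Polynomial.C 0) a (Lop a * b) m
        rw [cf_mul_nat (Lop_mem a) hb (lowBd_Lop a) hb0] at e3
        simp only [cf_zero, sub_zero] at e1 e2
        change cf (Lop (a + scl (algebraMap ℂ K t) * b)) (m + 1 : ℕ)
          = antidiff (pd (cf (Lop (a + scl (algebraMap ℂ K t) * b)) m)
            - ∑ p ∈ adiag m, tr (-p.2) (cf (Lop (a + scl (algebraMap ℂ K t) * b)) p.1)
              * cf (a + scl (algebraMap ℂ K t) * b) p.2) at e1
        change cf (Lop a) (m + 1 : ℕ) = _ at e2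
        change cf (Lvar a b) (m + 1 : ℕ) = antidiff (pd (cf (Lvar a b) m)
          - (∑ p ∈ adiag m, tr (-p.2) (cf (Lvar a b) p.1) * cf a p.2) - _) at e3
        rw [e1, e2, e3, ← antidiff_C_mul, ← map_pow, ← antidiff_C_mul, ← map_add, ← map_add]
        refine congrArg antidiff ?_
        rw [hgt m (by omega), map_add, map_add, pd_const_mul, ← map_pow, ← map_pow, pd_const_mul]
        have e4 : ∀ p ∈ adiag m, tr (-p.2) (cf (Lop (a + scl (algebraMap ℂ K t) * b)) p.1)
              * cf (a + scl (algebraMap ℂ K t) * b) p.2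
            = tr (-p.2) (cf (Lop a) p.1) * cf a p.2
              + Polynomial.C (algebraMap ℂ K t) * (tr (-p.2) (cf (Lvar a b) p.1) * cf a p.2
                + tr (-p.2) (cf (Lop a) p.1) * cf b p.2)
              + Polynomial.C (algebraMap ℂ K (t ^ 2)) * (tr (-p.2) (g p.1 t) * cf a p.2
                + tr (-p.2) (cf (Lvar a b) p.1) * cf b p.2
                + Polynomial.C (algebraMap ℂ K t) * (tr (-p.2) (g p.1 t) * cf b p.2)) := by
          intro p hp
          have hp := Finset.HasAntidiagonal.mem_antidiagonal.1 hp
          rw [hgt p.1 (by omega), cf_add, cf_scl_mul hb, map_add, map_add, ← map_pow, tr_C_mul, tr_C_mul,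
            map_pow, map_pow, map_pow]
          ring
        rw [Finset.sum_congr rfl e4, Finset.sum_add_distrib, Finset.sum_add_distrib,
          ← Finset.mul_sum, ← Finset.mul_sum, Finset.sum_add_distrib]
        simp only [Lop]
        ring

theorem colSeq_Lop_jet (lam : ℂ) {a b : Hs} (hb : b ∈ opRing) (hb0 : LowBd 0 b)
    (m : ℕ) : ∃ g, PolyK g ∧ ∀ t : ℂ, colSeq lam (Lop (a + scl (algebraMap ℂ K t) * b)) m
      = colSeq lam (Lop a) m
        + (algebraMap ℂ K t * colSeq lam (Lvar a b) m + algebraMap ℂ K t ^ 2 * g t) := by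
  obtain ⟨g, hg, h⟩ := cf_Lop_jet (a := a) hb hb0 m
  refine ⟨_, polyK_of_polyFam lam hg, fun t => ?_⟩
  rw [colSeq, vl, h]
  simp only [map_add, map_mul, map_pow, ev_C, ← add_assoc]
  rfl

/-! ### Variations and the anti-involution -/

theorem starSeq_add (lam : ℂ) (u v : ℕ → K) (m : ℕ) :
    starSeq lam (fun n => u n + v n) m = starSeq lam u m + starSeq lam v m := by
  simp only [starSeq, iter_dz_add, mul_add, Finset.sum_add_distrib]

theorem starSeq_const_mul (lam t : ℂ) (u : ℕ → K) (m : ℕ) :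
    starSeq lam (fun n => algebraMap ℂ K t * u n) m = algebraMap ℂ K t * starSeq lam u m := by
  simp only [starSeq, iter_dz_const_mul, Finset.mul_sum]
  exact Finset.sum_congr rfl fun p _ => by ring

theorem polyK_starSeq (lam : ℂ) {g : ℕ → ℂ → K} (hg : ∀ n, PolyK (g n)) (m : ℕ) :
    PolyK fun t => starSeq lam (fun n => g n t) m :=
  PolyK.sum _ fun p _ => (((hg p.2).iter_dz p.1).const_mul _).const_mul _

theorem sig_zero (lam : ℂ) : sig lam 0 = 0 := by simpa using sig_sub lam 0 0

theorem sig_scl_mul {lam : ℂ} {b : Hs} (hb : b ∈ opRing) (t : ℂ) :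
    sig lam (scl (algebraMap ℂ K t) * b) = scl (algebraMap ℂ K t) * sig lam b := by
  refine opRing_ext (sig_mem _ _) (mul_mem (scl_mem _) (sig_mem _ _)) fun d => ?_
  rw [cf_sig, cf_scl_mul hb, cf_scl_mul (sig_mem _ _), cf_sig, map_mul]
  rw [show refl (lam - 1 + d) (Polynomial.C (algebraMap ℂ K t)) = Polynomial.C (algebraMap ℂ K t) from
    (refl _).commutes _]
  ring

/-- The anti-involution acts on variations by taking adjoints, with a sign. -/
theorem Lvar_sig {lam : ℂ} {a b : Hs} (ha : a ∈ opRing) (ha0 : LowBd 0 a) (sa : Stab 0 a)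
    (hsa : sig lam a = -a) (hb : b ∈ opRing) (hb0 : LowBd 0 b) (sb : Stab 0 b)
    (sb' : Stab 0 (sig lam b)) (m : ℕ) :
    colSeq lam (Lvar a (sig lam b)) m = -starSeq lam (colSeq lam (Lvar a b)) m := by
  choose g hg hgt using fun m => colSeq_Lop_jet lam (a := a) hb hb0 m
  choose g' hg' hgt' using fun m => colSeq_Lop_jet lam (a := a) (sig_mem lam b) (hb0.sig lam) m
  -- The connection with -t and σ(b) is the adjoint of the one with t and b, because a is skew. The
  -- terms linear in t of this identity give the claim.
  have hstar : ∀ t : ℂ, colSeq lam (Lop (a + scl (algebraMap ℂ K (-t)) * sig lam b)) m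
      = starSeq lam (colSeq lam (Lop (a + scl (algebraMap ℂ K t) * b))) m := by
    intro t
    set c := a + scl (algebraMap ℂ K t) * b with hc
    have e : a + scl (algebraMap ℂ K (-t)) * sig lam b = -sig lam c := by
      rw [hc, sig_add, hsa, sig_scl_mul hb]
      refine opRing_ext (add_mem ha (mul_mem (scl_mem _) (sig_mem _ _)))
        (neg_mem (add_mem (neg_mem ha) (mul_mem (scl_mem _) (sig_mem _ _)))) fun d => ?_
      simp only [cf_add, cf_neg, cf_scl_mul (sig_mem lam b), map_neg]
      ring
    have stab_scl : ∀ {x : Hs} (y : K), x ∈ opRing → Stab 0 x → Stab 0 (scl y * x) :=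
      fun y hx h i d hd => by rw [vl_scl_mul hx, h i d hd, mul_zero]
    have hsc : Stab 0 c := fun i d hd => by
      rw [hc, vl_add, sa i d hd, stab_scl _ hb sb i d hd, add_zero]
    have hsc' : Stab 0 (sig lam c) := fun i d hd => by
      rw [hc, sig_add, hsa, sig_scl_mul hb, vl_add, vl_neg, sa i d hd,
        stab_scl _ (sig_mem _ _) sb' i d hd, neg_zero, add_zero]
    rw [e]
    refine vl_Lop_neg_sig (add_mem ha (mul_mem (scl_mem _) hb)) (ha0.add fun d hd => ?_) hsc hsc' m
    rw [cf_scl_mul hb, hb0 d hd, mul_zero]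
  have h0 : colSeq lam (Lop a) m = starSeq lam (colSeq lam (Lop a)) m := by
    have := hstar 0
    have z : scl (algebraMap ℂ K 0) = 0 := opRing_ext (scl_mem _) (zero_mem _) fun d => by
      rw [scl, cf_sgl, map_zero, map_zero, ite_self, cf_zero]
    rwa [neg_zero, z, zero_mul, zero_mul, add_zero] at this
  have key : starSeq lam (colSeq lam (Lvar a b)) m + colSeq lam (Lvar a (sig lam b)) m = 0 := by
    refine eq_zero_of_jet (g := fun t => starSeq lam (fun n => g n t) m - g' m (-t)) ?_ fun t => ?_
    · refine (polyK_starSeq lam hg m).sub ?_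
      obtain ⟨p, hp⟩ := hg' m
      exact ⟨refl 0 p, fun t => by simp only [ev_refl, hp, zero_sub]⟩
    · have e := hstar t
      rw [hgt', show colSeq lam (Lop (a + scl (algebraMap ℂ K t) * b)) = fun n =>
        colSeq lam (Lop a) n + (algebraMap ℂ K t * colSeq lam (Lvar a b) n
          + algebraMap ℂ K (t ^ 2) * g n t) from funext fun n => by rw [hgt, map_pow],
        starSeq_add, starSeq_add, starSeq_const_mul, starSeq_const_mul, ← h0, map_neg, map_pow] at e
      linear_combination -e
  exact eq_neg_of_add_eq_zero_right key

/-! ### Symbols with integer places and sequences -/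

/-- The symbol `∑ f_n D^{μ+N-n}`. -/
def toSymb (N : ℤ) (f : ℕ → K) : Symb := fun m => if m ≤ N then f (N - m).toNat else 0

theorem toSymb_sub (N : ℤ) (f : ℕ → K) (n : ℕ) : toSymb N f (N - n) = f n := by
  rw [toSymb, if_pos (by omega), sub_sub_cancel, Int.toNat_natCast]

theorem toSymb_of_lt {N m : ℤ} (h : N < m) (f : ℕ → K) : toSymb N f m = 0 := if_neg (by omega)

theorem eq_toSymb {u : Symb} {N : ℤ} (h : ∀ m, N < m → u m = 0) :
    u = toSymb N fun n => u (N - n) := by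
  funext m
  rw [toSymb]
  split_ifs with hm
  · rw [Int.toNat_of_nonneg (by omega), sub_sub_cancel]
  · exact h m (by omega)

theorem symb_ext {u v : Symb} {N : ℤ} (hu : ∀ m, N < m → u m = 0) (hv : ∀ m, N < m → v m = 0)
    (h : ∀ n : ℕ, u (N - n) = v (N - n)) : u = v := by
  rw [eq_toSymb hu, eq_toSymb hv]
  exact congrArg _ (funext h)

/-- The double sum over places and derivatives is regrouped by a = N - i, d = M - j and the number c
of derivatives, with a + c + d = n. -/
theorem comp_toSymb (mu : ℂ) (N M : ℤ) (f g : ℕ → K) :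
    comp mu (toSymb N f) (toSymb M g) = toSymb (N + M) (symMul (mu + N) f g) := by
  refine symb_ext (N := N + M) (fun m hm => ?_) (fun m hm => toSymb_of_lt hm _) fun n => ?_
  · rw [comp, finsum_eq_zero_of_forall_eq_zero]
    rintro ⟨i, j⟩
    rcases lt_or_ge N i with hi | hi
    · rw [toSymb_of_lt hi, zero_mul, mul_zero, ite_self]
    rcases lt_or_ge M j with hj | hj
    · rw [toSymb_of_lt hj, iter_dz_zero, mul_zero, mul_zero, ite_self]
    · rw [if_neg (by simp only; omega)]
  · rw [toSymb_sub, comp, symMul]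
    simp only [Th, Finset.mul_sum]
    rw [Finset.sum_sigma', finsum_eq_sum_of_support_subset _ (s := (Finset.sigma (adiag n)
      (fun p => adiag p.2)).image (fun x => (N - x.1.1, M - x.2.2))) ?_, Finset.sum_image]
    · refine Finset.sum_congr rfl ?_
      rintro ⟨⟨a, b⟩, ⟨c, d⟩⟩ hx
      obtain ⟨e1, e2⟩ := Finset.mem_sigma.1 hx
      have e1 := Finset.HasAntidiagonal.mem_antidiagonal.1 e1
      have e2 := Finset.HasAntidiagonal.mem_antidiagonal.1 e2
      simp only at *
      rw [if_pos (by omega), toSymb_sub, toSymb_sub,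
        show (N - (a : ℤ) + (M - (d : ℤ)) - (N + M - (n : ℤ))).toNat = c by omega]
      push_cast
      rw [add_sub_assoc]
      ring
    · rintro ⟨⟨a, b⟩, ⟨c, d⟩⟩ hx ⟨⟨a', b'⟩, ⟨c', d'⟩⟩ hx' h
      obtain ⟨e1, e2⟩ := Finset.mem_sigma.1 hx
      obtain ⟨e1', e2'⟩ := Finset.mem_sigma.1 hx'
      have e1 := Finset.HasAntidiagonal.mem_antidiagonal.1 e1
      have e2 := Finset.HasAntidiagonal.mem_antidiagonal.1 e2
      have e1' := Finset.HasAntidiagonal.mem_antidiagonal.1 e1'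
      have e2' := Finset.HasAntidiagonal.mem_antidiagonal.1 e2'
      simp only [Prod.mk.injEq] at *
      obtain ⟨h1, h2⟩ := h
      obtain rfl : a = a' := by omega
      obtain rfl : d = d' := by omega
      obtain rfl : b = b' := by omega
      obtain rfl : c = c' := by omega
      rfl
    · rintro ⟨i, j⟩ h
      rw [Function.mem_support] at h
      have hi : i ≤ N := by
        by_contra hi
        exact h (by simp only; rw [toSymb_of_lt (by omega), zero_mul, mul_zero, ite_self])
      have hj : j ≤ M := by
        by_contra hj
        exact h (by simp only; rw [toSymb_of_lt (show M < j by omega), iter_dz_zero, mul_zero, mul_zero, ite_self])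
      have hn : N + M - n ≤ i + j := by
        by_contra hn
        exact h (if_neg hn)
      rw [Finset.mem_coe, Finset.mem_image]
      refine ⟨⟨((N - i).toNat, n - (N - i).toNat), (n - (N - i).toNat - (M - j).toNat, (M - j).toNat)⟩,
        Finset.mem_sigma.2 ⟨Finset.HasAntidiagonal.mem_antidiagonal.2 ?_,
          Finset.HasAntidiagonal.mem_antidiagonal.2 ?_⟩, ?_⟩
      · simp only; omega
      · simp only; omega
      · simp only [Prod.mk.injEq]; omega

theorem mono_eq_toSymb (j : ℤ) (a : K) :
    mono j a = toSymb j fun n => a * if n = 0 then 1 else 0 := by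
  refine symb_ext (N := j) (fun m hm => by simp [mono, hm.ne'])
    (fun m hm => toSymb_of_lt hm _) fun n => ?_
  rw [toSymb_sub, mono]
  rcases Nat.eq_zero_or_pos n with rfl | h
  · simp
  · rw [if_neg h.ne', mul_zero]
    simp [h.ne']

theorem plus_toSymb (N : ℕ) (f : ℕ → K) : plus (toSymb N f) = toSymb N (truncSeq N f) := by
  refine symb_ext (N := N) (fun m hm => ?_) (fun m hm => toSymb_of_lt hm _) fun n => ?_
  · rw [plus, toSymb_of_lt hm, ite_self]
  · rw [plus, toSymb_sub, toSymb_sub, truncSeq]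
    exact if_congr (by omega) rfl rfl

theorem symTr_toSymb (N : ℕ) (f : ℕ → K) : symTr (toSymb N f) = res (f (N + 1)) := by
  rw [symTr, show (-1 : ℤ) = N - (N + 1 : ℕ) by push_cast; ring, toSymb_sub]

theorem FF_toSymb (lam : ℂ) (N : ℕ) (X d : ℕ → K) :
    FF lam (toSymb N X) (toSymb 0 d) = res (symMul lam d X (N + 1)) := by
  rw [FF, comp_toSymb, Int.cast_zero, add_zero, zero_add, symTr_toSymb]

theorem symMul_delta (al : ℂ) (g : ℕ → K) :
    symMul al (fun n => if n = 0 then 1 else 0) g = Th al g := by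
  funext n
  rw [symMul, Finset.sum_eq_single (0, n)]
  · simp
  · rintro ⟨l, p⟩ hp hne
    have := Finset.HasAntidiagonal.mem_antidiagonal.1 hp
    simp only at this
    rw [if_neg, zero_mul]
    rintro rfl
    exact hne (by rw [← this, zero_add])
  · intro h
    exact absurd (Finset.HasAntidiagonal.mem_antidiagonal.2 (by simp)) h

theorem Th_const_delta (b : ℂ) (a : K) (n : ℕ) :
    Th b (fun n => a * if n = 0 then 1 else 0) n = algebraMap ℂ K (Ring.choose b n) * dz^[n] a := by
  rw [Th, Finset.sum_eq_single (n, 0)]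
  · simp
  · rintro ⟨l, p⟩ hp hne
    have := Finset.HasAntidiagonal.mem_antidiagonal.1 hp
    simp only at this
    simp only
    rw [if_neg, mul_zero, iter_dz_zero, mul_zero]
    rintro rfl
    exact hne (by rw [← this, add_zero])
  · intro h
    exact absurd (Finset.HasAntidiagonal.mem_antidiagonal.2 (by simp)) h

theorem star_toSymb (lam : ℂ) (u : ℕ → K) : star lam (toSymb 0 u) = toSymb 0 (starSeq lam u) := by
  have hc : ∀ (j : ℤ) (a : K), comp lam (mono j 1) (mono 0 a)
      = toSymb j fun n => algebraMap ℂ K (Ring.choose (lam + j) n) * dz^[n] a := by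
    intro j a
    rw [mono_eq_toSymb, mono_eq_toSymb, comp_toSymb, add_zero]
    simp only [one_mul]
    rw [symMul_delta]
    exact congrArg _ (funext fun n => Th_const_delta _ _ _)
  have hz : ∀ j : ℤ, 0 < j → ∀ m, comp lam (mono j 1) (mono 0 (toSymb 0 u j)) m = 0 := by
    intro j hj m
    rw [hc, toSymb_of_lt hj]
    simp only [iter_dz_zero, mul_zero, toSymb, ite_self]
  refine symb_ext (N := 0) (fun m hm => ?_) (fun m hm => toSymb_of_lt hm _) fun n => ?_
  · rw [star, finsum_eq_zero_of_forall_eq_zero]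
    intro j
    rcases lt_or_ge 0 j with hj | hj
    · rw [hz j hj, mul_zero]
    · rw [hc, toSymb_of_lt (by omega), mul_zero]
  · rw [star, toSymb_sub, starSeq, finsum_eq_sum_of_support_subset _
      (s := (adiag n).image fun p => -(p.2 : ℤ)), Finset.sum_image]
    · refine Finset.sum_congr rfl fun p hp => ?_
      have hp := Finset.HasAntidiagonal.mem_antidiagonal.1 hp
      rw [hc, show (0 : ℤ) - n = -(p.2 : ℤ) - (p.1 : ℕ) by omega, toSymb_sub,
        show (-(p.2 : ℤ)) = 0 - (p.2 : ℕ) by omega, toSymb_sub]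
      rw [show ((-1 : ℂ) ^ ((0 : ℤ) - (p.2 : ℕ))) = (-1) ^ p.2 by
        rw [zero_sub, zpow_neg, zpow_natCast, ← inv_pow]; norm_num]
      rw [show ((-1 : K) ^ p.2) = algebraMap ℂ K ((-1) ^ p.2) by simp]
      push_cast
      rw [zero_sub, ← sub_eq_add_neg]
      ring
    · rintro ⟨a, b⟩ hp ⟨a', b'⟩ hp' h
      have hp := Finset.HasAntidiagonal.mem_antidiagonal.1 hp
      have hp' := Finset.HasAntidiagonal.mem_antidiagonal.1 hp'
      simp only [Prod.mk.injEq] at *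
      omega
    · intro j h
      rw [Function.mem_support] at h
      have hj : j ≤ 0 := by
        by_contra hj
        exact h (by rw [hz j (by omega), mul_zero])
      have hn : (0 : ℤ) - n ≤ j := by
        by_contra hn
        exact h (by rw [hc, toSymb_of_lt (by omega), mul_zero])
      rw [Finset.mem_coe, Finset.mem_image]
      exact ⟨(n - (-j).toNat, (-j).toNat), Finset.HasAntidiagonal.mem_antidiagonal.2 (by simp only; omega),
        by simp only; omega⟩

theorem exists_toSymb_of_mem_PsiCotangent {lam : ℂ} {X : Symb} (hX : X ∈ PsiCotangent lam) :
    ∃ (N : ℕ) (f : ℕ → K), X = toSymb N f := by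
  obtain ⟨Q, -, ⟨N, hN⟩, rfl⟩ := hX
  refine ⟨N.toNat, symMul (-lam + (0 : ℤ)) (fun n => 1 * if n = 0 then 1 else 0)
    (fun n => Q (N.toNat - n)), ?_⟩
  rw [eq_toSymb (u := Q) (N := N.toNat) fun m hm => hN m (by omega), mono_eq_toSymb, comp_toSymb,
    zero_add]
  simp only [toSymb_sub]

theorem toSymb_mem_PsiDS {u : ℕ → K} (h : u 0 = 1) : toSymb 0 u ∈ PsiDS :=
  ⟨by simpa [toSymb] using h, fun m hm => toSymb_of_lt hm _⟩

theorem eq_toSymb_of_mem_PsiDS {L : Symb} (hL : L ∈ PsiDS) : L = toSymb 0 fun n => L (-n) := by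
  rw [eq_toSymb hL.2]
  simp [toSymb]

theorem toSymb_mem_PsiTangent {u : ℕ → K} (h : u 0 = 0) : toSymb 0 u ∈ PsiTangent := fun m hm => by
  rcases hm.eq_or_lt with rfl | hm
  · simpa [toSymb] using h
  · exact toSymb_of_lt hm _

theorem toSymb_injective (N : ℤ) : Function.Injective (toSymb N) := fun f g h =>
  funext fun n => by rw [← toSymb_sub N f, h, toSymb_sub]

/-- The Hamiltonian vector field in terms of sequences. -/
theorem hamV_toSymb (lam : ℂ) (N : ℕ) (X q : ℕ → K) :
    hamV lam (toSymb N X) (toSymb 0 q) = toSymb 0 fun m =>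
      symMul N (truncSeq N (symMul lam q X)) q (m + N)
        - symMul lam q (truncSeq N (symMul (N - lam) X q)) (m + N) := by
  have e : hamV lam (toSymb N X) (toSymb 0 q) = fun m =>
      toSymb N (symMul N (truncSeq N (symMul lam q X)) q) m
        - toSymb N (symMul lam q (truncSeq N (symMul (N - lam) X q))) m := by
    funext m
    rw [hamV, comp_toSymb, comp_toSymb, Int.cast_zero, add_zero, zero_add, add_zero, plus_toSymb,
      plus_toSymb, comp_toSymb, comp_toSymb, Int.cast_zero, add_zero, zero_add, zero_add, add_zero,
      Int.cast_natCast, neg_add_eq_sub]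
    rfl
  refine symb_ext (N := 0) (fun m hm => ?_) (fun m hm => toSymb_of_lt hm _) fun n => ?_
  · rw [e]
    simp only
    rcases lt_or_ge (N : ℤ) m with h | h
    · rw [toSymb_of_lt h, toSymb_of_lt h, sub_zero]
    · obtain ⟨n, rfl⟩ : ∃ n : ℕ, m = N - n := ⟨(N - m).toNat, by omega⟩
      rw [toSymb_sub, toSymb_sub, symMul_truncSeq_left (by omega)]
      -- In positive places the truncations are not felt, and both terms of V_X are equal to L∘X∘L.
      have h2 : symMul lam q (truncSeq N (symMul (N - lam) X q)) n
          = symMul lam q (symMul (N - lam) X q) n := by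
        refine Finset.sum_congr rfl fun p hp => ?_
        have hp := Finset.HasAntidiagonal.mem_antidiagonal.1 hp
        congr 1
        refine Finset.sum_congr rfl fun r hr => ?_
        have hr := Finset.HasAntidiagonal.mem_antidiagonal.1 hr
        rw [truncSeq, if_pos (by omega)]
      rw [h2, ← symMul_assoc, add_sub_cancel, sub_self]
  · rw [e, toSymb_sub]
    simp only
    rw [show (0 : ℤ) - n = N - (n + N : ℕ) by push_cast; ring, toSymb_sub, toSymb_sub]

/-! ### The Poisson map in terms of operators -/

/-- The symbol of the connection `∇_a`. -/
def symbOf (lam : ℂ) (a : Hs) : Symb := toSymb 0 (colSeq lam (Lop a))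

/-- The variation of the symbol in the direction `b`. -/
def dSymb (lam : ℂ) (a b : Hs) : Symb := toSymb 0 (colSeq lam (Lvar a b))

theorem colSeq_Lvar_zero (lam : ℂ) (a b : Hs) : colSeq lam (Lvar a b) 0 = 0 := by
  rw [colSeq, vl, Lvar, cf_solOp, solSeq_zero, map_zero, map_zero]

theorem colSeq_add (lam : ℂ) (x y : Hs) (m : ℕ) : colSeq lam (x + y) m = colSeq lam x m + colSeq lam y m :=
  vl_add _ _ _ _

theorem gdef_add_mid (b x y a : Hs) : gdef b (x + y) a = gdef b x a + gdef b y a := by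
  rw [gdef, gdef, gdef]; noncomm_ring

theorem gdef_scl_mid {b x a : Hs} (hb : b ∈ opRing) (c : ℂ) :
    gdef b (scl (algebraMap ℂ K c) * x) a = scl (algebraMap ℂ K c) * gdef b x a := by
  have hsm : scl (algebraMap ℂ K c) ∈ opRing := scl_mem _
  have h0 : gdef b (scl (algebraMap ℂ K c)) b = 0 := by
    rw [gdef_eq, ← scl_comm hb, ← scl_comm Fop_mem, sub_self, sub_self, add_zero, add_zero]
    refine opRing_ext (dl_comm_mem hsm) (zero_mem _) fun d => ?_
    rw [cf_dl_comm hsm, cf_zero, scl, cf_sgl]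
    split_ifs
    · rw [pd_C, dz_const, map_zero]
    · rw [map_zero]
  rw [gdef_mul b _ b x a, h0, zero_mul, zero_add]

theorem Lvar_add {a b c : Hs} (ha : a ∈ opRing) (ha0 : LowBd 0 a) (hb : b ∈ opRing)
    (hb0 : LowBd 0 b) (hc : c ∈ opRing) (hc0 : LowBd 0 c) :
    Lvar a (b + c) = Lvar a b + Lvar a c :=
  Lvar_eq ha ha0 (add_mem hb hc) (hb0.add hc0) (add_mem (Lvar_mem a b) (Lvar_mem a c))
    (by rw [gdef_add_mid, gdef_Lvar ha ha0 hb hb0, gdef_Lvar ha ha0 hc hc0, mul_add])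
    fun d => by rw [vl_add, vl_Lvar_at_zero, vl_Lvar_at_zero, add_zero]

theorem Lvar_scl {a b : Hs} (ha : a ∈ opRing) (ha0 : LowBd 0 a) (hb : b ∈ opRing)
    (hb0 : LowBd 0 b) (c : ℂ) :
    Lvar a (scl (algebraMap ℂ K c) * b) = scl (algebraMap ℂ K c) * Lvar a b := by
  refine Lvar_eq ha ha0 (mul_mem (scl_mem _) hb) (fun d hd => by rw [cf_scl_mul hb, hb0 d hd, mul_zero])
    (mul_mem (scl_mem _) (Lvar_mem a b)) ?_ fun d => ?_
  · rw [gdef_scl_mid (zero_mem _), gdef_Lvar ha ha0 hb hb0, ← mul_assoc, ← mul_assoc,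
      scl_comm (Lop_mem a)]
  · rw [vl_scl_mul (Lvar_mem a b), vl_Lvar_at_zero, mul_zero]

theorem FF_add_toSymb (lam : ℂ) (N : ℕ) (X d e : ℕ → K) :
    FF lam (toSymb N X) (toSymb 0 fun n => d n + e n)
      = FF lam (toSymb N X) (toSymb 0 d) + FF lam (toSymb N X) (toSymb 0 e) := by
  rw [FF_toSymb, FF_toSymb, FF_toSymb, symMul_add_left, res_add]

theorem FF_const_mul_toSymb (lam : ℂ) (N : ℕ) (X d : ℕ → K) (c : ℂ) :
    FF lam (toSymb N X) (toSymb 0 fun n => algebraMap ℂ K c * d n)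
      = c * FF lam (toSymb N X) (toSymb 0 d) := by
  rw [FF_toSymb, FF_toSymb, symMul_const_left, res_const_mul]

theorem csum_mul_comm_gl {lam : ℂ} {x y : Hs} (hx : x ∈ glRing lam) (hy : y ∈ glRing lam) :
    csum lam (cf (x * y) 0) = csum lam (cf (y * x) 0) :=
  csum_mul_comm hx.1 hy.1 (fun e => Or.inl (hy.2 e)) fun e => Or.inl (hx.2 e)

theorem csum_sig {lam : ℂ} (x : Hs) : csum lam (cf (sig lam x) 0) = csum lam (cf x 0) := by
  rw [cf_sig]
  simp [csum_refl]

/-- The covectors of `ΨDS_λ^{SA}` are represented by skew elements, and these induce the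
Gelfand–Dickey structure. -/
theorem exists_skew_representing {lam : ℂ} {a : Hs} (ha : a ∈ glRing lam) (ha0 : LowBd 0 a)
    (hsa : sig lam a = -a) {X : Symb} (hX : X ∈ PsiSACotangent lam) :
    ∃ x ∈ glRing lam, sig lam x = -x ∧ LowBd 0 (gdef a x a) ∧
      (∀ b ∈ glRing lam, LowBd 0 b → sig lam b = -b →
        FF lam X (dSymb lam a b) = res (csum lam (cf (x * b) 0))) ∧
      ∀ Y ∈ PsiSACotangent lam, FF lam Y (dSymb lam a (gdef a x a))
        = -gelfandDickey lam (symbOf lam a) X Y := by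
  obtain ⟨N, X, rfl⟩ := exists_toSymb_of_mem_PsiCotangent hX.1
  obtain ⟨x, hx, hx0, hV, hres⟩ := exists_representing ha ha0 N X
  have hσ := sig_mem_glRing hx
  set c : K := algebraMap ℂ K (1 / 2) with hc
  have hcc : c + c = 1 := by rw [hc, ← map_add]; norm_num
  -- Skew elements b pair with x and with -σ(x) in the same way, so half of x - σ(x) represents the
  -- same functional on skew variations.
  set y := scl c * (x - sig lam x) with hy
  have hd : x - sig lam x ∈ glRing lam := sub_mem hx hσ
  have hym : y ∈ glRing lam := mul_mem (scl_mem_glRing lam c) hd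
  set B := gdef a x a with hB
  have hBm : B ∈ glRing lam := gdef_mem_glRing ha hx ha
  have hσB : sig lam B = gdef a (sig lam x) a := by
    rw [hB, sig_gdef ha.1 hx.1 ha.1, hsa, neg_neg]
  have hgy : gdef a y a = scl c * (B - sig lam B) := by
    rw [hy, gdef_scl_mid ha.1, gdef_sub_mid, hσB]
  have hB0' : LowBd 0 (sig lam B) := hx0.sig lam
  have hys : sig lam y = -y := by
    rw [hy, hc, sig_scl_mul hd.1, sig_sub, sig_sig hx.1, ← mul_neg, neg_sub]
  refine ⟨y, hym, hys, ?_, fun b hb hb0 hsb => ?_, fun Y hY => ?_⟩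
  · rw [hgy]
    intro d hd
    rw [cf_scl_mul (sub_mem hBm.1 (sig_mem _ _)), (hx0.sub hB0') d hd, mul_zero]
  · rw [dSymb, FF_toSymb, hres b hb.1 hb0]
    have e1 : csum lam (cf (sig lam x * b) 0) = -csum lam (cf (x * b) 0) := by
      have : sig lam x * b = -sig lam (b * x) := by
        rw [sig_mul hb.1 hx.1, hsb, mul_neg, neg_neg]
      rw [this, cf_neg, ← zero_sub, csum_sub, csum_zero, csum_sig, csum_mul_comm_gl hb hx, zero_sub]
    rw [hy, mul_assoc, cf_scl_mul (mul_mem hd.1 hb.1), sub_mul, cf_sub, csum_C_mul, csum_sub, e1,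
      sub_neg_eq_add, mul_add, ← add_mul, hcc, one_mul]
  · obtain ⟨M, Y, rfl⟩ := exists_toSymb_of_mem_PsiCotangent hY.1
    set V := hamV lam (toSymb N X) (symbOf lam a) with hVd
    have hV1 : toSymb 0 (fun m => -colSeq lam (Lvar a B) m) = V := by
      rw [hVd, symbOf, hamV_toSymb]
      refine congrArg _ (funext fun m => ?_)
      rw [hV, neg_sub]
    have hVt : V ∈ PsiTangent := by
      rw [← hV1]
      exact toSymb_mem_PsiTangent (by rw [colSeq_Lvar_zero, neg_zero])
    have e2 : dSymb lam a (gdef a y a) = toSymb 0 fun m => algebraMap ℂ K (1 / 2) *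
        (colSeq lam (Lvar a B) m + starSeq lam (colSeq lam (Lvar a B)) m) := by
      rw [dSymb, hgy, hc, Lvar_scl ha.1 ha0 (sub_mem hBm.1 (sig_mem _ _)) (hx0.sub hB0')]
      refine congrArg _ (funext fun m => ?_)
      rw [colSeq, vl_scl_mul (Lvar_mem _ _)]
      refine congrArg _ ?_
      have e3 := Lvar_add ha.1 ha0 (sub_mem hBm.1 (sig_mem lam B)) (hx0.sub hB0') (sig_mem lam B) hB0'
      rw [sub_add_cancel] at e3
      have e4 := Lvar_sig ha.1 ha0 (stab_zero_of_glRing ha) hsa hBm.1 hx0 (stab_zero_of_glRing hBm)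
        (stab_zero_of_glRing (sig_mem_glRing hBm)) m
      have e5 : colSeq lam (Lvar a B) m = _ := congrArg (fun z => colSeq lam z m) e3
      rw [colSeq_add, e4] at e5
      have e6 : vl (Lvar a (B - sig lam B)) m lam = colSeq lam (Lvar a B) m
        + starSeq lam (colSeq lam (Lvar a B)) m := by
        rw [e5]
        change _ = vl (Lvar a (B - sig lam B)) m lam + _ + _
        ring
      exact e6
    have hstar : star lam V = toSymb 0 fun m => -starSeq lam (colSeq lam (Lvar a B)) m := by
      rw [← hV1, star_toSymb]
      refine congrArg _ (funext fun m => ?_)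
      have := starSeq_const_mul lam (-1) (colSeq lam (Lvar a B)) m
      simpa using this
    -- The symmetrized variation is -(V + V^*)/2; invariance of F_Y under the involution makes its
    -- value -F_Y(V).
    have hinv := hY.2 V hVt
    have n1 := FF_const_mul_toSymb lam M Y (colSeq lam (Lvar a B)) (-1)
    have n2 := FF_const_mul_toSymb lam M Y (starSeq lam (colSeq lam (Lvar a B))) (-1)
    simp only [map_neg, map_one, neg_mul, one_mul] at n1 n2
    rw [hV1] at n1
    rw [← hstar, hinv] at n2
    rw [e2, FF_const_mul_toSymb, FF_add_toSymb, gelfandDickey]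
    linear_combination (1 / 2 : ℂ) * n1 + (1 / 2 : ℂ) * n2

/-! ### The exponential of a strictly upper triangular operator -/

theorem scl_add (a b : K) : scl (a + b) = scl a + scl b :=
  opRing_ext (scl_mem _) (add_mem (scl_mem _) (scl_mem _)) fun d => by
    rw [cf_add, scl, scl, scl, cf_sgl, cf_sgl, cf_sgl]
    split_ifs <;> simp

theorem scl_one : scl 1 = 1 := opRing_ext (scl_mem _) (one_mem _) fun d => by
  rw [scl, cf_sgl, cf_one, map_one]

theorem scl_zero : scl 0 = 0 := opRing_ext (scl_mem _) (zero_mem _) fun d => by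
  rw [scl, cf_sgl, cf_zero, map_zero, ite_self]

theorem cf_scl (a : K) (d : ℤ) : cf (scl a) d = if d = 0 then Polynomial.C a else 0 := by
  rw [scl, cf_sgl]

theorem scl_mul (a b : K) : scl (a * b) = scl a * scl b :=
  opRing_ext (scl_mem _) (mul_mem (scl_mem _) (scl_mem _)) fun d => by
    rw [cf_scl_mul (scl_mem _), cf_scl, cf_scl]
    split_ifs <;> simp

/-- Complex scalars. -/
def sclHom : ℂ →+* Hs where
  toFun c := scl (algebraMap ℂ K c)
  map_one' := by rw [map_one, scl_one]
  map_mul' a b := by rw [map_mul, scl_mul]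
  map_zero' := by rw [map_zero, scl_zero]
  map_add' a b := by rw [map_add, scl_add]

/-- The truncated exponential series. -/
def expPoly (M : ℕ) : ℂ[X] :=
  ∑ m ∈ Finset.range (M + 1), Polynomial.C ((m.factorial : ℂ)⁻¹) * Polynomial.X ^ m

theorem coeff_expPoly (M k : ℕ) :
    (expPoly M).coeff k = if k ≤ M then ((k.factorial : ℂ)⁻¹) else 0 := by
  simp [expPoly, Polynomial.coeff_C_mul, Polynomial.coeff_X_pow]

/-- Up to degree M the coefficients are those of exp(X) exp(-X) = 1. -/
theorem expPoly_mul_neg (M : ℕ) :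
    Polynomial.X ^ (M + 1) ∣ expPoly M * (expPoly M).comp (-Polynomial.X) - 1 := by
  rw [Polynomial.X_pow_dvd_iff]
  intro d hd
  have h := congrArg (PowerSeries.coeff d) (PowerSeries.exp_mul_exp_neg_eq_one (A := ℂ))
  rw [PowerSeries.coeff_mul, PowerSeries.coeff_one] at h
  rw [Polynomial.coeff_sub, Polynomial.coeff_mul, Polynomial.coeff_one, sub_eq_zero, ← h]
  refine Finset.sum_congr rfl fun p hp => ?_
  have hp := Finset.HasAntidiagonal.mem_antidiagonal.1 hp
  rw [show (-Polynomial.X : ℂ[X]) = Polynomial.C (-1) * Polynomial.X by simp,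
    Polynomial.comp_C_mul_X_coeff, coeff_expPoly, coeff_expPoly, if_pos (by omega),
    if_pos (by omega), PowerSeries.coeff_exp, PowerSeries.evalNegHom, PowerSeries.coeff_rescale,
    PowerSeries.coeff_exp]
  simp [mul_comm]

/-- Substitution of an operator into a polynomial. -/
def substHom {y : Hs} (hy : y ∈ opRing) : ℂ[X] →+* Hs :=
  Polynomial.eval₂RingHom' sclHom y fun _ => scl_comm hy _

theorem substHom_monomial {y : Hs} (hy : y ∈ opRing) (n : ℕ) (c : ℂ) :
    substHom hy (Polynomial.monomial n c) = scl (algebraMap ℂ K c) * y ^ n :=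
  Polynomial.eval₂_monomial _ _

theorem substHom_C {y : Hs} (hy : y ∈ opRing) (c : ℂ) :
    substHom hy (Polynomial.C c) = scl (algebraMap ℂ K c) := Polynomial.eval₂_C _ _

theorem substHom_X_pow {y : Hs} (hy : y ∈ opRing) (m : ℕ) :
    substHom hy (Polynomial.X ^ m) = y ^ m := Polynomial.eval₂_X_pow _ _

theorem substHom_mem {y : Hs} (hy : y ∈ opRing) (p : ℂ[X]) : substHom hy p ∈ opRing := by
  induction p using Polynomial.induction_on' with
  | add p q hp hq => rw [map_add]; exact add_mem hp hq
  | monomial n c =>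
    rw [substHom_monomial]
    exact mul_mem (scl_mem _) (pow_mem hy n)

theorem substHom_mem_glRing {lam : ℂ} {y : Hs} (hy : y ∈ glRing lam) (p : ℂ[X]) :
    substHom hy.1 p ∈ glRing lam := by
  induction p using Polynomial.induction_on' with
  | add p q hp hq => rw [map_add]; exact add_mem hp hq
  | monomial n c =>
    rw [substHom_monomial]
    exact mul_mem (scl_mem_glRing _ _) (pow_mem hy n)

theorem lowBd_pow {y : Hs} (hy : y ∈ opRing) (h : LowBd (-1) y) (m : ℕ) : LowBd (-m) (y ^ m) := by
  induction m with
  | zero => rw [pow_zero, Nat.cast_zero, neg_zero]; exact lowBd_one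
  | succ m ih =>
    rw [pow_succ]
    have := LowBd.mul (pow_mem hy m) hy ih h
    exact this.mono (by push_cast; omega)

theorem lowBd_scl_mul {N : ℤ} {y : Hs} (hy : y ∈ opRing) (h : LowBd N y) (a : K) :
    LowBd N (scl a * y) := fun d hd => by rw [cf_scl_mul hy, h d hd, mul_zero]

theorem lowBd_zero (N : ℤ) : LowBd N 0 := fun d _ => cf_zero d

theorem lowBd_substHom {y : Hs} (hy : y ∈ opRing) (h : LowBd (-1) y) (p : ℂ[X]) :
    LowBd 0 (substHom hy p) := by
  induction p using Polynomial.induction_on' with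
  | add p q hp hq => rw [map_add]; exact hp.add hq
  | monomial n c =>
    rw [substHom_monomial]
    exact lowBd_scl_mul (pow_mem hy n) ((lowBd_pow hy h n).mono (by omega)) _

theorem lowBd_substHom_of_dvd {y : Hs} (hy : y ∈ opRing) (h : LowBd (-1) y) {p : ℂ[X]} {m : ℕ}
    (hp : Polynomial.X ^ m ∣ p) : LowBd (-m) (substHom hy p) := by
  obtain ⟨q, rfl⟩ := hp
  rw [map_mul, substHom_X_pow]
  have := LowBd.mul (pow_mem hy m) (substHom_mem hy q) (lowBd_pow hy h m) (lowBd_substHom hy h q)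
  rwa [add_zero] at this

/-- The truncated exponential of an operator. -/
def expT {y : Hs} (hy : y ∈ opRing) (M : ℕ) : Hs := substHom hy (expPoly M)

theorem expT_eq {y : Hs} (hy : y ∈ opRing) (M : ℕ) : expT hy M
    = ∑ m ∈ Finset.range (M + 1), scl (algebraMap ℂ K ((m.factorial : ℂ)⁻¹)) * y ^ m := by
  rw [expT, expPoly, map_sum]
  refine Finset.sum_congr rfl fun m _ => ?_
  rw [map_mul, substHom_X_pow, substHom_C]

theorem cf_expT {y : Hs} (hy : y ∈ opRing) (h : LowBd (-1) y) {M M' : ℕ} {d : ℤ} (hd : d ≤ M)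
    (hd' : d ≤ M') : cf (expT hy M) d = cf (expT hy M') d := by
  wlog hMM : M ≤ M' generalizing M M'
  · exact (this hd' hd (by omega)).symm
  have hdv : Polynomial.X ^ (M + 1) ∣ expPoly M' - expPoly M := by
    rw [Polynomial.X_pow_dvd_iff]
    intro k hk
    rw [Polynomial.coeff_sub, coeff_expPoly, coeff_expPoly, if_pos (by omega), if_pos (by omega),
      sub_self]
  have := lowBd_substHom_of_dvd hy h hdv d (by push_cast; omega)
  rw [map_sub, cf_sub] at this
  exact (sub_eq_zero.1 this).symm

/-- The exponential of a strictly upper triangular operator. -/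
def expS {y : Hs} (hy : y ∈ opRing) : Hs := mkOp 0 fun d => cf (expT hy d.toNat) d

theorem expS_mem {y : Hs} (hy : y ∈ opRing) : expS hy ∈ opRing := mkOp_mem _ _
theorem lowBd_expS {y : Hs} (hy : y ∈ opRing) : LowBd 0 (expS hy) := lowBd_mkOp _ _

theorem cf_expS {y : Hs} (hy : y ∈ opRing) (h : LowBd (-1) y) {M : ℕ} {d : ℤ} (hd : d ≤ M) :
    cf (expS hy) d = cf (expT hy M) d := by
  rw [expS, cf_mkOp]
  split_ifs with h0
  · exact cf_expT hy h (by omega) hd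
  · exact (lowBd_substHom hy h _ d (by omega)).symm

theorem lowBd_expS_sub {y : Hs} (hy : y ∈ opRing) (h : LowBd (-1) y) (M : ℕ) :
    LowBd (-(M + 1)) (expS hy - expT hy M) := fun d hd => by
  rw [cf_sub, cf_expS hy h (show d ≤ M by omega), sub_self]

theorem expS_mul_neg {y : Hs} (hy : y ∈ opRing) (h : LowBd (-1) y) :
    expS hy * expS (neg_mem hy) = 1 := by
  have hy' := neg_mem hy
  have hn : ∀ p : ℂ[X], substHom hy' p = substHom hy (p.comp (-Polynomial.X)) := by
    intro p
    induction p using Polynomial.induction_on' with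
    | add p q hp hq => rw [map_add, hp, hq, Polynomial.add_comp, map_add]
    | monomial n c =>
      have hX := substHom_X_pow hy 1
      rw [pow_one, pow_one] at hX
      rw [Polynomial.monomial_comp, map_mul, map_pow, map_neg, hX, substHom_C, substHom_monomial]
  refine opRing_ext (mul_mem (expS_mem _) (expS_mem _)) (one_mem _) fun d => ?_
  set M := d.toNat with hM
  have e : expS hy * expS hy' - 1 = (expS hy - expT hy M) * expS hy'
      + expT hy M * (expS hy' - expT hy' M)
      + substHom hy (expPoly M * (expPoly M).comp (-Polynomial.X) - 1) := by
    rw [map_sub, map_mul, ← hn, map_one]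
    simp only [expT]
    noncomm_ring
  have l1 := LowBd.mul (sub_mem (expS_mem hy) (substHom_mem hy (expPoly M))) (expS_mem hy')
    (lowBd_expS_sub hy h M) (lowBd_expS hy')
  have l2 := LowBd.mul (substHom_mem hy (expPoly M)) (sub_mem (expS_mem hy')
    (substHom_mem hy' (expPoly M))) (lowBd_substHom hy h _) (lowBd_expS_sub hy' h.neg M)
  have l3 := lowBd_substHom_of_dvd hy h (expPoly_mul_neg M)
  have := congrArg (fun x => cf x d) e
  simp only [cf_add] at this
  rw [show cf ((expS hy - expT hy M) * expS hy') d = 0 from l1 d (by omega),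
    l3 d (by push_cast; omega), cf_sub] at this
  rw [show cf (expT hy M * (expS hy' - expT hy' M)) d = 0 from l2 d (by omega), add_zero, add_zero] at this
  exact sub_eq_zero.1 this

theorem expS_mem_glRing {lam : ℂ} {y : Hs} (hy : y ∈ glRing lam) (h : LowBd (-1) y) :
    expS hy.1 ∈ glRing lam :=
  ⟨expS_mem _, fun d => by
    rw [cf_expS hy.1 h (show d ≤ d.toNat by omega)]
    exact (substHom_mem_glRing hy _).2 d⟩

theorem unitri_expS {y : Hs} (hy : y ∈ opRing) (h : LowBd (-1) y) : Unitri (expS hy) :=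
  ⟨expS_mem _, lowBd_expS _, by
    rw [cf_expS hy h (M := 0) (by omega), expT_eq]
    simp [scl_one, cf_one]⟩

/-! ### Stability -/

theorem stab_mul {s₀ : ℂ} {x y : Hs} (hx : x ∈ opRing) (hy : y ∈ opRing) (hx0 : LowBd 0 x)
    (hy0 : LowBd 0 y) (sx : Stab s₀ x) (sy : Stab s₀ y) : Stab s₀ (x * y) := fun i _ hd =>
  vl_mul_eq_zero hx hy hx0 hy0 (fun j _ => sx j) (sy i) hd

theorem stab_one (s₀ : ℂ) : Stab s₀ 1 := fun i d hd => by rw [vl_one, if_neg (by omega)]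

theorem stab_pow {s₀ : ℂ} {y : Hs} (hy : y ∈ opRing) (hy0 : LowBd 0 y) (sy : Stab s₀ y) (m : ℕ) :
    Stab s₀ (y ^ m) ∧ LowBd 0 (y ^ m) := by
  induction m with
  | zero => rw [pow_zero]; exact ⟨stab_one s₀, lowBd_one⟩
  | succ m ih =>
    rw [pow_succ]
    exact ⟨stab_mul (pow_mem hy m) hy ih.2 hy0 ih.1 sy, LowBd.upper_mul (pow_mem hy m) hy ih.2 hy0⟩

theorem stab_expS {s₀ : ℂ} {y : Hs} (hy : y ∈ opRing) (h : LowBd (-1) y) (sy : Stab s₀ y) :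
    Stab s₀ (expS hy) := fun i d hd => by
  have hvl : ∀ (s : Finset ℕ) (f : ℕ → Hs), vl (∑ m ∈ s, f m) d (s₀ + i)
      = ∑ m ∈ s, vl (f m) d (s₀ + i) := fun s f =>
    map_sum (AddMonoidHom.mk' (fun x => vl x d (s₀ + i)) fun x y => vl_add x y d _) f s
  rw [vl, cf_expS hy h (show d ≤ d.toNat by omega), expT_eq]
  refine (hvl _ _).trans (Finset.sum_eq_zero fun m _ => ?_)
  rw [vl_scl_mul (pow_mem hy m), (stab_pow hy (h.mono (by omega)) sy m).1 i d hd, mul_zero]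

/-! ### Logarithms -/

theorem lowBd_pow_sub {y z : Hs} (hy : y ∈ opRing) (hz : z ∈ opRing) (h : LowBd (-1) y) {n : ℕ}
    (hn : 1 ≤ n) (hz0 : LowBd (-n) z) (m : ℕ) :
    LowBd (-(n + m)) ((y + z) ^ (m + 1) - y ^ (m + 1)) := by
  induction m with
  | zero => simpa using hz0
  | succ m ih =>
    have hyz : y + z ∈ opRing := add_mem hy hz
    have e : (y + z) ^ (m + 1 + 1) - y ^ (m + 1 + 1)
        = (y + z) * ((y + z) ^ (m + 1) - y ^ (m + 1)) + z * y ^ (m + 1) := by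
      rw [pow_succ' (y + z), pow_succ' y (m + 1)]; noncomm_ring
    rw [e]
    refine LowBd.add ((LowBd.mul hyz (sub_mem (pow_mem hyz _) (pow_mem hy _))
      (h.add (hz0.mono (by omega))) ih).mono (by push_cast; omega)) ?_
    exact (LowBd.mul hz (pow_mem hy _) hz0 (lowBd_pow hy h _)).mono (by push_cast; omega)

/-- A correction z starting in place n ≥ 1 enters the higher powers only beyond place n. This is the
step by which logarithms are compared and constructed place by place. -/
theorem cf_expS_add {y z : Hs} (hy : y ∈ opRing) (hz : z ∈ opRing) (h : LowBd (-1) y) {n : ℕ}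
    (hn : 1 ≤ n) (hz0 : LowBd (-n) z) {d : ℤ} (hd : d ≤ n) :
    cf (expS (add_mem hy hz)) d = cf (expS hy) d + cf z d := by
  rw [cf_expS (add_mem hy hz) (h.add (hz0.mono (by omega))) hd, cf_expS hy h hd, expT_eq, expT_eq,
    Finset.sum_range_succ', Finset.sum_range_succ', ← sub_eq_iff_eq_add']
  have hcf : ∀ (s : Finset ℕ) (f : ℕ → Hs), cf (∑ m ∈ s, f m) d = ∑ m ∈ s, cf (f m) d := fun s f =>
    map_sum (AddMonoidHom.mk' (fun x => cf x d) fun x y => cf_add x y d) f s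
  rw [cf_add, cf_add, pow_zero, pow_zero, add_sub_add_right_eq_sub, hcf, hcf, ← Finset.sum_sub_distrib,
    Finset.sum_eq_single 0]
  · simp [scl_one, cf_add]
  · intro m _ hm
    rw [← cf_sub, ← mul_sub, cf_scl_mul (sub_mem (pow_mem (add_mem hy hz) _) (pow_mem hy _)),
      lowBd_pow_sub hy hz h hn hz0 m d (by omega), mul_zero]
  · intro h0
    simp only [Finset.mem_range] at h0
    omega

theorem expS_congr {y y' : Hs} (hy : y ∈ opRing) (hy' : y' ∈ opRing) (h : y = y') :
    expS hy = expS hy' := by subst h; rfl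

theorem expS_injective {y y' : Hs} (hy : y ∈ opRing) (hy' : y' ∈ opRing) (h : LowBd (-1) y)
    (h' : LowBd (-1) y') (e : expS hy = expS hy') : y = y' := by
  have key : ∀ n : ℕ, LowBd (-(n + 1)) (y' - y) := by
    intro n
    induction n with
    | zero => exact (h'.sub h).mono (by omega)
    | succ n ih =>
      intro d hd
      have hz := sub_mem hy' hy
      have := cf_expS_add hy hz h (n := n + 1) (by omega) (by push_cast; exact ih)
        (d := d) (by push_cast at *; omega)
      rw [expS_congr (add_mem hy hz) hy' (by abel), ← e] at this
      exact left_eq_add.1 this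
  have : y' - y = 0 := opRing_ext (sub_mem hy' hy) (zero_mem _) fun d => by
    rw [cf_zero]; exact key d.toNat d (by omega)
  exact (sub_eq_zero.1 this).symm

theorem sig_pow {lam : ℂ} {y : Hs} (hy : y ∈ opRing) (m : ℕ) : sig lam (y ^ m) = sig lam y ^ m := by
  induction m with
  | zero => rw [pow_zero, pow_zero, sig_one]
  | succ m ih => rw [pow_succ, sig_mul (pow_mem hy m) hy, ih, pow_succ']

theorem sig_expS {lam : ℂ} {y : Hs} (hy : y ∈ opRing) (h : LowBd (-1) y) :
    sig lam (expS hy) = expS (sig_mem lam y) := by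
  refine opRing_ext (sig_mem _ _) (expS_mem _) fun d => ?_
  have e : sig lam (expT hy d.toNat) = expT (sig_mem lam y) d.toNat := by
    have hs : ∀ (s : Finset ℕ) (f : ℕ → Hs), sig lam (∑ m ∈ s, f m) = ∑ m ∈ s, sig lam (f m) := fun s f =>
      map_sum (AddMonoidHom.mk' (sig lam) (sig_add lam)) f s
    rw [expT_eq, expT_eq, hs]
    exact Finset.sum_congr rfl fun m _ => by rw [sig_scl_mul (pow_mem hy m), sig_pow hy]
  rw [cf_expS (sig_mem lam y) (h.sig lam) (show d ≤ d.toNat by omega), ← e, cf_sig, cf_sig,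
    cf_expS hy h (show d ≤ d.toNat by omega)]

theorem stab_sgl {s₀ : ℂ} {n : ℤ} {p : K[X]} (h : ∀ i : ℕ, (i : ℤ) < n → ev (s₀ + i) p = 0) :
    Stab s₀ (sgl n p) := fun i d hd => by
  rw [vl_sgl]
  split_ifs with e
  · exact h i (by omega)
  · rfl

/-- The logarithm is corrected one place at a time and inherits the vanishing at both ends. Skewness
follows from injectivity of the exponential, as exp σ(y) = σ(x) = x⁻¹ = exp(-y). -/
theorem exists_log {lam : ℂ} {x : Hs} (hx : Unitri x) (s0 : Stab 0 x) (s1 : Stab lam x)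
    (hs : sig lam x * x = 1) : ∃ (y : Hs) (hy : y ∈ opRing), LowBd (-1) y ∧ Stab 0 y ∧ Stab lam y ∧
      sig lam y = -y ∧ expS hy = x := by
  let T := {y : Hs // y ∈ opRing ∧ LowBd (-1) y ∧ Stab 0 y ∧ Stab lam y}
  have step : ∀ (n : ℕ) (y : T), ∃ y' : T, LowBd (-(n + 1)) (y'.1 - y.1) ∧
      ((∀ d : ℤ, d < n + 1 → cf (expS y.2.1) d = cf x d) →
        ∀ d : ℤ, d < n + 2 → cf (expS y'.2.1) d = cf x d) := by
    rintro n ⟨y, hy, hl, h0, h1⟩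
    -- The error in the next place; it vanishes at s₀ + i, i ≤ n, because x and the exponential
    -- already do, so adding it preserves stability.
    set c := cf x (n + 1) - cf (expS hy) (n + 1) with hc
    have hz : ∀ {s₀}, Stab s₀ x → Stab s₀ y → Stab s₀ (sgl (n + 1) c) := fun sx sy =>
      stab_sgl fun i hi => by
        have e1 := sx i (n + 1) hi
        have e2 := stab_expS hy hl sy i (n + 1) hi
        rw [vl] at e1 e2
        rw [hc, (ev _).map_sub, e1, e2, sub_zero]
    have hzl : LowBd (-(n + 1 : ℕ)) (sgl (n + 1) c) := fun d hd => by
      rw [cf_sgl, if_neg (by push_cast at hd; omega)]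
    have sadd : ∀ {s₀}, Stab s₀ y → Stab s₀ (sgl (n + 1) c) → Stab s₀ (y + sgl (n + 1) c) :=
      fun a b i d hd => by rw [vl_add, a i d hd, b i d hd, add_zero]
    refine ⟨⟨y + sgl (n + 1) c, add_mem hy (sgl_mem _ _), hl.add (hzl.mono (by push_cast; omega)),
      sadd h0 (hz s0 h0), sadd h1 (hz s1 h1)⟩, ?_, fun hd d hdn => ?_⟩
    · simpa using hzl
    · rw [cf_expS_add hy (sgl_mem _ _) hl (n := n + 1) (by omega) hzl (by push_cast; omega), cf_sgl]
      split_ifs with e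
      · rw [e, hc]; ring
      · rw [add_zero]; exact hd d (by omega)
  choose F hF1 hF2 using step
  let Y : ℕ → T := fun n => Nat.rec ⟨0, zero_mem _, lowBd_zero _, stab_zero 0, stab_zero lam⟩
    (fun n y => F n y) n
  have hY : ∀ n : ℕ, ∀ d : ℤ, d < n + 1 → cf (expS (Y n).2.1) d = cf x d := by
    intro n
    induction n with
    | zero =>
      intro d hd
      rcases lt_or_ge d 0 with h | h
      · rw [lowBd_expS _ d (by omega), hx.low d (by omega)]
      · obtain rfl : d = 0 := by push_cast at hd; omega
        rw [hx.cf_zero, (unitri_expS (Y 0).2.1 (Y 0).2.2.1).cf_zero]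
    | succ n ih =>
      intro d hd
      exact hF2 n (Y n) ih d (by push_cast at hd; omega)
  have hdiff : ∀ n m : ℕ, LowBd (-(n + 1)) ((Y (n + m)).1 - (Y n).1) := by
    intro n m
    induction m with
    | zero => rw [add_zero, sub_self]; exact lowBd_zero _
    | succ m ih =>
      have := (((hF1 (n + m) (Y (n + m))).mono (M := -(n + 1)) (by push_cast; omega)).add ih)
      rwa [sub_add_sub_cancel] at this
  -- The limit exists because place d no longer changes after step d.
  set y := mkOp (-1) fun d => cf (Y d.toNat).1 d with hyd
  have hym : y ∈ opRing := mkOp_mem _ _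
  have hyl : LowBd (-1) y := lowBd_mkOp _ _
  have hyY : ∀ n : ℕ, LowBd (-(n + 1)) (y - (Y n).1) := by
    intro n d hd
    rw [cf_sub, hyd, cf_mkOp]
    split_ifs with h
    · obtain ⟨m, rfl⟩ := Nat.exists_eq_add_of_le (show d.toNat ≤ n by omega)
      have := hdiff d.toNat m d (by omega)
      rw [cf_sub] at this
      rw [← neg_sub, this, neg_zero]
    · rw [(Y n).2.2.1 d (by omega), sub_zero]
  have hexp : expS hym = x := by
    refine opRing_ext (expS_mem _) hx.mem fun d => ?_
    set n := d.toNat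
    have hz := sub_mem hym (Y n).2.1
    have h1 := cf_expS_add (Y n).2.1 hz (Y n).2.2.1 (n := n + 1) (by omega)
      (by push_cast; exact hyY n) (d := d) (by push_cast; omega)
    rw [expS_congr (add_mem (Y n).2.1 hz) hym (by abel), hY n d (by omega),
      hyY n d (by omega), add_zero] at h1
    exact h1
  have hst : ∀ {s₀}, (∀ n, Stab s₀ (Y n).1) → Stab s₀ y := fun h i d hd => by
    rw [hyd, vl_mkOp]
    split_ifs
    · exact h d.toNat i d hd
    · rfl
  refine ⟨y, hym, hyl, hst fun n => (Y n).2.2.2.1, hst fun n => (Y n).2.2.2.2, ?_, hexp⟩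
  have h1 := expS_mul_neg hym hyl
  have h2 := sig_expS (lam := lam) hym hyl
  rw [hexp] at h1 h2
  have h3 : expS (sig_mem lam y) = expS (neg_mem hym) := by
    rw [← h2]
    calc sig lam x = sig lam x * (x * expS (neg_mem hym)) := by rw [h1, mul_one]
      _ = expS (neg_mem hym) := by rw [← mul_assoc, hs, one_mul]
  exact expS_injective _ _ (hyl.sig lam) hyl.neg h3

/-! ### Matrices of operators -/

section Matrices

variable {ι : Type}

theorem matrix_ext {A B : Mat ι} (h : ∀ i j, entry A i j = entry B i j) : A = B := by
  apply Finsupp.lhom_ext'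
  intro j
  apply LinearMap.ext_ring
  exact Finsupp.ext fun i => h i j

theorem ofCols_bas (c : ι → ι →₀ K) (j : ι) : ofCols c (bas j) = c j := by simp [ofCols, bas]

theorem entry_ofCols (c : ι → ι →₀ K) (i j : ι) : entry (ofCols c) i j = c j i := by
  rw [entry, ofCols_bas]

theorem entry_add (A B : Mat ι) (i j : ι) : entry (A + B) i j = entry A i j + entry B i j := rfl
theorem entry_sub (A B : Mat ι) (i j : ι) : entry (A - B) i j = entry A i j - entry B i j := rfl
theorem entry_neg (A : Mat ι) (i j : ι) : entry (-A) i j = -entry A i j := rfl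
theorem entry_zero (i j : ι) : entry (0 : Mat ι) i j = 0 := rfl
theorem entry_smul (c : K) (A : Mat ι) (i j : ι) : entry (c • A) i j = c * entry A i j := rfl
theorem entry_one [DecidableEq ι] (i j : ι) : entry (1 : Mat ι) i j = if i = j then 1 else 0 := by
  rw [entry, Module.End.one_apply, bas, Finsupp.single_apply]
  simp only [eq_comm]

theorem entry_mul (A B : Mat ι) (i j : ι) (S : Finset ι) (hS : ∀ m, m ∉ S → entry B m j = 0) :
    entry (A * B) i j = ∑ m ∈ S, entry A i m * entry B m j := by
  have h : B (bas j) = ∑ m ∈ S, entry B m j • bas m := by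
    refine Finsupp.ext fun m => ?_
    classical
    rw [Finsupp.finsetSum_apply]
    by_cases hm : m ∈ S
    · rw [Finset.sum_eq_single m]
      · simp [bas, entry]
      · intro b _ hb
        simp [bas, hb]
      · exact fun h => absurd hm h
    · rw [Finset.sum_eq_zero fun b hb => by
        simp [bas, show b ≠ m from fun e => hm (e ▸ hb)]]
      exact hS m hm
  rw [entry, Module.End.mul_apply, h, map_sum, Finsupp.finsetSum_apply]
  refine Finset.sum_congr rfl fun m _ => ?_
  rw [map_smul, Finsupp.smul_apply, smul_eq_mul, mul_comm]
  rfl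

theorem entry_matDeriv (A : Mat ι) (i j : ι) : entry (matDeriv A) i j = dz (entry A i j) := by
  rw [matDeriv, entry_ofCols, Finsupp.mapRange_apply]; rfl

end Matrices

/-- Either all natural numbers, or those less than `n = λ`, as indices. -/
structure IsFrame {ι : Type} [LinearOrder ι] (lam : ℂ) (v : ι → ℕ) : Prop where
  mono : StrictMono v
  range : (∀ m, m ∈ Set.range v) ∨ ∃ n : ℕ, lam = n ∧ ∀ m, m ∈ Set.range v ↔ m < n

theorem isFrame_id (lam : ℂ) : IsFrame lam (id : ℕ → ℕ) := ⟨strictMono_id, Or.inl fun m => ⟨m, rfl⟩⟩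

theorem isFrame_fin (n : ℕ) : IsFrame (n : ℂ) (Fin.val : Fin n → ℕ) :=
  ⟨fun _ _ h => h, Or.inr ⟨n, rfl, fun m => ⟨fun ⟨i, hi⟩ => hi ▸ i.2, fun h => ⟨⟨m, h⟩, rfl⟩⟩⟩⟩

section Rep

variable {ι : Type} [LinearOrder ι] {lam : ℂ} {v : ι → ℕ}

theorem rep_support_finite (hv : IsFrame lam v) (κ : K) (x : Hs) (j : ι) :
    (Function.support fun i => κ ^ ((v j : ℤ) - v i) * vl x (v j - v i) (v j)).Finite := by
  obtain ⟨N, hN⟩ := exists_lowBd x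
  refine ((Set.finite_Iic (v j + N)).preimage hv.mono.injective.injOn).subset fun i hi => ?_
  by_contra h
  refine hi ?_
  simp only [Set.mem_preimage, Set.mem_Iic, not_le] at h
  simp only
  rw [hN.vl (by omega), mul_zero]

/-- The matrix of an operator in the basis `κ^{-v_i} v_i`. -/
def rep (hv : IsFrame lam v) (κ : K) (x : Hs) : Mat ι :=
  ofCols fun j => Finsupp.ofSupportFinite _ (rep_support_finite hv κ x j)

variable (hv : IsFrame lam v) (κ : K)

theorem entry_rep (x : Hs) (i j : ι) :
    entry (rep hv κ x) i j = κ ^ ((v j : ℤ) - v i) * vl x (v j - v i) (v j) := by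
  rw [rep, entry_ofCols]; rfl

theorem rep_add (x y : Hs) : rep hv κ (x + y) = rep hv κ x + rep hv κ y :=
  matrix_ext fun i j => by rw [entry_add, entry_rep, entry_rep, entry_rep, vl_add, mul_add]

theorem rep_sub (x y : Hs) : rep hv κ (x - y) = rep hv κ x - rep hv κ y :=
  matrix_ext fun i j => by rw [entry_sub, entry_rep, entry_rep, entry_rep, vl_sub, mul_sub]

theorem rep_neg (x : Hs) : rep hv κ (-x) = -rep hv κ x :=
  matrix_ext fun i j => by rw [entry_neg, entry_rep, entry_rep, vl_neg, mul_neg]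

theorem rep_zero : rep hv κ 0 = 0 :=
  matrix_ext fun i j => by rw [entry_rep, vl_zero, mul_zero, entry_zero]

theorem rep_scl_mul {x : Hs} (hx : x ∈ opRing) (c : K) : rep hv κ (scl c * x) = c • rep hv κ x :=
  matrix_ext fun i j => by rw [entry_smul, entry_rep, entry_rep, vl_scl_mul hx]; ring

theorem rep_one : rep hv κ 1 = 1 := by
  classical
  refine matrix_ext fun i j => ?_
  rw [entry_rep, entry_one, vl_one]
  by_cases h : i = j
  · subst h; simp
  · rw [if_neg h, if_neg, mul_zero]
    exact fun e => h (hv.mono.injective (by omega))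

/-- The matrix product sums only over intermediate indices in the frame, so the contributions
through v_m with m outside the frame must vanish. -/
theorem rep_mul_of_vanish {x y : Hs} (hκ : κ ≠ 0) (hx : x ∈ opRing) (hy : y ∈ opRing)
    (h : ∀ i j, ∀ e : ℤ, (∀ m, (v j : ℤ) - v m ≠ e) →
      vl x (v j - v i - e) ((v j : ℂ) - e) * vl y e (v j) = 0) :
    rep hv κ (x * y) = rep hv κ x * rep hv κ y := by
  refine matrix_ext fun i j => ?_
  obtain ⟨N, hN⟩ := exists_lowBd x
  obtain ⟨M, hM⟩ := exists_lowBd y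
  let S : Finset ι := (Finset.range (v j + M + 1)).preimage v hv.mono.injective.injOn
  rw [entry_mul _ _ _ _ S, entry_rep, vl_mul hx hy hN hM, Finset.mul_sum]
  · set R := max ((v j : ℤ) - v i + N) (v j)
    rw [Finset.sum_subset (s₂ := Finset.Icc (-(M : ℤ)) R)]
    · symm
      refine Finset.sum_of_injOn (fun m => (v j : ℤ) - v m) ?_ ?_ ?_ ?_
      · intro a _ b _ hab
        exact hv.mono.injective (by simp only at hab; omega)
      · intro m hm
        simp only [Finset.coe_preimage, Set.mem_preimage, Finset.mem_coe, Finset.mem_range, S] at hm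
        simp only [Finset.coe_Icc, Set.mem_Icc]
        omega
      · intro e he he'
        rw [h i j e, mul_zero]
        intro m hm
        refine he' ⟨m, ?_, hm⟩
        simp only [Finset.mem_Icc] at he
        simp only [Finset.coe_preimage, Set.mem_preimage, Finset.mem_coe, Finset.mem_range, S]
        omega
      · intro m _
        rw [entry_rep, entry_rep, show (v j : ℤ) - v i - (v j - v m) = v m - v i by ring]
        push_cast
        rw [sub_sub_cancel, show (v j : ℤ) - v i = (v m - v i) + (v j - v m) by ring, zpow_add₀ hκ]
        ring
    · exact Finset.Icc_subset_Icc_right (le_max_left _ _)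
    · intro e he he'
      simp only [Finset.mem_Icc] at he he'
      rw [hN.vl (by omega), zero_mul, mul_zero]
  · intro m hm
    simp only [Finset.mem_preimage, Finset.mem_range, S] at hm
    rw [entry_rep, hM.vl (by omega), mul_zero]

/-- Elements of gl_λ do not lead below v_0, and at λ = n they do not lead from v_n, v_{n+1}, … back
into the n-dimensional block. The block is thus multiplicative. -/
theorem rep_mul {x y : Hs} (hκ : κ ≠ 0) (hx : x ∈ glRing lam) (hy : y ∈ glRing lam) :
    rep hv κ (x * y) = rep hv κ x * rep hv κ y := by
  refine rep_mul_of_vanish hv κ hκ hx.1 hy.1 fun i j e he => ?_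
  rcases lt_or_ge (v j : ℤ) e with h | h
  · rw [vl_eq_zero_of_glRing hy h, mul_zero]
  obtain ⟨m, hm⟩ := Int.eq_ofNat_of_zero_le (show 0 ≤ (v j : ℤ) - e by omega)
  have hmr : m ∉ Set.range v := fun ⟨i, hi⟩ => he i (by omega)
  rcases hv.range with hr | ⟨n, hn, hr⟩
  · exact absurd (hr m) hmr
  · have hmn : n ≤ m := not_lt.1 fun h => hmr ((hr m).2 h)
    have hi : v i < n := (hr _).1 ⟨i, rfl⟩
    obtain ⟨t, rfl⟩ := Nat.exists_eq_add_of_le hmn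
    have e1 : (v j : ℂ) - e = lam + t := by
      rw [hn]
      have := congrArg (Int.cast (R := ℂ)) hm
      push_cast at this
      exact this
    rw [e1, vl_eq_zero_of_glRing' hx (by omega), zero_mul]

/-- The Cartan element `h / 2z`. -/
def hOp (lam : ℂ) : Hs :=
  sgl 0 (Polynomial.C ((2 * zz)⁻¹) * (Polynomial.C (algebraMap ℂ K (lam - 1)) - 2 * Polynomial.X))

theorem hOp_mem_glRing (lam : ℂ) : hOp lam ∈ glRing lam :=
  sgl_mem_glRing (by rw [wPoly_of_nonpos lam le_rfl]; exact one_dvd _)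

theorem lowBd_hOp (lam : ℂ) : LowBd 0 (hOp lam) := fun d hd => by
  rw [hOp, cf_sgl, if_neg (by omega)]

theorem ev_hOp (lam s : ℂ) : ev s (Polynomial.C ((2 * zz)⁻¹)
    * (Polynomial.C (algebraMap ℂ K (lam - 1)) - 2 * Polynomial.X))
      = (2 * zz)⁻¹ * algebraMap ℂ K (lam - 1 - 2 * s) := by
  simp only [map_mul, map_sub, ev_C, ev_X, map_ofNat]

theorem sig_hOp (lam : ℂ) : sig lam (hOp lam) = -hOp lam := by
  refine opRing_ext_vl (sig_mem _ _) (neg_mem (sgl_mem _ _)) fun d s => ?_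
  rw [vl_sig, vl_neg, hOp, vl_sgl, vl_sgl]
  split_ifs with h
  · subst h
    rw [ev_hOp, ev_hOp]
    simp only [Int.natAbs_zero, pow_zero, one_mul, Int.cast_zero, add_zero, ← mul_neg, ← map_neg]
    congr 2
    ring
  · simp

/-- The entry in place d carries the factor (kz)^d, whose derivative multiplies it by d/z.
Commutation with h/2z does the same; the choice h/2, rather than a shift of it, keeps the extra term
skew. -/
theorem matDeriv_rep {k : ℂ} (hk : k ≠ 0) {x : Hs} (hx : x ∈ opRing) :
    matDeriv (rep hv (algebraMap ℂ K k * zz) x) = rep hv (algebraMap ℂ K k * zz)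
      ((dl * x - x * dl) + (hOp lam * x - x * hOp lam)) := by
  refine matrix_ext fun i j => ?_
  have hz := zz_ne_zero
  rw [entry_matDeriv, entry_rep, entry_rep, dz_mul, dz_zpow hk, vl_add, vl_dl_comm hx, vl_sub, hOp,
    vl_sgl_mul hx, vl_mul_sgl hx, ev_hOp, ev_hOp]
  simp only [sub_zero, Int.cast_zero]
  have h2 : (2 : K) ≠ 0 := two_ne_zero
  push_cast [map_sub, map_mul, map_ofNat]
  field_simp
  ring

/-- The gauge action in terms of connections. -/
theorem rep_gdef {k : ℂ} (hk : k ≠ 0) {a b x : Hs} (ha : a ∈ glRing lam) (hb : b ∈ glRing lam)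
    (hx : x ∈ glRing lam) :
    rep hv (algebraMap ℂ K k * zz) (scl (algebraMap ℂ K k * zz) * gdef (b + hOp lam) x (a + hOp lam))
      = rep hv (algebraMap ℂ K k * zz) (scl (algebraMap ℂ K k * zz) * (Fop + b))
          * rep hv (algebraMap ℂ K k * zz) x
        - rep hv (algebraMap ℂ K k * zz) x
          * rep hv (algebraMap ℂ K k * zz) (scl (algebraMap ℂ K k * zz) * (Fop + a))
        + (algebraMap ℂ K k * zz) • matDeriv (rep hv (algebraMap ℂ K k * zz) x) := by
  set κ := algebraMap ℂ K k * zz with hκd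
  have hκ : κ ≠ 0 := mul_ne_zero (by simpa using hk) zz_ne_zero
  have hs := scl_mem_glRing lam κ
  have hF := Fop_mem_glRing lam
  have hh := hOp_mem_glRing lam
  have hdl := dl_comm_mem_glRing hx
  rw [matDeriv_rep hv hk hx.1, ← rep_mul hv κ hκ (mul_mem hs (add_mem hF hb)) hx,
    ← rep_mul hv κ hκ hx (mul_mem hs (add_mem hF ha)),
    ← rep_scl_mul hv κ (add_mem hdl.1 (sub_mem (mul_mem hh.1 hx.1) (mul_mem hx.1 hh.1))), ← rep_sub,
    ← rep_add, gdef_eq]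
  congr 1
  rw [← mul_assoc x, ← scl_comm hx.1]
  noncomm_ring

end Rep

/-! ### The algebra `gl_λ` in terms of operators -/

/-- The matrix of an operator in the basis `v_0, v_1, …` of the Verma module. -/
abbrev repV (lam : ℂ) (x : Hs) : Mat ℕ := rep (isFrame_id lam) 1 x

theorem entry_repV (lam : ℂ) (x : Hs) (i j : ℕ) : entry (repV lam x) i j = vl x (j - i) j := by
  rw [entry_rep, one_zpow, one_mul]; rfl

theorem repV_add (lam : ℂ) (x y : Hs) : repV lam (x + y) = repV lam x + repV lam y := rep_add _ _ x y
theorem repV_sub (lam : ℂ) (x y : Hs) : repV lam (x - y) = repV lam x - repV lam y := rep_sub _ _ x y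
theorem repV_neg (lam : ℂ) (x : Hs) : repV lam (-x) = -repV lam x := rep_neg _ _ x
theorem repV_zero (lam : ℂ) : repV lam 0 = 0 := rep_zero _ _
theorem repV_one (lam : ℂ) : repV lam 1 = 1 := rep_one _ _

theorem repV_scl_mul (lam : ℂ) {x : Hs} (hx : x ∈ opRing) (c : K) :
    repV lam (scl c * x) = c • repV lam x := rep_scl_mul _ _ hx c

theorem repV_mul {lam : ℂ} {x y : Hs} (hx : x ∈ glRing lam) (hy : y ∈ glRing lam) :
    repV lam (x * y) = repV lam x * repV lam y := rep_mul _ _ one_ne_zero hx hy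

/-- The matrix shows each coefficient at all sufficiently large integers, which determines a
polynomial. -/
theorem repV_injective {lam : ℂ} {x y : Hs} (hx : x ∈ opRing) (hy : y ∈ opRing)
    (h : repV lam x = repV lam y) : x = y := by
  refine opRing_ext hx hy fun d => ev_ext_nat d.toNat fun n hn => ?_
  have := congrArg (fun A => entry A (n - d).toNat n) h
  simp only [entry_repV] at this
  rwa [Int.toNat_of_nonneg (by omega), sub_sub_cancel] at this

/-- Elements of `gl_λ` and operators with the same matrix. -/
def Same (lam : ℂ) (g : Gl lam) (x : Hs) : Prop :=
  x ∈ glRing lam ∧ verma lam g = repV lam x ∧ verma lam (sigma lam g).unop = repV lam (sig lam x)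

theorem Same.mul {lam : ℂ} {g h : Gl lam} {x y : Hs} (hx : Same lam g x) (hy : Same lam h y) :
    Same lam (g * h) (x * y) := by
  refine ⟨mul_mem hx.1 hy.1, ?_, ?_⟩
  · rw [map_mul, hx.2.1, hy.2.1, repV_mul hx.1 hy.1]
  · rw [map_mul, MulOpposite.unop_mul, map_mul, hx.2.2, hy.2.2, sig_mul hx.1.1 hy.1.1,
      repV_mul (sig_mem_glRing hy.1) (sig_mem_glRing hx.1)]

theorem Same.add {lam : ℂ} {g h : Gl lam} {x y : Hs} (hx : Same lam g x) (hy : Same lam h y) :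
    Same lam (g + h) (x + y) := by
  refine ⟨add_mem hx.1 hy.1, ?_, ?_⟩
  · rw [map_add, hx.2.1, hy.2.1, repV_add]
  · rw [map_add, MulOpposite.unop_add, map_add, hx.2.2, hy.2.2, sig_add, repV_add]

theorem Same.smul {lam : ℂ} {g : Gl lam} {x : Hs} (hx : Same lam g x) (c : ℂ) :
    Same lam (c • g) (scl (algebraMap ℂ K c) * x) := by
  refine ⟨mul_mem (scl_mem_glRing lam _) hx.1, ?_, ?_⟩
  · rw [map_smul, hx.2.1, repV_scl_mul _ hx.1.1, algebraMap_smul]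
  · rw [map_smul, MulOpposite.unop_smul, map_smul, hx.2.2, sig_scl_mul hx.1.1,
      repV_scl_mul _ (sig_mem _ _), algebraMap_smul]

theorem Same.one (lam : ℂ) : Same lam 1 1 :=
  ⟨one_mem _, by rw [map_one, repV_one],
    by rw [map_one, MulOpposite.unop_one, map_one, sig_one, repV_one]⟩

theorem Same.pow {lam : ℂ} {g : Gl lam} {x : Hs} (hx : Same lam g x) (m : ℕ) :
    Same lam (g ^ m) (x ^ m) := by
  induction m with
  | zero => rw [pow_zero, pow_zero]; exact Same.one lam
  | succ m ih => rw [pow_succ, pow_succ]; exact ih.mul hx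

/-- The operator `e`. -/
def eOp (lam : ℂ) : Hs := sgl 1 (wPoly lam 1)

/-- The operator `h`. -/
def hPol (lam : ℂ) : K[X] := Polynomial.C (algebraMap ℂ K (lam - 1)) - 2 * Polynomial.X

theorem ev_hPol (lam s : ℂ) : ev s (hPol lam) = algebraMap ℂ K (lam - 1 - 2 * s) := by
  simp only [hPol, map_mul, map_sub, ev_C, ev_X, map_ofNat]

theorem wPoly_one (lam : ℂ) : wPoly lam 1 = wFactor lam 0 := by
  have := wPoly_succ lam 0
  rw [Nat.cast_zero, zero_add, wPoly_of_nonpos lam le_rfl, mul_one] at this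
  exact this

theorem eOp_mem (lam : ℂ) : eOp lam ∈ glRing lam := sgl_mem_glRing dvd_rfl

theorem sgl_zero_mem (lam : ℂ) (p : K[X]) : sgl 0 p ∈ glRing lam :=
  sgl_mem_glRing (by rw [wPoly_of_nonpos lam le_rfl]; exact one_dvd _)

theorem sig_sgl (lam : ℂ) (d : ℤ) (p : K[X]) :
    sig lam (sgl d p) = sgl d ((-1) ^ d.natAbs * refl (lam - 1 + d) p) := by
  refine opRing_ext (sig_mem _ _) (sgl_mem _ _) fun e => ?_
  rw [cf_sig, cf_sgl, cf_sgl]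
  split_ifs with h
  · rw [h]
  · rw [map_zero, mul_zero]

theorem sig_eOp (lam : ℂ) : sig lam (eOp lam) = -eOp lam := by
  rw [eOp, sig_sgl, refl_wPoly]
  refine opRing_ext (sgl_mem _ _) (neg_mem (sgl_mem _ _)) fun e => ?_
  rw [cf_neg, cf_sgl, cf_sgl]
  split_ifs <;> simp

theorem sig_sgl_hPol (lam : ℂ) : sig lam (sgl 0 (hPol lam)) = -sgl 0 (hPol lam) := by
  rw [sig_sgl]
  refine opRing_ext_vl (sgl_mem _ _) (neg_mem (sgl_mem _ _)) fun e s => ?_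
  rw [vl_neg, vl_sgl, vl_sgl]
  split_ifs
  · rw [map_mul, ev_refl, ev_hPol, ev_hPol, ← map_neg]
    simp only [Int.natAbs_zero, pow_zero, map_one, one_mul, Int.cast_zero, add_zero]
    congr 1
    ring
  · simp

theorem ofCols_smul_bas_entry {ι : Type} [DecidableEq ι] (c : ι → K) (g : ι → ι) (i j : ι) :
    entry (ofCols fun j => c j • bas (g j)) i j = if g j = i then c j else 0 := by
  rw [entry_ofCols, Finsupp.smul_apply, bas, Finsupp.single_apply]
  split_ifs <;> simp

theorem vF_eq_repV (lam : ℂ) : vF = repV lam Fop := by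
  refine matrix_ext fun i j => ?_
  rw [entry_repV, vl_Fop, vF, entry_ofCols, bas, Finsupp.single_apply]
  exact if_congr (by omega) rfl rfl

theorem vH_eq_repV (lam : ℂ) : vH lam = repV lam (sgl 0 (hPol lam)) := by
  refine matrix_ext fun i j => ?_
  rw [entry_repV, vl_sgl, vH, ofCols_smul_bas_entry _ fun j => j, ev_hPol]
  exact if_congr (by omega) rfl rfl

theorem vE_eq_repV (lam : ℂ) : vE lam = repV lam (eOp lam) := by
  refine matrix_ext fun i j => ?_
  rw [entry_repV, eOp, vl_sgl, vE, ofCols_smul_bas_entry _ fun j => j - 1, wPoly_one, ev_wFactor]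
  rcases j with _ | j
  · simp
  · rw [if_congr (show j + 1 - 1 = i ↔ ((j + 1 : ℕ) : ℤ) - i = 1 by omega) rfl rfl]
    simp

theorem verma_toU (lam : ℂ) (x : sl2) : verma lam (toGl lam (toU x)) = vermaLie lam x := by
  refine (RingQuot.liftAlgHom_mkAlgHom_apply ℂ _ _ _).trans ?_
  exact UniversalEnvelopingAlgebra.lift_ι_apply ℂ (vermaLie lam) x

theorem same_sl2 (lam : ℂ) (x : sl2) : Same lam (toGl lam (toU x))
    (scl (algebraMap ℂ K (x.1 0 1)) * eOp lam + scl (algebraMap ℂ K (x.1 1 0)) * Fop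
      + scl (algebraMap ℂ K (x.1 0 0)) * sgl 0 (hPol lam)) := by
  have h1 := (eOp_mem lam).1
  have h3 : sgl 0 (hPol lam) ∈ opRing := sgl_mem _ _
  have key : vermaLie lam x = repV lam (scl (algebraMap ℂ K (x.1 0 1)) * eOp lam
      + scl (algebraMap ℂ K (x.1 1 0)) * Fop + scl (algebraMap ℂ K (x.1 0 0)) * sgl 0 (hPol lam)) := by
    rw [repV_add, repV_add, repV_scl_mul _ h1, repV_scl_mul _ Fop_mem, repV_scl_mul _ h3,
      ← vE_eq_repV, ← vF_eq_repV, ← vH_eq_repV, algebraMap_smul, algebraMap_smul, algebraMap_smul]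
    rfl
  refine ⟨add_mem (add_mem (mul_mem (scl_mem_glRing _ _) (eOp_mem lam))
    (mul_mem (scl_mem_glRing _ _) (Fop_mem_glRing lam)))
    (mul_mem (scl_mem_glRing _ _) (sgl_zero_mem _ _)), ?_, ?_⟩
  · rw [verma_toU, key]
  · rw [sigma_sl2, MulOpposite.unop_op, map_neg, verma_toU, key, sig_add, sig_add, sig_scl_mul h1,
      sig_scl_mul Fop_mem, sig_scl_mul h3, sig_eOp, sig_Fop, sig_sgl_hPol, ← repV_neg]
    congr 1
    noncomm_ring

/-- `U(sl₂)` is generated by `sl₂`. -/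
theorem mem_of_toU_mem (S : Subalgebra ℂ U) (hS : ∀ x : sl2, toU x ∈ S) (u : U) : u ∈ S := by
  let φ : sl2 →ₗ⁅ℂ⁆ S :=
    { toFun := fun x => ⟨toU x, hS x⟩
      map_add' := fun x y => Subtype.ext (map_add toU x y)
      map_smul' := fun c x => Subtype.ext (map_smul toU c x)
      map_lie' := fun {x y} => Subtype.ext (LieHom.map_lie toU x y) }
  have hid : S.val.comp (UniversalEnvelopingAlgebra.lift ℂ φ) = AlgHom.id ℂ U := by
    refine UniversalEnvelopingAlgebra.hom_ext (R := ℂ) (LieHom.ext fun x => ?_)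
    exact congrArg Subtype.val (UniversalEnvelopingAlgebra.lift_ι_apply ℂ φ x)
  have h := congrArg (fun ψ : U →ₐ[ℂ] U => ψ u) hid
  simp only [AlgHom.comp_apply, AlgHom.id_apply] at h
  rw [← h]
  exact (UniversalEnvelopingAlgebra.lift ℂ φ u).2

/-- The elements that have an operator form a subalgebra of U(sl₂) containing sl₂. The second half
of `Same` records that the abstract anti-involution becomes `sig`. -/
theorem exists_same (lam : ℂ) (g : Gl lam) : ∃ x, Same lam g x := by
  let S : Subalgebra ℂ U :=
    { carrier := {u | ∃ x, Same lam (toGl lam u) x}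
      mul_mem' := by
        rintro a b ⟨x, hx⟩ ⟨y, hy⟩
        exact ⟨x * y, by rw [map_mul]; exact hx.mul hy⟩
      add_mem' := by
        rintro a b ⟨x, hx⟩ ⟨y, hy⟩
        exact ⟨x + y, by rw [map_add]; exact hx.add hy⟩
      algebraMap_mem' := by
        intro c
        refine ⟨scl (algebraMap ℂ K c) * 1, ?_⟩
        rw [Algebra.algebraMap_eq_smul_one, map_smul, map_one]
        exact (Same.one lam).smul c }
  obtain ⟨u, rfl⟩ := RingQuot.mkAlgHom_surjective ℂ (CasimirRel lam) g
  exact mem_of_toU_mem S (fun x => ⟨_, same_sl2 lam x⟩) u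

theorem sigma_sigma (lam : ℂ) (g : Gl lam) :
    sigma lam (sigma lam g).unop = MulOpposite.op g := by
  let S : Subalgebra ℂ U :=
    { carrier := {u | sigma lam (sigma lam (toGl lam u)).unop = MulOpposite.op (toGl lam u)}
      mul_mem' := by
        intro a b ha hb
        simp only [Set.mem_ofPred_eq] at ha hb ⊢
        rw [map_mul, map_mul, MulOpposite.unop_mul, map_mul, ha, hb, MulOpposite.op_mul]
      add_mem' := by
        intro a b ha hb
        simp only [Set.mem_ofPred_eq] at ha hb ⊢
        rw [map_add, map_add, MulOpposite.unop_add, map_add, ha, hb, MulOpposite.op_add]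
      algebraMap_mem' := by
        intro c
        simp only [Set.mem_ofPred_eq, AlgHom.commutes]
        simp only [MulOpposite.algebraMap_apply, MulOpposite.unop_op, AlgHom.commutes] }
  obtain ⟨u, rfl⟩ := RingQuot.mkAlgHom_surjective ℂ (CasimirRel lam) g
  refine mem_of_toU_mem S (fun x => ?_) u
  change sigma lam (sigma lam (toGl lam (toU x))).unop = _
  rw [sigma_sl2, MulOpposite.unop_op, map_neg, sigma_sl2, MulOpposite.op_neg, neg_neg]

theorem exists_skew_of_mem_span {lam : ℂ} {B : Mat ℕ}
    (hB : B ∈ Submodule.span K (verma lam '' po lam)) :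
    ∃ x ∈ glRing lam, sig lam x = -x ∧ B = repV lam x := by
  induction hB using Submodule.span_induction with
  | mem B hB =>
    obtain ⟨g, hg, rfl⟩ := hB
    obtain ⟨x, hx, h1, h2⟩ := exists_same lam g
    refine ⟨x, hx, ?_, h1⟩
    rw [show sigma lam g = MulOpposite.op (-g) from hg, MulOpposite.unop_op, map_neg, h1, ← repV_neg] at h2
    exact (repV_injective (neg_mem hx.1) (sig_mem _ _) h2).symm
  | zero => exact ⟨0, zero_mem _, by rw [sig_zero, neg_zero], by rw [repV_zero]⟩
  | add A B _ _ hA hB =>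
    obtain ⟨x, hx, sx, rfl⟩ := hA
    obtain ⟨y, hy, sy, rfl⟩ := hB
    exact ⟨x + y, add_mem hx hy, by rw [sig_add, sx, sy, neg_add], by rw [repV_add]⟩
  | smul c A _ hA =>
    obtain ⟨x, hx, sx, rfl⟩ := hA
    refine ⟨scl c * x, mul_mem (scl_mem_glRing _ _) hx, ?_, by rw [repV_scl_mul _ hx.1]⟩
    refine opRing_ext (sig_mem _ _) (neg_mem (mul_mem (scl_mem _) hx.1)) fun d => ?_
    have e := congrArg (fun y => cf y d) sx
    simp only [cf_neg] at e
    rw [cf_sig] at e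
    rw [cf_sig, cf_neg, cf_scl_mul hx.1, map_mul,
      show refl (lam - 1 + d) (Polynomial.C c) = Polynomial.C c from (refl _).commutes _]
    linear_combination Polynomial.C c * e

theorem skew_mem_span {lam : ℂ} {g : Gl lam} {x : Hs} (h : Same lam g x) :
    repV lam (x - sig lam x) ∈ Submodule.span K (verma lam '' po lam) := by
  refine Submodule.subset_span ⟨g - (sigma lam g).unop, ?_, ?_⟩
  · change sigma lam _ = MulOpposite.op (-_)
    rw [map_sub, sigma_sigma, neg_sub]
    rfl
  · rw [map_sub, h.2.1, h.2.2, repV_sub]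

/-! ### The loop algebras in terms of operators -/

/-- Diagonals of skew elements of `gl_λ`. -/
def PoPoly (lam : ℂ) (d : ℤ) (p : K[X]) : Prop :=
  wPoly lam d ∣ p ∧ (-1) ^ d.natAbs * refl (lam - 1 + d) p = -p

theorem PoPoly.const_mul {lam : ℂ} {d : ℤ} {p : K[X]} (h : PoPoly lam d p) (c : K) :
    PoPoly lam d (Polynomial.C c * p) := by
  refine ⟨dvd_mul_of_dvd_right h.1 _, ?_⟩
  rw [map_mul, show refl (lam - 1 + d) (Polynomial.C c) = Polynomial.C c from (refl _).commutes _]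
  linear_combination Polynomial.C c * h.2

/-- The operators that are skew under `σ`. -/
def poOp (lam : ℂ) : AddSubgroup Hs where
  carrier := {x | x ∈ glRing lam ∧ sig lam x = -x}
  zero_mem' := ⟨zero_mem _, by rw [sig_zero, neg_zero]⟩
  add_mem' hx hy := ⟨add_mem hx.1 hy.1, by rw [sig_add, hx.2, hy.2, neg_add]⟩
  neg_mem' hx := ⟨neg_mem hx.1, by rw [sig_neg, hx.2]⟩

theorem mem_poOp_iff {lam : ℂ} {x : Hs} :
    x ∈ poOp lam ↔ x ∈ opRing ∧ ∀ d, PoPoly lam d (cf x d) := by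
  constructor
  · rintro ⟨hx, h⟩
    refine ⟨hx.1, fun d => ⟨hx.2 d, ?_⟩⟩
    rw [← cf_sig, h, cf_neg]
  · rintro ⟨hx, h⟩
    refine ⟨⟨hx, fun d => (h d).1⟩, opRing_ext (sig_mem _ _) (neg_mem hx) fun d => ?_⟩
    rw [cf_sig, cf_neg, (h d).2]

theorem poPoly_zero (lam : ℂ) (d : ℤ) : PoPoly lam d 0 := ⟨dvd_zero _, by simp⟩

theorem mkOp_mem_poOp {lam : ℂ} (N : ℤ) {p : ℤ → K[X]} (h : ∀ d, PoPoly lam d (p d)) :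
    mkOp N p ∈ poOp lam := by
  refine mem_poOp_iff.2 ⟨mkOp_mem _ _, fun d => ?_⟩
  rw [cf_mkOp]
  split_ifs
  · exact h d
  · exact poPoly_zero lam d

theorem sgl_mem_poOp {lam : ℂ} {d : ℤ} {p : K[X]} (h : PoPoly lam d p) : sgl d p ∈ poOp lam := by
  refine mem_poOp_iff.2 ⟨sgl_mem _ _, fun e => ?_⟩
  rw [cf_sgl]
  split_ifs with he
  · exact he ▸ h
  · exact poPoly_zero lam e

theorem scl_mul_mem_poOp {lam : ℂ} {x : Hs} (hx : x ∈ poOp lam) (c : K) : scl c * x ∈ poOp lam := by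
  obtain ⟨h1, h2⟩ := mem_poOp_iff.1 hx
  refine mem_poOp_iff.2 ⟨mul_mem (scl_mem _) h1, fun d => ?_⟩
  rw [cf_scl_mul h1]
  exact (h2 d).const_mul c

theorem hOp_mem_poOp (lam : ℂ) : hOp lam ∈ poOp lam := ⟨hOp_mem_glRing lam, sig_hOp lam⟩

theorem Fop_mem_poOp (lam : ℂ) : Fop ∈ poOp lam := ⟨Fop_mem_glRing lam, sig_Fop lam⟩

theorem skew_part_mem_poOp {lam : ℂ} {x : Hs} (hx : x ∈ glRing lam) : x - sig lam x ∈ poOp lam :=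
  ⟨sub_mem hx (sig_mem_glRing hx), by rw [sig_sub, sig_sig hx.1, neg_sub]⟩

theorem sgl_mul_sgl (d e : ℤ) (p q : K[X]) : sgl d p * sgl e q = sgl (d + e) (tr (-e) p * q) := by
  refine Hs.ext fun i => ?_
  rw [sgl, Hs.coeff_single_mul, coeff_sgl, coeff_sgl]
  split_ifs with h1 h2 h2
  · obtain rfl : i = d + e := by omega
    rw [op_mul, add_sub_cancel_left]
  · omega
  · omega
  · rw [op_zero, op_zero, mul_zero]

theorem eOp_pow (lam : ℂ) (d : ℕ) : eOp lam ^ d = sgl d (wPoly lam d) := by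
  induction d with
  | zero =>
    rw [pow_zero, Nat.cast_zero, wPoly_of_nonpos lam le_rfl]
    exact opRing_ext (one_mem _) (sgl_mem _ _) fun e => by rw [cf_one, cf_sgl]
  | succ d ih =>
    rw [pow_succ', ih, eOp, sgl_mul_sgl, wPoly_one, tr_wFactor, zero_add, ← wPoly_succ, add_comm]
    rfl

theorem Fop_pow (d : ℕ) : Fop ^ d = sgl (-d) 1 := by
  induction d with
  | zero =>
    rw [pow_zero, Nat.cast_zero, neg_zero]
    exact opRing_ext (one_mem _) (sgl_mem _ _) fun e => by rw [cf_one, cf_sgl]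
  | succ d ih =>
    rw [pow_succ, ih, Fop, sgl_mul_sgl, map_one, mul_one]
    push_cast
    rw [neg_add]

theorem sgl_zero_pow (p : K[X]) (m : ℕ) : sgl 0 p ^ m = sgl 0 (p ^ m) := by
  induction m with
  | zero =>
    rw [pow_zero, pow_zero]
    exact opRing_ext (one_mem _) (sgl_mem _ _) fun e => by rw [cf_one, cf_sgl]
  | succ m ih => rw [pow_succ, ih, sgl_mul_sgl, neg_zero, tr_zero, pow_succ, zero_add]

theorem exists_same_of_toU (lam : ℂ) :
    (∃ g, Same lam g (eOp lam)) ∧ (∃ g, Same lam g Fop) ∧ ∃ g, Same lam g (sgl 0 (hPol lam)) := by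
  have hE := same_sl2 lam sl2E
  have hF := same_sl2 lam sl2F
  have hH := same_sl2 lam sl2H
  simp only [sl2E, sl2F, sl2H, Matrix.of_apply, Matrix.cons_val_zero, Matrix.cons_val_one, map_one,
    map_zero, scl_zero, scl_one, one_mul, zero_mul, add_zero, zero_add, Matrix.cons_val_fin_one]
    at hE hF hH
  exact ⟨⟨_, hE⟩, ⟨_, hF⟩, ⟨_, hH⟩⟩

theorem exists_same_X (lam : ℂ) : ∃ g, Same lam g (sgl 0 Polynomial.X) := by
  obtain ⟨g, hg⟩ := (exists_same_of_toU lam).2.2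
  have := (((Same.one lam).smul (lam - 1)).add (hg.smul (-1))).smul (1 / 2)
  have e : sgl 0 Polynomial.X = scl (algebraMap ℂ K (1 / 2)) *
      (scl (algebraMap ℂ K (lam - 1)) * 1 + scl (algebraMap ℂ K (-1)) * sgl 0 (hPol lam)) := by
    refine opRing_ext_vl (sgl_mem _ _) (mul_mem (scl_mem _) (add_mem (mul_mem (scl_mem _)
      (one_mem _)) (mul_mem (scl_mem _) (sgl_mem _ _)))) fun d s => ?_
    rw [vl_scl_mul (add_mem (mul_mem (scl_mem _) (one_mem _)) (mul_mem (scl_mem _) (sgl_mem _ _))),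
      vl_add, vl_scl_mul (one_mem _), vl_scl_mul (sgl_mem _ _), vl_sgl, vl_sgl, vl_one, ev_X, ev_hPol]
    split_ifs
    · rw [← map_one (algebraMap ℂ K), ← map_mul, ← map_mul, ← map_add, ← map_mul]
      congr 1
      ring
    · simp
  exact ⟨_, e ▸ this⟩

/-- Place d of gl_λ consists of e^d, or f^{|d|}, times polynomials in h; the row index is an affine
function of h. -/
theorem exists_same_wPoly_mul (lam : ℂ) (d : ℤ) (m : ℕ) :
    ∃ g, Same lam g (sgl d (wPoly lam d * Polynomial.X ^ m)) := by
  obtain ⟨x, hx⟩ := exists_same_X lam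
  obtain ⟨⟨e, he⟩, ⟨f, hf⟩, -⟩ := exists_same_of_toU lam
  have hxm := hx.pow m
  rw [sgl_zero_pow] at hxm
  rcases Int.eq_nat_or_neg d with ⟨d, rfl | rfl⟩
  · have := (he.pow d).mul hxm
    rw [eOp_pow, sgl_mul_sgl, neg_zero, tr_zero, add_zero] at this
    exact ⟨_, this⟩
  · have := (hf.pow d).mul hxm
    rw [Fop_pow, sgl_mul_sgl, neg_zero, tr_zero, add_zero] at this
    rw [wPoly_of_nonpos lam (by omega)]
    exact ⟨_, this⟩

theorem sgl_add (d : ℤ) (p q : K[X]) : sgl d (p + q) = sgl d p + sgl d q :=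
  opRing_ext (sgl_mem _ _) (add_mem (sgl_mem _ _) (sgl_mem _ _)) fun e => by
    rw [cf_add, cf_sgl, cf_sgl, cf_sgl]; split_ifs <;> simp

theorem sgl_const_mul (d : ℤ) (c : K) (p : K[X]) : sgl d (Polynomial.C c * p) = scl c * sgl d p :=
  opRing_ext (sgl_mem _ _) (mul_mem (scl_mem _) (sgl_mem _ _)) fun e => by
    rw [cf_scl_mul (sgl_mem _ _), cf_sgl, cf_sgl]; split_ifs <;> simp

theorem sig_scl_mul' {lam : ℂ} {x : Hs} (hx : x ∈ opRing) (c : K) :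
    sig lam (scl c * x) = scl c * sig lam x := by
  refine opRing_ext (sig_mem _ _) (mul_mem (scl_mem _) (sig_mem _ _)) fun d => ?_
  rw [cf_sig, cf_scl_mul hx, cf_scl_mul (sig_mem _ _), cf_sig, map_mul,
    show refl (lam - 1 + d) (Polynomial.C c) = Polynomial.C c from (refl _).commutes _]
  ring

theorem skew_sgl_mem_span (lam : ℂ) (d : ℤ) (q : K[X]) :
    repV lam (sgl d (wPoly lam d * q) - sig lam (sgl d (wPoly lam d * q))) ∈
      Submodule.span K (verma lam '' po lam) := by
  induction q using Polynomial.induction_on' with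
  | add p q hp hq =>
    rw [mul_add, sgl_add, sig_add, add_sub_add_comm, repV_add]
    exact add_mem hp hq
  | monomial m c =>
    rw [← Polynomial.C_mul_X_pow_eq_monomial, mul_left_comm, sgl_const_mul,
      sig_scl_mul' (sgl_mem _ _), ← mul_sub, repV_scl_mul _ (sub_mem (sgl_mem _ _) (sig_mem _ _))]
    obtain ⟨g, hg⟩ := exists_same_wPoly_mul lam d m
    exact Submodule.smul_mem _ _ (skew_mem_span hg)

theorem scl_half_mul_add (x : Hs) : scl (1 / 2) * (x + x) = x := by
  rw [← two_mul, ← mul_assoc, show (2 : Hs) = scl 2 by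
    rw [← one_add_one_eq_two, ← one_add_one_eq_two (R := K), scl_add, scl_one], ← scl_mul, one_div_mul_cancel two_ne_zero, scl_one, one_mul]

theorem sgl_mem_span_of_poPoly {lam : ℂ} {d : ℤ} {p : K[X]} (h : PoPoly lam d p) :
    repV lam (sgl d p) ∈ Submodule.span K (verma lam '' po lam) := by
  obtain ⟨q, hq⟩ := h.1
  have := skew_sgl_mem_span lam d q
  rw [← hq, (sgl_mem_poOp h).2, sub_neg_eq_add] at this
  have h2 := Submodule.smul_mem _ (1 / 2 : K) this
  rwa [← repV_scl_mul _ (add_mem (sgl_mem _ _) (sgl_mem _ _)), scl_half_mul_add] at h2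

/-- Membership is tested diagonal by diagonal: diagonals of po_λ ⊗ ℂ((z)) are exactly the
W_d-multiples with the right reflection symmetry. -/
theorem loopPo_eq (lam : ℂ) {κ : K} (hκ : κ ≠ 0) (A : Mat ℕ) :
    A ∈ loopPo lam ↔ ∃ x ∈ poOp lam, A = rep (isFrame_id lam) κ x := by
  constructor
  · rintro ⟨⟨N, hN⟩, h⟩
    have h' : ∀ d : ℤ, ∃ x ∈ poOp lam, ∀ i j : ℕ, (j : ℤ) - i = d → entry A i j = vl x d j := by
      intro d
      obtain ⟨B, hB, hAB⟩ := h d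
      obtain ⟨x, hx, sx, rfl⟩ := exists_skew_of_mem_span hB
      refine ⟨x, ⟨hx, sx⟩, fun i j hij => ?_⟩
      rw [hAB i j hij, entry_repV, hij]
    choose x hx hA using h'
    -- The factor κ^{-d} undoes the scaling of the basis built into `rep`.
    refine ⟨mkOp N fun d => Polynomial.C (κ ^ (-d)) * cf (x d) d, mkOp_mem_poOp _ fun d =>
      ((mem_poOp_iff.1 (hx d)).2 d).const_mul _, matrix_ext fun i j => ?_⟩
    rw [entry_rep, vl_mkOp]
    simp only [id_eq]
    split_ifs with hd
    · rw [hA _ i j rfl, map_mul, ev_C, zpow_neg, mul_inv_cancel_left₀ (zpow_ne_zero _ hκ)]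
      rfl
    · rw [mul_zero, hN i j (by omega)]
  · rintro ⟨x, hx, rfl⟩
    obtain ⟨hx1, hx2⟩ := mem_poOp_iff.1 hx
    obtain ⟨N, hN⟩ := exists_lowBd x
    refine ⟨⟨N, fun i j hij => ?_⟩, fun d => ⟨repV lam (sgl d (Polynomial.C (κ ^ d) * cf x d)),
      sgl_mem_span_of_poPoly ((hx2 d).const_mul _), fun i j hij => ?_⟩⟩
    · rw [entry_rep, hN.vl (by simp only [id_eq]; omega), mul_zero]
    · rw [entry_rep, entry_repV, vl_sgl, if_pos hij, map_mul, ev_C]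
      simp only [id_eq, hij]
      rfl

/-- The partial sums of the diagonal are the values of `antidiff` at integers, and any polynomial
with eventually the same values coincides with it. -/
theorem traceC_rep (lam : ℂ) (κ : K) (x : Hs) :
    traceC lam (rep (isFrame_id lam) κ x) = csum lam (cf x 0) := by
  have hs : ∀ N : ℕ, (antidiff (cf x 0)).eval (N : K)
      = ∑ i ∈ Finset.range N, entry (rep (isFrame_id lam) κ x) i i := by
    intro N
    rw [← ev_natCast, ev_antidiff_nat]
    refine Finset.sum_congr rfl fun i _ => ?_
    rw [entry_rep]
    simp only [id_eq, sub_self, zpow_zero, one_mul]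
    rfl
  have hex : ∃ P : K[X], ∀ᶠ N : ℕ in Filter.atTop,
      P.eval (N : K) = ∑ i ∈ Finset.range N, entry (rep (isFrame_id lam) κ x) i i :=
    ⟨_, Filter.Eventually.of_forall hs⟩
  rw [traceC, dif_pos hex, csum, ev_apply]
  congr 1
  obtain ⟨N, hN⟩ := Filter.eventually_atTop.1 hex.choose_spec
  refine ev_ext_nat N fun n hn => ?_
  rw [ev_natCast, ev_natCast, hN n hn, hs]

theorem traceN_rep (n : ℕ) (κ : K) (x : Hs) :
    traceN n (rep (isFrame_fin n) κ x) = csum n (cf x 0) := by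
  rw [traceN, csum_nat, ← Fin.sum_univ_eq_sum_range fun i => ev (i : ℂ) (cf x 0)]
  refine Finset.sum_congr rfl fun i _ => ?_
  rw [entry_rep, sub_self, zpow_zero, one_mul]
  rfl

theorem block_rep (n : ℕ) (κ : K) (x : Hs) :
    block n (rep (isFrame_id n) κ x) = rep (isFrame_fin n) κ x := by
  refine matrix_ext fun i j => ?_
  rw [block, entry_ofCols, Finsupp.equivFunOnFinite_symm_apply_apply, entry_rep, entry_rep]
  rfl

theorem clForm_bas_right (n : ℕ) (v : Fin n →₀ K) (i : Fin n) :
    clForm n v (bas i) = (-1) ^ (i.rev : ℕ) * v i.rev := by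
  rw [clForm, Finset.sum_eq_single i.rev]
  · rw [Fin.rev_rev, bas, Finsupp.single_eq_same, mul_one]
  · intro m _ hm
    rw [bas, Finsupp.single_eq_of_ne (fun h => hm (by rw [← h, Fin.rev_rev])), mul_zero]
  · exact fun h => absurd (Finset.mem_univ _) h

theorem clForm_bas_left (n : ℕ) (w : Fin n →₀ K) (j : Fin n) :
    clForm n (bas j) w = (-1) ^ (j : ℕ) * w j.rev := by
  rw [clForm, Finset.sum_eq_single j]
  · rw [bas, Finsupp.single_eq_same, mul_one]
  · intro m _ hm
    rw [bas, Finsupp.single_eq_of_ne hm, mul_zero, zero_mul]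
  · exact fun h => absurd (Finset.mem_univ _) h

theorem clForm_add_left (n : ℕ) (u v w : Fin n →₀ K) :
    clForm n (u + v) w = clForm n u w + clForm n v w := by
  simp only [clForm, ← Finset.sum_add_distrib, Finsupp.add_apply]
  exact Finset.sum_congr rfl fun i _ => by ring

theorem clForm_add_right (n : ℕ) (u v w : Fin n →₀ K) :
    clForm n u (v + w) = clForm n u v + clForm n u w := by
  simp only [clForm, ← Finset.sum_add_distrib, Finsupp.add_apply]
  exact Finset.sum_congr rfl fun i _ => by ring

theorem clForm_smul_left (n : ℕ) (c : K) (v w : Fin n →₀ K) :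
    clForm n (c • v) w = c * clForm n v w := by
  simp only [clForm, Finset.mul_sum, Finsupp.smul_apply, smul_eq_mul]
  exact Finset.sum_congr rfl fun i _ => by ring

theorem clForm_smul_right (n : ℕ) (c : K) (v w : Fin n →₀ K) :
    clForm n v (c • w) = c * clForm n v w := by
  simp only [clForm, Finset.mul_sum, Finsupp.smul_apply, smul_eq_mul]
  exact Finset.sum_congr rfl fun i _ => by ring

theorem mem_loopCl_iff (n : ℕ) (A : Mat (Fin n)) : A ∈ loopCl n ↔
    ∀ i j : Fin n, (-1) ^ (i : ℕ) * entry A i j = -((-1) ^ (j : ℕ) * entry A j.rev i.rev) := by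
  constructor
  · intro h i j
    have := h (bas j) (bas i.rev)
    rwa [clForm_bas_right, clForm_bas_left, Fin.rev_rev] at this
  · intro h v w
    induction v using Finsupp.induction_linear with
    | zero => rw [map_zero]; simp [clForm]
    | add u v hu hv => rw [map_add, clForm_add_left, clForm_add_left, hu, hv, neg_add]
    | single j c =>
      induction w using Finsupp.induction_linear with
      | zero => rw [map_zero]; simp [clForm]
      | add u v hu hv => rw [map_add, clForm_add_right, clForm_add_right, hu, hv, neg_add]
      | single i b =>
        have e : ∀ (i : Fin n) (c : K), Finsupp.single i c = c • bas i := fun i c => by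
          rw [bas, Finsupp.smul_single, smul_eq_mul, mul_one]
        rw [e, e, map_smul, map_smul, clForm_smul_left, clForm_smul_left, clForm_smul_right,
          clForm_smul_right, clForm_bas_right, clForm_bas_left]
        have := h i.rev j
        rw [Fin.rev_rev] at this
        rw [show (A (bas j)) i.rev = entry A i.rev j from rfl,
          show (A (bas i)) j.rev = entry A j.rev i from rfl, this]
        ring

/-- At λ = n the reflection of rows in σ is i ↦ n - 1 - i, so σ is the adjoint with respect to
`clForm`. -/
theorem vl_sig_fin (n : ℕ) (x : Hs) (i j : Fin n) : vl (sig n x) ((j : ℤ) - i) (j : ℕ)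
    = (-1) ^ (i : ℕ) * (-1) ^ (j : ℕ) * vl x ((i.rev : ℤ) - j.rev) (i.rev : ℕ) := by
  have e1 : ((i.rev : ℕ) : ℤ) - (j.rev : ℕ) = j - i := by rw [Fin.val_rev, Fin.val_rev]; omega
  rw [vl_sig, e1]
  congr 1
  · rw [← pow_add, neg_one_pow_eq_pow_mod_two, neg_one_pow_eq_pow_mod_two (_ + _)]
    congr 1
    omega
  · congr 1
    have e2 : ((i.rev : ℕ) : ℤ) = n - 1 + (j - i) - j := by rw [Fin.val_rev]; omega
    have := congrArg (Int.cast (R := ℂ)) e2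
    push_cast at this ⊢
    rw [this]

theorem ev_wPoly_nat_ne_zero {n j d : ℕ} (hd : d ≤ j) (hj : j < n) : ev j (wPoly n d) ≠ 0 := by
  rw [wPoly, map_prod]
  refine Finset.prod_ne_zero_iff.2 fun t ht => ?_
  rw [Finset.mem_Ico] at ht
  rw [ev_wFactor]
  refine (map_ne_zero _).2 (mul_ne_zero ?_ ?_)
  · have : ((j - t : ℤ) : ℂ) ≠ 0 := Int.cast_ne_zero.2 (by omega)
    simpa using this
  · have : ((n + t - j : ℤ) : ℂ) ≠ 0 := Int.cast_ne_zero.2 (by omega)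
    simpa using this

/-- A finite diagonal is arbitrary, by Lagrange interpolation; one may divide by W_d because it does
not vanish on the rows d ≤ j < n. -/
theorem exists_diag (n : ℕ) (d : ℤ) (c : Fin n → K) :
    ∃ p : K[X], wPoly n d ∣ p ∧ ∀ j : Fin n, d ≤ j → ev (j : ℕ) p = c j := by
  refine ⟨wPoly n d * Lagrange.interpolate Finset.univ (fun j : Fin n => ((j : ℕ) : K))
    (fun j => c j / ev (j : ℕ) (wPoly n d)), dvd_mul_right _ _, fun j hj => ?_⟩
  have hne : ev (j : ℕ) (wPoly n d) ≠ 0 := by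
    rcases le_or_gt d 0 with h | h
    · rw [wPoly_of_nonpos _ h, map_one]; exact one_ne_zero
    · lift d to ℕ using h.le
      exact ev_wPoly_nat_ne_zero (by omega) j.2
  rw [map_mul, ev_natCast _ (Lagrange.interpolate _ _ _),
    Lagrange.eval_interpolate_at_node _ (fun a _ b _ h => Fin.ext (Nat.cast_injective h))
      (Finset.mem_univ j), mul_div_cancel₀ _ hne]

theorem loopCl_eq (n : ℕ) {κ : K} (hκ : κ ≠ 0) (A : Mat (Fin n)) :
    A ∈ loopCl n ↔ ∃ x ∈ poOp n, A = rep (isFrame_fin n) κ x := by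
  constructor
  · intro hA
    rw [mem_loopCl_iff] at hA
    choose p hp1 hp2 using fun d : ℤ => exists_diag n d fun j =>
      κ ^ (-d) * if h : 0 ≤ (j : ℤ) - d ∧ (j : ℤ) - d < n then entry A ⟨(j - d).toNat, by omega⟩ j else 0
    have hy : mkOp n p ∈ glRing n := ⟨mkOp_mem _ _, fun d => by
      rw [cf_mkOp]; split_ifs; exacts [hp1 d, dvd_zero _]⟩
    have e1 : ∀ i j : Fin n, κ ^ ((j : ℤ) - i) * vl (mkOp n p) (j - i) (j : ℕ) = entry A i j := by
      intro i j
      rw [vl_mkOp, if_pos (by omega), hp2 _ _ (by omega), dif_pos (by omega), ← mul_assoc, zpow_neg,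
        mul_inv_cancel₀ (zpow_ne_zero _ hκ), one_mul]
      congr 1
      exact Fin.ext (by simp)
    refine ⟨_, scl_mul_mem_poOp (skew_part_mem_poOp hy) (1 / 2), matrix_ext fun i j => ?_⟩
    rw [entry_rep, vl_scl_mul (sub_mem hy.1 (sig_mem _ _)), vl_sub, vl_sig_fin]
    have e2 := e1 j.rev i.rev
    have e3 : ((i.rev : ℕ) : ℤ) - (j.rev : ℕ) = j - i := by rw [Fin.val_rev, Fin.val_rev]; omega
    rw [e3] at e2 ⊢
    have e4 := hA i j
    have hi : ((-1 : K) ^ (i : ℕ)) * (-1) ^ (i : ℕ) = 1 := by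
      rw [← mul_pow, neg_one_mul, neg_neg, one_pow]
    have e5 : entry A i j = -((-1) ^ (i : ℕ) * (-1) ^ (j : ℕ) * entry A j.rev i.rev) := by
      linear_combination (-1) ^ (i : ℕ) * e4 - entry A i j * hi
    have e6 := e1 i j
    have h2 : (2 : K) ≠ 0 := two_ne_zero
    field_simp
    linear_combination e5 - e6 + (-1) ^ (i : ℕ) * (-1) ^ (j : ℕ) * e2
  · rintro ⟨x, hx, rfl⟩
    rw [mem_loopCl_iff]
    intro i j
    rw [entry_rep, entry_rep]
    have h := vl_sig_fin n x i j
    rw [hx.2, vl_neg] at h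
    have e3 : ((i.rev : ℕ) : ℤ) - (j.rev : ℕ) = j - i := by rw [Fin.val_rev, Fin.val_rev]; omega
    rw [e3] at h ⊢
    have hi : ((-1 : K) ^ (i : ℕ)) * (-1) ^ (i : ℕ) = 1 := by
      rw [← mul_pow, neg_one_mul, neg_neg, one_pow]
    linear_combination -(-1) ^ (i : ℕ) * κ ^ ((j : ℤ) - i) * h
      - κ ^ ((j : ℤ) - i) * (-1) ^ (j : ℕ) * vl x (j - i) (i.rev : ℕ) * hi

/-! ### Nondegeneracy of the trace -/

theorem csum_one (lam : ℂ) : csum lam 1 = algebraMap ℂ K lam := by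
  rw [csum_eq_of_diff (q := Polynomial.X) fun s => by simp [ev_X], ev_X, ev_X, map_zero, sub_zero]

/-- The radical of the trace form on polynomials. -/
def csumRadical (lam : ℂ) : Ideal K[X] where
  carrier := {G | ∀ q, csum lam (G * q) = 0}
  zero_mem' q := by rw [zero_mul, csum_zero]
  add_mem' ha hb q := by rw [add_mul, csum_add, ha, hb, add_zero]
  smul_mem' c G hG q := by rw [smul_eq_mul, mul_assoc, mul_left_comm]; exact hG _

theorem csum_tr_one {lam : ℂ} (p : K[X]) :
    csum lam (tr 1 (wFactor lam 0 * p)) = csum lam (wFactor lam 0 * p) := by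
  refine csum_tr (p := wFactor lam 0 * p) 1 (fun i hi => ?_) fun i hi => ?_ <;>
  · obtain rfl : i = 0 := by omega
    rw [map_mul, ev_wFactor]
    simp

/-- The factor X(λ - X) vanishes at both ends, so the sum of its multiples may be translated by one
step. -/
theorem csumRadical_down {lam : ℂ} {G : K[X]} (h : G ∈ csumRadical lam) :
    wFactor lam 0 * tr (-1) G ∈ csumRadical lam := fun q => by
  rw [mul_assoc, ← csum_tr_one, map_mul, map_mul, tr_tr, add_neg_cancel, tr_zero, mul_left_comm]
  exact h _

theorem csumRadical_up {lam : ℂ} {G : K[X]} (h : G ∈ csumRadical lam) :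
    tr 1 (wFactor lam 0) * tr 1 G ∈ csumRadical lam := fun q => by
  have : tr 1 (wFactor lam 0) * tr 1 G * q = tr 1 (wFactor lam 0 * (G * tr (-1) q)) := by
    rw [map_mul, map_mul, tr_tr, add_neg_cancel, tr_zero, mul_assoc]
  rw [this, csum_tr_one, mul_left_comm]
  exact h _

theorem exists_not_of_finite {F : Type*} [Field F] [CharZero F] {p : F → Prop} (hp : {r | p r}.Finite)
    (c : F) (hc : c ≠ 0) (r : F) : ∃ a : ℕ, ¬p (r + a * c) := by
  by_contra! h
  refine Set.infinite_range_of_injective (f := fun a : ℕ => r + a * c) (fun a b hab => ?_)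
    (hp.subset (by rintro _ ⟨a, rfl⟩; exact h a))
  simpa [hc] using hab

theorem exists_chain_end {F : Type*} [Field F] [CharZero F] {p : F → Prop} (hp : {r | p r}.Finite)
    {c : F} (hc : c ≠ 0) {q : F → Prop} (h : ∀ r, p r → q r ∨ p (r + c)) {r : F} (hr : p r) :
    ∃ a : ℕ, q (r + a * c) := by
  by_contra! hq
  obtain ⟨a, ha⟩ := exists_not_of_finite hp c hc r
  refine ha ?_
  clear ha
  induction a with
  | zero => simpa using hr
  | succ a ih =>
    have := (h _ ih).resolve_left (hq a)
    rwa [add_assoc, ← add_one_mul, ← Nat.cast_succ] at this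

/-- The radical is principal. Translating down and up, a root r of its generator propagates to r - 1
unless r ∈ {0, λ}, and to r + 1 unless r + 1 ∈ {0, λ}. As the roots are finite in number, both
chains stop, which forces a positive integer to be 0 or ±λ. A constant generator would give csum 1 =
λ = 0. -/
theorem csumRadical_eq_bot {lam : ℂ} (hlam : ∀ m : ℤ, lam ≠ m) : csumRadical lam = ⊥ := by
  by_contra hJ
  set g := Submodule.IsPrincipal.generator (csumRadical lam) with hg
  have hg0 : g ≠ 0 := fun h => hJ ((Submodule.IsPrincipal.eq_bot_iff_generator_eq_zero _).2 h)
  have hgJ : g ∈ csumRadical lam := Submodule.IsPrincipal.generator_mem _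
  have hdvd : ∀ x ∈ csumRadical lam, g ∣ x := fun x hx =>
    (Submodule.IsPrincipal.mem_iff_generator_dvd _).1 hx
  have hdeg : g.degree ≠ 0 := by
    intro h
    have h1 : (1 : K[X]) ∈ csumRadical lam :=
      (Submodule.IsPrincipal.mem_iff_generator_dvd _).2 (Polynomial.isUnit_iff_degree_eq_zero.2 h).dvd
    have := h1 1
    rw [mul_one, csum_one, map_eq_zero] at this
    exact hlam 0 (by simpa using this)
  let F := AlgebraicClosure K
  have : CharZero F := charZero_of_injective_algebraMap (algebraMap K F).injective
  let φ : ℂ →+* F := (algebraMap K F).comp (algebraMap ℂ K)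
  obtain ⟨r, hr⟩ := IsAlgClosed.exists_aeval_eq_zero F g hdeg
  have htr : ∀ (d : ℤ) (p : K[X]) (s : F), Polynomial.aeval s (tr d p) = Polynomial.aeval (s + d) p := by
    intro d p s
    rw [tr_apply, Polynomial.taylor_apply, Polynomial.aeval_comp]
    simp
  have hw : ∀ s : F, Polynomial.aeval s (wFactor lam 0) = s * (φ lam - s) := by
    intro s
    simp [wFactor, φ]
  have hfin : {s : F | Polynomial.aeval s g = 0}.Finite :=
    (Polynomial.rootSet_finite g F).subset fun s hs => (Polynomial.mem_rootSet).2 ⟨hg0, hs⟩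
  obtain ⟨a, ha⟩ := exists_chain_end hfin (c := -1) (by simp) (q := fun s => s = 0 ∨ s = φ lam)
    (fun s hs => by
      obtain ⟨u, hu⟩ := hdvd _ (csumRadical_down hgJ)
      have := congrArg (Polynomial.aeval s) hu
      rw [map_mul, map_mul, hs, zero_mul, hw, htr, mul_eq_zero, mul_eq_zero, sub_eq_zero] at this
      push_cast at this
      rcases this with (h | h) | h
      exacts [Or.inl (Or.inl h), Or.inl (Or.inr h.symm), Or.inr h]) hr
  obtain ⟨b, hb⟩ := exists_chain_end hfin (c := 1) (by simp) (q := fun s => s + 1 = 0 ∨ s + 1 = φ lam)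
    (fun s hs => by
      obtain ⟨u, hu⟩ := hdvd _ (csumRadical_up hgJ)
      have := congrArg (Polynomial.aeval s) hu
      rw [map_mul, map_mul, hs, zero_mul, htr, hw, htr, mul_eq_zero, mul_eq_zero, sub_eq_zero] at this
      push_cast at this
      rcases this with (h | h) | h
      exacts [Or.inl (Or.inl h), Or.inl (Or.inr h.symm), Or.inr h]) hr
  have hn : ((a + b + 1 : ℕ) : F) ≠ 0 := Nat.cast_ne_zero.2 (by omega)
  push_cast at hn
  rcases ha with ha | ha <;> rcases hb with hb | hb
  · exact hn (by linear_combination hb - ha)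
  · refine hlam (a + b + 1 : ℕ) (φ.injective ?_)
    rw [map_intCast]
    push_cast
    linear_combination ha - hb
  · refine hlam (-(a + b + 1 : ℕ)) (φ.injective ?_)
    rw [map_intCast]
    push_cast
    linear_combination hb - ha
  · exact hn (by linear_combination hb - ha)

/-- The trace is σ-invariant and g is skew, so g pairs to zero with the symmetric part of any
element; testing on skew elements is enough. -/
theorem csum_skew {lam : ℂ} {d : ℤ} {g : K[X]} (hg : PoPoly lam (-d) g)
    (h : ∀ p, PoPoly lam d p → csum lam (tr d p * g) = 0) {q : K[X]} (hq : wPoly lam d ∣ q) :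
    csum lam (tr d q * g) = 0 := by
  have hx := sgl_mem_poOp hg
  have hy : sgl d q ∈ glRing lam := sgl_mem_glRing hq
  have hc : ∀ p, cf (sgl d p * sgl (-d) g) 0 = tr d p * g := fun p => by
    rw [cf_sgl_mul (sgl_mem _ _), cf_sgl, if_pos (by ring), zero_sub, neg_neg]
  have h1 := csum_sig (lam := lam) (sgl (-d) g * sgl d q)
  rw [sig_mul hx.1.1 hy.1, hx.2, csum_mul_comm_gl hx.1 hy, mul_neg, cf_neg, sig_sgl, hc,
    hc, ← zero_sub, csum_sub, csum_zero] at h1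
  have h2 := h (q - (-1) ^ d.natAbs * refl (lam - 1 + d) q) ?_
  · rw [map_sub, sub_mul, csum_sub] at h2
    linear_combination (1 / 2 : K) * h2 - (1 / 2 : K) * h1
  · have := mem_poOp_iff.1 (skew_part_mem_poOp hy)
    have := this.2 d
    rwa [cf_sub, sig_sgl, cf_sgl, cf_sgl, if_pos rfl, if_pos rfl] at this

theorem wPoly_ne_zero (lam : ℂ) (d : ℤ) : wPoly lam d ≠ 0 := by
  refine Finset.prod_ne_zero_iff.2 fun t _ => mul_ne_zero (Polynomial.X_sub_C_ne_zero _) ?_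
  rw [← neg_ne_zero, neg_sub]
  exact Polynomial.X_sub_C_ne_zero _

/-- The properties of a loop algebra of matrices and its trace that are used in the reduction. -/
structure IsLoop {ι : Type} [LinearOrder ι] {lam : ℂ} {v : ι → ℕ} (hv : IsFrame lam v)
    (𝔤 : Set (Mat ι)) (tr' : Mat ι → K) : Prop where
  mem : ∀ κ : K, κ ≠ 0 → ∀ A, A ∈ 𝔤 ↔ ∃ x ∈ poOp lam, A = rep hv κ x
  trace : ∀ κ x, tr' (rep hv κ x) = csum lam (cf x 0)
  nondeg : ∀ d : ℕ, ∀ g, PoPoly lam (-d) g → (∀ p, PoPoly lam d p → csum lam (tr d p * g) = 0) →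
    ∀ i j, v i = v j + d → ev (v j) g = 0

theorem isLoop_loopPo {lam : ℂ} (hlam : ∀ m : ℤ, lam ≠ m) :
    IsLoop (isFrame_id lam) (loopPo lam) (traceC lam) where
  mem κ hκ A := loopPo_eq lam hκ A
  trace := traceC_rep lam
  nondeg d g hg h i j _ := by
    have hz : tr d (wPoly lam d) * g ∈ csumRadical lam := fun q => by
      have := csum_skew hg h (q := wPoly lam d * tr (-d) q) (dvd_mul_right _ _)
      rw [map_mul, tr_tr, add_neg_cancel, tr_zero] at this
      rw [← this]
      congr 1
      ring
    rw [csumRadical_eq_bot hlam, Ideal.mem_bot, mul_eq_zero] at hz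
    rcases hz with hz | hz
    · have := congrArg (tr (-d)) hz
      rw [tr_tr, neg_add_cancel, tr_zero, map_zero] at this
      exact absurd this (wPoly_ne_zero lam d)
    · rw [hz, map_zero]

theorem isLoop_loopCl (n : ℕ) : IsLoop (isFrame_fin n) (loopCl n) (traceN n) where
  mem κ hκ A := loopCl_eq n hκ A
  trace := traceN_rep n
  nondeg d g hg h i j hij := by
    have hjn : (j : ℕ) + d < n := hij ▸ i.2
    -- This polynomial vanishes at all rows below n except j, so the trace isolates the value of g
    -- at j.
    set u : K[X] := ∏ m ∈ (Finset.range n).erase j, (Polynomial.X - Polynomial.C (m : K)) with hu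
    have hev : ∀ m : ℕ, ev m u = ∏ t ∈ (Finset.range n).erase j, ((m : K) - t) := fun m => by
      rw [hu, map_prod]
      exact Finset.prod_congr rfl fun t _ => by rw [map_sub, ev_X, ev_C, map_natCast]
    have := csum_skew hg h (q := wPoly n d * tr (-d) u) (dvd_mul_right _ _)
    rw [map_mul, tr_tr, add_neg_cancel, tr_zero, csum_nat, Finset.sum_eq_single (j : ℕ)] at this
    · rw [map_mul, map_mul, ev_tr, hev, mul_eq_zero, mul_eq_zero] at this
      rcases this with (h | h) | h
      · have h' := ev_wPoly_nat_ne_zero (show d ≤ j + d by omega) hjn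
        push_cast at h h'
        exact absurd h h'
      · obtain ⟨t, ht, h⟩ := Finset.prod_eq_zero_iff.1 h
        rw [sub_eq_zero, Nat.cast_inj] at h
        exact absurd h.symm (Finset.ne_of_mem_erase ht)
      · exact h
    · intro m hm hmj
      rw [map_mul, map_mul, hev, Finset.prod_eq_zero (Finset.mem_erase.2 ⟨hmj, hm⟩) (sub_self _),
        mul_zero, zero_mul]
    · intro hj
      exact absurd (Finset.mem_range.2 j.2) hj

/-! ### The fibre of the momentum map -/

/-- The scaling factor `k z`. -/
abbrev kz (k : ℂ) : K := algebraMap ℂ K k * zz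

theorem kz_ne_zero {k : ℂ} (hk : k ≠ 0) : kz k ≠ 0 := mul_ne_zero (by simpa using hk) zz_ne_zero

/-- The pairing `Res Tr(xy) dz` of operators. -/
def pair (lam : ℂ) (x y : Hs) : ℂ := res (csum lam (cf (x * y) 0))

theorem pair_comm {lam : ℂ} {x y : Hs} (hx : x ∈ glRing lam) (hy : y ∈ glRing lam) :
    pair lam x y = pair lam y x := by rw [pair, csum_mul_comm_gl hx hy]; rfl

theorem pair_sub_left (lam : ℂ) (x y z : Hs) : pair lam (x - y) z = pair lam x z - pair lam y z := by
  rw [pair, sub_mul, cf_sub, csum_sub, res_sub]; rfl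

theorem pair_sub_right (lam : ℂ) (x y z : Hs) : pair lam z (x - y) = pair lam z x - pair lam z y := by
  rw [pair, mul_sub, cf_sub, csum_sub, res_sub]; rfl

theorem pair_scl_left {lam : ℂ} {x y : Hs} (hx : x ∈ opRing) (hy : y ∈ opRing) (c : ℂ) :
    pair lam (scl (algebraMap ℂ K c) * x) y = c * pair lam x y := by
  rw [pair, mul_assoc, cf_scl_mul (mul_mem hx hy), csum_C_mul, res_const_mul]; rfl

theorem pair_eq_zero_of_lowBd {lam : ℂ} {x y : Hs} (hx : x ∈ opRing) (hy : y ∈ opRing)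
    (hx0 : LowBd 0 x) (hy0 : LowBd (-1) y) : pair lam x y = 0 := by
  have h : LowBd (0 + -1) (x * y) := LowBd.mul hx hy hx0 hy0
  rw [pair, h 0 (by omega), csum_zero, res_zero]

/-- Integration by parts: the boundary terms of `csum_gdef` vanish because the product lies in gl_λ
and so kills the ends. -/
theorem pair_gdef {lam : ℂ} {a x y : Hs} (ha : a ∈ glRing lam) (ha0 : LowBd 0 a)
    (hx : x ∈ glRing lam) (hy : y ∈ glRing lam) :
    pair lam (gdef a x a) y = -pair lam x (gdef a y a) := by
  have h := csum_gdef ha ha0 (mul_mem hx hy).1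
  have hxy := mul_mem hx hy
  have e0 := vl_eq_zero_of_glRing hxy (d := 1) (i := 0) (by norm_num)
  have e1 := vl_eq_zero_of_glRing' hxy (d := 1) (i := 0) (by norm_num)
  rw [Nat.cast_zero] at e0
  rw [Nat.cast_zero, add_zero] at e1
  rw [gdef_mul a x a y a, cf_add, csum_add, e0, e1, sub_zero, sub_zero] at h
  have := congrArg res h
  rw [res_add, res_dz] at this
  exact eq_neg_of_add_eq_zero_left this

theorem mat_sub_eq_iff {ι : Type} {A B C : Mat ι} : A - B = C ↔ A = C + B := by
  constructor
  · rintro rfl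
    exact matrix_ext fun i j => by rw [entry_add, entry_sub, sub_add_cancel]
  · rintro rfl
    exact matrix_ext fun i j => by rw [entry_sub, entry_add, add_sub_cancel_right]

theorem mat_add_right_inj {ι : Type} {A B C : Mat ι} : A + B = A + C ↔ B = C := by
  constructor
  · intro h
    refine matrix_ext fun i j => ?_
    have := congrArg (fun A => entry A i j) h
    simp only [entry_add] at this
    exact add_left_cancel this
  · rintro rfl
    rfl

/-! ### Tangent vectors, the fibre and the map to symbols -/

section Fibre

variable {ι : Type} [LinearOrder ι] {lam : ℂ} {v : ι → ℕ} {hv : IsFrame lam v}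
  {𝔤 : Set (Mat ι)} {tr' : Mat ι → K} {k : ℂ}

theorem trace_mul_rep (H : IsLoop hv 𝔤 tr') {κ : K} (hκ : κ ≠ 0) {x y : Hs} (hx : x ∈ glRing lam)
    (hy : y ∈ glRing lam) : tr' (rep hv κ x * rep hv κ y) = csum lam (cf (x * y) 0) := by
  rw [← rep_mul hv κ hκ hx hy, H.trace]

theorem form_rep (H : IsLoop hv 𝔤 tr') (hk : k ≠ 0) {x y : Hs} (hx : x ∈ glRing lam)
    (hy : y ∈ glRing lam) :
    form tr' (rep hv (kz k) (scl (kz k) * x)) (rep hv (kz k) y) = k * pair lam x y := by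
  rw [form, trace_mul_rep H (kz_ne_zero hk) (mul_mem (scl_mem_glRing _ _) hx) hy, mul_assoc,
    cf_scl_mul (mul_mem hx.1 hy.1), csum_C_mul, pair, ← res_const_mul]
  have := zz_ne_zero
  congr 1
  field_simp

theorem form_rep' (H : IsLoop hv 𝔤 tr') (hk : k ≠ 0) {x y : Hs} (hx : x ∈ glRing lam)
    (hy : y ∈ glRing lam) :
    form tr' (rep hv (kz k) x) (rep hv (kz k) (scl (kz k) * y)) = k * pair lam x y := by
  have h : x * (scl (kz k) * y) = scl (kz k) * x * y := by rw [scl_comm hx.1, mul_assoc]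
  rw [← form_rep H hk hx hy, form, form, trace_mul_rep H (kz_ne_zero hk) hx
    (mul_mem (scl_mem_glRing _ _) hy), trace_mul_rep H (kz_ne_zero hk)
    (mul_mem (scl_mem_glRing _ _) hx) hy, h]

theorem rep_eq_iff {κ : K} (hκ : κ ≠ 0) (x y : Hs) : rep hv κ x = rep hv κ y ↔
    ∀ i j, vl x (v j - v i) (v j) = vl y (v j - v i) (v j) := by
  constructor
  · intro h i j
    have := congrArg (fun A => entry A i j) h
    simp only [entry_rep] at this
    exact mul_left_cancel₀ (zpow_ne_zero _ hκ) this
  · intro h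
    exact matrix_ext fun i j => by rw [entry_rep, entry_rep, h]

theorem mkOp_cf_mem_poOp {x : Hs} (hx : x ∈ poOp lam) (N : ℤ) : mkOp N (cf x) ∈ poOp lam :=
  mkOp_mem_poOp N (mem_poOp_iff.1 hx).2

theorem rep_mkOp {κ : K} (x : Hs) (N : ℤ)
    (h : ∀ i j, (v j : ℤ) - v i < -N → vl x (v j - v i) (v j) = 0) :
    rep hv κ (mkOp N (cf x)) = rep hv κ x := by
  refine matrix_ext fun i j => ?_
  rw [entry_rep, entry_rep, vl_mkOp]
  split_ifs with hd
  · rfl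
  · rw [h i j (by omega)]

theorem nilp_iff (H : IsLoop hv 𝔤 tr') {κ : K} (hκ : κ ≠ 0) (Y : Mat ι) :
    Y ∈ nilp 𝔤 ↔ ∃ y ∈ poOp lam, LowBd (-1) y ∧ Y = rep hv κ y := by
  constructor
  · rintro ⟨hY, h⟩
    obtain ⟨y, hy, rfl⟩ := (H.mem κ hκ Y).1 hY
    refine ⟨mkOp (-1) (cf y), mkOp_cf_mem_poOp hy _, lowBd_mkOp _ _, (rep_mkOp y _ ?_).symm⟩
    intro i j hij
    have := h i j (hv.mono.le_iff_le.1 (by omega))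
    rw [entry_rep] at this
    exact (mul_eq_zero.1 this).resolve_left (zpow_ne_zero _ hκ)
  · rintro ⟨y, hy, hy0, rfl⟩
    refine ⟨(H.mem κ hκ _).2 ⟨y, hy, rfl⟩, fun i j hij => ?_⟩
    have := hv.mono.monotone hij
    rw [entry_rep, hy0.vl (by omega), mul_zero]

/-- An operator orthogonal to the skew operators of degrees at least `n` is of degree greater than
`-n`, as a matrix. -/
theorem vl_eq_zero_of_pair (H : IsLoop hv 𝔤 tr') {x : Hs} (hx : x ∈ poOp lam) (n : ℕ)
    (h : ∀ y ∈ poOp lam, LowBd (-n) y → pair lam x y = 0) (i j : ι)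
    (hij : (v j : ℤ) - v i < -n + 1) : vl x (v j - v i) (v j) = 0 := by
  obtain ⟨d, hd⟩ := Nat.exists_eq_add_of_le (show v j + n ≤ v i by omega)
  have e : (v j : ℤ) - v i = -((n + d : ℕ) : ℤ) := by omega
  rw [e]
  refine H.nondeg (n + d) _ ((mem_poOp_iff.1 hx).2 _) (fun p hp => ?_) i j (by omega)
  refine eq_zero_of_res_mul fun c => ?_
  have hy := sgl_mem_poOp (hp.const_mul c)
  have := h _ hy fun e he => by rw [cf_sgl, if_neg (by omega)]
  rw [pair_comm hx.1 hy.1, pair, cf_sgl_mul hx.1.1, zero_sub, neg_neg, map_mul,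
    show tr ((n + d : ℕ) : ℤ) (Polynomial.C c) = Polynomial.C c from (tr _).commutes _, mul_assoc,
    csum_C_mul, mul_comm] at this
  exact this

/-- The matrix `k z (f + a)`. -/
def conn (hv : IsFrame lam v) (k : ℂ) (a : Hs) : Mat ι := rep hv (kz k) (scl (kz k) * (Fop + a))

theorem scl_mul_inv_mul {c : K} (hc : c ≠ 0) (x : Hs) : scl c * (scl c⁻¹ * x) = x := by
  rw [← mul_assoc, ← scl_mul, mul_inv_cancel₀ hc, scl_one, one_mul]

/-- By nondegeneracy of the trace on each pair of opposite diagonals, orthogonality to the strictly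
upper triangular elements means being upper triangular. -/
theorem fiberTangent_iff (H : IsLoop hv 𝔤 tr') (hk : k ≠ 0) (B : Mat ι) :
    B ∈ fiberTangent 𝔤 tr' ↔
      ∃ b ∈ poOp lam, LowBd 0 b ∧ B = rep hv (kz k) (scl (kz k) * b) := by
  have hκ := kz_ne_zero hk
  constructor
  · rintro ⟨hB, h⟩
    obtain ⟨x, hx, rfl⟩ := (H.mem _ hκ B).1 hB
    obtain ⟨y, rfl⟩ : ∃ y, x = scl (kz k) * y := ⟨_, (scl_mul_inv_mul hκ x).symm⟩
    have hy : y ∈ poOp lam := by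
      have := scl_mul_mem_poOp hx (kz k)⁻¹
      rwa [← mul_assoc, ← scl_mul, inv_mul_cancel₀ hκ, scl_one, one_mul] at this
    refine ⟨mkOp 0 (cf y), mkOp_cf_mem_poOp hy _, lowBd_mkOp _ _, ?_⟩
    rw [rep_scl_mul _ _ hy.1.1, rep_scl_mul _ _ (mkOp_mem _ _), rep_mkOp]
    intro i j hij
    refine vl_eq_zero_of_pair H hy 1 (fun z hz hz0 => ?_) i j (by omega)
    have := h _ ((nilp_iff H hκ _).2 ⟨z, hz, hz0, rfl⟩)
    rw [form_rep H hk hy.1 hz.1] at this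
    exact (mul_eq_zero.1 this).resolve_left hk
  · rintro ⟨b, hb, hb0, rfl⟩
    refine ⟨(H.mem _ hκ _).2 ⟨_, scl_mul_mem_poOp hb _, rfl⟩, fun Y hY => ?_⟩
    obtain ⟨y, hy, hy0, rfl⟩ := (nilp_iff H hκ Y).1 hY
    rw [form_rep H hk hb.1 hy.1, pair_eq_zero_of_lowBd hb.1.1 hy.1.1 hb0 hy0, mul_zero]

theorem fiber_iff (H : IsLoop hv 𝔤 tr') (hk : k ≠ 0) (A : Mat ι) :
    A ∈ fiber 𝔤 tr' (conn hv k 0) ↔ ∃ a ∈ poOp lam, LowBd 0 a ∧ A = conn hv k a := by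
  have hκ := kz_ne_zero hk
  have key : ∀ A, A ∈ fiber 𝔤 tr' (conn hv k 0) ↔ A - conn hv k 0 ∈ fiberTangent 𝔤 tr' := by
    intro A
    have hf := scl_mul_mem_poOp (Fop_mem_poOp lam) (kz k)
    have hlin : ∀ x ∈ poOp lam, ∀ Y ∈ nilp 𝔤, form tr' (rep hv (kz k) x - conn hv k 0) Y
        = form tr' (rep hv (kz k) x) Y - form tr' (conn hv k 0) Y := by
      rintro x hx Y hY
      obtain ⟨y, hy, hy0, rfl⟩ := (nilp_iff H hκ Y).1 hY
      rw [conn, add_zero, ← rep_sub, form, form, form, trace_mul_rep H hκ (sub_mem hx.1 hf.1) hy.1,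
        trace_mul_rep H hκ hx.1 hy.1, trace_mul_rep H hκ hf.1 hy.1, sub_mul, cf_sub, csum_sub,
        sub_mul, res_sub]
    constructor
    · rintro ⟨hA, h⟩
      obtain ⟨x, hx, rfl⟩ := (H.mem _ hκ A).1 hA
      refine ⟨?_, fun Y hY => by rw [hlin x hx Y hY, h Y hY, sub_self]⟩
      rw [conn, add_zero, ← rep_sub]
      exact (H.mem _ hκ _).2 ⟨_, sub_mem hx hf, rfl⟩
    · rintro ⟨hA, h⟩
      obtain ⟨x, hx, hxA⟩ := (H.mem _ hκ _).1 hA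
      have hA' : A = rep hv (kz k) (x + scl (kz k) * Fop) := by
        rw [rep_add, ← mat_sub_eq_iff, ← hxA, conn, add_zero]
      have hm := add_mem hx hf
      rw [hA'] at h ⊢
      refine ⟨(H.mem _ hκ _).2 ⟨_, hm, rfl⟩, fun Y hY => ?_⟩
      rw [← sub_eq_zero, ← hlin _ hm Y hY, h Y hY]
  rw [key, fiberTangent_iff H hk]
  refine exists_congr fun a => and_congr_right fun _ => and_congr_right fun _ => ?_
  rw [mat_sub_eq_iff, conn, conn, ← rep_add, add_zero, mul_add, add_comm (scl (kz k) * a)]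

theorem conn_eq_iff (hk : k ≠ 0) {a b : Hs} (ha : a ∈ opRing) (hb : b ∈ opRing) :
    conn hv k a = conn hv k b ↔ rep hv (kz k) a = rep hv (kz k) b := by
  rw [conn, conn, mul_add, mul_add, rep_add, rep_add, mat_add_right_inj, rep_scl_mul _ _ ha,
    rep_scl_mul _ _ hb]
  exact (smul_right_injective _ (kz_ne_zero hk)).eq_iff

/-- For an infinite frame the matrix determines the operator. For the first n indices it determines
the columns before n, which suffices by `vl_Lop_congr`. -/
theorem colSeq_Lop_congr (hk : k ≠ 0) {a b : Hs} (ha : a ∈ glRing lam) (hb : b ∈ glRing lam)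
    (ha0 : LowBd 0 a) (hb0 : LowBd 0 b) (h : rep hv (kz k) a = rep hv (kz k) b) (m : ℕ) :
    colSeq lam (Lop a) m = colSeq lam (Lop b) m := by
  rw [rep_eq_iff (kz_ne_zero hk)] at h
  have key : ∀ n ∈ Set.range v, (∀ m < n, m ∈ Set.range v) → ∀ d : ℤ, vl a d n = vl b d n := by
    rintro _ ⟨j, rfl⟩ hm d
    rcases lt_or_ge d 0 with hd | hd
    · rw [ha0.vl (by omega), hb0.vl (by omega)]
    rcases lt_or_ge (v j : ℤ) d with hd' | hd'
    · rw [vl_eq_zero_of_glRing ha hd', vl_eq_zero_of_glRing hb hd']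
    obtain ⟨i, hi⟩ : v j - d.toNat ∈ Set.range v := by
      rcases eq_or_ne d 0 with rfl | h0
      · exact ⟨j, by simp⟩
      · exact hm _ (by omega)
    have := h i j
    rwa [show (v j : ℤ) - v i = d by omega] at this
  rcases hv.range with hr | ⟨n, hn, hr⟩
  · have : a = b := opRing_ext ha.1 hb.1 fun d => ev_ext_nat 0 fun n _ =>
      key n (hr n) (fun m _ => hr m) d
    rw [this]
  · rw [colSeq, colSeq, hn]
    refine vl_Lop_congr ha.1 hb.1 ha0 hb0 (stab_zero_of_glRing hb) n (fun j hj d => ?_) m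
    exact key j ((hr j).2 hj) (fun m hm => (hr m).2 (hm.trans hj)) d

open Classical in
/-- The map from the fibre to symbols. -/
def Phi (hv : IsFrame lam v) (k : ℂ) (A : Mat ι) : Symb :=
  if h : ∃ a ∈ poOp lam, LowBd 0 a ∧ A = conn hv k a then symbOf lam (h.choose + hOp lam) else 0

/-- The operator chosen in `Phi` may differ from a, but has the same matrix and hence the same
symbol. The summand `hOp` is the Cartan term created by the rescaling of the basis. -/
theorem Phi_conn (hk : k ≠ 0) {a : Hs} (ha : a ∈ poOp lam) (ha0 : LowBd 0 a) :
    Phi hv k (conn hv k a) = symbOf lam (a + hOp lam) := by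
  have h : ∃ a' ∈ poOp lam, LowBd 0 a' ∧ conn hv k a = conn hv k a' := ⟨a, ha, ha0, rfl⟩
  rw [Phi, dif_pos h]
  obtain ⟨h1, h2, h3⟩ := h.choose_spec
  refine congrArg (toSymb 0) (funext fun m => ?_)
  refine colSeq_Lop_congr hk (hv := hv) (add_mem h1.1 (hOp_mem_glRing _))
    (add_mem ha.1 (hOp_mem_glRing _)) (h2.add (lowBd_hOp _)) (ha0.add (lowBd_hOp _)) ?_ m
  rw [rep_add, rep_add, (conn_eq_iff hk ha.1.1 h1.1.1).1 h3]

end Fibre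

/-! ### The Poisson map -/

theorem symbOf_mem_PsiSA {lam : ℂ} {a : Hs} (ha : a ∈ poOp lam) (ha0 : LowBd 0 a) :
    symbOf lam a ∈ PsiSA lam := by
  refine ⟨toSymb_mem_PsiDS ?_, ?_⟩
  · exact (unitri_Lop a).vl_zero lam
  · rw [symbOf, star_toSymb]
    refine congrArg _ (funext fun m => ?_)
    have := vl_Lop_neg_sig (lam := lam) ha.1.1 ha0 (stab_zero_of_glRing ha.1)
      (stab_zero_of_glRing (sig_mem_glRing ha.1)) m
    rw [ha.2, neg_neg] at this
    exact this.symm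

/-- L_a v_n stays in the span of v_0, v_1, …, that is, it involves only D^n, …, D^0. -/
theorem symbOf_mem_DO {n : ℕ} {a : Hs} (ha : a ∈ poOp n) (ha0 : LowBd 0 a) : symbOf n a ∈ DO n := by
  refine ⟨(symbOf_mem_PsiSA ha ha0).1, fun m hm => ?_⟩
  obtain ⟨d, rfl⟩ : ∃ d : ℕ, m = 0 - d := ⟨(-m).toNat, by omega⟩
  rw [symbOf, toSymb_sub, colSeq]
  have := stab_Lop ha.1.1 ha0 (stab_zero_of_glRing ha.1) n d (by omega)
  rwa [zero_add] at this

theorem hasDerivAt_symbOf {lam : ℂ} {a b : Hs} (hb : b ∈ opRing) (hb0 : LowBd 0 b) {X : Symb}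
    (hX : X ∈ PsiCotangent lam) :
    HasDerivAt (fun t : ℂ => FF lam X (symbOf lam (a + scl (algebraMap ℂ K t) * b) - symbOf lam a))
      (FF lam X (dSymb lam a b)) 0 := by
  obtain ⟨N, X, rfl⟩ := exists_toSymb_of_mem_PsiCotangent hX
  choose g hg hjet using fun m => colSeq_Lop_jet lam (a := a) hb hb0 m
  have h := hasDerivAt_jet (adiag (N + 1)) (fun p => colSeq lam (Lvar a b) p.1) (fun p => g p.1)
    (fun p => Th (lam - p.1) X p.2) fun p => hg p.1
  rw [dSymb, FF_toSymb, symMul, res_sum]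
  refine h.congr_of_eventuallyEq (Filter.Eventually.of_forall fun t => ?_)
  have e : symbOf lam (a + scl (algebraMap ℂ K t) * b) - symbOf lam a = toSymb 0 fun m =>
      algebraMap ℂ K t * colSeq lam (Lvar a b) m + algebraMap ℂ K t ^ 2 * g m t := by
    refine symb_ext (N := 0) (fun m hm => ?_) (fun m hm => toSymb_of_lt hm _) fun n => ?_
    · rw [Pi.sub_apply, symbOf, symbOf, toSymb_of_lt hm, toSymb_of_lt hm, sub_zero]
    · rw [Pi.sub_apply, symbOf, symbOf, toSymb_sub, toSymb_sub, toSymb_sub, hjet, add_sub_cancel_left]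
  simp only
  rw [e, FF_toSymb, symMul, res_sum]

/-- Only F lowers the place, and only by one. -/
theorem lowBd_gdef {a b n : Hs} {N : ℤ} (hn : n ∈ opRing) (hn0 : LowBd (N - 1) n) (ha : a ∈ opRing)
    (ha0 : LowBd 0 a) (hb : b ∈ opRing) (hb0 : LowBd 0 b) : LowBd N (gdef b n a) := by
  have h1 : LowBd N (dl * n - n * dl) := fun d hd => by
    rw [cf_dl_comm hn, hn0 d (by omega), map_zero]
  have h2 : LowBd N (Fop * n) := (LowBd.mul Fop_mem hn lowBd_Fop hn0).mono (by omega)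
  have h3 : LowBd N (n * Fop) := (LowBd.mul hn Fop_mem hn0 lowBd_Fop).mono (by omega)
  have h4 : LowBd N (b * n) := (LowBd.mul hb hn hb0 hn0).mono (by omega)
  have h5 : LowBd N (n * a) := (LowBd.mul hn ha hn0 ha0).mono (by omega)
  rw [gdef_eq]
  exact (h1.add (h2.sub h3)).add (h4.sub h5)

/-! ### Differentials and Poisson brackets on the fibre -/

section Fibre

variable {ι : Type} [LinearOrder ι] {lam : ℂ} {v : ι → ℕ} {hv : IsFrame lam v}
  {𝔤 : Set (Mat ι)} {tr' : Mat ι → K} {k : ℂ}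

theorem conn_add_smul (a : Hs) {b : Hs} (hb : b ∈ opRing) (t : K) :
    conn hv k a + t • rep hv (kz k) (scl (kz k) * b) = conn hv k (a + scl t * b) := by
  have e : scl (kz k) * (Fop + (a + scl t * b))
      = scl (kz k) * (Fop + a) + scl t * (scl (kz k) * b) := by
    rw [← add_assoc, mul_add _ (Fop + a), ← mul_assoc, ← mul_assoc, ← scl_mul, ← scl_mul, mul_comm t]
  rw [conn, conn, e, rep_add, rep_scl_mul _ _ (mul_mem (scl_mem _) hb)]

theorem represents_iff (H : IsLoop hv 𝔤 tr') (hk : k ≠ 0) {a : Hs} (ha : a ∈ poOp lam)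
    (ha0 : LowBd 0 a) {X : Symb} (hX : X ∈ PsiCotangent lam) {x : Hs} (hx : x ∈ poOp lam) :
    Represents 𝔤 tr' lam (Phi hv k) (conn hv k a) X (rep hv (kz k) x) ↔
      ∀ b ∈ poOp lam, LowBd 0 b → k * pair lam x b = FF lam X (dSymb lam (a + hOp lam) b) := by
  have hd : ∀ b ∈ poOp lam, LowBd 0 b → HasDerivAt (fun t : ℂ => FF lam X (Phi hv k (conn hv k a
      + algebraMap ℂ K t • rep hv (kz k) (scl (kz k) * b)) - Phi hv k (conn hv k a)))
      (FF lam X (dSymb lam (a + hOp lam) b)) 0 := by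
    intro b hb hb0
    have h := hasDerivAt_symbOf (a := a + hOp lam) hb.1.1 hb0 hX
    refine h.congr_of_eventuallyEq (Filter.Eventually.of_forall fun t => ?_)
    simp only
    rw [conn_add_smul a hb.1.1, Phi_conn hk ha ha0, Phi_conn hk (add_mem ha (scl_mul_mem_poOp hb _))
      (ha0.add (lowBd_scl_mul hb.1.1 hb0 _)), add_right_comm]
  constructor
  · rintro ⟨_, h⟩ b hb hb0
    have := h _ ((fiberTangent_iff H hk _).2 ⟨b, hb, hb0, rfl⟩)
    rw [form_rep' H hk hx.1 hb.1] at this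
    exact this.unique (hd b hb hb0)
  · intro h
    refine ⟨(H.mem _ (kz_ne_zero hk) _).2 ⟨x, hx, rfl⟩, fun B hB => ?_⟩
    obtain ⟨b, hb, hb0, rfl⟩ := (fiberTangent_iff H hk _).1 hB
    rw [form_rep' H hk hx.1 hb.1, h b hb hb0]
    exact hd b hb hb0

theorem exists_represents (H : IsLoop hv 𝔤 tr') (hk : k ≠ 0) {a : Hs} (ha : a ∈ poOp lam)
    (ha0 : LowBd 0 a) {X : Symb} (hX : X ∈ PsiSACotangent lam) :
    ∃ x, Represents 𝔤 tr' lam (Phi hv k) (conn hv k a) X x := by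
  have hα := add_mem ha (hOp_mem_poOp lam)
  obtain ⟨x, hx, sx, -, hP, -⟩ := exists_skew_representing hα.1 (ha0.add (lowBd_hOp _)) hα.2 hX
  have hx' : x ∈ poOp lam := ⟨hx, sx⟩
  refine ⟨_, (represents_iff H hk ha ha0 hX.1 (scl_mul_mem_poOp hx' (algebraMap ℂ K k⁻¹))).2
    fun b hb hb0 => ?_⟩
  rw [hP b hb.1 hb0 hb.2, pair_scl_left hx.1 hb.1.1, mul_inv_cancel_left₀ hk, pair]

/-- By cyclicity of the trace the Lie bracket term becomes a commutator with kz(F + a), and the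
cocycle supplies d/dz together with the Cartan term; all combine into the commutator with one
connection. -/
theorem kirillovKostant_rep (H : IsLoop hv 𝔤 tr') (hk : k ≠ 0) {a x y : Hs} (ha : a ∈ glRing lam)
    (hx : x ∈ glRing lam) (hy : y ∈ glRing lam) :
    kirillovKostant tr' k (conn hv k a) (rep hv (kz k) x) (rep hv (kz k) y)
      = k * pair lam (gdef (a + hOp lam) x (a + hOp lam)) y := by
  have hκ := kz_ne_zero hk
  have hF : scl (kz k) * (Fop + a) ∈ glRing lam :=
    mul_mem (scl_mem_glRing _ _) (add_mem (Fop_mem_glRing _) ha)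
  have hh := hOp_mem_glRing lam
  have hdx : (dl * x - x * dl) + (hOp lam * x - x * hOp lam) ∈ glRing lam :=
    add_mem (dl_comm_mem_glRing hx) (sub_mem (mul_mem hh hx) (mul_mem hx hh))
  have hg := gdef_mem_glRing (add_mem ha hh) hx (add_mem ha hh)
  rw [← form_rep H hk hg hy, kirillovKostant, affPair, affBracket]
  simp only [cocycle]
  rw [matDeriv_rep hv hk hx.1, trace_mul_rep H hκ hdx hy, form, form, ← rep_mul _ _ hκ hx hy,
    ← rep_mul _ _ hκ hy hx, ← rep_sub, conn, trace_mul_rep H hκ hF (sub_mem (mul_mem hx hy)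
    (mul_mem hy hx)), trace_mul_rep H hκ (mul_mem (scl_mem_glRing _ _) hg) hy, ← res_const_mul,
    ← res_add]
  congr 1
  have e : scl (kz k) * gdef (a + hOp lam) x (a + hOp lam)
      = (scl (kz k) * (Fop + a) * x - x * (scl (kz k) * (Fop + a)))
        + scl (kz k) * ((dl * x - x * dl) + (hOp lam * x - x * hOp lam)) := by
    rw [gdef_eq, ← mul_assoc x, ← scl_comm hx.1]
    noncomm_ring
  set u := scl (kz k) * (Fop + a)
  have h1 : csum lam (cf (u * (x * y - y * x)) 0) = csum lam (cf ((u * x - x * u) * y) 0) := by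
    rw [mul_sub, sub_mul, cf_sub, cf_sub, csum_sub, csum_sub, ← mul_assoc, ← mul_assoc,
      csum_mul_comm_gl (mul_mem hF hy) hx, ← mul_assoc]
  set D := (dl * x - x * dl) + (hOp lam * x - x * hOp lam)
  have e2 : csum lam (cf (scl (kz k) * gdef (a + hOp lam) x (a + hOp lam) * y) 0)
      = csum lam (cf ((u * x - x * u) * y) 0) + kz k * csum lam (cf (D * y) 0) := by
    rw [e, add_mul, cf_add, csum_add, mul_assoc (scl (kz k)) D y, cf_scl_mul (mul_mem hdx hy).1,
      csum_C_mul]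
  rw [e2, h1]
  have := zz_ne_zero
  field_simp

/-- An operator orthogonal to the upper triangular ones is strictly upper triangular, as a matrix. -/
theorem exists_nilp_of_pair (H : IsLoop hv 𝔤 tr') {x : Hs} (hx : x ∈ poOp lam)
    (h : ∀ b ∈ poOp lam, LowBd 0 b → pair lam x b = 0) (κ : K) :
    ∃ n ∈ poOp lam, LowBd (-1) n ∧ rep hv κ n = rep hv κ x :=
  ⟨mkOp (-1) (cf x), mkOp_cf_mem_poOp hx _, lowBd_mkOp _ _, rep_mkOp _ _ fun i j hij =>
    vl_eq_zero_of_pair H hx 0 (fun y hy hy0 => h y hy (by simpa using hy0)) i j (by simp; omega)⟩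

theorem pair_congr_right (H : IsLoop hv 𝔤 tr') (hk : k ≠ 0) {u x y : Hs} (hu : u ∈ glRing lam)
    (hx : x ∈ glRing lam) (hy : y ∈ glRing lam) (h : rep hv (kz k) x = rep hv (kz k) y) :
    pair lam u x = pair lam u y := by
  have := form_rep H hk hu hx
  rw [h, form_rep H hk hu hy] at this
  exact (mul_left_cancel₀ hk this).symm

/-- For the special representatives ξ, η the bracket is computed by `exists_skew_representing`.
Arbitrary representatives differ from ξ/k, η/k, as functionals, by elements of the nilpotent
subalgebra, and these do not contribute, by invariance of the pairing. -/
theorem poisson_Phi (H : IsLoop hv 𝔤 tr') (hk : k ≠ 0) {a : Hs} (ha : a ∈ poOp lam)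
    (ha0 : LowBd 0 a) {X Y : Symb} (hX : X ∈ PsiSACotangent lam) (hY : Y ∈ PsiSACotangent lam)
    {x y : Mat ι} (hx : Represents 𝔤 tr' lam (Phi hv k) (conn hv k a) X x)
    (hy : Represents 𝔤 tr' lam (Phi hv k) (conn hv k a) Y y) :
    kirillovKostant tr' k (conn hv k a) x y
      = -k⁻¹ * gelfandDickey lam (Phi hv k (conn hv k a)) X Y := by
  have hκ := kz_ne_zero hk
  obtain ⟨x, hxp, rfl⟩ := (H.mem _ hκ x).1 hx.1
  obtain ⟨y, hyp, rfl⟩ := (H.mem _ hκ y).1 hy.1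
  rw [represents_iff H hk ha ha0 hX.1 hxp] at hx
  rw [represents_iff H hk ha ha0 hY.1 hyp] at hy
  rw [kirillovKostant_rep H hk ha.1 hxp.1 hyp.1, Phi_conn hk ha ha0]
  set α := a + hOp lam with hαd
  have hα : α ∈ poOp lam := add_mem ha (hOp_mem_poOp lam)
  have hα0 : LowBd 0 α := ha0.add (lowBd_hOp _)
  obtain ⟨ξ, hξ, sξ, uξ, pξ, gξ⟩ := exists_skew_representing hα.1 hα0 hα.2 hX
  obtain ⟨η, hη, sη, uη, pη, -⟩ := exists_skew_representing hα.1 hα0 hα.2 hY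
  have hG : ∀ {u : Hs}, u ∈ poOp lam → gdef α u α ∈ poOp lam := fun hu =>
    ⟨gdef_mem_glRing hα.1 hu.1 hα.1, by rw [sig_gdef hα.1.1 hu.1.1 hα.1.1, hα.2, hu.2, neg_neg,
      gdef_neg_mid]⟩
  have hxy : ∀ b ∈ poOp lam, LowBd 0 b → k * pair lam x b = pair lam ξ b := fun b hb hb0 =>
    (hx b hb hb0).trans (pξ b hb.1 hb0 hb.2)
  have hyy : ∀ b ∈ poOp lam, LowBd 0 b → k * pair lam y b = pair lam η b := fun b hb hb0 =>
    (hy b hb hb0).trans (pη b hb.1 hb0 hb.2)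
  have hGD : gelfandDickey lam (symbOf lam α) X Y = -pair lam (gdef α ξ α) η := by
    have h1 := gξ Y hY
    have hGξ := hG ⟨hξ, sξ⟩
    rw [pη _ hGξ.1 uξ hGξ.2] at h1
    rw [pair_comm hGξ.1 hη, pair, h1, neg_neg]
  have hD : scl (algebraMap ℂ K k) * y - η ∈ poOp lam :=
    sub_mem (scl_mul_mem_poOp hyp _) ⟨hη, sη⟩
  -- The difference ky - η annihilates upper triangular variations, so its matrix is that of a
  -- nilpotent n.
  obtain ⟨n, hn, hn0, hrn⟩ := exists_nilp_of_pair H hD (fun b hb hb0 => by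
    rw [pair_sub_left, pair_scl_left hyp.1.1 hb.1.1, hyy b hb hb0, sub_self]) (kz k)
  have hGn0 : LowBd 0 (gdef α n α) := lowBd_gdef hn.1.1 hn0 hα.1.1 hα0 hα.1.1 hα0
  -- Moving the commutator to n gives an upper triangular element, on which kx acts as ξ; moving it
  -- back gives the pairing of the upper triangular [∇, ξ] with n, which is zero.
  have h1 : pair lam (gdef α x α) (scl (algebraMap ℂ K k) * y - η) = 0 := by
    rw [← pair_congr_right H hk (hG hxp).1 hn.1 hD.1 hrn, pair_gdef hα.1 hα0 hxp.1 hn.1, neg_eq_zero]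
    have h2 := hxy _ (hG hn) hGn0
    have h3 := pair_gdef hα.1 hα0 hξ hn.1
    rw [pair_eq_zero_of_lowBd (hG ⟨hξ, sξ⟩).1.1 hn.1.1 uξ hn0, zero_eq_neg] at h3
    rw [h3] at h2
    exact (mul_eq_zero.1 h2).resolve_left hk
  have hky := mul_mem (scl_mem_glRing lam (algebraMap ℂ K k)) hyp.1
  rw [pair_sub_right, pair_comm (hG hxp).1 hky, pair_scl_left hyp.1.1 (hG hxp).1.1,
    pair_comm hyp.1 (hG hxp).1, sub_eq_zero, pair_gdef hα.1 hα0 hxp.1 hη] at h1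
  have h4 := hxy _ (hG ⟨hη, sη⟩) uη
  have h5 := pair_gdef hα.1 hα0 hξ hη
  rw [h1, hGD, h5, neg_neg, ← h4]
  field_simp

end Fibre

/-! ### The orbits -/

/-- The roots 0, …, d - 1 and λ, …, λ + d - 1 are distinct by assumption, so vanishing at each of
them gives divisibility by the product. -/
theorem wPoly_dvd_of_vanish {lam : ℂ} {d : ℤ}
    (hd : ∀ i j : ℕ, (i : ℤ) < d → (j : ℤ) < d → (i : ℂ) ≠ lam + j) {p : K[X]}
    (h0 : ∀ i : ℕ, (i : ℤ) < d → ev i p = 0) (h1 : ∀ i : ℕ, (i : ℤ) < d → ev (lam + i) p = 0) :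
    wPoly lam d ∣ p := by
  have hcop : ∀ {a b : ℂ}, a ≠ b → IsCoprime (Polynomial.X - Polynomial.C (algebraMap ℂ K a))
      (Polynomial.X - Polynomial.C (algebraMap ℂ K b)) := fun {a b} hab =>
    Polynomial.isCoprime_X_sub_C_of_isUnit_sub (by
      rw [← map_sub]; exact ((sub_ne_zero.2 hab).isUnit.map (algebraMap ℂ K)))
  have hw : ∀ i : ℕ, wFactor lam i = -((Polynomial.X - Polynomial.C (algebraMap ℂ K i))
      * (Polynomial.X - Polynomial.C (algebraMap ℂ K (lam + i)))) := fun i => by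
    rw [wFactor]
    push_cast [map_add, map_natCast]
    ring
  have hroot : ∀ {s : ℂ}, ev s p = 0 → Polynomial.X - Polynomial.C (algebraMap ℂ K s) ∣ p :=
    fun h => Polynomial.dvd_iff_isRoot.2 h
  refine Finset.prod_dvd_of_coprime (fun s hs t ht hst => ?_) fun t ht => ?_
  · simp only [Finset.coe_Ico, Set.mem_Ico] at hs ht
    lift s to ℕ using hs.1
    lift t to ℕ using ht.1
    have hst' : (s : ℂ) ≠ t := by
      intro h
      exact hst (by exact_mod_cast h)
    rw [Function.onFun, hw, hw]
    refine (IsCoprime.neg_neg ?_)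
    refine IsCoprime.mul_left (IsCoprime.mul_right (hcop hst') (hcop (hd s t hs.2 ht.2)))
      (IsCoprime.mul_right (hcop (hd t s ht.2 hs.2).symm) (hcop fun h => hst' (add_left_cancel h)))
  · rw [Finset.mem_Ico] at ht
    lift t to ℕ using ht.1
    rw [hw, neg_dvd]
    exact (hcop (hd t t ht.2 ht.2)).mul_dvd (hroot (h0 t ht.2)) (hroot (h1 t ht.2))

theorem entry_sum {ι β : Type} (s : Finset β) (A : β → Mat ι) (i j : ι) :
    entry (∑ b ∈ s, A b) i j = ∑ b ∈ s, entry (A b) i j := by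
  rw [entry, LinearMap.sum_apply, Finsupp.finsetSum_apply]
  rfl

/-! ### Gauge equivalence of matrices and of operators -/

section Fibre

variable {ι : Type} [LinearOrder ι] {lam : ℂ} {v : ι → ℕ} {hv : IsFrame lam v}
  {𝔤 : Set (Mat ι)} {tr' : Mat ι → K} {k : ℂ}

theorem rep_sum {β : Type} (s : Finset β) (κ : K) (x : β → Hs) :
    rep hv κ (∑ b ∈ s, x b) = ∑ b ∈ s, rep hv κ (x b) := by
  classical
  induction s using Finset.induction_on with
  | empty => rw [Finset.sum_empty, Finset.sum_empty, rep_zero]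
  | insert b s hb ih => rw [Finset.sum_insert hb, Finset.sum_insert hb, rep_add, ih]

theorem rep_pow {κ : K} (hκ : κ ≠ 0) {y : Hs} (hy : y ∈ glRing lam) (m : ℕ) :
    rep hv κ y ^ m = rep hv κ (y ^ m) := by
  induction m with
  | zero => rw [pow_zero, pow_zero, rep_one]
  | succ m ih => rw [pow_succ, pow_succ, ih, rep_mul hv κ hκ (pow_mem hy m) hy]

theorem exp_partial {κ : K} (hκ : κ ≠ 0) {y : Hs} (hy : y ∈ glRing lam) (h : LowBd (-1) y)
    (w : ι →₀ K) : ∃ M, ∀ M' ≥ M, (rep hv κ y ^ M') w = 0 ∧ rep hv κ (expS hy.1) w =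
      ∑ m ∈ Finset.range M', algebraMap ℂ K ((m.factorial : ℂ)⁻¹) • (rep hv κ y ^ m) w := by
  induction w using Finsupp.induction_linear with
  | zero => exact ⟨0, fun M' _ => by simp⟩
  | add u w hu hw =>
    obtain ⟨M, hM⟩ := hu
    obtain ⟨N, hN⟩ := hw
    refine ⟨max M N, fun M' h' => ?_⟩
    obtain ⟨h1, h2⟩ := hM M' (le_of_max_le_left h')
    obtain ⟨h3, h4⟩ := hN M' (le_of_max_le_right h')
    refine ⟨by rw [map_add, h1, h3, add_zero], ?_⟩
    rw [map_add, h2, h4, ← Finset.sum_add_distrib]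
    exact Finset.sum_congr rfl fun m _ => by rw [map_add, smul_add]
  | single j c =>
    have e : Finsupp.single j c = c • bas j := by rw [bas, Finsupp.smul_single, smul_eq_mul, mul_one]
    have hz : ∀ m > v j, (rep hv κ y ^ m) (bas j) = 0 := by
      intro m hm
      refine Finsupp.ext fun i => ?_
      rw [rep_pow hκ hy]
      change entry _ i j = 0
      rw [entry_rep, (lowBd_pow hy.1 h m).vl (by omega), mul_zero]
    refine ⟨v j + 1, fun M' h' => ⟨by rw [e, map_smul, hz M' (by omega), smul_zero], ?_⟩⟩
    rw [e, map_smul]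
    simp only [map_smul, smul_comm _ c, ← Finset.smul_sum]
    congr 1
    refine Finsupp.ext fun i => ?_
    rw [Finsupp.finsetSum_apply]
    change entry _ i j = ∑ m ∈ _, algebraMap ℂ K _ * entry (rep hv κ y ^ m) i j
    obtain ⟨N, rfl⟩ := Nat.exists_eq_add_of_le' (show 1 ≤ M' by omega)
    rw [entry_rep, vl, cf_expS hy.1 h (M := N) (by omega)]
    change κ ^ _ * vl _ _ _ = _
    rw [← entry_rep hv, expT_eq, rep_sum, entry_sum]
    refine Finset.sum_congr rfl fun m _ => ?_
    rw [rep_scl_mul _ _ (pow_mem hy.1 m), entry_smul, rep_pow hκ hy]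

theorem isExp_rep {κ : K} (hκ : κ ≠ 0) {y : Hs} (hy : y ∈ glRing lam) (h : LowBd (-1) y) :
    IsExp (rep hv κ y) (rep hv κ (expS hy.1)) := by
  intro w
  obtain ⟨M, hM⟩ := exp_partial (hv := hv) hκ hy h w
  rw [(hM M le_rfl).2]
  symm
  refine finsum_eq_finsetSum_of_support_subset _ fun m hm => ?_
  simp only [Finset.coe_range, Set.mem_Iio]
  by_contra hmM
  refine hm ?_
  simp only
  rw [(hM m (not_lt.1 hmM)).1, smul_zero]

theorem gauge_rel_iff (hk : k ≠ 0) {a b x : Hs} (ha : a ∈ glRing lam) (hb : b ∈ glRing lam)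
    (hx : x ∈ glRing lam) :
    conn hv k b * rep hv (kz k) x = rep hv (kz k) x * conn hv k a
        - kz k • matDeriv (rep hv (kz k) x) ↔
      rep hv (kz k) (gdef (b + hOp lam) x (a + hOp lam)) = 0 := by
  have hh := hOp_mem_glRing lam
  have hg := gdef_mem_glRing (add_mem hb hh) hx (add_mem ha hh)
  have h := rep_gdef hv hk ha hb hx
  rw [rep_scl_mul _ _ hg.1] at h
  change _ = conn hv k b * _ - _ * conn hv k a + _ at h
  have hκ := kz_ne_zero hk
  constructor
  · intro e
    rw [e] at h
    refine matrix_ext fun i j => ?_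
    have := congrArg (fun A => entry A i j) h
    simp only [entry_add, entry_sub, entry_smul] at this
    rw [entry_zero]
    refine (mul_eq_zero.1 (this.trans ?_)).resolve_left hκ
    ring
  · intro e
    rw [e] at h
    refine matrix_ext fun i j => ?_
    have := congrArg (fun A => entry A i j) h
    simp only [entry_add, entry_sub, entry_smul, entry_zero, mul_zero] at this
    rw [entry_sub, entry_smul]
    linear_combination -this

/-- The only possible term below the diagonal is x_0(s) - x_0(s + 1) in place -1, and x_0 = 1. -/
theorem lowBd_gdef_unitri {a b x : Hs} (hx : Unitri x) (ha : a ∈ opRing)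
    (ha0 : LowBd 0 a) (hb : b ∈ opRing) (hb0 : LowBd 0 b) : LowBd 0 (gdef b x a) := by
  have h1 := lowBd_gdef (N := 1) hx.mem hx.low ha ha0 hb hb0
  intro d hd
  rcases eq_or_ne d (-1) with rfl | hd'
  · refine ev_ext fun s => ?_
    have := vl_gdef b a hx.mem (-1) s
    rw [(LowBd.upper_mul hb hx.mem hb0 hx.low).vl (by omega),
      (LowBd.upper_mul hx.mem ha hx.low ha0).vl (by omega), hx.low.vl (by omega), neg_add_cancel,
      hx.vl_zero, hx.vl_zero] at this
    rw [map_zero]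
    change vl _ _ _ = 0
    simpa using this
  · exact h1 d (by omega)

/-- In finite size the gauge relation of matrices only says that the defect z has zero matrix. It
becomes an identity of operators after α is replaced by α + x⁻¹z, which changes neither the matrix
nor the symbol. -/
theorem colSeq_eq_of_gauge (H : IsLoop hv 𝔤 tr') (hk : k ≠ 0) {a b : Hs} (ha : a ∈ poOp lam)
    (ha0 : LowBd 0 a) (hb : b ∈ poOp lam) (hb0 : LowBd 0 b)
    (h : Gauge 𝔤 k (conn hv k a) (conn hv k b)) (m : ℕ) :
    colSeq lam (Lop (a + hOp lam)) m = colSeq lam (Lop (b + hOp lam)) m := by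
  have hκ := kz_ne_zero hk
  obtain ⟨Y, hY, X, hX, hrel⟩ := h
  obtain ⟨y, hy, hy0, rfl⟩ := (nilp_iff H hκ Y).1 hY
  obtain rfl : X = rep hv (kz k) (expS hy.1.1) :=
    LinearMap.ext fun w => (hX w).trans (isExp_rep hκ hy.1 hy0 w).symm
  set x := expS hy.1.1 with hxd
  have hx : x ∈ glRing lam := expS_mem_glRing hy.1 hy0
  have hxu : Unitri x := unitri_expS hy.1.1 hy0
  rw [gauge_rel_iff hk ha.1 hb.1 hx] at hrel
  have hα := add_mem ha.1 (hOp_mem_glRing lam)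
  have hβ := add_mem hb.1 (hOp_mem_glRing lam)
  have hα0 := ha0.add (lowBd_hOp lam)
  have hβ0 := hb0.add (lowBd_hOp lam)
  set α := a + hOp lam
  set β := b + hOp lam
  set z := gdef β x α
  have hz : z ∈ glRing lam := gdef_mem_glRing hβ hx hα
  have hz0 : LowBd 0 z := lowBd_gdef_unitri hxu hα.1 hα0 hβ.1 hβ0
  set x' := expS (neg_mem hy.1.1)
  have hx' : x' ∈ glRing lam := expS_mem_glRing (neg_mem hy.1) hy0.neg
  have hx'0 : LowBd 0 x' := lowBd_expS _
  have hxx' : x * x' = 1 := expS_mul_neg hy.1.1 hy0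
  have hxz := mul_mem hx' hz
  have hxz0 := LowBd.upper_mul hx'.1 hz.1 hx'0 hz0
  have e1 : rep hv (kz k) (α + x' * z) = rep hv (kz k) α := by
    rw [rep_add, rep_mul hv _ hκ hx' hz, hrel, mul_zero, add_zero]
  rw [← colSeq_Lop_congr hk (add_mem hα hxz) hα (hα0.add hxz0) hα0 e1]
  have hg : gdef β x (α + x' * z) = 0 := by
    have : gdef β x (α + x' * z) = z - x * x' * z := by
      change nabla β * x - x * (dl + Fop + (α + x' * z)) = nabla β * x - x * (dl + Fop + α) - _
      noncomm_ring
    rw [this, hxx', one_mul, sub_self]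
  exact vl_Lop_eq_of_gauge (add_mem hα hxz).1 hβ.1 (hα0.add hxz0) hβ0 hxu hg
    (stab_zero_of_glRing hx) (stab_of_glRing hx) m

/-- `exists_gauge` and `exists_log` give an operator y; it remains to see that it lies in gl_λ,
which is vanishing at both ends as long as the points i and λ + j stay distinct. -/
theorem gauge_of_colSeq_eq (H : IsLoop hv 𝔤 tr') (hk : k ≠ 0)
    (hl : (∀ m : ℤ, lam ≠ m) ∨ ∃ n : ℕ, lam = n ∧ ∀ j, v j < n) {a b : Hs} (ha : a ∈ poOp lam)
    (ha0 : LowBd 0 a) (hb : b ∈ poOp lam) (hb0 : LowBd 0 b)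
    (h : ∀ m, colSeq lam (Lop (a + hOp lam)) m = colSeq lam (Lop (b + hOp lam)) m) :
    Gauge 𝔤 k (conn hv k a) (conn hv k b) := by
  have hκ := kz_ne_zero hk
  have hα := add_mem ha (hOp_mem_poOp lam)
  have hβ := add_mem hb (hOp_mem_poOp lam)
  have hα0 := ha0.add (lowBd_hOp lam)
  have hβ0 := hb0.add (lowBd_hOp lam)
  obtain ⟨x, hx, hg, s0, s1⟩ := exists_gauge hα.1.1 hβ.1.1 hα0 hβ0 (stab_zero_of_glRing hα.1)
    (stab_zero_of_glRing hβ.1) (stab_of_glRing hα.1) (stab_of_glRing hβ.1) fun d => by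
      rcases lt_or_ge d 0 with hd | hd
      · rw [(lowBd_Lop _).vl (by omega), (lowBd_Lop _).vl (by omega)]
      · lift d to ℕ using hd
        exact h d
  obtain ⟨y, hy, hy0, t0, t1, hys, rfl⟩ := exists_log hx s0 s1
    (sig_mul_eq_one hα.1.1 hβ.1.1 hα0 hx hg s0 s1 hα.2 hβ.2)
  have hsk : ∀ d : ℤ, (-1) ^ d.natAbs * refl (lam - 1 + d) (cf y d) = -cf y d := fun d => by
    rw [← cf_sig, hys, cf_neg]
  suffices hs : ∃ y' ∈ poOp lam, ∃ hy' : y' ∈ opRing, LowBd (-1) y' ∧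
      rep hv (kz k) (gdef (b + hOp lam) (expS hy') (a + hOp lam)) = 0 by
    obtain ⟨y', hp, hy', hy'0, hrep⟩ := hs
    exact ⟨_, (nilp_iff H hκ _).2 ⟨y', hp, hy'0, rfl⟩, _, isExp_rep hκ hp.1 hy'0,
      (gauge_rel_iff hk ha.1 hb.1 (expS_mem_glRing hp.1 hy'0)).2 hrep⟩
  rcases hl with hl | ⟨n, hn, hvn⟩
  · refine ⟨y, mem_poOp_iff.2 ⟨hy, fun d => ⟨wPoly_dvd_of_vanish (fun i j _ _ e => ?_)
      (fun i hi => ?_) (fun i hi => t1 i d hi), hsk d⟩⟩, hy, hy0, by rw [hg, rep_zero]⟩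
    · refine hl (i - j : ℤ) ?_
      push_cast
      rw [e]; ring
    · have := t0 i d hi
      rwa [zero_add] at this
  -- For λ = n the roots are distinct only in places d ≤ n, so y is cut off there. The gauge
  -- relation is then disturbed only in places ≥ n, which an n × n matrix does not see.
  · set y' := mkOp 0 fun d => if d ≤ n then cf y d else 0 with hy'd
    have hcf : ∀ d ≤ (n : ℤ), cf y' d = cf y d := by
      intro d hd
      rw [hy'd, cf_mkOp, if_pos hd]
      split_ifs with h0
      · rfl
      · rw [hy0 d (by omega)]
    have hp : y' ∈ poOp lam := by
      refine mkOp_mem_poOp 0 fun d => ?_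
      split_ifs with hd
      · refine ⟨wPoly_dvd_of_vanish (fun i j hi hj e => ?_) (fun i hi => ?_)
          (fun i hi => t1 i d hi), hsk d⟩
        · rw [hn] at e
          have : i = n + j := by exact_mod_cast e
          omega
        · have := t0 i d hi
          rwa [zero_add] at this
      · exact poPoly_zero lam d
    have hy'm : y' ∈ opRing := hp.1.1
    have hy'0 : LowBd (-1) y' := fun d hd => by rw [hcf d (by omega), hy0 d hd]
    refine ⟨y', hp, hy'm, hy'0, ?_⟩
    have hz : LowBd (-(n + 1 : ℕ)) (y - y') := fun d hd => by
      rw [cf_sub, hcf d (by push_cast at hd; omega), sub_self]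
    have hD : LowBd (-n - 1) (expS hy - expS hy'm) := by
      intro d hd
      have := cf_expS_add hy'm (sub_mem hy hy'm) hy'0 (n := n + 1) (by omega) hz (d := d)
        (by push_cast; omega)
      rw [hz d (by push_cast; omega), add_zero,
        expS_congr (add_mem hy'm (sub_mem hy hy'm)) hy (by abel)] at this
      rw [cf_sub, this, sub_self]
    have hG := lowBd_gdef (sub_mem (expS_mem hy) (expS_mem hy'm)) hD hα.1.1 hα0 hβ.1.1 hβ0
    rw [gdef_sub_mid, hg, zero_sub] at hG
    refine matrix_ext fun i j => ?_
    have h1 := hG.vl (d := v j - v i) (by have := hvn j; omega) (v j)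
    rw [vl_neg, neg_eq_zero] at h1
    rw [entry_rep, h1, mul_zero, entry_zero]

end Fibre

/-! ### The involution on symbols -/

/-- Since `starSeq c u` stands for Σ (-1)^p D^{c-p}∘u_p, left composition with D^b only changes the
exponents; in coefficients this is Vandermonde's identity. -/
theorem Th_starSeq (b c : ℂ) (u : ℕ → K) : Th b (starSeq c u) = starSeq (b + c) u := by
  funext n
  have h1 : ∀ p : ℕ × ℕ, algebraMap ℂ K (Ring.choose b p.1) * dz^[p.1] (starSeq c u p.2)
      = ∑ q ∈ adiag p.2, algebraMap ℂ K (Ring.choose b p.1 * Ring.choose (c - q.2) q.1)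
        * ((-1) ^ q.2 * dz^[p.1 + q.1] (u q.2)) := fun p => by
    rw [starSeq, ← dzP_apply, map_sum, Finset.mul_sum]
    refine Finset.sum_congr rfl fun q _ => ?_
    have h2 : ((-1 : K) ^ q.2) = algebraMap ℂ K ((-1) ^ q.2) := by simp
    rw [dzP_apply, iter_dz_const_mul, h2, iter_dz_const_mul, ← Function.iterate_add_apply, map_mul,
      mul_assoc]
  have h2 : ∀ p : ℕ × ℕ, algebraMap ℂ K (Ring.choose (b + c - p.2) p.1)
        * ((-1) ^ p.2 * dz^[p.1] (u p.2))
      = ∑ q ∈ adiag p.1, algebraMap ℂ K (Ring.choose b q.1 * Ring.choose (c - p.2) q.2)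
        * ((-1) ^ p.2 * dz^[q.1 + q.2] (u p.2)) := fun p => by
    rw [add_sub_assoc, Ring.add_choose_eq _ (Commute.all _ _), map_sum, Finset.sum_mul]
    refine Finset.sum_congr rfl fun q hq => ?_
    rw [Finset.HasAntidiagonal.mem_antidiagonal.1 hq]
  rw [Th, starSeq, Finset.sum_congr rfl fun p _ => h1 p, Finset.sum_congr rfl fun p _ => h2 p]
  exact (sum_adiag_assoc n fun i j k => algebraMap ℂ K (Ring.choose b i * Ring.choose (c - k) j)
    * ((-1) ^ k * dz^[i + j] (u k))).symm

/-- The D⁻¹-coefficient is in question, and D^{q-1-p}∘u_p with p < q is a differential operator. -/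
theorem starSeq_self (u : ℕ → K) {q : ℕ} {c : ℂ} (hc : c = q - 1) : starSeq c u q = (-1) ^ q * u q := by
  rw [starSeq, Finset.sum_eq_single (0, q)]
  · simp
  · rintro ⟨l, p⟩ hp hne
    have hp := Finset.HasAntidiagonal.mem_antidiagonal.1 hp
    simp only at hp
    obtain ⟨l, rfl⟩ : ∃ k, l = k + 1 := ⟨l - 1, by
      rcases Nat.eq_zero_or_pos l with rfl | h
      · exact absurd (by simp at hp; rw [hp]) hne
      · omega⟩
    have e : c - p = (l : ℕ) := by rw [hc, ← hp]; push_cast; ring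
    simp only
    rw [e, Ring.choose_natCast, Nat.choose_eq_zero_of_lt (Nat.lt_succ_self l), Nat.cast_zero,
      map_zero, zero_mul]
  · exact fun h => absurd (Finset.HasAntidiagonal.mem_antidiagonal.2 (by simp)) h

/-- Upper negation of binomial coefficients rewrites the q-th coefficient of the double adjoint, up
to sign, as the D⁻¹-coefficient of D^{q-1-λ} composed with the adjoint, which `starSeq_self`
evaluates. -/
theorem starSeq_starSeq (lam : ℂ) (u : ℕ → K) : starSeq lam (starSeq lam u) = u := by
  funext q
  have h1 := starSeq_self u (q := q) (c := (q - 1 - lam) + lam) (by ring)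
  rw [← Th_starSeq] at h1
  have h2 : starSeq lam (starSeq lam u) q = (-1) ^ q * Th (q - 1 - lam) (starSeq lam u) q := by
    rw [Th, Finset.mul_sum]
    refine Finset.sum_congr rfl fun p hp => ?_
    have hp := Finset.HasAntidiagonal.mem_antidiagonal.1 hp
    have e : (q : ℂ) - 1 - lam = -(lam - p.2 - p.1 + 1) := by
      rw [← hp]; push_cast; ring
    rw [e, Ring.choose_neg, show lam - p.2 - p.1 + 1 + p.1 - 1 = lam - p.2 by ring,
      Int.negOnePow_def, zpow_natCast, Units.smul_def]
    have h3 : (-1 : K) ^ q = (-1) ^ p.1 * (-1) ^ p.2 := by rw [← pow_add, hp]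
    have h4 : ((-1 : K) ^ p.1) * (-1) ^ p.1 = 1 := by rw [← mul_pow, neg_one_mul, neg_neg, one_pow]
    push_cast [zsmul_eq_mul, map_mul, map_pow, map_neg, map_one]
    rw [h3]
    linear_combination -(algebraMap ℂ K (Ring.choose (lam - p.2) p.1)) * (-1) ^ p.2
      * dz^[p.1] (starSeq lam u p.2) * h4
  rw [h2, h1, ← mul_assoc, ← mul_pow, neg_one_mul, neg_neg, one_pow, one_mul]

/-- The part of `starSeq` that involves only earlier terms. -/
def starRest (lam : ℂ) (u : ℕ → K) (m : ℕ) : K :=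
  ∑ p ∈ (adiag m).erase (0, m), algebraMap ℂ K (Ring.choose (lam - p.2) p.1)
    * ((-1) ^ p.2 * dz^[p.1] (u p.2))

theorem starSeq_eq (lam : ℂ) (u : ℕ → K) (m : ℕ) :
    starSeq lam u m = (-1) ^ m * u m + starRest lam u m := by
  rw [starSeq, starRest, ← Finset.add_sum_erase _ _
    (Finset.HasAntidiagonal.mem_antidiagonal.2 (zero_add m) : (0, m) ∈ adiag m)]
  simp

theorem lt_of_mem_erase {m : ℕ} {p : ℕ × ℕ} (hp : p ∈ (adiag m).erase (0, m)) : p.2 < m := by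
  have h1 := Finset.HasAntidiagonal.mem_antidiagonal.1 (Finset.mem_of_mem_erase hp)
  have h2 := Finset.ne_of_mem_erase hp
  rcases p with ⟨l, p⟩
  rcases Nat.eq_zero_or_pos l with rfl | h
  · exact absurd (by simp at h1; rw [h1]) h2
  · simp only at h1 ⊢; omega

theorem starRest_congr (lam : ℂ) {u w : ℕ → K} {m : ℕ} (h : ∀ i < m, u i = w i) :
    starRest lam u m = starRest lam w m :=
  Finset.sum_congr rfl fun p hp => by rw [h _ (lt_of_mem_erase hp)]

/-- The self-adjoint symbol with given coefficients in even places. -/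
def selfAdj (lam : ℂ) (g : ℕ → K) : ℕ → K :=
  seqRec fun m f => if Even m then g (m / 2) else algebraMap ℂ K (1 / 2) * starRest lam f m

theorem selfAdj_eq (lam : ℂ) (g : ℕ → K) (m : ℕ) : selfAdj lam g m =
    if Even m then g (m / 2) else algebraMap ℂ K (1 / 2) * starRest lam (selfAdj lam g) m :=
  seqRec_eq (fun m f g' h => by rw [starRest_congr lam h]) m

theorem selfAdj_even (lam : ℂ) (g : ℕ → K) (i : ℕ) : selfAdj lam g (2 * i) = g i := by
  rw [selfAdj_eq, if_pos (even_two_mul i), Nat.mul_div_cancel_left _ two_pos]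

/-- Odd coefficients are chosen to satisfy their equation; the equations in even places follow from
involutivity. -/
theorem starSeq_selfAdj (lam : ℂ) (g : ℕ → K) : starSeq lam (selfAdj lam g) = selfAdj lam g := by
  funext m
  induction m using Nat.strong_induction_on with
  | _ m ih =>
    have h1 := starSeq_eq lam (selfAdj lam g) m
    rcases Nat.even_or_odd m with hm | hm
    -- In an even place, taking the adjoint twice adds the same lower-order part twice and returns
    -- the original, so that part is zero.
    · have h2 := starSeq_eq lam (starSeq lam (selfAdj lam g)) m
      rw [starSeq_starSeq, starRest_congr lam ih, h1, hm.neg_one_pow] at h2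
      rw [h1, hm.neg_one_pow]
      linear_combination (-1 / 2 : K) * h2
    · rw [h1, hm.neg_one_pow]
      have h3 := selfAdj_eq lam g m
      rw [if_neg (Nat.not_even_iff_odd.2 hm)] at h3
      have h4 : algebraMap ℂ K (1 / 2) = 1 / 2 := by rw [map_div₀, map_one, map_ofNat]
      rw [h4] at h3
      linear_combination -2 * h3

theorem eq_selfAdj {lam : ℂ} {u : ℕ → K} (h : starSeq lam u = u) :
    u = selfAdj lam fun i => u (2 * i) := by
  funext m
  induction m using Nat.strong_induction_on with
  | _ m ih =>
    rw [selfAdj_eq]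
    split_ifs with hm
    · rw [Nat.mul_div_cancel' hm.two_dvd]
    · have h1 := starSeq_eq lam u m
      rw [h, (Nat.not_even_iff_odd.1 hm).neg_one_pow, starRest_congr lam ih] at h1
      have h4 : algebraMap ℂ K (1 / 2) = 1 / 2 := by rw [map_div₀, map_one, map_ofNat]
      rw [h4]
      linear_combination (1 / 2 : K) * h1

theorem eq_of_even_eq {lam : ℂ} {u w : ℕ → K} (hu : starSeq lam u = u) (hw : starSeq lam w = w)
    (h : ∀ i, u (2 * i) = w (2 * i)) : u = w := by
  rw [eq_selfAdj hu, eq_selfAdj hw]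
  exact congrArg _ (funext h)

theorem mem_PsiSA_iff {lam : ℂ} {L : Symb} :
    L ∈ PsiSA lam ↔ ∃ u, u 0 = 1 ∧ starSeq lam u = u ∧ L = toSymb 0 u := by
  constructor
  · rintro ⟨hL, hs⟩
    have e := eq_toSymb_of_mem_PsiDS hL
    refine ⟨_, hL.1, ?_, e⟩
    rw [e, star_toSymb] at hs
    exact toSymb_injective 0 hs
  · rintro ⟨u, h0, hs, rfl⟩
    exact ⟨toSymb_mem_PsiDS h0, by rw [star_toSymb, hs]⟩

theorem toSymb_zero_even (u : ℕ → K) (m : ℕ) : toSymb 0 u (-(2 * (m + 1) : ℤ)) = u (2 * (m + 1)) := by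
  rw [show (-(2 * (m + 1) : ℤ)) = 0 - (2 * (m + 1) : ℕ) by push_cast; ring, toSymb_sub]

/-- The sequence of coefficients in even places of a monic symbol. -/
def monicSeq (w : ℕ → K) : ℕ → K
  | 0 => 1
  | i + 1 => w i

theorem existsUnique_PsiSA (lam : ℂ) (w : ℕ → K) :
    ∃! L : Symb, L ∈ PsiSA lam ∧ ∀ m : ℕ, L (-(2 * (m + 1) : ℤ)) = w m := by
  refine ⟨toSymb 0 (selfAdj lam (monicSeq w)), ⟨mem_PsiSA_iff.2 ⟨_, selfAdj_even lam _ 0,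
    starSeq_selfAdj _ _, rfl⟩, fun m => ?_⟩, ?_⟩
  · rw [toSymb_zero_even, selfAdj_even]; rfl
  · rintro L ⟨hL, hw⟩
    obtain ⟨u, h0, hs, rfl⟩ := mem_PsiSA_iff.1 hL
    refine congrArg _ (eq_of_even_eq hs (starSeq_selfAdj _ _) fun i => ?_)
    rw [selfAdj_even]
    cases i with
    | zero => exact h0
    | succ i => exact (toSymb_zero_even u i).symm.trans (hw i)

/-! ### Covectors with given coefficients -/

theorem res_mul_iter_dz (a b : K) (l : ℕ) : res (a * dz^[l] b) = (-1) ^ l * res (dz^[l] a * b) := by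
  induction l generalizing a with
  | zero => simp
  | succ l ih =>
    have h : ∀ a b : K, res (a * dz b) = -res (dz a * b) := fun a b => by
      have := res_dz (a * b)
      rw [dz_mul, res_add] at this
      linear_combination this
    rw [Function.iterate_succ_apply', h, ih, ← Function.iterate_succ_apply]
    ring

/-- The covector `∑_{1 ≤ p ≤ N + 1} D^{-λ + p - 1} ∘ ξ_p`. -/
def covSeq (lam : ℂ) (N : ℕ) (xi : ℕ → K) : ℕ → K :=
  starSeq (N - lam) fun p => if p ≤ N then (-1) ^ p * xi (N + 1 - p) else 0

theorem covSeq_mem (lam : ℂ) (N : ℕ) (xi : ℕ → K) : toSymb N (covSeq lam N xi) ∈ PsiCotangent lam := by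
  set eta : ℕ → K := fun p => if p ≤ N then (-1) ^ p * xi (N + 1 - p) else 0 with he
  refine ⟨toSymb N (starSeq N eta), fun m hm => ?_, ⟨N, fun m hm => toSymb_of_lt hm _⟩, ?_⟩
  · obtain ⟨n, rfl⟩ : ∃ n : ℕ, m = N - n := ⟨(N - m).toNat, by omega⟩
    rw [toSymb_sub, starSeq]
    refine Finset.sum_eq_zero fun p hp => ?_
    have hp := Finset.HasAntidiagonal.mem_antidiagonal.1 hp
    rcases le_or_gt p.2 N with h | h
    · rw [← Nat.cast_sub h, Ring.choose_natCast, Nat.choose_eq_zero_of_lt (by omega), Nat.cast_zero,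
        map_zero, zero_mul]
    · rw [he]
      simp only
      rw [if_neg (by omega), iter_dz_zero, mul_zero, mul_zero]
  · rw [mono_eq_toSymb, comp_toSymb]
    simp only [one_mul]
    rw [symMul_delta, Th_starSeq, covSeq, zero_add, Int.cast_zero, add_zero, neg_add_eq_sub]

/-- In the trace of d_p D^{λ-p}∘D^{-λ+r-1}∘ξ_r only r = p yields D⁻¹ after truncation to the
relevant order: the coefficients ξ_p are dual to the coordinates. -/
theorem FF_covSeq (lam : ℂ) (N : ℕ) (xi d : ℕ → K) (hd : d 0 = 0) :
    FF lam (toSymb N (covSeq lam N xi)) (toSymb 0 d)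
      = ∑ p ∈ adiag (N + 1), res (xi p.1 * d p.1) := by
  rw [FF_toSymb, symMul, res_sum]
  refine Finset.sum_congr rfl fun p hp => ?_
  have hp := Finset.HasAntidiagonal.mem_antidiagonal.1 hp
  rcases Nat.eq_zero_or_pos p.1 with h | h
  · rw [h, hd, zero_mul, mul_zero]
  · have hc : lam - p.1 + (N - lam) = (p.2 : ℂ) - 1 := by
      have := congrArg (Nat.cast (R := ℂ)) hp
      push_cast at this
      linear_combination -this
    rw [covSeq, Th_starSeq, starSeq_self _ hc, if_pos (by omega), ← mul_assoc ((-1) ^ p.2),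
      ← mul_pow, neg_one_mul, neg_neg, one_pow, one_mul, mul_comm, show N + 1 - p.2 = p.1 by omega]

/-- The coefficients of the covector of `u ↦ Res a u_{-m}`, symmetrized. -/
def coordXi (lam : ℂ) (m : ℕ) (a : K) (p : ℕ) : K :=
  algebraMap ℂ K (1 / 2) * ((if p = m then a else 0)
    + algebraMap ℂ K (Ring.choose (lam - p) (m - p)) * dz^[m - p] a)

theorem FF_coord (lam : ℂ) (N : ℕ) (hN : Even (N + 1)) (a : K) (d : ℕ → K) (hd : d 0 = 0) :
    FF lam (toSymb N (covSeq lam N (coordXi lam (N + 1) a))) (toSymb 0 d)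
      = 1 / 2 * (res (a * d (N + 1)) + res (a * starSeq lam d (N + 1))) := by
  have h1 : res (a * d (N + 1)) = ∑ p ∈ adiag (N + 1), res ((if p.1 = N + 1 then a else 0) * d p.1) := by
    rw [Finset.sum_eq_single (N + 1, 0)]
    · rw [if_pos rfl]
    · rintro ⟨p, q⟩ hp hne
      have hp := Finset.HasAntidiagonal.mem_antidiagonal.1 hp
      simp only at hp ⊢
      rw [if_neg, zero_mul, res_zero]
      rintro rfl
      exact hne (by simp at hp; rw [hp])
    · exact fun h => absurd (Finset.HasAntidiagonal.mem_antidiagonal.2 (by simp)) h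
  have h2 : res (a * starSeq lam d (N + 1)) = ∑ p ∈ adiag (N + 1),
      res (algebraMap ℂ K (Ring.choose (lam - p.1) (N + 1 - p.1)) * dz^[N + 1 - p.1] a * d p.1) := by
    rw [starSeq, Finset.mul_sum, res_sum, ← Finset.Nat.sum_antidiagonal_swap]
    refine Finset.sum_congr rfl fun p hp => ?_
    have hp := Finset.HasAntidiagonal.mem_antidiagonal.1 hp
    have e : ((-1 : ℂ)) ^ p.1 * (-1) ^ p.2 = 1 := by rw [← pow_add, hp, hN.neg_one_pow]
    simp only [Prod.fst_swap, Prod.snd_swap]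
    rw [show N + 1 - p.1 = p.2 by omega, mul_assoc, res_const_mul, mul_left_comm, res_const_mul,
      mul_left_comm, show ((-1 : K)) ^ p.1 = algebraMap ℂ K ((-1) ^ p.1) by simp, res_const_mul,
      res_mul_iter_dz]
    linear_combination Ring.choose (lam - p.1) p.2 * res (dz^[p.2] a * d p.1) * e
  rw [FF_covSeq lam N _ d hd, h1, h2, ← Finset.sum_add_distrib, Finset.mul_sum]
  refine Finset.sum_congr rfl fun p _ => ?_
  rw [coordXi, mul_assoc, res_const_mul, add_mul, res_add]

theorem exists_seq_of_mem_PsiTangent {δ : Symb} (h : δ ∈ PsiTangent) :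
    ∃ d : ℕ → K, d 0 = 0 ∧ δ = toSymb 0 d :=
  ⟨_, h _ (by simp), eq_toSymb fun m hm => h m hm.le⟩

/-- The covector is the average of the coordinate functional and its adjoint; `coordXi` is obtained
by moving derivatives off d in Res a·d^*. -/
theorem exists_coordCovector (lam : ℂ) (i : ℕ) (a : K) :
    IsCoordCovector lam i a
      (toSymb (2 * i + 1 : ℕ) (covSeq lam (2 * i + 1) (coordXi lam (2 * i + 1 + 1) a))) := by
  have hN : Even (2 * i + 1 + 1) := ⟨i + 1, by ring⟩
  refine ⟨⟨covSeq_mem _ _ _, fun δ hδ => ?_⟩, fun δ hδ => ?_⟩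
  · obtain ⟨d, h0, rfl⟩ := exists_seq_of_mem_PsiTangent hδ
    have h0' : starSeq lam d 0 = 0 := by simp [starSeq, h0]
    rw [star_toSymb, FF_coord lam _ hN a _ h0, FF_coord lam _ hN a _ h0', starSeq_starSeq, add_comm]
  · obtain ⟨d, h0, rfl⟩ := exists_seq_of_mem_PsiTangent hδ.1
    have hs := hδ.2
    rw [star_toSymb] at hs
    rw [FF_coord lam _ hN a _ h0, toSymb_injective 0 hs, toSymb_zero_even,
      show 2 * i + 1 + 1 = 2 * (i + 1) by ring]
    ring

/-! ### Polynomial dependence on `λ` -/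

theorem polyK_const (a : K) : PolyK fun _ => a := ⟨Polynomial.C a, fun t => (ev_C t a).symm⟩

theorem PolyK.add {f g : ℂ → K} (hf : PolyK f) (hg : PolyK g) : PolyK fun t => f t + g t := by
  obtain ⟨p, hp⟩ := hf
  obtain ⟨q, hq⟩ := hg
  exact ⟨p + q, fun t => by simp only [map_add, hp, hq]⟩

theorem PolyK.mul {f g : ℂ → K} (hf : PolyK f) (hg : PolyK g) : PolyK fun t => f t * g t := by
  obtain ⟨p, hp⟩ := hf
  obtain ⟨q, hq⟩ := hg
  exact ⟨p * q, fun t => by simp only [map_mul, hp, hq]⟩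

theorem exists_res_ev (p : K[X]) : ∃ P : ℂ[X], ∀ t, res (ev t p) = P.eval t := by
  induction p using Polynomial.induction_on' with
  | add p q hp hq =>
    obtain ⟨P, hP⟩ := hp
    obtain ⟨Q, hQ⟩ := hq
    exact ⟨P + Q, fun t => by rw [map_add, res_add, hP, hQ, Polynomial.eval_add]⟩
  | monomial n c =>
    refine ⟨Polynomial.monomial n (res c), fun t => ?_⟩
    rw [ev_apply, Polynomial.eval_monomial, Polynomial.eval_monomial, mul_comm c, ← map_pow,
      res_const_mul, mul_comm]

theorem PolyK.exists_res {f : ℂ → K} (hf : PolyK f) : ∃ P : ℂ[X], ∀ t, res (f t) = P.eval t := by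
  obtain ⟨p, hp⟩ := hf
  obtain ⟨P, hP⟩ := exists_res_ev p
  exact ⟨P, fun t => by rw [hp, hP]⟩

/-- Affine functions of `λ`. -/
def Affine (b : ℂ → ℂ) : Prop := ∃ c d : ℂ, ∀ t, b t = c * t + d

theorem affine_id : Affine fun t => t := ⟨1, 0, fun t => by ring⟩

theorem affine_const (c : ℂ) : Affine fun _ => c := ⟨0, c, fun t => by ring⟩

theorem Affine.sub {b c : ℂ → ℂ} (hb : Affine b) (hc : Affine c) : Affine fun t => b t - c t := by
  obtain ⟨b1, b0, hb⟩ := hb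
  obtain ⟨c1, c0, hc⟩ := hc
  exact ⟨b1 - c1, b0 - c0, fun t => by simp only [hb, hc]; ring⟩

theorem polyK_choose {b : ℂ → ℂ} (hb : Affine b) (l : ℕ) :
    PolyK fun t => algebraMap ℂ K (Ring.choose (b t) l) := by
  obtain ⟨c, d, hb⟩ := hb
  refine ⟨(chPoly l).comp (Polynomial.C (algebraMap ℂ K c) * Polynomial.X
    + Polynomial.C (algebraMap ℂ K d)), fun t => ?_⟩
  simp only
  rw [← ev_chPoly, hb, ev_apply, ev_apply, Polynomial.eval_comp]
  simp

theorem polyK_Th {b : ℂ → ℂ} (hb : Affine b) {f : ℕ → ℂ → K} (hf : ∀ n, PolyK (f n)) (m : ℕ) :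
    PolyK fun t => Th (b t) (fun n => f n t) m :=
  PolyK.sum _ fun p _ => (polyK_choose hb p.1).mul ((hf p.2).iter_dz p.1)

theorem polyK_symMul {b : ℂ → ℂ} (hb : Affine b) {f g : ℕ → ℂ → K} (hf : ∀ n, PolyK (f n))
    (hg : ∀ n, PolyK (g n)) (m : ℕ) :
    PolyK fun t => symMul (b t) (fun n => f n t) (fun n => g n t) m :=
  PolyK.sum _ fun p _ => (hf p.1).mul (polyK_Th (hb.sub (affine_const p.1)) hg p.2)

theorem polyK_truncSeq (N : ℕ) {f : ℕ → ℂ → K} (hf : ∀ n, PolyK (f n)) (m : ℕ) :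
    PolyK fun t => truncSeq N (fun n => f n t) m := by
  simp only [truncSeq]
  split_ifs
  · exact hf m
  · exact polyK_const 0

theorem polyK_starSeq_affine {b : ℂ → ℂ} (hb : Affine b) {f : ℕ → ℂ → K} (hf : ∀ n, PolyK (f n))
    (m : ℕ) : PolyK fun t => starSeq (b t) (fun n => f n t) m :=
  PolyK.sum _ fun p _ => (polyK_choose (hb.sub (affine_const p.2)) p.1).mul
    (((hf p.2).iter_dz p.1).const_mul _)

theorem polyK_selfAdj (g : ℕ → K) (m : ℕ) : PolyK fun t => selfAdj t g m := by
  induction m using Nat.strong_induction_on with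
  | _ m ih =>
    simp only [selfAdj_eq _ g m]
    split_ifs
    · exact polyK_const _
    · exact (PolyK.sum _ fun p hp => (polyK_choose (affine_id.sub (affine_const p.2)) p.1).mul
        (((ih p.2 (lt_of_mem_erase hp)).iter_dz p.1).const_mul _)).const_mul _

theorem polyK_covSeq (N m : ℕ) (a : K) (n : ℕ) :
    PolyK fun t => covSeq t N (coordXi t m a) n := by
  refine polyK_starSeq_affine ((affine_const N).sub affine_id)
    (f := fun p t => if p ≤ N then (-1) ^ p * coordXi t m a (N + 1 - p) else 0) (fun p => ?_) n
  split_ifs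
  · refine (((polyK_const _).add ?_).const_mul _).const_mul _
    exact (polyK_choose (affine_id.sub (affine_const _)) _).mul (polyK_const _)
  · exact polyK_const 0

/-! ### Dependence of the Gelfand–Dickey structure on the functionals -/

/-- The coefficients of the Hamiltonian vector field. -/
def hamSeq (lam : ℂ) (N : ℕ) (X q : ℕ → K) (m : ℕ) : K :=
  symMul N (truncSeq N (symMul lam q X)) q (m + N)
    - symMul lam q (truncSeq N (symMul (N - lam) X q)) (m + N)

theorem hamSeq_zero (lam : ℂ) (N : ℕ) (X q : ℕ → K) : hamSeq lam N X q 0 = 0 := by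
  have h2 : symMul lam q (truncSeq N (symMul (N - lam) X q)) N
      = symMul lam q (symMul (N - lam) X q) N := by
    refine Finset.sum_congr rfl fun p hp => ?_
    have hp := Finset.HasAntidiagonal.mem_antidiagonal.1 hp
    congr 1
    refine Finset.sum_congr rfl fun r hr => ?_
    have hr := Finset.HasAntidiagonal.mem_antidiagonal.1 hr
    rw [truncSeq, if_pos (by omega)]
  rw [hamSeq, zero_add, symMul_truncSeq_left le_rfl, h2, ← symMul_assoc, add_sub_cancel, sub_self]

theorem symMul_congr_le {al : ℂ} {f f' g g' : ℕ → K} {N : ℕ} (hf : ∀ n ≤ N, f n = f' n)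
    (hg : ∀ n ≤ N, g n = g' n) {n : ℕ} (hn : n ≤ N) : symMul al f g n = symMul al f' g' n := by
  refine Finset.sum_congr rfl fun p hp => ?_
  have hp := Finset.HasAntidiagonal.mem_antidiagonal.1 hp
  rw [hf _ (by omega)]
  congr 1
  refine Finset.sum_congr rfl fun r hr => ?_
  have hr := Finset.HasAntidiagonal.mem_antidiagonal.1 hr
  rw [hg _ (by omega)]

theorem hamSeq_congr (lam : ℂ) (N : ℕ) {X X' : ℕ → K} (h : ∀ n ≤ N, X n = X' n) (q : ℕ → K) :
    hamSeq lam N X q = hamSeq lam N X' q := by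
  have h1 : truncSeq N (symMul lam q X) = truncSeq N (symMul lam q X') := by
    funext n
    rw [truncSeq, truncSeq]
    split_ifs with hn
    · exact symMul_congr_le (fun _ _ => rfl) h hn
    · rfl
  have h2 : truncSeq N (symMul (N - lam) X q) = truncSeq N (symMul (N - lam) X' q) := by
    funext n
    rw [truncSeq, truncSeq]
    split_ifs with hn
    · exact symMul_congr_le h (fun _ _ => rfl) hn
    · rfl
  funext m
  rw [hamSeq, hamSeq, h1, h2]

/-- Testing on δ concentrated in a single place determines the coefficients one after another, by
triangularity of `Th`. -/
theorem eq_of_FF_eq {lam : ℂ} {N : ℕ} {X X' : ℕ → K}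
    (h : ∀ δ ∈ PsiTangent, FF lam (toSymb N X) δ = FF lam (toSymb N X') δ) :
    ∀ n ≤ N, X n = X' n := by
  intro n
  induction n using Nat.strong_induction_on with
  | _ n ih =>
    intro hn
    have key : Th (lam - (N + 1 - n : ℕ)) X n = Th (lam - (N + 1 - n : ℕ)) X' n := by
      refine sub_eq_zero.1 (eq_zero_of_res_mul fun c => ?_)
      have h1 := h (toSymb 0 fun p => if p = N + 1 - n then c else 0)
        (toSymb_mem_PsiTangent (if_neg (by omega)))
      have h2 : ∀ X : ℕ → K, symMul lam (fun p => if p = N + 1 - n then c else 0) X (N + 1)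
          = c * Th (lam - (N + 1 - n : ℕ)) X n := by
        intro X
        rw [symMul, Finset.sum_eq_single (N + 1 - n, n)]
        · rw [if_pos rfl]
        · rintro ⟨p, q⟩ hp hne
          have hp := Finset.HasAntidiagonal.mem_antidiagonal.1 hp
          simp only at hp ⊢
          rw [if_neg, zero_mul]
          rintro rfl
          exact hne (by rw [show q = n by omega])
        · exact fun h => absurd (Finset.HasAntidiagonal.mem_antidiagonal.2
            (show N + 1 - n + n = N + 1 by omega)) h
      rw [FF_toSymb, FF_toSymb, h2, h2, ← sub_eq_zero, ← res_sub] at h1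
      rw [← h1]
      congr 1
      ring
    have h3 : ∀ (b : ℂ) (X : ℕ → K), Th b X n = X n + ∑ p ∈ (adiag n).erase (0, n),
        algebraMap ℂ K (Ring.choose b p.1) * dz^[p.1] (X p.2) := by
      intro b X
      rw [Th, ← Finset.add_sum_erase _ _
        (Finset.HasAntidiagonal.mem_antidiagonal.2 (zero_add n) : (0, n) ∈ adiag n)]
      simp
    rw [h3, h3, Finset.sum_congr rfl fun p hp => by
      rw [ih p.2 (lt_of_mem_erase hp) ((lt_of_mem_erase hp).le.trans hn)]] at key
    exact add_right_cancel key

theorem FF_of_isCoordCovector {lam : ℂ} {j : ℕ} {c : K} {Y : Symb} (hY : IsCoordCovector lam j c Y)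
    {d : ℕ → K} (hd : d 0 = 0) : FF lam Y (toSymb 0 d)
      = 1 / 2 * (res (c * d (2 * (j + 1))) + res (c * starSeq lam d (2 * (j + 1)))) := by
  obtain ⟨⟨hY1, hY2⟩, hY3⟩ := hY
  have h1 := hY2 _ (toSymb_mem_PsiTangent hd)
  have hd' : starSeq lam d 0 = 0 := by simp [starSeq, hd]
  have h2 := hY3 (toSymb 0 fun n => d n + starSeq lam d n)
    ⟨toSymb_mem_PsiTangent (by rw [hd, hd', add_zero]), by
      rw [star_toSymb]
      congr 1
      funext n
      rw [starSeq_add, starSeq_starSeq, add_comm]⟩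
  obtain ⟨M, Y, rfl⟩ := exists_toSymb_of_mem_PsiCotangent hY1
  rw [star_toSymb] at h1
  rw [FF_add_toSymb, toSymb_zero_even, mul_add, res_add, h1] at h2
  linear_combination (1 / 2 : ℂ) * h2

/-- The coefficients of X that F_X does not see lie beyond the orders that enter the differential
parts of LX and XL. -/
theorem hamV_congr {lam : ℂ} {X X' L : Symb} (hX : X ∈ PsiCotangent lam) (hX' : X' ∈ PsiCotangent lam)
    (h : ∀ δ ∈ PsiTangent, FF lam X δ = FF lam X' δ) (hL : L ∈ PsiDS) :
    hamV lam X L = hamV lam X' L := by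
  obtain ⟨N, X, rfl⟩ := exists_toSymb_of_mem_PsiCotangent hX
  obtain ⟨N', X', rfl⟩ := exists_toSymb_of_mem_PsiCotangent hX'
  have e1 := eq_toSymb (u := toSymb N X) (N := (max N N' : ℕ))
    fun m hm => toSymb_of_lt (by push_cast at hm; omega) _
  have e2 := eq_toSymb (u := toSymb N' X') (N := (max N N' : ℕ))
    fun m hm => toSymb_of_lt (by push_cast at hm; omega) _
  rw [e1, e2] at h ⊢
  rw [eq_toSymb_of_mem_PsiDS hL, hamV_toSymb, hamV_toSymb]
  exact congrArg _ (hamSeq_congr lam _ (eq_of_FF_eq h) _)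

/-- The bracket depends only on the functionals, so the explicit covectors may be used; they, the
self-adjoint symbol with given even coefficients, and composition are all polynomial in λ. -/
theorem gelfandDickey_polynomial (w : ℕ → K) (i j : ℕ) (a c : K) : ∃ P : Polynomial ℂ,
    ∀ (lam : ℂ) (L X Y : Symb), L ∈ PsiSA lam → (∀ m : ℕ, L (-(2 * (m + 1) : ℤ)) = w m) →
      IsCoordCovector lam i a X → IsCoordCovector lam j c Y →
        gelfandDickey lam L X Y = P.eval lam := by
  let X0 : ℕ → ℂ → K := fun n t => covSeq t (2 * i + 1) (coordXi t (2 * i + 1 + 1) a) n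
  let q : ℕ → ℂ → K := fun n t => selfAdj t (monicSeq w) n
  have hX0 : ∀ n, PolyK (X0 n) := fun n => polyK_covSeq _ _ a n
  have hq : ∀ n, PolyK (q n) := fun n => polyK_selfAdj _ n
  let V : ℕ → ℂ → K := fun m t => hamSeq t (2 * i + 1) (fun n => X0 n t) (fun n => q n t) m
  have hV : ∀ m, PolyK (V m) := fun m =>
    (polyK_symMul (affine_const _) (polyK_truncSeq _ (polyK_symMul affine_id hq hX0)) hq _).sub
      (polyK_symMul affine_id hq
        (polyK_truncSeq _ (polyK_symMul ((affine_const _).sub affine_id) hX0 hq)) _)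
  obtain ⟨P, hP⟩ := (((hV (2 * (j + 1))).const_mul c).add
    ((polyK_starSeq_affine affine_id hV (2 * (j + 1))).const_mul c)).exists_res
  refine ⟨Polynomial.C (1 / 2) * P, fun lam L X Y hL hw hX hY => ?_⟩
  have hX' := exists_coordCovector lam i a
  obtain ⟨L', _, huniq⟩ := existsUnique_PsiSA lam w
  have hL' : L = toSymb 0 fun n => q n lam := by
    refine (huniq L ⟨hL, hw⟩).trans (huniq _ ⟨mem_PsiSA_iff.2 ⟨_, selfAdj_even lam _ 0,
      starSeq_selfAdj _ _, rfl⟩, fun m => ?_⟩).symm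
    rw [toSymb_zero_even]
    exact selfAdj_even lam _ _
  rw [gelfandDickey, hamV_congr hX.1.1 hX'.1.1 (fun δ hδ => ?_) hL.1, hL', hamV_toSymb]
  · rw [Polynomial.eval_mul, Polynomial.eval_C, ← hP, res_add]
    exact FF_of_isCoordCovector hY (hamSeq_zero lam _ _ _)
  · obtain ⟨d, hd, rfl⟩ := exists_seq_of_mem_PsiTangent hδ
    rw [FF_of_isCoordCovector hX hd, FF_of_isCoordCovector hX' hd]

/-! ### The trace of `e^d f^d` -/

theorem ev_wPoly_add_one (lam s : ℂ) (d : ℕ) : ev (s + 1) (wPoly lam (d + 1))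
    = algebraMap ℂ K ((s + 1) * (lam - s - 1)) * ev s (wPoly lam d) := by
  have h := ev_tr s 1 (wPoly lam (d + 1))
  have h' := tr_wPoly lam (d + 1) (-1)
  rw [neg_neg] at h'
  have hI : Finset.Ico (-1 : ℤ) (d + 1 + -1) = insert (-1 : ℤ) (Finset.Ico 0 (d : ℤ)) := by
    ext t; simp only [Finset.mem_insert, Finset.mem_Ico]; omega
  rw [h', hI, Finset.prod_insert (by simp), map_mul, ev_wFactor] at h
  rw [← Int.cast_one, ← h, wPoly]
  congr 2
  push_cast
  ring

/-- The combination of W_{d+1} and W_d on the two sides is a finite difference. -/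
theorem csum_wPoly_succ (lam : ℂ) (d : ℕ) : (2 * d + 3 : K) * csum lam (wPoly lam (d + 1))
    = algebraMap ℂ K ((d + 1) * (lam ^ 2 - (d + 1) ^ 2) / 2) * csum lam (wPoly lam d) := by
  have e1 : ev 0 (wPoly lam (d + 1)) = 0 := by
    have := ev_wPoly_eq_zero (lam := lam) (d := d + 1) (i := 0) (by omega)
    rwa [Nat.cast_zero] at this
  have e2 : ev lam (wPoly lam (d + 1)) = 0 := by
    have := ev_wPoly_eq_zero' (lam := lam) (d := d + 1) (i := 0) (by omega)
    rwa [Nat.cast_zero, add_zero] at this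
  -- Try (X - c) W_{d+1} as the primitive: it vanishes at 0 and λ, and c = (λ + 3d + 3)/2 makes its
  -- difference a combination of W_{d+1} and W_d with constant coefficients.
  have h := csum_eq_of_diff (lam := lam)
    (p := Polynomial.C (2 * d + 3 : K) * wPoly lam (d + 1)
      - Polynomial.C (algebraMap ℂ K ((d + 1) * (lam ^ 2 - (d + 1) ^ 2) / 2)) * wPoly lam d)
    (q := (Polynomial.X - Polynomial.C (algebraMap ℂ K ((lam + 3 * d + 3) / 2)))
      * wPoly lam (d + 1)) fun s => by
        rw [map_mul, ev_wPoly_add_one]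
        simp only [wPoly_succ, map_sub, map_mul, ev_C, ev_X, ev_wFactor]
        rw [← sub_eq_zero]
        have e : (2 * d + 3 : K) = algebraMap ℂ K (2 * d + 3) := by
          rw [map_add, map_mul, map_ofNat, map_ofNat, map_natCast]
        rw [e]
        simp only [← mul_assoc, ← map_mul, ← map_sub, ← sub_mul]
        rw [mul_eq_zero, map_eq_zero]
        left
        push_cast
        ring
  rw [map_mul, map_mul, e1, e2, mul_zero, mul_zero, sub_zero, csum_sub, csum_C_mul,
    csum_C_mul] at h
  exact sub_eq_zero.1 h

theorem csum_wPoly_ne_zero {lam : ℂ} (d : ℕ) (h : ∀ i : ℤ, -d ≤ i → i ≤ d → lam ≠ i) :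
    csum lam (wPoly lam d) ≠ 0 := by
  induction d with
  | zero =>
    rw [wPoly_of_nonpos _ (by simp), csum_one, Ne, map_eq_zero]
    simpa using h 0
  | succ d ih =>
    have h1 := csum_wPoly_succ lam d
    intro h0
    push_cast at h0
    rw [h0, mul_zero, eq_comm, mul_eq_zero, map_eq_zero] at h1
    rcases h1 with h1 | h1
    · rw [div_eq_zero_iff, or_iff_left two_ne_zero, mul_eq_zero,
        or_iff_right (Nat.cast_add_one_ne_zero d), sub_eq_zero, sq_eq_sq_iff_eq_or_eq_neg] at h1
      rcases h1 with h1 | h1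
      · exact h (d + 1) (by push_cast; omega) (by push_cast; omega) (by push_cast; exact h1)
      · exact h (-(d + 1)) (by push_cast; omega) (by push_cast; omega) (by push_cast; exact h1)
    · exact ih (fun i hi hi' => h i (by push_cast; omega) (by push_cast; omega)) h1

/-! ### The slice -/

/-- The operator `∑ c_i e^{2i+1}`. -/
def sliceOp (lam : ℂ) (c : ℕ → K) : Hs := mkOp 0 fun d =>
  if Odd d then Polynomial.C (c (d.toNat / 2)) * wPoly lam d else 0

theorem lowBd_sliceOp (lam : ℂ) (c : ℕ → K) : LowBd 0 (sliceOp lam c) := lowBd_mkOp _ _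

theorem cf_sliceOp (lam : ℂ) (c : ℕ → K) (m : ℕ) : cf (sliceOp lam c) m =
    if Odd m then Polynomial.C (c (m / 2)) * wPoly lam m else 0 := by
  rw [sliceOp, cf_mkOp, if_pos (by omega), Int.toNat_natCast]
  simp only [Int.odd_coe_nat]

theorem PoPoly.zero (lam : ℂ) (d : ℤ) : PoPoly lam d 0 := by
  have := (mem_poOp_iff.1 (zero_mem (poOp lam))).2 d
  rwa [cf_zero] at this

theorem poPoly_wPoly {lam : ℂ} (i : ℕ) : PoPoly lam (2 * i + 1 : ℕ) (wPoly lam (2 * i + 1 : ℕ)) := by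
  have h : sgl (2 * i + 1 : ℕ) (wPoly lam (2 * i + 1 : ℕ)) ∈ poOp lam := by
    refine ⟨sgl_mem_glRing dvd_rfl, ?_⟩
    rw [sig_sgl, refl_wPoly, Int.natAbs_natCast, pow_succ, pow_mul]
    refine opRing_ext (sgl_mem _ _) (neg_mem (sgl_mem _ _)) fun e => ?_
    rw [cf_neg, cf_sgl, cf_sgl]
    split_ifs <;> simp
  have := (mem_poOp_iff.1 h).2 (2 * i + 1 : ℕ)
  rwa [cf_sgl, if_pos rfl] at this

theorem sliceOp_mem_poOp (lam : ℂ) (c : ℕ → K) : sliceOp lam c ∈ poOp lam := by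
  rw [sliceOp]
  have : ∀ d : ℤ, 0 ≤ d → PoPoly lam d
      (if Odd d then Polynomial.C (c (d.toNat / 2)) * wPoly lam d else 0) := by
    intro d hd
    obtain ⟨m, rfl⟩ := Int.eq_ofNat_of_zero_le hd
    split_ifs with h
    · obtain ⟨i, rfl⟩ := (Int.odd_coe_nat m).1 h
      exact (poPoly_wPoly i).const_mul _
    · exact PoPoly.zero _ _
  refine mem_poOp_iff.2 ⟨mkOp_mem _ _, fun d => ?_⟩
  rw [cf_mkOp]
  split_ifs with h h'
  · have := this d (by omega)
    rwa [if_pos h'] at this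
  · exact PoPoly.zero _ _
  · exact PoPoly.zero _ _

theorem cf_Lop_succ (a : Hs) (m : ℕ) : cf (Lop a) (m + 1 : ℕ) = antidiff (pd (cf (Lop a) m)
    - ∑ p ∈ adiag m, tr (-p.2) (cf (Lop a) p.1) * cf a p.2) := by
  rw [Lop, cf_solOp_succ, cf_zero, sub_zero]

theorem cf_Lop_congr {a b : Hs} {m : ℕ} (h : ∀ i : ℕ, i < m → cf a i = cf b i) :
    cf (Lop a) m = cf (Lop b) m := by
  induction m using Nat.strong_induction_on with
  | _ m ih =>
    cases m with
    | zero => rw [Nat.cast_zero, cf_Lop_zero, cf_Lop_zero]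
    | succ m =>
      have ih' : ∀ n : ℕ, n ≤ m → cf (Lop a) n = cf (Lop b) n := fun n hn =>
        ih n (by omega) fun i hi => h i (by omega)
      rw [cf_Lop_succ, cf_Lop_succ, ih' m le_rfl]
      refine congrArg (fun t => antidiff (pd (cf (Lop b) m) - t))
        (Finset.sum_congr rfl fun p hp => ?_)
      have hp := Finset.HasAntidiagonal.mem_antidiagonal.1 hp
      rw [ih' _ (by omega), h _ (by omega)]

/-- Since L_a starts with 1, the coefficient a_m first enters in place m + 1, linearly, through its
indefinite sum. -/
theorem colSeq_Lop_sub {lam : ℂ} {a b : Hs} {m : ℕ} (h : ∀ i : ℕ, i < m → cf a i = cf b i) :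
    colSeq lam (Lop a) (m + 1) - colSeq lam (Lop b) (m + 1) = csum lam (cf b m - cf a m) := by
  have h1 : ∀ n : ℕ, n ≤ m → cf (Lop a) n = cf (Lop b) n := fun n hn =>
    cf_Lop_congr fun i hi => h i (by omega)
  have hm : ((0, m) : ℕ × ℕ) ∈ adiag m := Finset.HasAntidiagonal.mem_antidiagonal.2 (zero_add m)
  have h2 : ∑ p ∈ (adiag m).erase (0, m), tr (-p.2) (cf (Lop a) p.1) * cf a p.2
      = ∑ p ∈ (adiag m).erase (0, m), tr (-p.2) (cf (Lop b) p.1) * cf b p.2 := by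
    refine Finset.sum_congr rfl fun p hp => ?_
    have hne := Finset.ne_of_mem_erase hp
    have hp := Finset.HasAntidiagonal.mem_antidiagonal.1 (Finset.mem_of_mem_erase hp)
    have : p.2 ≠ m := fun h => hne (Prod.ext (by omega) h)
    rw [h1 _ (by omega), h _ (by omega)]
  have h3 : ∀ a : Hs, ∑ p ∈ adiag m, tr (-p.2) (cf (Lop a) p.1) * cf a p.2 = cf a m
      + ∑ p ∈ (adiag m).erase (0, m), tr (-p.2) (cf (Lop a) p.1) * cf a p.2 := fun a => by
    rw [← Finset.add_sum_erase _ _ hm, Nat.cast_zero, cf_Lop_zero, map_one, one_mul]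
  have h4 : ∀ a : Hs, colSeq lam (Lop a) (m + 1)
      = csum lam (pd (cf (Lop a) m) - ∑ p ∈ adiag m, tr (-p.2) (cf (Lop a) p.1) * cf a p.2) :=
    fun a => congrArg (ev lam) (cf_Lop_succ a m)
  rw [h4, h4, ← csum_sub, h3, h3, h2, h1 m le_rfl]
  congr 1
  abel

/-- The coefficients of the symbol attached to `∑ c_i e^{2i+1}`. -/
def sliceSeq (lam : ℂ) (c : ℕ → K) : ℕ → K := colSeq lam (Lop (sliceOp lam c + hOp lam))

/-- Triangularity of the slice coordinates: c_i first appears in the coefficient of D^{λ-2i-2},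
multiplied by minus the trace of W_{2i+1}. -/
theorem sliceSeq_sub {lam : ℂ} {c c' : ℕ → K} {i : ℕ} (h : ∀ j < i, c j = c' j) :
    sliceSeq lam c (2 * i + 2) - sliceSeq lam c' (2 * i + 2)
      = (c' i - c i) * csum lam (wPoly lam (2 * i + 1 : ℕ)) := by
  rw [sliceSeq, sliceSeq, colSeq_Lop_sub, cf_add, cf_add, add_sub_add_right_eq_sub, cf_sliceOp,
    cf_sliceOp, if_pos (odd_two_mul_add_one i), if_pos (odd_two_mul_add_one i), ← sub_mul,
    ← Polynomial.C_sub, csum_C_mul, show (2 * i + 1) / 2 = i by omega]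
  intro j hj
  rw [cf_add, cf_add, cf_sliceOp, cf_sliceOp]
  split_ifs with hj'
  · rw [h _ (by have := Nat.odd_iff.1 hj'; omega)]
  · rfl

/-! ### Differential polynomials -/

theorem exists_evalDiff_dz (P : MvPolynomial (ℕ × ℕ) K) :
    ∃ P', ∀ b, evalDiff P' b = dz (evalDiff P b) := by
  induction P using MvPolynomial.induction_on with
  | C a => exact ⟨MvPolynomial.C (dz a), fun b => by simp [evalDiff]⟩
  | add p q hp hq =>
    obtain ⟨p', hp⟩ := hp
    obtain ⟨q', hq⟩ := hq
    refine ⟨p' + q', fun b => ?_⟩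
    have := hp b
    have := hq b
    simp only [evalDiff, map_add] at *
    rw [hp, hq]
  | mul_X p i hp =>
    obtain ⟨p', hp⟩ := hp
    refine ⟨p' * MvPolynomial.X i + p * MvPolynomial.X (i.1, i.2 + 1), fun b => ?_⟩
    have := hp b
    simp only [evalDiff, map_add, map_mul, MvPolynomial.eval_X, dz_mul,
      Function.iterate_succ_apply'] at *
    rw [hp]

/-- Functions given by differential polynomials. -/
def DiffPoly (g : (ℕ → K) → K) : Prop := ∃ P, ∀ b, g b = evalDiff P b

theorem DiffPoly.dz_iter {g : (ℕ → K) → K} (hg : DiffPoly g) (n : ℕ) :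
    DiffPoly fun b => dz^[n] (g b) := by
  induction n with
  | zero => exact hg
  | succ n ih =>
    obtain ⟨P, hP⟩ := ih
    obtain ⟨P', hP'⟩ := exists_evalDiff_dz P
    refine ⟨P', fun b => ?_⟩
    rw [hP', ← hP]
    exact Function.iterate_succ_apply' _ _ _

theorem diffPoly_const (a : K) : DiffPoly fun _ => a := ⟨MvPolynomial.C a, fun b => by simp [evalDiff]⟩

theorem diffPoly_coord (i : ℕ) : DiffPoly fun b => b i :=
  ⟨MvPolynomial.X (i, 0), fun b => by simp [evalDiff]⟩

theorem DiffPoly.add {f g : (ℕ → K) → K} (hf : DiffPoly f) (hg : DiffPoly g) :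
    DiffPoly fun b => f b + g b := by
  obtain ⟨P, hP⟩ := hf
  obtain ⟨Q, hQ⟩ := hg
  exact ⟨P + Q, fun b => by simp only [hP, hQ, evalDiff, map_add]⟩

theorem DiffPoly.mul {f g : (ℕ → K) → K} (hf : DiffPoly f) (hg : DiffPoly g) :
    DiffPoly fun b => f b * g b := by
  obtain ⟨P, hP⟩ := hf
  obtain ⟨Q, hQ⟩ := hg
  exact ⟨P * Q, fun b => by simp only [hP, hQ, evalDiff, map_mul]⟩

/-- Substitution of differential polynomials into a differential polynomial. -/
theorem DiffPoly.subst (P : MvPolynomial (ℕ × ℕ) K) {r : ℕ → (ℕ → K) → K}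
    (hr : ∀ j, DiffPoly (r j)) : DiffPoly fun b => evalDiff P fun j => r j b := by
  induction P using MvPolynomial.induction_on with
  | C a => simpa [evalDiff] using diffPoly_const a
  | add p q hp hq => simpa only [evalDiff, map_add] using hp.add hq
  | mul_X p i hp =>
    simpa only [evalDiff, map_mul, MvPolynomial.eval_X] using hp.mul ((hr i.1).dz_iter i.2)

/-! ### Differential polynomials with coefficients polynomial in `λ` -/

/-- Differential polynomials with coefficients polynomial in `λ`. -/
abbrev UDiff : Type := MvPolynomial (ℕ × ℕ) K[X]

/-- The value of a universal differential polynomial. -/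
def uev (lam : ℂ) (b : ℕ → K) : UDiff →+* K :=
  MvPolynomial.eval₂Hom (ev lam) fun p => dz^[p.2] (b p.1)

theorem evalDiff_specialize (lam : ℂ) (P : UDiff) (b : ℕ → K) :
    evalDiff (specialize lam P) b = uev lam b P := by
  rw [evalDiff, specialize, MvPolynomial.eval_map]
  rfl

theorem exists_uev_dz (P : UDiff) : ∃ P', ∀ lam b, uev lam b P' = dz (uev lam b P) := by
  induction P using MvPolynomial.induction_on with
  | C a => exact ⟨MvPolynomial.C (pd a), fun lam b => by simp [uev, ev_pd]⟩
  | add p q hp hq =>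
    obtain ⟨p', hp⟩ := hp
    obtain ⟨q', hq⟩ := hq
    exact ⟨p' + q', fun lam b => by rw [map_add, map_add, hp, hq, map_add]⟩
  | mul_X p i hp =>
    obtain ⟨p', hp⟩ := hp
    refine ⟨p' * MvPolynomial.X i + p * MvPolynomial.X (i.1, i.2 + 1), fun lam b => ?_⟩
    have hX : ∀ j, uev lam b (MvPolynomial.X j) = dz^[j.2] (b j.1) := fun j =>
      MvPolynomial.eval₂_X _ _ _
    rw [map_add, map_mul, map_mul, map_mul, hp, hX, hX, dz_mul, Function.iterate_succ_apply']

/-- Polynomials in the row index with coefficients universal differential polynomials. -/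
def UPoly (F : ℂ → (ℕ → K) → K[X]) : Prop := ∃ P : UDiff[X], ∀ lam b, F lam b = P.map (uev lam b)

theorem uPoly_const (p : K[X]) : UPoly fun _ _ => p :=
  ⟨p.map (MvPolynomial.C.comp Polynomial.C), fun lam b => by
    rw [Polynomial.map_map]
    have : (uev lam b).comp (MvPolynomial.C.comp Polynomial.C) = RingHom.id K :=
      RingHom.ext fun a => by simp [uev, ev_C]
    rw [this, Polynomial.map_id]⟩

theorem uPoly_lam : UPoly fun lam _ => Polynomial.C (algebraMap ℂ K lam) :=
  ⟨Polynomial.C (MvPolynomial.C Polynomial.X), fun lam b => by simp [uev, ev_X]⟩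

theorem uPoly_coord (i : ℕ) : UPoly fun _ b => Polynomial.C (b i) :=
  ⟨Polynomial.C (MvPolynomial.X (i, 0)), fun lam b => by simp [uev]⟩

theorem UPoly.add {F G : ℂ → (ℕ → K) → K[X]} (hF : UPoly F) (hG : UPoly G) :
    UPoly fun lam b => F lam b + G lam b := by
  obtain ⟨P, hP⟩ := hF
  obtain ⟨Q, hQ⟩ := hG
  exact ⟨P + Q, fun lam b => by simp only [hP, hQ, Polynomial.map_add]⟩

theorem UPoly.mul {F G : ℂ → (ℕ → K) → K[X]} (hF : UPoly F) (hG : UPoly G) :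
    UPoly fun lam b => F lam b * G lam b := by
  obtain ⟨P, hP⟩ := hF
  obtain ⟨Q, hQ⟩ := hG
  exact ⟨P * Q, fun lam b => by simp only [hP, hQ, Polynomial.map_mul]⟩

theorem UPoly.sub {F G : ℂ → (ℕ → K) → K[X]} (hF : UPoly F) (hG : UPoly G) :
    UPoly fun lam b => F lam b - G lam b := by
  obtain ⟨P, hP⟩ := hF
  obtain ⟨Q, hQ⟩ := hG
  exact ⟨P - Q, fun lam b => by simp only [hP, hQ, Polynomial.map_sub]⟩

theorem UPoly.sum {β : Type*} (s : Finset β) {F : β → ℂ → (ℕ → K) → K[X]}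
    (h : ∀ i ∈ s, UPoly (F i)) : UPoly fun lam b => ∑ i ∈ s, F i lam b := by
  classical
  induction s using Finset.induction_on with
  | empty => simpa using uPoly_const 0
  | insert i s hi ih =>
    simp only [Finset.sum_insert hi]
    exact (h i (Finset.mem_insert_self _ _)).add (ih fun j hj => h j (Finset.mem_insert_of_mem hj))

theorem UPoly.tr {F : ℂ → (ℕ → K) → K[X]} (hF : UPoly F) (d : ℤ) :
    UPoly fun lam b => tr d (F lam b) := by
  obtain ⟨P, hP⟩ := hF
  refine ⟨P.comp (Polynomial.X + Polynomial.C (d : UDiff)), fun lam b => ?_⟩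
  simp only [hP, tr_apply, Polynomial.taylor_apply, Polynomial.map_comp, Polynomial.map_add,
    Polynomial.map_X, map_intCast, Polynomial.map_intCast]

theorem UPoly.antidiff {F : ℂ → (ℕ → K) → K[X]} (hF : UPoly F) :
    UPoly fun lam b => antidiff (F lam b) := by
  obtain ⟨P, hP⟩ := hF
  exact ⟨ComplexSize.antidiff P, fun lam b => by simp only [hP, map_antidiff]⟩

theorem UPoly.pd {F : ℂ → (ℕ → K) → K[X]} (hF : UPoly F) : UPoly fun lam b => pd (F lam b) := by
  obtain ⟨P, hP⟩ := hF
  simp only [hP]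
  clear hP
  induction P using Polynomial.induction_on' with
  | add p q hp hq => simpa only [Polynomial.map_add, map_add] using hp.add hq
  | monomial n c =>
    obtain ⟨c', hc'⟩ := exists_uev_dz c
    exact ⟨Polynomial.monomial n c', fun lam b => by
      simp only [Polynomial.map_monomial, pd_monomial, hc']⟩

/-- The row index is specialized to the variable that stands for λ, so the column at λ depends
polynomially on λ. -/
theorem UPoly.exists_ev {F : ℂ → (ℕ → K) → K[X]} (hF : UPoly F) :
    ∃ Q : UDiff, ∀ lam b, ev lam (F lam b) = uev lam b Q := by
  obtain ⟨P, hP⟩ := hF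
  refine ⟨P.eval (MvPolynomial.C Polynomial.X), fun lam b => ?_⟩
  have : uev lam b (MvPolynomial.C Polynomial.X) = algebraMap ℂ K lam := by simp [uev, ev_X]
  rw [hP, ev_apply, ← this, Polynomial.eval_map, Polynomial.eval₂_hom]

theorem uPoly_wFactor (t : ℤ) : UPoly fun lam _ => wFactor lam t := by
  have h := (uPoly_const (Polynomial.X - Polynomial.C (t : K))).mul
    ((uPoly_lam.add (uPoly_const (Polynomial.C (t : K)))).sub (uPoly_const Polynomial.X))
  simpa only [wFactor, Polynomial.C_add] using h

theorem uPoly_wPoly (m : ℕ) : UPoly fun lam _ => wPoly lam m := by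
  induction m with
  | zero => simpa only [wPoly_of_nonpos _ (le_of_eq Nat.cast_zero)] using uPoly_const 1
  | succ m ih => simpa only [Nat.cast_succ, wPoly_succ] using (uPoly_wFactor m).mul ih

theorem uPoly_cf_sliceOp (κ : ℕ → K) (m : ℕ) :
    UPoly fun lam b => cf (sliceOp lam fun i => κ i * b i) m := by
  simp only [cf_sliceOp]
  split_ifs
  · simp only [Polynomial.C_mul]
    exact ((uPoly_const _).mul (uPoly_coord _)).mul (uPoly_wPoly m)
  · exact uPoly_const 0

theorem uPoly_cf_hOp (m : ℕ) : UPoly fun lam _ => cf (hOp lam) m := by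
  simp only [hOp, cf_sgl]
  split_ifs
  · have h := (uPoly_const (Polynomial.C (2 * zz)⁻¹)).mul
      ((uPoly_lam.sub (uPoly_const 1)).sub (uPoly_const (2 * Polynomial.X)))
    simpa only [map_sub, map_one] using h
  · exact uPoly_const 0

/-- Differentiation, translation, products and indefinite summation all make sense for universal
coefficients, and λ enters only through W_d and the Cartan term. -/
theorem uPoly_cf_Lop (κ : ℕ → K) (m : ℕ) :
    UPoly fun lam b => cf (Lop (sliceOp lam (fun i => κ i * b i) + hOp lam)) m := by
  induction m using Nat.strong_induction_on with
  | _ m ih =>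
    cases m with
    | zero => simpa only [Nat.cast_zero, cf_Lop_zero] using uPoly_const 1
    | succ m =>
      simp only [cf_Lop_succ, cf_add]
      refine ((ih m (by omega)).pd.sub (UPoly.sum _ fun p hp => ?_)).antidiff
      have hp := Finset.HasAntidiagonal.mem_antidiagonal.1 hp
      exact ((ih p.1 (by omega)).tr _).mul ((uPoly_cf_sliceOp κ _).add (uPoly_cf_hOp _))

theorem exists_universal (κ : ℕ → K) : ∃ Q : ℕ → UDiff, ∀ m lam b,
    sliceSeq lam (fun i => κ i * b i) (m + 1) = evalDiff (specialize lam (Q m)) b := by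
  choose Q hQ using fun m => (uPoly_cf_Lop κ m).exists_ev
  refine ⟨fun m => Q (m + 1), fun m lam b => ?_⟩
  rw [evalDiff_specialize, ← hQ]
  rfl

/-! ### The slice as a set of matrices -/

section Slice

variable {ι : Type} [LinearOrder ι] {lam : ℂ} {v : ι → ℕ} {hv : IsFrame lam v} {k : ℂ}

/-- The matrix `e`. -/
def raise (hv : IsFrame lam v) (k : ℂ) : Mat ι := rep hv (kz k) (scl (kz k)⁻¹ * eOp lam)

theorem scl_pow (c : K) (m : ℕ) : scl c ^ m = scl (c ^ m) := by
  induction m with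
  | zero => rw [pow_zero, pow_zero, scl_one]
  | succ m ih => rw [pow_succ, pow_succ, ih, scl_mul]

theorem entry_raise_pow (hk : k ≠ 0) (m : ℕ) (i j : ι) : entry (raise hv k ^ m) i j =
    if (v j : ℤ) - v i = m then ev (v j) (wPoly lam m) else 0 := by
  have hκ := kz_ne_zero hk
  have hc : Commute (scl (kz k)⁻¹) (eOp lam) := scl_comm (eOp_mem lam).1 _
  rw [raise, rep_pow hκ (mul_mem (scl_mem_glRing _ _) (eOp_mem lam)), hc.mul_pow, scl_pow, eOp_pow,
    entry_rep, vl_scl_mul (sgl_mem _ _), vl_sgl]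
  split_ifs with h
  · rw [h, zpow_natCast, ← mul_assoc, ← mul_pow, mul_inv_cancel₀ hκ, one_pow, one_mul]
  · rw [mul_zero, mul_zero]

theorem entry_conn_zero (hk : k ≠ 0) (i j : ι) : entry (conn hv k 0) i j =
    if v j + 1 = v i then 1 else 0 := by
  have hκ := kz_ne_zero hk
  rw [conn, add_zero, entry_rep, vl_scl_mul Fop_mem, vl_Fop]
  split_ifs with h h' h'
  · rw [h, mul_one, zpow_neg_one, inv_mul_cancel₀ hκ]
  · omega
  · omega
  · rw [mul_zero, mul_zero]

/-- The entry of e^m from v_m to v_0 is W_m(m), nonzero because λ is not among 1, …, m. -/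
theorem raise_pow_eq_zero_iff (hk : k ≠ 0)
    (hl : (∀ m : ℤ, lam ≠ m) ∨ ∃ n : ℕ, lam = n ∧ ∀ j, v j < n) (m : ℕ) :
    raise hv k ^ m = 0 ↔ m ∉ Set.range v := by
  have hz : (raise hv k ^ m = 0) ↔ ∀ i j, entry (raise hv k ^ m) i j = 0 := by
    constructor
    · intro h i j
      rw [h, entry_zero]
    · intro h
      exact matrix_ext fun i j => by rw [h, entry_zero]
  have h0m : m ∈ Set.range v → 0 ∈ Set.range v := by
    rcases hv.range with hr | ⟨n, -, hr⟩
    · exact fun _ => hr 0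
    · rw [hr, hr]; omega
  rw [hz]
  constructor
  · rintro h ⟨j, rfl⟩
    obtain ⟨i, hi⟩ := h0m ⟨j, rfl⟩
    have := h i j
    rw [entry_raise_pow hk, if_pos (by rw [hi]; simp), wPoly, map_prod,
      Finset.prod_eq_zero_iff] at this
    obtain ⟨t, ht, h⟩ := this
    rw [Finset.mem_Ico] at ht
    rw [ev_wFactor, map_eq_zero, mul_eq_zero] at h
    rcases h with h | h
    · rw [sub_eq_zero] at h
      have : (v j : ℤ) = t := by exact_mod_cast h
      omega
    · have h' : lam = ((v j - t : ℤ) : ℂ) := by push_cast; linear_combination h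
      rcases hl with hl | ⟨n, hn, hl⟩
      · exact hl _ h'
      · rw [hn] at h'
        have : (n : ℤ) = v j - t := by exact_mod_cast h'
        have := hl j
        omega
  · intro h i j
    rw [entry_raise_pow hk]
    split_ifs with hm
    · exfalso
      rcases hv.range with hr | ⟨n, -, hr⟩
      · exact h (hr m)
      · have := (hr (v j)).1 ⟨j, rfl⟩
        exact h ((hr m).2 (by omega))
    · rfl

/-- The rescaling between the coordinates `b_i` and the coefficients of operators. -/
def sliceScale (k : ℂ) (i : ℕ) : K := ((kz k) ^ (2 * i + 2))⁻¹

/-- The matrix `f + ∑ b_i e^{2i+1}`. -/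
def sliceMat (hv : IsFrame lam v) (k : ℂ) (b : ℕ → K) : Mat ι :=
  conn hv k (sliceOp lam fun i => sliceScale k i * b i)

theorem sliceMat_bas (hk : k ≠ 0) (b : ℕ → K) {M : ℕ} {j : ι} (hj : v j < M) :
    sliceMat hv k b (bas j) = conn hv k 0 (bas j)
      + ∑ r ∈ Finset.range M, b r • (raise hv k ^ (2 * r + 1)) (bas j) := by
  have hκ := kz_ne_zero hk
  ext i
  rw [Finsupp.add_apply, Finsupp.finsetSum_apply]
  have h1 : sliceMat hv k b (bas j) i = conn hv k 0 (bas j) i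
      + (kz k) ^ ((v j : ℤ) - v i) * (kz k *
        vl (sliceOp lam fun i => sliceScale k i * b i) (v j - v i) (v j)) := by
    have := rep_add hv (kz k) (scl (kz k) * (Fop + 0))
      (scl (kz k) * sliceOp lam fun i => sliceScale k i * b i)
    rw [← mul_add, add_zero] at this
    have h2 := congrArg (fun A => entry A i j) this
    simp only [entry_add] at h2
    rw [entry_rep, entry_rep, entry_rep, vl_scl_mul (sliceOp_mem_poOp _ _).1.1] at h2
    have h3 : entry (conn hv k 0) i j = _ := entry_rep _ _ _ _ _
    rw [add_zero] at h3
    rw [← h3, ← entry_rep hv] at h2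
    exact h2
  rw [h1]
  congr 1
  have h2 : ∀ r, (b r • (raise hv k ^ (2 * r + 1)) (bas j)) i
      = if (v j : ℤ) - v i = (2 * r + 1 : ℕ) then b r * ev (v j) (wPoly lam (2 * r + 1 : ℕ)) else 0 := by
    intro r
    rw [Finsupp.smul_apply, smul_eq_mul]
    have := entry_raise_pow (hv := hv) hk (2 * r + 1) i j
    rw [entry] at this
    rw [this, mul_ite, mul_zero]
  simp only [h2]
  rcases lt_or_ge ((v j : ℤ) - v i) 0 with hn | hn
  · rw [(lowBd_sliceOp _ _).vl (by omega), mul_zero, mul_zero, eq_comm]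
    exact Finset.sum_eq_zero fun r _ => if_neg (by omega)
  · obtain ⟨m, hm⟩ := Int.eq_ofNat_of_zero_le hn
    rw [hm, vl, cf_sliceOp]
    split_ifs with ho
    -- The entry carries kz from the connection and (kz)^{2r+1} from the basis; this is the exponent
    -- 2r + 2 in `sliceScale`.
    · obtain ⟨r, rfl⟩ := ho
      rw [Finset.sum_eq_single_of_mem r (Finset.mem_range.2 (by omega)) fun r' _ hr' =>
        if_neg (by omega), if_pos rfl, show (2 * r + 1) / 2 = r by omega, map_mul, ev_C, sliceScale,
        zpow_natCast, pow_succ (kz k) (2 * r + 1)]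
      generalize kz k = κ at hκ
      field_simp
    · rw [map_zero, mul_zero, mul_zero, eq_comm]
      refine Finset.sum_eq_zero fun r _ => if_neg fun h => ho ⟨r, by omega⟩

theorem sliceMat_apply (hk : k ≠ 0) (b : ℕ → K) (w : ι →₀ K) : sliceMat hv k b w
    = conn hv k 0 w + ∑ᶠ r : ℕ, b r • (raise hv k ^ (2 * r + 1)) w := by
  obtain ⟨M, hM⟩ : ∃ M, ∀ j ∈ w.support, v j < M :=
    ⟨w.support.sup v + 1, fun j hj => Nat.lt_succ_of_le (Finset.le_sup hj)⟩
  have hw : w = ∑ j ∈ w.support, w j • bas j := by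
    conv_lhs => rw [← w.sum_single]
    exact Finset.sum_congr rfl fun j _ => by rw [bas, Finsupp.smul_single, smul_eq_mul, mul_one]
  have hlin : ∀ A : Mat ι, A w = ∑ j ∈ w.support, w j • A (bas j) := fun A => by
    conv_lhs => rw [hw]
    rw [map_sum]
    exact Finset.sum_congr rfl fun j _ => map_smul _ _ _
  rw [finsum_eq_sum_of_support_subset (s := Finset.range M) _ fun r hr => ?_]
  · simp only [hlin (sliceMat hv k b), hlin (conn hv k 0), fun r : ℕ => hlin (raise hv k ^ (2 * r + 1))]
    simp only [Finset.smul_sum]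
    rw [Finset.sum_comm, ← Finset.sum_add_distrib]
    refine Finset.sum_congr rfl fun j hj => ?_
    rw [sliceMat_bas hk b (hM j hj), smul_add, Finset.smul_sum]
    simp only [smul_smul, mul_comm]
  · rw [Finset.coe_range, Set.mem_Iio]
    by_contra hr'
    refine hr ?_
    simp only
    rw [hlin, Finset.sum_eq_zero, smul_zero]
    intro j hj
    have : (raise hv k ^ (2 * r + 1)) (bas j) = 0 := by
      ext i
      have h := entry_raise_pow (hv := hv) hk (2 * r + 1) i j
      have := hM j hj
      rw [if_neg (by omega)] at h
      exact h
    rw [this, smul_zero]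

theorem isSlice_iff (hk : k ≠ 0)
    (hl : (∀ m : ℤ, lam ≠ m) ∨ ∃ n : ℕ, lam = n ∧ ∀ j, v j < n) (b : ℕ → K) (A : Mat ι) :
    IsSlice (raise hv k) (conn hv k 0) b A ↔
      (∀ i, 2 * i + 1 ∉ Set.range v → b i = 0) ∧ A = sliceMat hv k b := by
  refine and_congr (forall_congr' fun i => by rw [raise_pow_eq_zero_iff hk hl]) ?_
  constructor
  · exact fun h => LinearMap.ext fun w => by rw [h, sliceMat_apply hk]
  · rintro rfl
    exact sliceMat_apply hk b

theorem Phi_sliceMat (hk : k ≠ 0) (b : ℕ → K) : Phi hv k (sliceMat hv k b)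
    = toSymb 0 (sliceSeq lam fun i => sliceScale k i * b i) :=
  Phi_conn hk (sliceOp_mem_poOp _ _) (lowBd_sliceOp _ _)

end Slice

/-! ### The reduction theorem -/

theorem csum_wPoly_ne_zero_of_range {ι : Type} {lam : ℂ} {v : ι → ℕ}
    (hl : (∀ m : ℤ, lam ≠ m) ∨ ∃ n : ℕ, lam = n ∧ ∀ j, v j < n) {m : ℕ} (hm : m ∈ Set.range v) :
    csum lam (wPoly lam m) ≠ 0 := by
  refine csum_wPoly_ne_zero m fun i _ hi => ?_
  rcases hl with hl | ⟨n, rfl, hl⟩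
  · exact hl i
  · obtain ⟨j, rfl⟩ := hm
    have := hl j
    intro h
    have : (n : ℤ) = i := by exact_mod_cast h
    omega

theorem sliceScale_ne_zero {k : ℂ} (hk : k ≠ 0) (i : ℕ) : sliceScale k i ≠ 0 :=
  inv_ne_zero (pow_ne_zero _ (kz_ne_zero hk))

/-- The even coefficients of a symbol determine a point of the slice. -/
theorem exists_slice {ι : Type} {lam : ℂ} {v : ι → ℕ} {k : ℂ} (hk : k ≠ 0)
    (hl : (∀ m : ℤ, lam ≠ m) ∨ ∃ n : ℕ, lam = n ∧ ∀ j, v j < n) (w : ℕ → K) :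
    ∃ b : ℕ → K, (∀ i, 2 * i + 1 ∉ Set.range v → b i = 0) ∧
      ∀ i, 2 * i + 1 ∈ Set.range v →
        sliceSeq lam (fun i => sliceScale k i * b i) (2 * i + 2) = w i := by
  classical
  let cut : ℕ → (ℕ → K) → ℕ → K := fun i c j => if j < i then c j else 0
  -- By `sliceSeq_sub`, restoring the i-th coordinate after cutting the sequence off at i changes
  -- the coefficient by -c_i times the trace, which is solved for c_i.
  let G : ℕ → (ℕ → K) → K := fun i c => if 2 * i + 1 ∈ Set.range v then
    (sliceSeq lam (cut i c) (2 * i + 2) - w i) / csum lam (wPoly lam (2 * i + 1 : ℕ)) else 0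
  have hG : ∀ m f g, (∀ i < m, f i = g i) → G m f = G m g := by
    intro m f g h
    have : cut m f = cut m g := funext fun j => by
      by_cases hj : j < m
      · simp only [cut, if_pos hj, h j hj]
      · simp only [cut, if_neg hj]
    simp only [G, this]
  set c := seqRec G with hc
  have hcG : ∀ m, c m = G m c := seqRec_eq hG
  have hb : (fun i => sliceScale k i * ((sliceScale k i)⁻¹ * c i)) = c := funext fun i =>
    mul_inv_cancel_left₀ (sliceScale_ne_zero hk i) _
  refine ⟨fun i => (sliceScale k i)⁻¹ * c i, fun i hi => ?_, fun i hi => ?_⟩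
  · simp only
    rw [(hcG i).trans (if_neg hi), mul_zero]
  · have h1 := sliceSeq_sub (lam := lam) (c := c) (c' := cut i c) (i := i) fun j hj =>
      (if_pos hj).symm
    have h2 : cut i c i = 0 := if_neg (lt_irrefl i)
    have h3 : c i = (sliceSeq lam (cut i c) (2 * i + 2) - w i)
        / csum lam (wPoly lam (2 * i + 1 : ℕ)) := (hcG i).trans (if_pos hi)
    rw [h2, zero_sub, neg_mul, h3, div_mul_cancel₀ _ (csum_wPoly_ne_zero_of_range hl hi)] at h1
    rw [hb]
    linear_combination h1

/-- The triangular system is inverted by recursion: expressions for the earlier b_j are substituted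
into the formula for u_{-2i-2}, and one divides by a nonzero constant times a power of z. -/
theorem exists_inverse {ι : Type} {lam : ℂ} {v : ι → ℕ} {k : ℂ} (hk : k ≠ 0)
    (hl : (∀ m : ℤ, lam ≠ m) ∨ ∃ n : ℕ, lam = n ∧ ∀ j, v j < n)
    {Q : ℕ → UDiff} (hQ : ∀ m lam b,
      sliceSeq lam (fun i => sliceScale k i * b i) (m + 1) = evalDiff (specialize lam (Q m)) b)
    (i : ℕ) : ∃ R, ∀ b : ℕ → K, (∀ i, 2 * i + 1 ∉ Set.range v → b i = 0) →
      b i = evalDiff R fun m => sliceSeq lam (fun i => sliceScale k i * b i) (m + 1) := by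
  induction i using Nat.strong_induction_on with
  | _ i ih =>
    by_cases hi : 2 * i + 1 ∈ Set.range v
    · have h : ∀ j, ∃ R, j < i → ∀ b : ℕ → K, (∀ i, 2 * i + 1 ∉ Set.range v → b i = 0) →
          b j = evalDiff R fun m => sliceSeq lam (fun i => sliceScale k i * b i) (m + 1) := by
        intro j
        by_cases hj : j < i
        · obtain ⟨R, hR⟩ := ih j hj
          exact ⟨R, fun _ => hR⟩
        · exact ⟨0, fun h => absurd h hj⟩
      choose R hR using h
      have hr : ∀ j, DiffPoly fun u => if j < i then evalDiff (R j) u else 0 := by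
        intro j
        by_cases hj : j < i
        · simp only [if_pos hj]
          exact ⟨R j, fun _ => rfl⟩
        · simp only [if_neg hj]
          exact diffPoly_const 0
      have hW := csum_wPoly_ne_zero_of_range hl hi
      have hs := sliceScale_ne_zero hk i
      obtain ⟨P, hP⟩ := ((DiffPoly.subst (specialize lam (Q (2 * i + 1))) hr).add
        ((diffPoly_const (-1)).mul (diffPoly_coord (2 * i + 1)))).mul
          (diffPoly_const (sliceScale k i * csum lam (wPoly lam (2 * i + 1 : ℕ)))⁻¹)
      refine ⟨P, fun b hb => ?_⟩
      rw [← hP]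
      have hcut : (fun j => if j < i then
          evalDiff (R j) fun m => sliceSeq lam (fun i => sliceScale k i * b i) (m + 1) else 0)
          = fun j => if j < i then b j else 0 := funext fun j => by
        split_ifs with hj
        · exact (hR j hj b hb).symm
        · rfl
      have h1 := sliceSeq_sub (lam := lam) (c := fun j => sliceScale k j * b j)
        (c' := fun j => sliceScale k j * if j < i then b j else 0) (i := i) fun j hj => by
          simp only [if_pos hj]
      rw [if_neg (lt_irrefl i), mul_zero, zero_sub] at h1
      simp only
      rw [hcut, ← hQ, eq_mul_inv_iff_mul_eq₀ (mul_ne_zero hs hW)]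
      linear_combination h1
    · exact ⟨0, fun b hb => by rw [hb i hi, evalDiff, map_zero]⟩

section Reduction

variable {ι : Type} [LinearOrder ι] {lam : ℂ} {v : ι → ℕ} {hv : IsFrame lam v} {k : ℂ}

/-- The reduction theorem for a loop algebra of matrices. -/
theorem isReductionIso {𝔤 : Set (Mat ι)} {tr' : Mat ι → K} (H : IsLoop hv 𝔤 tr') (hk : k ≠ 0)
    (hl : (∀ m : ℤ, lam ≠ m) ∨ ∃ n : ℕ, lam = n ∧ ∀ j, v j < n) {S : Set Symb}
    (hS : S ⊆ PsiSA lam) (hS0 : ∀ L ∈ S, ∀ m : ℕ, m ∉ Set.range v → L (-(m + 1 : ℤ)) = 0)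
    (hPS : ∀ a ∈ poOp lam, LowBd 0 a → symbOf lam a ∈ S) {Q : ℕ → UDiff} (hQ : ∀ m lam b,
      sliceSeq lam (fun i => sliceScale k i * b i) (m + 1) = evalDiff (specialize lam (Q m)) b) :
    IsReductionIso 𝔤 tr' (raise hv k) (conn hv k 0) k lam S (fun m => specialize lam (Q m))
      (Phi hv k) := by
  have hmem : ∀ b, sliceMat hv k b ∈ fiber 𝔤 tr' (conn hv k 0) := fun b =>
    (fiber_iff H hk _).2 ⟨_, sliceOp_mem_poOp _ _, lowBd_sliceOp _ _, rfl⟩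
  have hmaps : ∀ A ∈ fiber 𝔤 tr' (conn hv k 0), Phi hv k A ∈ S := by
    intro A hA
    obtain ⟨a, ha, ha0, rfl⟩ := (fiber_iff H hk A).1 hA
    rw [Phi_conn hk ha ha0]
    exact hPS _ (add_mem ha (hOp_mem_poOp lam)) (ha0.add (lowBd_hOp lam))
  have horbit : ∀ A ∈ fiber 𝔤 tr' (conn hv k 0), ∀ B ∈ fiber 𝔤 tr' (conn hv k 0),
      Phi hv k A = Phi hv k B ↔ Gauge 𝔤 k A B := by
    intro A hA B hB
    obtain ⟨a, ha, ha0, rfl⟩ := (fiber_iff H hk A).1 hA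
    obtain ⟨b, hb, hb0, rfl⟩ := (fiber_iff H hk B).1 hB
    rw [Phi_conn hk ha ha0, Phi_conn hk hb hb0, symbOf, symbOf, (toSymb_injective 0).eq_iff]
    exact ⟨fun h => gauge_of_colSeq_eq H hk hl ha ha0 hb hb0 fun m => congrFun h m,
      fun h => funext fun m => colSeq_eq_of_gauge H hk ha ha0 hb hb0 h m⟩
  -- Even coefficients with 2i + 1 in the frame are matched by `exists_slice`; the remaining even
  -- ones vanish for both symbols by `hS0`, and odd ones are determined by self-adjointness.
  have hexists : ∀ L ∈ S, ∃ b : ℕ → K, (∀ i, 2 * i + 1 ∉ Set.range v → b i = 0) ∧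
      Phi hv k (sliceMat hv k b) = L := by
    intro L hL
    obtain ⟨u, hu0, hu, rfl⟩ := mem_PsiSA_iff.1 (hS hL)
    obtain ⟨b, hb, hbu⟩ := exists_slice (lam := lam) hk hl fun i => u (2 * i + 2)
    refine ⟨b, hb, ?_⟩
    have h1 := hmaps _ (hmem b)
    obtain ⟨u', hu0', hu', e⟩ := mem_PsiSA_iff.1 (hS h1)
    have h0 := hS0 _ h1
    have e' := toSymb_injective 0 ((Phi_sliceMat (hv := hv) hk b).symm.trans e)
    rw [e] at h0 ⊢
    refine congrArg _ (eq_of_even_eq hu' hu fun i => ?_)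
    rcases i with _ | i
    · rw [mul_zero, hu0, hu0']
    · rw [show 2 * (i + 1) = 2 * i + 2 by ring]
      by_cases hi : 2 * i + 1 ∈ Set.range v
      · rw [← e', hbu i hi]
      · have hv1 := h0 _ hi
        have hv2 := hS0 _ hL _ hi
        have e2 : (-((2 * i + 1 : ℕ) + 1 : ℤ)) = 0 - (2 * i + 2 : ℕ) := by push_cast; ring
        rw [e2, toSymb_sub] at hv1 hv2
        rw [hv1, hv2]
  have hcoef : ∀ b (m : ℕ), Phi hv k (sliceMat hv k b) (-(m + 1 : ℤ))
      = sliceSeq lam (fun i => sliceScale k i * b i) (m + 1) := by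
    intro b m
    rw [Phi_sliceMat hk, show (-(m + 1 : ℤ)) = 0 - (m + 1 : ℕ) by push_cast; ring, toSymb_sub]
  choose R hR using exists_inverse (lam := lam) hk hl hQ
  have hinv : ∀ b : ℕ → K, (∀ i, 2 * i + 1 ∉ Set.range v → b i = 0) → ∀ i, b i
      = evalDiff (R i) fun m => Phi hv k (sliceMat hv k b) (-(m + 1 : ℤ)) := by
    intro b hb i
    simp only [hcoef]
    exact hR i b hb
  constructor
  · exact hmaps
  · intro L hL
    obtain ⟨b, -, h⟩ := hexists L hL
    exact ⟨_, hmem b, h⟩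
  · exact horbit
  · intro b hb
    exact ⟨_, hmem b, (isSlice_iff hk hl _ _).2
      ⟨fun i hi => hb i ((raise_pow_eq_zero_iff hk hl _).2 hi), rfl⟩⟩
  · intro A hA
    obtain ⟨b, hb, h⟩ := hexists _ (hmaps A hA)
    refine ⟨b, ⟨_, hmem b, (isSlice_iff hk hl _ _).2 ⟨hb, rfl⟩,
      (horbit _ hA _ (hmem b)).1 h.symm⟩, ?_⟩
    rintro b' ⟨B, hB, hs, hg⟩
    obtain ⟨hb', rfl⟩ := (isSlice_iff hk hl _ _).1 hs
    have h' := (horbit _ hA _ hB).2 hg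
    exact funext fun i => by rw [hinv b' hb', hinv b hb, ← h', h]
  · intro b A hs m
    obtain ⟨-, rfl⟩ := (isSlice_iff hk hl _ _).1 hs
    rw [hcoef, hQ]
  · refine ⟨R, fun b A hs i => ?_⟩
    obtain ⟨hb, rfl⟩ := (isSlice_iff hk hl _ _).1 hs
    exact hinv b hb i
  · intro A hA X hX
    obtain ⟨a, ha, ha0, rfl⟩ := (fiber_iff H hk A).1 hA
    exact exists_represents H hk ha ha0 hX
  · intro A hA X hX Y hY x y hx hy
    obtain ⟨a, ha, ha0, rfl⟩ := (fiber_iff H hk A).1 hA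
    exact poisson_Phi H hk ha ha0 hX hY hx hy

end Reduction

theorem conn_id_zero (lam : ℂ) {k : ℂ} (hk : k ≠ 0) : conn (isFrame_id lam) k 0 = vF :=
  matrix_ext fun i j => by
    rw [entry_conn_zero hk, vF, entry_ofCols, bas, Finsupp.single_apply]
    rfl

theorem conn_fin_zero (n : ℕ) {k : ℂ} (hk : k ≠ 0) : conn (isFrame_fin n) k 0 = finF n :=
  matrix_ext fun i j => by
    rw [entry_conn_zero hk, finF, entry_ofCols]
    split_ifs with h1 h2 h2
    · rw [bas, Finsupp.single_apply, if_pos (Fin.ext h1)]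
    · exact absurd i.2 (by omega)
    · rw [bas, Finsupp.single_apply, if_neg fun h => h1 (congrArg Fin.val h)]
    · rfl

theorem raise_id (lam : ℂ) {k : ℂ} (hk : k ≠ 0) : raise (isFrame_id lam) k = vE lam :=
  matrix_ext fun i j => by
    have h := entry_raise_pow (hv := isFrame_id lam) hk 1 i j
    rw [pow_one] at h
    rw [h, vE_eq_repV, entry_repV, eOp, vl_sgl]
    rfl

theorem block_vE (n : ℕ) : block n (vE n) = finE n :=
  matrix_ext fun i j => by
    rw [block, entry_ofCols, Finsupp.equivFunOnFinite_symm_apply_apply, vE,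
      ofCols_smul_bas_entry _ fun j => j - 1, finE,
      ofCols_smul_bas_entry _ fun j : Fin n => ⟨(j : ℕ) - 1, by omega⟩]
    exact if_congr (by rw [Fin.ext_iff]) rfl rfl

theorem raise_fin (n : ℕ) {k : ℂ} (hk : k ≠ 0) : raise (isFrame_fin n) k = finE n := by
  rw [← block_vE, ← raise_id n hk, raise, raise, block_rep]

theorem block_vF (n : ℕ) : block n vF = finF n := by
  rw [← conn_id_zero n one_ne_zero, conn, block_rep, ← conn_fin_zero n one_ne_zero, conn]

theorem block_image_loopPo (n : ℕ) : block n '' loopPo n = loopCl n := by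
  ext A
  rw [loopCl_eq n one_ne_zero]
  constructor
  · rintro ⟨B, hB, rfl⟩
    obtain ⟨x, hx, rfl⟩ := (loopPo_eq _ one_ne_zero B).1 hB
    exact ⟨x, hx, block_rep n 1 x⟩
  · rintro ⟨x, hx, rfl⟩
    exact ⟨_, (loopPo_eq _ one_ne_zero _).2 ⟨x, hx, rfl⟩, block_rep n 1 x⟩

theorem block_mul (n : ℕ) {A B : Mat ℕ} (hA : A ∈ loopPo n) (hB : B ∈ loopPo n) :
    block n (A * B) = block n A * block n B ∧
      traceC n (A * B) = traceN n (block n A * block n B) := by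
  obtain ⟨x, hx, rfl⟩ := (loopPo_eq _ one_ne_zero A).1 hA
  obtain ⟨y, hy, rfl⟩ := (loopPo_eq _ one_ne_zero B).1 hB
  rw [← rep_mul _ _ one_ne_zero hx.1 hy.1, block_rep, block_rep, block_rep,
    ← rep_mul _ _ one_ne_zero hx.1 hy.1, traceC_rep, traceN_rep]
  exact ⟨rfl, rfl⟩

end ComplexSize

end
-- The main theorem
open ComplexSize in
theorem mainTheorem3 (k : ℂ) (hk : k ≠ 0) :
    -- one family of reductions, with coordinate expressions polynomial in `lam`
    (∃ Q : ℕ → MvPolynomial (ℕ × ℕ) (Polynomial K),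
      -- the reduction for `po_lam`
      (∀ lam : ℂ, (∀ m : ℤ, lam ≠ m) →
        ∃ Φ : Mat ℕ → Symb,
          IsReductionIso (loopPo lam) (traceC lam) (vE lam) vF k lam (PsiSA lam)
            (fun m => specialize lam (Q m)) Φ) ∧
      -- the reductions for `sp_n` (`n` even) and `so_n` (`n` odd)
      (∀ n : ℕ, 1 ≤ n →
        ∃ Φ : Mat (Fin n) → Symb,
          IsReductionIso (loopCl n) (traceN n) (finE n) (finF n) k n (PsiSA n ∩ DO n)
            (fun m => specialize n (Q m)) Φ)) ∧
    -- for `lam = n` the loop algebra of `sp_n` or `so_n` is a quotient of that of `po_lam`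
    (∀ n : ℕ, 1 ≤ n →
      block n '' loopPo n = loopCl n ∧
      block n (vE n) = finE n ∧ block n vF = finF n ∧
      ∀ A ∈ loopPo n, ∀ B ∈ loopPo n,
        block n (A * B) = block n A * block n B ∧
        traceC n (A * B) = traceN n (block n A * block n B)) ∧
    -- in the coordinates `u_{-2}, u_{-4}, ...` on the spaces of self-adjoint symbols, the
    -- Gelfand-Dickey structure is polynomial in `lam`
    (∀ (lam : ℂ) (w : ℕ → K),
      ∃! L : Symb, L ∈ PsiSA lam ∧ ∀ m : ℕ, L (-(2 * (m + 1) : ℤ)) = w m) ∧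
    (∀ (lam : ℂ) (i : ℕ) (a : K), ∃ X : Symb, IsCoordCovector lam i a X) ∧
    (∀ (w : ℕ → K) (i j : ℕ) (a c : K), ∃ P : Polynomial ℂ,
      ∀ (lam : ℂ) (L X Y : Symb), L ∈ PsiSA lam → (∀ m : ℕ, L (-(2 * (m + 1) : ℤ)) = w m) →
        IsCoordCovector lam i a X → IsCoordCovector lam j c Y →
          gelfandDickey lam L X Y = P.eval lam) := by
  obtain ⟨Q, hQ⟩ := exists_universal (sliceScale k)
  refine ⟨⟨Q, fun lam hlam => ⟨Phi (isFrame_id lam) k, ?_⟩, fun n _ => ⟨Phi (isFrame_fin n) k, ?_⟩⟩,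
    fun n _ => ⟨block_image_loopPo n, block_vE n, block_vF n, fun A hA B hB => block_mul n hA hB⟩,
    existsUnique_PsiSA, fun lam i a => ⟨_, exists_coordCovector lam i a⟩, gelfandDickey_polynomial⟩
  · rw [← conn_id_zero lam hk, ← raise_id lam hk]
    exact isReductionIso (isLoop_loopPo hlam) hk (Or.inl hlam) subset_rfl
      (fun _ _ m hm => absurd ⟨m, rfl⟩ hm) (fun _ ha ha0 => symbOf_mem_PsiSA ha ha0) hQ
  · rw [← conn_fin_zero n hk, ← raise_fin n hk]
    refine isReductionIso (isLoop_loopCl n) hk (Or.inr ⟨n, rfl, fun j => j.2⟩)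
      Set.inter_subset_left (fun L hL m hm => hL.2.2 _ ?_)
      (fun _ ha ha0 => ⟨symbOf_mem_PsiSA ha ha0, symbOf_mem_DO ha ha0⟩) hQ
    have : ¬m < n := fun h => hm ⟨⟨m, h⟩, rfl⟩
    omega
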